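/- **Theorem 4.3.** Let $l,T,\alpha,\varepsilon>0$, $\lambda\ge 0$, $\Omega_T=(0,l)\times(0,T]$, $\overline{\Omega}_T=[0,l]\times[0,T]$. For $n\ge 1$ put $$\gamma_n=\frac{n\pi}{l},\quad b_n=\gamma_n^2+\frac{\lambda^2}{4},\quad g_n=\tfrac12(\alpha+\varepsilon b_n),\quad \omega_n=\sqrt{g_n^2-b_n},\quad G_n(t)=e^{-g_nt}\,\frac{\sinh(\omega_n t)}{\omega_n}$$ (that is, $G_n(t)=e^{-g_nt}\sin(|\omega_n|t)/|\omega_n|$ if $g_n^2<b_n$, and $G_n(t)=te^{-g_nt}$ if $g_n^2=b_n$), and $$G(x,\xi,t)=\frac2l\,e^{\frac{\lambda}{2}(x-\xi)}\sum_{n=1}^\infty G_n(t)\sin(\gamma_n\xi)\sin(\gamma_nx),\qquad u_h(x,t)=\int_0^l h(\xi)\,G(x,\xi,t)\,d\xi,$$ $$u_f(x,t)=-\int_0^t d\tau\int_0^l f(\xi,\tau)\,G(x,\xi,t-\tau)\,d\xi .$$ Let $h_1\in C^1([0,l])$; let $h_0\in C^3([0,l])$ with $h_0^{(i)}(0)=h_0^{(i)}(l)=0$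 for $i=0,1,2$; and let $f$ be bounded and continuous on $\Omega_T$, with $\partial_xf$ existing and continuous on $\Omega_T$. Consider the linear strip problem $$\begin{cases}(\partial_{xx}-\lambda\partial_x)(\varepsilon u_t+u)-\partial_t(u_t+\alpha u)=f(x,t), & (x,t)\in\Omega_T,\\ u(x,0)=h_0(x)\ (0\le x\le l),\qquad u_t(x,0)=h_1(x)\ (0<x<l),\\ u(0,t)=u(l,t)=0, & 0<t\le T.\end{cases}\tag{2.1}$$ A solution of (2.1) is a function $u$ that satisfies these equations, such that $u$ is continuous on $\overline\Omega_T$; $u_t$ exists and is bounded on $\overline\Omega_T$ and is continuous on $\overline\Omega_T\setminus\{(0,0),(l,0)\}$; and $u_{tt}$, $\partial_x(\varepsilon u_t+u)$, $\partial_{xx}(\varepsilon u_t+u)$ exist and are continuous on $\Omega_T$. (Time derivatives at $t=0$ and $t=T$, and space derivatives at $x=0$ and $x=l$, are one-sided.) Then all series, integrals and derivatives in $$u=u_{h_1}+(\partial_t+\alpha+\varepsilon\lambda\partial_x-\varepsilon\partial_{xx})\,u_{h_0}+u_f$$ exist on $\overline\Omega_T$ (the series of $G$ converges for all real $x,\xi$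 and all $t\ge0$), $u$ is a solution of (2.1), and every solution of (2.1) equals $u$ on $\overline\Omega_T$. If moreover $h_1(0)=h_1(l)=0$, then $u_t$ is continuous on all of $\overline\Omega_T$ and $u_t(x,0)=h_1(x)$ for every $x\in[0,l]$. -/

import Mathlib

open Set MeasureTheory

noncomputable section

namespace StripProblem

/-- The set `Ω_T = {(x,t) : 0 < x < l, 0 < t ≤ T}`. -/
def Omega (l T : ℝ) : Set (ℝ × ℝ) := Ioo 0 l ×ˢ Ioc 0 T

/-- The closure `[0,l] × [0,T]` of `Ω_T`. -/
def closedStrip (l T : ℝ) : Set (ℝ × ℝ) := Icc 0 l ×ˢ Icc 0 T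

/-- The two corners `(0,0)` and `(l,0)`. -/
def corners (l : ℝ) : Set (ℝ × ℝ) := {(0, 0), (l, 0)}

/-- `∂_t u (x,t)`, one-sided at `t = 0` and at `t = T`. -/
def dt (T : ℝ) (u : ℝ → ℝ → ℝ) (x t : ℝ) : ℝ :=
  derivWithin (fun s => u x s) (Icc 0 T) t

/-- `∂_x u (x,t)`, one-sided at `x = 0` and at `x = l`; the usual derivative for `0 < x < l`. -/
def dx (l : ℝ) (u : ℝ → ℝ → ℝ) (x t : ℝ) : ℝ :=
  derivWithin (fun y => u y t) (Icc 0 l) x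

/-- `∂_t u` exists at `(x,t)`. -/
def HasDt (T : ℝ) (u : ℝ → ℝ → ℝ) (x t : ℝ) : Prop :=
  DifferentiableWithinAt ℝ (fun s => u x s) (Icc 0 T) t

/-- `∂_x u` exists at `(x,t)`. -/
def HasDx (l : ℝ) (u : ℝ → ℝ → ℝ) (x t : ℝ) : Prop :=
  DifferentiableWithinAt ℝ (fun y => u y t) (Icc 0 l) x

/-- The function `ε u_t + u`. -/
def visc (T ε : ℝ) (u : ℝ → ℝ → ℝ) (x t : ℝ) : ℝ := ε * dt T u x t + u x t

/-- The operator `(∂_xx - λ ∂_x)(ε u_t + u) - ∂_t (u_t + α u)`. -/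
def stripOp (l T α ε lam : ℝ) (u : ℝ → ℝ → ℝ) (x t : ℝ) : ℝ :=
  dx l (dx l (visc T ε u)) x t - lam * dx l (visc T ε u) x t
    - dt T (fun y s => dt T u y s + α * u y s) x t

/-- Classical solutions of the linear Dirichlet strip problem with source `f` and initial
data `h0`, `h1`. The condition `u_t (x,0) = h1 x` is imposed for `0 < x < l`: at `x = 0` and
`x = l` the boundary condition alone forces `u_t (x,0) = 0`. For the same reason `u_t` is
required to be bounded, and continuous away from the two corners only. -/
structure IsSolution (l T α ε lam : ℝ) (f : ℝ → ℝ → ℝ) (h0 h1 : ℝ → ℝ)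
    (u : ℝ → ℝ → ℝ) : Prop where
  continuousOn : ContinuousOn (fun p : ℝ × ℝ => u p.1 p.2) (closedStrip l T)
  hasDt : ∀ p ∈ closedStrip l T, HasDt T u p.1 p.2
  continuousOn_dt :
    ContinuousOn (fun p : ℝ × ℝ => dt T u p.1 p.2) (closedStrip l T \ corners l)
  bounded_dt : ∃ C : ℝ, ∀ p ∈ closedStrip l T, |dt T u p.1 p.2| ≤ C
  hasDtt : ∀ p ∈ Omega l T, HasDt T (dt T u) p.1 p.2
  continuousOn_dtt : ContinuousOn (fun p : ℝ × ℝ => dt T (dt T u) p.1 p.2) (Omega l T)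
  hasDx : ∀ p ∈ Omega l T, HasDx l (visc T ε u) p.1 p.2
  continuousOn_dx : ContinuousOn (fun p : ℝ × ℝ => dx l (visc T ε u) p.1 p.2) (Omega l T)
  hasDxx : ∀ p ∈ Omega l T, HasDx l (dx l (visc T ε u)) p.1 p.2
  continuousOn_dxx :
    ContinuousOn (fun p : ℝ × ℝ => dx l (dx l (visc T ε u)) p.1 p.2) (Omega l T)
  equation : ∀ p ∈ Omega l T, stripOp l T α ε lam u p.1 p.2 = f p.1 p.2
  initial : ∀ x ∈ Icc 0 l, u x 0 = h0 x
  initial_dt : ∀ x ∈ Ioo 0 l, dt T u x 0 = h1 x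
  boundary : ∀ t ∈ Ioc 0 T, u 0 t = 0 ∧ u l t = 0

/-- `γ_n = n π / l`. -/
def gam (l : ℝ) (n : ℕ) : ℝ := n * Real.pi / l

/-- `b_n = γ_n ^ 2 + λ ^ 2 / 4`. -/
def bn (l lam : ℝ) (n : ℕ) : ℝ := gam l n ^ 2 + lam ^ 2 / 4

/-- `g_n = (α + ε b_n) / 2`. -/
def gn (l α ε lam : ℝ) (n : ℕ) : ℝ := (α + ε * bn l lam n) / 2

/-- `ω_n ^ 2 = g_n ^ 2 - b_n`, a real number of any sign. -/
def omegaSq (l α ε lam : ℝ) (n : ℕ) : ℝ := gn l α ε lam n ^ 2 - bn l lam n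

/-- `sinh (ω t) / ω` with `ω ^ 2 = d`, as an even entire function of `ω`: it is
`sin (|ω| t) / |ω|` for imaginary `ω`, and `t` for `ω = 0`. -/
def sinhc (d t : ℝ) : ℝ :=
  if 0 < d then Real.sinh (√d * t) / √d
  else if d = 0 then t
  else Real.sin (√(-d) * t) / √(-d)

/-- `G_n (t) = exp (- g_n t) sinh (ω_n t) / ω_n`. -/
def Gn (l α ε lam : ℝ) (n : ℕ) (t : ℝ) : ℝ :=
  Real.exp (-(gn l α ε lam n) * t) * sinhc (omegaSq l α ε lam n) t

/-- The terms of the series of the Green function; the index `n` stands for `n + 1 ≥ 1`. -/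
def greenTerm (l α ε lam x ξ t : ℝ) (n : ℕ) : ℝ :=
  Gn l α ε lam (n + 1) t * Real.sin (gam l (n + 1) * ξ) * Real.sin (gam l (n + 1) * x)

/-- The Green function
`G (x,ξ,t) = (2/l) exp (λ (x - ξ) / 2) ∑_{n ≥ 1} G_n (t) sin (γ_n ξ) sin (γ_n x)`. -/
def green (l α ε lam x ξ t : ℝ) : ℝ :=
  2 / l * Real.exp (lam / 2 * (x - ξ)) * ∑' n : ℕ, greenTerm l α ε lam x ξ t n

/-- `u_h (x,t) = ∫_0^l h(ξ) G(x,ξ,t) dξ`. -/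
def uData (l α ε lam : ℝ) (h : ℝ → ℝ) (x t : ℝ) : ℝ :=
  ∫ ξ in (0 : ℝ)..l, h ξ * green l α ε lam x ξ t

/-- `u_h^* = (∂_t + α + ε λ ∂_x - ε ∂_xx) u_h`. -/
def uStar (l T α ε lam : ℝ) (h : ℝ → ℝ) (x t : ℝ) : ℝ :=
  dt T (uData l α ε lam h) x t + α * uData l α ε lam h x t
    + ε * lam * dx l (uData l α ε lam h) x t - ε * dx l (dx l (uData l α ε lam h)) x t

/-- `u_f (x,t) = - ∫_0^t dτ ∫_0^l f(ξ,τ) G(x,ξ,t-τ) dξ`. -/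
def uSource (l α ε lam : ℝ) (f : ℝ → ℝ → ℝ) (x t : ℝ) : ℝ :=
  -∫ τ in (0 : ℝ)..t, ∫ ξ in (0 : ℝ)..l, f ξ τ * green l α ε lam x ξ (t - τ)

/-- `u = u_{h1} + (∂_t + α + ε λ ∂_x - ε ∂_xx) u_{h0} + u_f`. -/
def explicitSolution (l T α ε lam : ℝ) (f : ℝ → ℝ → ℝ) (h0 h1 : ℝ → ℝ) (x t : ℝ) : ℝ :=
  uData l α ε lam h1 x t + uStar l T α ε lam h0 x t + uSource l α ε lam f x t

/-- Every series, integral and derivative in `explicitSolution` exists on `[0,l] × [0,T]`. -/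
structure ExplicitWellDefined (l T α ε lam : ℝ) (f : ℝ → ℝ → ℝ) (h0 h1 : ℝ → ℝ) : Prop where
  summable : ∀ x ξ t : ℝ, 0 ≤ t → Summable (greenTerm l α ε lam x ξ t)
  integrable_h0 : ∀ p ∈ closedStrip l T,
    IntervalIntegrable (fun ξ => h0 ξ * green l α ε lam p.1 ξ p.2) volume 0 l
  integrable_h1 : ∀ p ∈ closedStrip l T,
    IntervalIntegrable (fun ξ => h1 ξ * green l α ε lam p.1 ξ p.2) volume 0 l
  integrable_f : ∀ p ∈ closedStrip l T, ∀ τ ∈ Ioc 0 p.2,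
    IntervalIntegrable (fun ξ => f ξ τ * green l α ε lam p.1 ξ (p.2 - τ)) volume 0 l
  integrable_f' : ∀ p ∈ closedStrip l T,
    IntervalIntegrable
      (fun τ => ∫ ξ in (0 : ℝ)..l, f ξ τ * green l α ε lam p.1 ξ (p.2 - τ)) volume 0 p.2
  hasDt : ∀ p ∈ closedStrip l T, HasDt T (uData l α ε lam h0) p.1 p.2
  hasDx : ∀ p ∈ closedStrip l T, HasDx l (uData l α ε lam h0) p.1 p.2
  hasDxx : ∀ p ∈ closedStrip l T, HasDx l (dx l (uData l α ε lam h0)) p.1 p.2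

end StripProblem

end

noncomputable section

namespace StripProblem

open Filter Topology

/-! ### Odd periodic extension and completeness of the sine system -/

section


/-! Writing u = exp(λx/2) v turns ∂_xx − λ∂_x into ∂_xx − λ²/4, and the n-th sine coefficient of v
then obeys y'' + 2 g_n y' + b_n y = −F_n. `Gn` solves the homogeneous equation with data 0, 1 and
`Kn` = G_n' + (α + ε b_n) G_n solves it with data 1, 0, so on the closed strip the explicit formula
is exp(λx/2) times the sine series with coefficients `modeV` (`explicitSolution_eq`). What needs
proof is that this series is differentiable as often as the equation demands.

The structure is parabolic: w = ε v_t + v satisfies w_t = ε w_xx + Q with Q = c₁ w − c₂ v − ε F,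
while v_t = (w − v)/ε is an ordinary differential equation at each x. On the modes this is a
two-dimensional stiff system. An energy estimate uniform in γ_n and blind to the sign of g_n² − b_n
(`exists_bound_stiff_system`) gives G_n = O(γ_n⁻²) and ε G_n' + G_n = ε exp(−ε γ_n² t) + O(γ_n⁻²).
Hence v has coefficients O(γ_n⁻²), and w is ε times the Dirichlet heat flow of the initial velocity
plus a series with coefficients O(γ_n⁻²) (`exists_bound_modes`). The heat flow carries the only
possible discontinuity, at the two corners, and that disappears when h₁ vanishes at the end points.

Coefficients O(γ_n⁻²) do not allow two space derivatives term by term. They do give Hölder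
continuity of exponent 1/2, so at positive times Q is locally Hölder in space (`heatSource_fieldQ`).
Since the second derivative of the Gaussian has mean zero, ∂_xx S(s) Q is then O(s^(-3/4)) inside
the interval, which is integrable in Duhamel's formula. Damping the modes by exp(−ε γ_n² η) with η >
0 makes every series manipulation legitimate; the damped second derivative `modesXX` is jointly
continuous up to η = 0 (`continuousOn_modesXX`), and the identities integrated in t and in x pass to
the limit (`HeatModes.sub_eq_integral`, `HeatModes.eq_second_primitive`). The heat semigroup itself
is the Gaussian average of the odd periodic extension. Its sine series is found by comparing
coefficients (`kernelAvg_eq_sineSeries`), which rests on the completeness of the sines, that is, on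
Parseval's identity.

For uniqueness, the sine moments of an arbitrary solution are shown to satisfy the modal equations
in integrated form. Nothing is known about space derivatives at x = 0 and x = l, so the integration
by parts takes place on a slightly shrunk interval before passing to the limit
(`StripEquation.sub_eq_integral_of_pos`). The moments of the difference of two solutions vanish by
Gronwall's inequality, and completeness finishes the argument. -/

/-- The Dirichlet eigenfunction `sin (γ_{n+1} x)` of the interval `(0, l)`. -/
def sinMode (l : ℝ) (n : ℕ) (x : ℝ) : ℝ := Real.sin (gam l (n + 1) * x)

/-- The coefficients of the sine series of `q` on `(0, l)`. -/
def sinCoeff (l : ℝ) (q : ℝ → ℝ) (n : ℕ) : ℝ :=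
  2 / l * ∫ ξ in (0 : ℝ)..l, q ξ * sinMode l n ξ

/-- The `2l`-periodic even triangle wave that is the identity on `[0, l]`. -/
def fold (l x : ℝ) : ℝ := l / Real.pi * Real.arccos (Real.cos (Real.pi * x / l))

/-- The odd `2l`-periodic extension of a function on `(0, l)`; it vanishes at the multiples of `l`. -/
def oddExt (l : ℝ) (q : ℝ → ℝ) (x : ℝ) : ℝ :=
  Real.sign (Real.sin (Real.pi * x / l)) * q (fold l x)

variable {l : ℝ}

lemma gam_pos (hl : 0 < l) (n : ℕ) : 0 < gam l (n + 1) := by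
  unfold gam; push_cast; positivity

lemma abs_sinMode_le (n : ℕ) (x : ℝ) : |sinMode l n x| ≤ 1 := Real.abs_sin_le_one _

lemma continuous_sinMode (n : ℕ) : Continuous (sinMode l n) := by
  unfold sinMode; fun_prop

lemma sinMode_zero (n : ℕ) : sinMode l n 0 = 0 := by simp [sinMode]

lemma sinMode_right (hl : 0 < l) (n : ℕ) : sinMode l n l = 0 := by
  have : gam l (n + 1) * l = ((n + 1 : ℕ) : ℝ) * Real.pi := by
    unfold gam; field_simp
  rw [sinMode, this, Real.sin_nat_mul_pi]

lemma summable_inv_gam_sq (hl : 0 < l) : Summable fun n => (gam l (n + 1) ^ 2)⁻¹ := by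
  have h := (summable_nat_add_iff 1).2 (Real.summable_nat_pow_inv.2 (one_lt_two))
  refine (h.mul_left ((l / Real.pi) ^ 2)).congr fun n => ?_
  unfold gam; field_simp

lemma summable_of_le_inv_gam_sq (hl : 0 < l) {a : ℕ → ℝ} {C : ℝ}
    (h : ∀ n, |a n| ≤ C / gam l (n + 1) ^ 2) : Summable a :=
  Summable.of_norm_bounded ((summable_inv_gam_sq hl).mul_left C) fun n => by
    simpa [div_eq_mul_inv] using h n

lemma fold_of_mem (hl : 0 < l) {x : ℝ} (hx : x ∈ Icc 0 l) : fold l x = x := by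
  have h0 : 0 ≤ Real.pi * x / l := div_nonneg (mul_nonneg Real.pi_pos.le hx.1) hl.le
  have h1 : Real.pi * x / l ≤ Real.pi := by
    rw [div_le_iff₀ hl]; exact mul_le_mul_of_nonneg_left hx.2 Real.pi_pos.le
  rw [fold, Real.arccos_cos h0 h1]; field_simp

lemma continuous_fold : Continuous (fold l) := by
  unfold fold
  exact continuous_const.mul (Real.continuous_arccos.comp (Real.continuous_cos.comp (by fun_prop)))

lemma fold_mem_Ioo (hl : 0 < l) {x : ℝ} (hx : Real.sin (Real.pi * x / l) ≠ 0) :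
    fold l x ∈ Ioo 0 l := by
  set θ := Real.pi * x / l
  have hs := Real.sin_sq_add_cos_sq θ
  have hpos : 0 < Real.sin θ ^ 2 := by positivity
  have h1 : Real.cos θ < 1 := by nlinarith
  have h2 : -1 < Real.cos θ := by nlinarith
  have h3 := Real.arccos_pos.2 h1
  have h4 : Real.arccos (Real.cos θ) < Real.pi := by
    refine lt_of_le_of_ne (Real.arccos_le_pi _) fun h => ?_
    rw [Real.arccos_eq_pi] at h; linarith
  constructor
  · exact mul_pos (div_pos hl Real.pi_pos) h3
  · calc fold l x < l / Real.pi * Real.pi := by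
          exact mul_lt_mul_of_pos_left h4 (div_pos hl Real.pi_pos)
      _ = l := by field_simp

lemma fold_mem_Icc (hl : 0 < l) (x : ℝ) : fold l x ∈ Icc 0 l := by
  constructor
  · exact mul_nonneg (div_pos hl Real.pi_pos).le (Real.arccos_nonneg _)
  · calc fold l x ≤ l / Real.pi * Real.pi :=
          mul_le_mul_of_nonneg_left (Real.arccos_le_pi _) (div_pos hl Real.pi_pos).le
      _ = l := by field_simp

lemma sin_pos_of_mem_Ioo (hl : 0 < l) {x : ℝ} (hx : x ∈ Ioo 0 l) :
    0 < Real.sin (Real.pi * x / l) := by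
  apply Real.sin_pos_of_pos_of_lt_pi
  · exact div_pos (mul_pos Real.pi_pos hx.1) hl
  · rw [div_lt_iff₀ hl]; exact mul_lt_mul_of_pos_left hx.2 Real.pi_pos

lemma oddExt_of_mem_Ioo (hl : 0 < l) (q : ℝ → ℝ) {x : ℝ} (hx : x ∈ Ioo 0 l) :
    oddExt l q x = q x := by
  rw [oddExt, Real.sign_of_pos (sin_pos_of_mem_Ioo hl hx), fold_of_mem hl ⟨hx.1.le, hx.2.le⟩,
    one_mul]

lemma oddExt_of_sin_eq_zero (q : ℝ → ℝ) {x : ℝ} (hx : Real.sin (Real.pi * x / l) = 0) :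
    oddExt l q x = 0 := by
  simp [oddExt, hx]

lemma oddExt_zero (q : ℝ → ℝ) : oddExt l q 0 = 0 := oddExt_of_sin_eq_zero _ (by simp)

lemma oddExt_right (hl : 0 < l) (q : ℝ → ℝ) : oddExt l q l = 0 :=
  oddExt_of_sin_eq_zero _ (by rw [mul_div_cancel_right₀ _ hl.ne', Real.sin_pi])

lemma oddExt_of_mem_Icc (hl : 0 < l) {q : ℝ → ℝ} (h0 : q 0 = 0) (h1 : q l = 0) {x : ℝ}
    (hx : x ∈ Icc 0 l) : oddExt l q x = q x := by
  rcases eq_or_lt_of_le hx.1 with h | h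
  · rw [← h, oddExt_zero, h0]
  rcases eq_or_lt_of_le hx.2 with h' | h'
  · rw [h', oddExt_right hl, h1]
  · exact oddExt_of_mem_Ioo hl q ⟨h, h'⟩

lemma oddExt_neg (q : ℝ → ℝ) (x : ℝ) : oddExt l q (-x) = -oddExt l q x := by
  have : Real.pi * -x / l = -(Real.pi * x / l) := by ring
  rw [oddExt, oddExt, fold, fold, this, Real.sin_neg, Real.cos_neg, Real.sign_neg]; ring

lemma oddExt_periodic (hl : 0 < l) (q : ℝ → ℝ) : Function.Periodic (oddExt l q) (2 * l) := by
  intro x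
  have : Real.pi * (x + 2 * l) / l = Real.pi * x / l + 2 * Real.pi := by field_simp
  rw [oddExt, oddExt, fold, fold, this, Real.sin_add_two_pi, Real.cos_add_two_pi]

lemma abs_oddExt_le (hl : 0 < l) {q : ℝ → ℝ} {M : ℝ} (hM : 0 ≤ M)
    (hq : ∀ ξ ∈ Ioo 0 l, |q ξ| ≤ M) (x : ℝ) : |oddExt l q x| ≤ M := by
  by_cases hx : Real.sin (Real.pi * x / l) = 0
  · rw [oddExt_of_sin_eq_zero _ hx]; simpa
  · have h1 : |Real.sign (Real.sin (Real.pi * x / l))| = 1 := by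
      rcases Real.sign_apply_eq_of_ne_zero _ hx with h | h <;> simp [h]
    rw [oddExt, abs_mul, h1, one_mul]
    exact hq _ (fold_mem_Ioo hl hx)

/-- Away from the multiples of l the sign factor is locally constant and `fold` lands in the open
interval, so no behaviour of `Q` at the end points enters. The second variable is carried along for
time-dependent sources. -/
lemma continuousWithinAt_oddExt (hl : 0 < l) {Q : ℝ → ℝ → ℝ} {A : Set ℝ}
    (hQ : ContinuousOn (fun p : ℝ × ℝ => Q p.1 p.2) (Ioo 0 l ×ˢ A)) {x τ : ℝ}
    (hx : Real.sin (Real.pi * x / l) ≠ 0) (hτ : τ ∈ A) :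
    ContinuousWithinAt (fun p : ℝ × ℝ => oddExt l (fun ξ => Q ξ p.2) p.1) (univ ×ˢ A) (x, τ) := by
  have hc : Continuous fun p : ℝ × ℝ => Real.sin (Real.pi * p.1 / l) := by fun_prop
  have hcf : Continuous fun p : ℝ × ℝ => (fold l p.1, p.2) :=
    (continuous_fold.comp continuous_fst).prodMk continuous_snd
  have hev : ∀ᶠ p : ℝ × ℝ in 𝓝 (x, τ), Real.sin (Real.pi * p.1 / l) ≠ 0 :=
    hc.continuousAt.eventually_ne hx
  have hsign : ∀ᶠ p : ℝ × ℝ in 𝓝 (x, τ), Real.sign (Real.sin (Real.pi * p.1 / l)) =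
      Real.sign (Real.sin (Real.pi * x / l)) := by
    rcases lt_or_gt_of_ne hx with h | h
    · filter_upwards [hc.continuousAt.eventually_lt_const h] with p hp
      rw [Real.sign_of_neg hp, Real.sign_of_neg h]
    · filter_upwards [hc.continuousAt.eventually_const_lt h] with p hp
      rw [Real.sign_of_pos hp, Real.sign_of_pos h]
  have h2 := hQ (fold l x, τ) ⟨fold_mem_Ioo hl hx, hτ⟩
  have h3 : Tendsto (fun p : ℝ × ℝ => (fold l p.1, p.2)) (𝓝[univ ×ˢ A] (x, τ))
      (𝓝[Ioo 0 l ×ˢ A] (fold l x, τ)) := by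
    refine tendsto_nhdsWithin_iff.2 ⟨(hcf.tendsto (x, τ)).mono_left nhdsWithin_le_nhds, ?_⟩
    filter_upwards [self_mem_nhdsWithin, nhdsWithin_le_nhds hev] with p hp hp'
    exact ⟨fold_mem_Ioo hl hp', hp.2⟩
  have h1 := (Tendsto.comp h2 h3).const_mul (Real.sign (Real.sin (Real.pi * x / l)))
  refine Tendsto.congr' ?_ h1
  filter_upwards [nhdsWithin_le_nhds hsign] with p hp
  simp only [oddExt, hp, Function.comp_apply]

/-- At a zero of the sine, `fold` equals 0 or l, where `q` vanishes; as |oddExt| ≤ |q ∘ fold|, the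
jump closes. -/
lemma continuous_oddExt (hl : 0 < l) {q : ℝ → ℝ} (hq : ContinuousOn q (Icc 0 l)) (h0 : q 0 = 0)
    (h1 : q l = 0) : Continuous (oddExt l q) := by
  rw [continuous_iff_continuousAt]
  intro x
  by_cases hx : Real.sin (Real.pi * x / l) = 0
  · have hqf : Continuous fun y => q (fold l y) :=
      hq.comp_continuous continuous_fold (fold_mem_Icc hl)
    have hz : q (fold l x) = 0 := by
      have hs := Real.sin_sq_add_cos_sq (Real.pi * x / l)
      rw [hx] at hs
      have : (Real.cos (Real.pi * x / l) - 1) * (Real.cos (Real.pi * x / l) + 1) = 0 := by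
        linarith [hs]
      rcases mul_eq_zero.1 this with h | h
      · rw [fold, sub_eq_zero.1 h]; simpa using h0
      · rw [fold, eq_neg_of_add_eq_zero_left h, Real.arccos_neg_one,
          div_mul_cancel₀ _ Real.pi_ne_zero, h1]
    rw [ContinuousAt, oddExt_of_sin_eq_zero _ hx]
    refine squeeze_zero_norm (a := fun y => |q (fold l y)|) (fun y => ?_) ?_
    · rw [oddExt, norm_mul, Real.norm_eq_abs, Real.norm_eq_abs]
      refine mul_le_of_le_one_left (abs_nonneg _) ?_
      rcases Real.sign_apply_eq (Real.sin (Real.pi * y / l)) with h | h | h <;> simp [h]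
    · have := hqf.abs.tendsto x
      rwa [hz, abs_zero] at this
  · have hq' : ContinuousOn (fun p : ℝ × ℝ => q p.1) (Ioo 0 l ×ˢ univ) :=
      (hq.mono Ioo_subset_Icc_self).comp continuousOn_fst fun p hp => hp.1
    have h2 := continuousWithinAt_oddExt (Q := fun ξ _ => q ξ) hl hq' hx (mem_univ (0 : ℝ))
    rw [univ_prod_univ, continuousWithinAt_univ] at h2
    exact ContinuousAt.comp (f := fun y : ℝ => (y, (0 : ℝ)))
      (g := fun p : ℝ × ℝ => oddExt l q p.1) h2 (by fun_prop)

/-- The sign factor vanishes whenever `fold` reaches an end point, so `q` may be replaced by its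
indicator on the open interval, the only place where it is controlled. -/
lemma measurable_oddExt (hl : 0 < l) {q : ℝ → ℝ} (hq : ContinuousOn q (Ioo 0 l)) :
    Measurable (oddExt l q) := by
  have h1 : Measurable ((Ioo 0 l).indicator q) := by
    classical
    rw [← piecewise_eq_indicator]
    exact hq.measurable_piecewise continuousOn_const measurableSet_Ioo
  have h2 : oddExt l q = fun x => Real.sign (Real.sin (Real.pi * x / l)) *
      (Ioo 0 l).indicator q (fold l x) := by
    funext x
    by_cases hx : Real.sin (Real.pi * x / l) = 0
    · simp [oddExt, hx]
    · rw [oddExt, indicator_of_mem (fold_mem_Ioo hl hx)]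
  have h3 : Measurable Real.sign := by
    unfold Real.sign
    exact Measurable.ite measurableSet_Iio measurable_const
      (Measurable.ite measurableSet_Ioi measurable_const measurable_const)
  rw [h2]
  exact (h3.comp (by fun_prop)).mul (h1.comp continuous_fold.measurable)

lemma intervalIntegrable_of_bounded {q : ℝ → ℝ} {a b M : ℝ} (hab : a ≤ b)
    (hq : ContinuousOn q (Ioo a b)) (hM : ∀ ξ ∈ Ioo a b, |q ξ| ≤ M) :
    IntervalIntegrable q volume a b := by
  rw [intervalIntegrable_iff_integrableOn_Ioo_of_le hab]
  refine Integrable.of_bound (hq.aestronglyMeasurable measurableSet_Ioo) M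
    ((ae_restrict_iff' measurableSet_Ioo).2 (ae_of_all _ hM))

/-- The excluded points are countable. Thus almost every sample point of an average at nonzero scale
misses the jumps of the odd extension. -/
lemma ae_sin_sub_mul_ne_zero (hl : 0 < l) (x : ℝ) {σ : ℝ} (hσ : σ ≠ 0) :
    ∀ᵐ y : ℝ, Real.sin (Real.pi * (x - σ * y) / l) ≠ 0 := by
  have : {y : ℝ | ¬ Real.sin (Real.pi * (x - σ * y) / l) ≠ 0} ⊆
      range fun n : ℤ => (x - (n : ℝ) * l) / σ := by
    intro y hx
    simp only [ne_eq, not_not, mem_ofPred_eq] at hx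
    obtain ⟨n, hn⟩ := Real.sin_eq_zero_iff.1 hx
    refine ⟨n, ?_⟩
    have h2 : (n : ℝ) * Real.pi * l = Real.pi * (x - σ * y) := by rw [hn]; field_simp
    have h3 : Real.pi * ((n : ℝ) * l - (x - σ * y)) = 0 := by linarith
    rcases mul_eq_zero.1 h3 with h | h
    · exact absurd h Real.pi_ne_zero
    · simp only; rw [div_eq_iff hσ]; linarith
  exact measure_mono_null this ((countable_range _).measure_zero volume)

/-- A continuous function on `[0, l]` with vanishing sine coefficients vanishes. -/
theorem eq_zero_of_sinCoeff_eq_zero (hl : 0 < l) {g : ℝ → ℝ} (hg : ContinuousOn g (Icc 0 l))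
    (h : ∀ n, sinCoeff l g n = 0) : ∀ x ∈ Icc 0 l, g x = 0 := by
  obtain ⟨M, hM⟩ := isCompact_Icc.exists_bound_of_continuousOn hg
  have hM0 : 0 ≤ M := (norm_nonneg _).trans (hM 0 ⟨le_rfl, hl.le⟩)
  have hint : ∀ n : ℕ, ∫ ξ in (0 : ℝ)..l, g ξ * sinMode l n ξ = 0 := fun n => by
    have := h n
    rw [sinCoeff, mul_eq_zero] at this
    exact this.resolve_left (by positivity)
  have hll : -l < l := by linarith
  -- Parseval is applied to the odd extension on (-l, l), as a bounded complex function.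
  set f : ℝ → ℂ := fun x => ((oddExt l g x : ℝ) : ℂ) with hf
  have hmeas : Measurable f :=
    Complex.measurable_ofReal.comp (measurable_oddExt hl (hg.mono Ioo_subset_Icc_self))
  have hb : ∀ x, ‖f x‖ ≤ M := fun x => by
    rw [hf]; simp only [Complex.norm_real, Real.norm_eq_abs]
    exact abs_oddExt_le hl hM0 (fun ξ hξ => hM ξ ⟨hξ.1.le, hξ.2.le⟩) x
  have hL2 : MemLp f 2 (volume.restrict (Ioc (-l) l)) :=
    MemLp.of_bound hmeas.aestronglyMeasurable M (ae_of_all _ hb)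
  have hcoeff : ∀ n : ℤ, fourierCoeffOn hll f n = 0 := by
    intro n
    rw [fourierCoeffOn_eq_integral]
    refine smul_eq_zero_of_right _ ?_
    set e : ℝ → ℂ := fun x => fourier (-n) (x : AddCircle (l - -l)) with he
    have hec : Continuous e := by
      rw [he]; exact (map_continuous _).comp (AddCircle.continuous_mk' _)
    have hee : ∀ x, e x = Complex.exp (((-(n * Real.pi * x / l) : ℝ) : ℂ) * Complex.I) := by
      intro x
      rw [he]; simp only [fourier_coe_apply]
      congr 1
      have : (l : ℂ) ≠ 0 := by exact_mod_cast hl.ne'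
      push_cast; field_simp; ring
    have heb : ∀ x, ‖e x‖ ≤ 1 := fun x => by rw [hee, Complex.norm_exp_ofReal_mul_I]
    have hI : ∀ a b : ℝ, IntervalIntegrable (fun x => e x • f x) volume a b := fun a b => by
      refine (intervalIntegrable_const (c := M)).mono_fun
        (hec.measurable.mul hmeas).aestronglyMeasurable (ae_of_all _ fun x => ?_)
      simp only [norm_smul, Real.norm_eq_abs]
      calc ‖e x‖ * ‖f x‖ ≤ 1 * M := mul_le_mul (heb x) (hb x) (norm_nonneg _) zero_le_one
        _ ≤ |M| := by rw [one_mul]; exact le_abs_self _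
    -- Pairing x with −x leaves only the odd part of the exponential, that is, −2i times a sine
    -- moment of `g` on (0, l), which vanishes by hypothesis.
    have hneg : ∫ x in (-l)..0, e x • f x = ∫ x in (0 : ℝ)..l, e (-x) • f (-x) := by
      rw [intervalIntegral.integral_comp_neg (fun x => e x • f x), neg_zero]
    have hI' : IntervalIntegrable (fun x => e (-x) • f (-x)) volume 0 l := by
      simpa using (hI 0 (-l)).comp_sub_left (c := 0)
    have hreal : ∫ x in (0 : ℝ)..l, Real.sin (n * Real.pi * x / l) * oddExt l g x = 0 := by
      have key : ∀ m : ℕ, ∫ x in (0 : ℝ)..l, Real.sin ((m + 1 : ℕ) * Real.pi * x / l) *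
          oddExt l g x = 0 := fun m => by
        refine (intervalIntegral.integral_congr_ae ?_).trans (hint m)
        filter_upwards [Measure.ae_ne volume l] with x hx hx'
        rw [uIoc_of_le hl.le] at hx'
        rw [oddExt_of_mem_Ioo hl g ⟨hx'.1, lt_of_le_of_ne hx'.2 hx⟩, sinMode, gam, mul_comm]
        congr 2; ring
      obtain ⟨m, rfl | rfl⟩ := n.eq_nat_or_neg
      · cases m with
        | zero => simp
        | succ m => exact_mod_cast key m
      · cases m with
        | zero => simp
        | succ m =>
          rw [← neg_eq_zero, ← intervalIntegral.integral_neg]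
          refine (intervalIntegral.integral_congr fun x _ => ?_).trans (key m)
          have : (((-((m + 1 : ℕ) : ℤ)) : ℤ) : ℝ) * Real.pi * x / l =
            -((m + 1 : ℕ) * Real.pi * x / l) := by push_cast; ring
          simp only [this, Real.sin_neg]; ring
    rw [← intervalIntegral.integral_add_adjacent_intervals (hI (-l) 0) (hI 0 l), hneg,
      ← intervalIntegral.integral_add hI' (hI 0 l)]
    have hpt : ∀ x, e (-x) • f (-x) + e x • f x =
        -2 * Complex.I * ((Real.sin (n * Real.pi * x / l) * oddExt l g x : ℝ) : ℂ) := fun x => by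
      have h1 : -(n * Real.pi * -x / l) = n * Real.pi * x / l := by ring
      simp only [hf, oddExt_neg, hee, h1, smul_eq_mul]
      push_cast
      rw [Complex.exp_mul_I, Complex.exp_mul_I, Complex.cos_neg, Complex.sin_neg]
      ring
    simp_rw [hpt]
    rw [intervalIntegral.integral_const_mul, intervalIntegral.integral_ofReal, hreal]
    simp
  -- All Fourier coefficients are zero, so the L² norm of the extension is zero; continuity of `g`
  -- then excludes a nonzero value anywhere on the closed interval.
  have hzero := hasSum_sq_fourierCoeffOn hll hL2
  simp only [hcoeff, norm_zero, ne_eq, OfNat.ofNat_ne_zero, not_false_eq_true, zero_pow] at hzero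
  have h0 := hzero.unique hasSum_zero
  have h1 : ∫ x in (-l)..l, ‖f x‖ ^ 2 = 0 := by
    rw [smul_eq_mul, mul_eq_zero] at h0
    exact h0.resolve_left (inv_ne_zero (by linarith))
  have hsqI : ∀ a b : ℝ, IntervalIntegrable (fun x => ‖f x‖ ^ 2) volume a b := fun a b => by
    refine (intervalIntegrable_const (c := M ^ 2)).mono_fun
      (hmeas.norm.pow_const 2).aestronglyMeasurable (ae_of_all _ fun x => ?_)
    simp only [norm_pow, norm_norm]
    exact pow_le_pow_left₀ (norm_nonneg _) ((hb x).trans (le_abs_self M)) 2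
  have h2 : ∫ x in (0 : ℝ)..l, ‖f x‖ ^ 2 = 0 := by
    have h3 := intervalIntegral.integral_add_adjacent_intervals (hsqI (-l) 0) (hsqI 0 l)
    have h4 : 0 ≤ ∫ x in (-l)..0, ‖f x‖ ^ 2 :=
      intervalIntegral.integral_nonneg (by linarith) fun x _ => by positivity
    have h5 : 0 ≤ ∫ x in (0 : ℝ)..l, ‖f x‖ ^ 2 :=
      intervalIntegral.integral_nonneg hl.le fun x _ => by positivity
    linarith
  have h3 : ∫ x in (0 : ℝ)..l, g x ^ 2 = 0 := by
    refine (intervalIntegral.integral_congr_ae ?_).trans h2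
    filter_upwards [Measure.ae_ne volume l] with x hx hx'
    rw [uIoc_of_le hl.le] at hx'
    simp only [hf]
    rw [oddExt_of_mem_Ioo hl g ⟨hx'.1, lt_of_le_of_ne hx'.2 hx⟩]
    simp
  by_contra hne
  push Not at hne
  obtain ⟨x, hx, hgx⟩ := hne
  exact (intervalIntegral.integral_pos hl (f := fun x => g x ^ 2) (hg.pow 2)
    (fun x _ => sq_nonneg (g x)) ⟨x, hx, lt_of_le_of_ne (sq_nonneg _) (pow_ne_zero 2 hgx).symm⟩).ne' h3

end

/-! ### Sine series and kernel averages of the odd extension -/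

section


variable {l : ℝ}

lemma integral_sinMode_mul_self (hl : 0 < l) (n : ℕ) :
    ∫ x in (0 : ℝ)..l, sinMode l n x * sinMode l n x = l / 2 := by
  have hg := gam_pos hl n
  have hd : ∀ x ∈ uIcc 0 l, HasDerivAt
      (fun x => x / 2 - Real.sin (2 * gam l (n + 1) * x) / (4 * gam l (n + 1)))
      (sinMode l n x * sinMode l n x) x := fun x _ => by
    have h1 : HasDerivAt (fun x => Real.sin (2 * gam l (n + 1) * x))
        (Real.cos (2 * gam l (n + 1) * x) * (2 * gam l (n + 1) * 1)) x :=
      ((hasDerivAt_id x).const_mul _).sin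
    convert! ((hasDerivAt_id x).div_const 2).sub (h1.div_const (4 * gam l (n + 1))) using 1
    have h2 : Real.cos (2 * gam l (n + 1) * x) = 1 - 2 * Real.sin (gam l (n + 1) * x) ^ 2 := by
      rw [mul_assoc, Real.cos_two_mul']; nlinarith [Real.sin_sq_add_cos_sq (gam l (n + 1) * x)]
    rw [sinMode, h2]; field_simp; ring
  rw [intervalIntegral.integral_eq_sub_of_hasDerivAt hd
    (((continuous_sinMode n).mul (continuous_sinMode n)).intervalIntegrable _ _)]
  have : 2 * gam l (n + 1) * l = ((2 * (n + 1) : ℕ) : ℝ) * Real.pi := by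
    unfold gam; push_cast; field_simp
  rw [this, Real.sin_nat_mul_pi]; simp

lemma integral_sinMode_mul_of_ne (hl : 0 < l) {n m : ℕ} (hnm : n ≠ m) :
    ∫ x in (0 : ℝ)..l, sinMode l n x * sinMode l m x = 0 := by
  have hs : ((n : ℝ) + 1 + (m + 1)) * Real.pi / l ≠ 0 := by positivity
  have hd : ((n : ℝ) + 1 - (m + 1)) * Real.pi / l ≠ 0 := by
    refine div_ne_zero (mul_ne_zero ?_ Real.pi_ne_zero) hl.ne'
    rw [add_sub_add_right_eq_sub, sub_ne_zero]; exact_mod_cast hnm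
  set a := ((n : ℝ) + 1 - (m + 1)) * Real.pi / l
  set b := ((n : ℝ) + 1 + (m + 1)) * Real.pi / l
  have hder : ∀ x ∈ uIcc 0 l, HasDerivAt
      (fun x => Real.sin (a * x) / (2 * a) - Real.sin (b * x) / (2 * b))
      (sinMode l n x * sinMode l m x) x := fun x _ => by
    have h1 : ∀ a : ℝ, HasDerivAt (fun x => Real.sin (a * x)) (Real.cos (a * x) * (a * 1)) x :=
      fun a => ((hasDerivAt_id x).const_mul _).sin
    convert! ((h1 a).div_const (2 * a)).sub ((h1 b).div_const (2 * b)) using 1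
    have ha : a * x = gam l (n + 1) * x - gam l (m + 1) * x := by
      simp only [a, gam]; push_cast; ring
    have hb : b * x = gam l (n + 1) * x + gam l (m + 1) * x := by
      simp only [b, gam]; push_cast; ring
    have e1 : Real.cos (a * x) * (a * 1) / (2 * a) = Real.cos (a * x) / 2 := by field_simp
    have e2 : Real.cos (b * x) * (b * 1) / (2 * b) = Real.cos (b * x) / 2 := by field_simp
    rw [e1, e2, ha, hb, Real.cos_sub, Real.cos_add, sinMode, sinMode]; ring
  rw [intervalIntegral.integral_eq_sub_of_hasDerivAt hder
    (((continuous_sinMode n).mul (continuous_sinMode m)).intervalIntegrable _ _)]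
  have ha : a * l = (((n : ℤ) - m : ℤ) : ℝ) * Real.pi := by
    simp only [a]; push_cast; field_simp; ring
  have hb : b * l = ((n + 1 + (m + 1) : ℕ) : ℝ) * Real.pi := by
    simp only [b]; push_cast; field_simp
  rw [ha, hb, Real.sin_nat_mul_pi, Real.sin_int_mul_pi]; simp

/-- The sine series with coefficients `c`. -/
def sineSeries (l : ℝ) (c : ℕ → ℝ) (x : ℝ) : ℝ := ∑' n, c n * sinMode l n x

lemma abs_mul_sinMode_le (c : ℝ) (n : ℕ) (x : ℝ) : |c * sinMode l n x| ≤ |c| := by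
  rw [abs_mul]; exact mul_le_of_le_one_right (abs_nonneg _) (abs_sinMode_le n x)

lemma summable_mul_sinMode {c : ℕ → ℝ} (hc : Summable c) (x : ℝ) :
    Summable fun n => c n * sinMode l n x :=
  Summable.of_norm_bounded hc.abs fun n => abs_mul_sinMode_le _ n x

lemma continuous_sineSeries {c : ℕ → ℝ} (hc : Summable c) : Continuous (sineSeries l c) :=
  continuous_tsum (fun n => continuous_const.mul (continuous_sinMode n)) hc.abs
    fun n x => abs_mul_sinMode_le _ n x

lemma sineSeries_zero (c : ℕ → ℝ) : sineSeries l c 0 = 0 := by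
  simp [sineSeries, sinMode_zero]

lemma sineSeries_right (hl : 0 < l) (c : ℕ → ℝ) : sineSeries l c l = 0 := by
  simp [sineSeries, sinMode_right hl]

/-- Absolute summability of the coefficients permits integration term by term, and orthogonality
keeps one term. -/
lemma sinCoeff_sineSeries (hl : 0 < l) {c : ℕ → ℝ} (hc : Summable c) (m : ℕ) :
    sinCoeff l (sineSeries l c) m = c m := by
  have h : HasSum (fun n => ∫ x in (0 : ℝ)..l, c n * sinMode l n x * sinMode l m x)
      (∫ x in (0 : ℝ)..l, sineSeries l c x * sinMode l m x) := by
    have := intervalIntegral.hasSum_integral_of_dominated_convergence (μ := volume)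
      (a := (0 : ℝ)) (b := l) (F := fun n x => c n * sinMode l n x * sinMode l m x)
      (f := fun x => sineSeries l c x * sinMode l m x) (fun n _ => |c n|)
      (fun n => (((continuous_const.mul (continuous_sinMode n)).mul
        (continuous_sinMode m)).aestronglyMeasurable))
      (fun n => ae_of_all _ fun x _ => by
        rw [Real.norm_eq_abs]
        exact (abs_mul_sinMode_le _ m x).trans (abs_mul_sinMode_le _ n x))
      (ae_of_all _ fun x _ => hc.abs) intervalIntegrable_const
      (ae_of_all _ fun x _ => (summable_mul_sinMode hc x).hasSum.mul_right _)
    exact this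
  have h2 : HasSum (fun n => ∫ x in (0 : ℝ)..l, c n * sinMode l n x * sinMode l m x)
      (c m * (l / 2)) := by
    convert hasSum_single m fun n hn => ?_ using 1
    · simp_rw [mul_assoc]
      rw [intervalIntegral.integral_const_mul, integral_sinMode_mul_self hl]
    · simp_rw [mul_assoc]
      rw [intervalIntegral.integral_const_mul, integral_sinMode_mul_of_ne hl hn, mul_zero]
  rw [sinCoeff, h.unique h2]; field_simp

lemma intervalIntegrable_mul_sinMode {q : ℝ → ℝ} (hq : IntervalIntegrable q volume 0 l) (n : ℕ) :
    IntervalIntegrable (fun ξ => q ξ * sinMode l n ξ) volume 0 l :=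
  hq.mul_continuousOn (continuous_sinMode n).continuousOn

lemma sinCoeff_sub {p q : ℝ → ℝ} (hp : IntervalIntegrable p volume 0 l)
    (hq : IntervalIntegrable q volume 0 l) (n : ℕ) :
    sinCoeff l (fun x => p x - q x) n = sinCoeff l p n - sinCoeff l q n := by
  simp only [sinCoeff, sub_mul]
  rw [intervalIntegral.integral_sub (intervalIntegrable_mul_sinMode hp n)
    (intervalIntegrable_mul_sinMode hq n), mul_sub]

lemma sinCoeff_add {p q : ℝ → ℝ} (hp : IntervalIntegrable p volume 0 l)
    (hq : IntervalIntegrable q volume 0 l) (n : ℕ) :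
    sinCoeff l (fun x => p x + q x) n = sinCoeff l p n + sinCoeff l q n := by
  simp only [sinCoeff, add_mul]
  rw [intervalIntegral.integral_add (intervalIntegrable_mul_sinMode hp n)
    (intervalIntegrable_mul_sinMode hq n), mul_add]

lemma sinCoeff_const_mul (a : ℝ) (q : ℝ → ℝ) (n : ℕ) :
    sinCoeff l (fun x => a * q x) n = a * sinCoeff l q n := by
  simp only [sinCoeff, mul_assoc]
  rw [intervalIntegral.integral_const_mul]; ring

lemma sinCoeff_congr (hl : 0 < l) {p q : ℝ → ℝ} (h : ∀ x ∈ Ioo 0 l, p x = q x) (n : ℕ) :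
    sinCoeff l p n = sinCoeff l q n := by
  unfold sinCoeff
  congr 1
  refine intervalIntegral.integral_congr_ae ?_
  filter_upwards [Measure.ae_ne volume l] with x hx hx'
  rw [uIoc_of_le hl.le] at hx'
  rw [h x ⟨hx'.1, lt_of_le_of_ne hx'.2 hx⟩]

lemma abs_sinCoeff_le (hl : 0 < l) {q : ℝ → ℝ} {M : ℝ} (hM : ∀ ξ ∈ Ioo 0 l, |q ξ| ≤ M) (n : ℕ) :
    |sinCoeff l q n| ≤ 2 * M := by
  have h1 : |∫ ξ in (0 : ℝ)..l, q ξ * sinMode l n ξ| ≤ M * |l - 0| := by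
    rw [← Real.norm_eq_abs]
    refine intervalIntegral.norm_integral_le_of_norm_le_const_ae ?_
    filter_upwards [Measure.ae_ne volume l] with x hx hx'
    rw [uIoc_of_le hl.le] at hx'
    exact (abs_mul_sinMode_le _ n x).trans (hM x ⟨hx'.1, lt_of_le_of_ne hx'.2 hx⟩)
  rw [sub_zero, abs_of_pos hl] at h1
  rw [sinCoeff, abs_mul, abs_of_pos (by positivity : 0 < 2 / l)]
  calc 2 / l * _ ≤ 2 / l * (M * l) := mul_le_mul_of_nonneg_left h1 (by positivity)
    _ = 2 * M := by field_simp

/-- A continuous function on `[0, l]` with summable sine coefficients is the sum of its sine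
series. -/
theorem eq_sineSeries (hl : 0 < l) {g : ℝ → ℝ} (hg : ContinuousOn g (Icc 0 l))
    (hs : Summable (sinCoeff l g)) {x : ℝ} (hx : x ∈ Icc 0 l) :
    g x = sineSeries l (sinCoeff l g) x := by
  have hc := continuous_sineSeries (l := l) hs
  refine sub_eq_zero.1 (eq_zero_of_sinCoeff_eq_zero hl
    (g := fun x => g x - sineSeries l (sinCoeff l g) x) (hg.sub hc.continuousOn) (fun n => ?_) x hx)
  rw [sinCoeff_sub (ContinuousOn.intervalIntegrable_of_Icc hl.le hg) (hc.intervalIntegrable _ _),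
    sinCoeff_sineSeries hl hs, sub_self]

/-- The average of the odd extension of `q` against the kernel `k` at scale `σ`. -/
def kernelAvg (l : ℝ) (k : ℝ → ℝ) (q : ℝ → ℝ) (σ x : ℝ) : ℝ :=
  ∫ y, k y * oddExt l q (x - σ * y)

/-- A reflection joins the two translates into one integral over a full period; periodicity moves
the shift onto the sine, and in sin(γx + γa) the cosine part integrates to zero against an odd
function. The symmetric pair ±a is what makes the translation act diagonally on the sine
coefficients. -/
lemma integral_oddExt_shift (hl : 0 < l) {q : ℝ → ℝ} {M : ℝ} (hM0 : 0 ≤ M)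
    (hq : ContinuousOn q (Ioo 0 l)) (hM : ∀ ξ ∈ Ioo 0 l, |q ξ| ≤ M) (n : ℕ) (a : ℝ) :
    ∫ x in (0 : ℝ)..l, (oddExt l q (x - a) + oddExt l q (x + a)) * sinMode l n x =
      Real.cos (gam l (n + 1) * a) * (2 * ∫ x in (0 : ℝ)..l, q x * sinMode l n x) := by
  have hm := measurable_oddExt hl hq
  have hb := abs_oddExt_le hl hM0 hM
  have hI : ∀ (f : ℝ → ℝ) (c u v : ℝ), Continuous f → (∀ x, |f x| ≤ 1) →
      IntervalIntegrable (fun x => oddExt l q (x + c) * f x) volume u v := fun f c u v hf hf1 => by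
    refine (intervalIntegrable_const (c := M)).mono_fun
      ((hm.comp (measurable_id.add_const c)).mul hf.measurable).aestronglyMeasurable
      (ae_of_all _ fun x => ?_)
    simp only [norm_mul, Real.norm_eq_abs]
    calc |oddExt l q (x + c)| * |f x| ≤ M * 1 := mul_le_mul (hb _) (hf1 x) (abs_nonneg _) hM0
      _ ≤ |M| := by rw [mul_one]; exact le_abs_self _
  have hS : Continuous (sinMode l n) := continuous_sinMode n
  have hSneg : ∀ x, sinMode l n (-x) = -sinMode l n x := fun x => by
    simp [sinMode]
  -- the left side is an integral over a full period
  have h1 : ∫ x in (0 : ℝ)..l, (oddExt l q (x - a) + oddExt l q (x + a)) * sinMode l n x =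
      ∫ x in (-l)..l, oddExt l q (x + -a) * sinMode l n x := by
    have h2 := intervalIntegral.integral_comp_neg
      (fun x => oddExt l q (x + -a) * sinMode l n x) (a := 0) (b := l)
    rw [← intervalIntegral.integral_add_adjacent_intervals
      (hI _ (-a) (-l) 0 hS (abs_sinMode_le n)) (hI _ (-a) 0 l hS (abs_sinMode_le n))]
    rw [neg_zero] at h2
    rw [← h2, ← intervalIntegral.integral_add]
    · refine intervalIntegral.integral_congr fun x _ => ?_
      have : -x + -a = -(x + a) := by ring
      simp only [this, oddExt_neg, hSneg, sub_eq_add_neg]; ring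
    · refine (hI _ a 0 l hS (abs_sinMode_le n)).congr fun x _ => ?_
      have : -x + -a = -(x + a) := by ring
      simp only [this, oddExt_neg, hSneg]; ring
    · exact hI _ (-a) 0 l hS (abs_sinMode_le n)
  -- The window of integration slides by −a over one period without changing the integral.
  have hper : Function.Periodic (fun x => oddExt l q x * sinMode l n (x + a)) (2 * l) := by
    intro x
    have : gam l (n + 1) * (x + 2 * l + a) =
        gam l (n + 1) * (x + a) + (n + 1 : ℕ) * (2 * Real.pi) := by
      unfold gam; field_simp; ring
    simp only [oddExt_periodic hl q x, sinMode, this, Real.sin_add_nat_mul_two_pi]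
  have h3 : ∫ x in (-l)..l, oddExt l q (x + -a) * sinMode l n x =
      ∫ x in (-l)..l, oddExt l q x * sinMode l n (x + a) := by
    have h4 := intervalIntegral.integral_comp_add_right (a := -l) (b := l)
      (fun x => oddExt l q x * sinMode l n (x + a)) (-a)
    have h5 := hper.intervalIntegral_add_eq (-l + -a) (-l)
    rw [show -l + -a + 2 * l = l + -a by ring, show -l + 2 * l = l by ring] at h5
    rw [← h5, ← h4]
    refine intervalIntegral.integral_congr fun x _ => ?_
    simp
  set C : ℝ → ℝ := fun x => Real.cos (gam l (n + 1) * x)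
  have hC : Continuous C := by fun_prop
  have hC1 : ∀ x, |C x| ≤ 1 := fun x => Real.abs_cos_le_one _
  have hI0 : ∀ (f : ℝ → ℝ) (u v : ℝ), Continuous f → (∀ x, |f x| ≤ 1) →
      IntervalIntegrable (fun x => oddExt l q x * f x) volume u v := fun f u v hf hf1 => by
    simpa using hI f 0 u v hf hf1
  have hcosI : ∫ x in (-l)..l, oddExt l q x * C x = 0 := by
    have h2 := intervalIntegral.integral_comp_neg
      (fun x => oddExt l q x * C x) (a := -l) (b := l)
    rw [neg_neg] at h2
    have h6 : ∫ x in (-l)..l, oddExt l q (-x) * C (-x) = -∫ x in (-l)..l, oddExt l q x * C x := by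
      rw [← intervalIntegral.integral_neg]
      refine intervalIntegral.integral_congr fun x _ => ?_
      simp [oddExt_neg, C]
    linarith
  have hsinI : ∫ x in (-l)..l, oddExt l q x * sinMode l n x =
      2 * ∫ x in (0 : ℝ)..l, q x * sinMode l n x := by
    have h2 := intervalIntegral.integral_comp_neg
      (fun x => oddExt l q x * sinMode l n x) (a := 0) (b := l)
    rw [neg_zero] at h2
    rw [← intervalIntegral.integral_add_adjacent_intervals
      (hI0 _ (-l) 0 hS (abs_sinMode_le n)) (hI0 _ 0 l hS (abs_sinMode_le n)), ← h2]
    have h7 : ∫ x in (0 : ℝ)..l, oddExt l q x * sinMode l n x =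
        ∫ x in (0 : ℝ)..l, q x * sinMode l n x := by
      refine intervalIntegral.integral_congr_ae ?_
      filter_upwards [Measure.ae_ne volume l] with x hx hx'
      rw [uIoc_of_le hl.le] at hx'
      rw [oddExt_of_mem_Ioo hl q ⟨hx'.1, lt_of_le_of_ne hx'.2 hx⟩]
    rw [h7, two_mul]
    congr 1
    rw [← h7]
    refine intervalIntegral.integral_congr fun x _ => ?_
    simp [oddExt_neg, hSneg]
  rw [h1, h3, ← hsinI]
  have hexp : ∀ x, oddExt l q x * sinMode l n (x + a) =
      Real.cos (gam l (n + 1) * a) * (oddExt l q x * sinMode l n x) +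
        Real.sin (gam l (n + 1) * a) * (oddExt l q x * C x) := fun x => by
    simp only [sinMode, C, mul_add, Real.sin_add]; ring
  simp_rw [hexp]
  rw [intervalIntegral.integral_add ((hI0 _ _ _ hS (abs_sinMode_le n)).const_mul _)
    ((hI0 _ _ _ hC hC1).const_mul _), intervalIntegral.integral_const_mul,
    intervalIntegral.integral_const_mul, hcosI, mul_zero, add_zero]

/-- For an even kernel the translates by σy and −σy carry the same weight, so
`integral_oddExt_shift` applies under the integral in y: averaging multiplies each sine coefficient
by the cosine transform of the kernel. -/
lemma sinCoeff_kernelAvg (hl : 0 < l) {k q : ℝ → ℝ} {M : ℝ} (hM0 : 0 ≤ M)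
    (hk : Integrable k) (hke : ∀ y, k (-y) = k y)
    (hq : ContinuousOn q (Ioo 0 l)) (hM : ∀ ξ ∈ Ioo 0 l, |q ξ| ≤ M) (σ : ℝ) (n : ℕ) :
    sinCoeff l (kernelAvg l k q σ) n =
      (∫ y, k y * Real.cos (gam l (n + 1) * σ * y)) * sinCoeff l q n := by
  have hm := measurable_oddExt hl hq
  have hb := abs_oddExt_le hl hM0 hM
  have hprod : ∀ s : ℝ, Integrable (Function.uncurry fun x y =>
      k y * oddExt l q (x + s * y) * sinMode l n x)
      ((volume.restrict (Ioc 0 l)).prod volume) := fun s => by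
    have h1 : Integrable (fun p : ℝ × ℝ => M * k p.2) ((volume.restrict (Ioc 0 l)).prod volume) :=
      (integrable_const M).mul_prod hk
    refine Integrable.mono h1 ?_ (ae_of_all _ fun p => ?_)
    · exact (hk.aestronglyMeasurable.comp_snd.mul
        (hm.comp (by fun_prop : Measurable fun p : ℝ × ℝ => p.1 + s * p.2)).aestronglyMeasurable).mul
        ((continuous_sinMode n).comp continuous_fst).aestronglyMeasurable
    · simp only [Function.uncurry, norm_mul, Real.norm_eq_abs]
      calc |k p.2| * |oddExt l q (p.1 + s * p.2)| * |sinMode l n p.1| ≤ |k p.2| * M * 1 := by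
            gcongr
            · exact hb _
            · exact abs_sinMode_le n _
        _ ≤ |M| * |k p.2| := by rw [abs_of_nonneg hM0]; linarith
  have hsw : ∀ s : ℝ, ∫ x in (0 : ℝ)..l, (∫ y, k y * oddExt l q (x + s * y)) * sinMode l n x =
      ∫ y, k y * ∫ x in (0 : ℝ)..l, oddExt l q (x + s * y) * sinMode l n x := fun s => by
    rw [intervalIntegral.integral_of_le hl.le]
    calc _ = ∫ x in Ioc 0 l, ∫ y, k y * oddExt l q (x + s * y) * sinMode l n x := by
          simp_rw [integral_mul_const]
      _ = ∫ y, ∫ x in Ioc 0 l, k y * oddExt l q (x + s * y) * sinMode l n x :=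
          integral_integral_swap (hprod s)
      _ = _ := by
          simp_rw [intervalIntegral.integral_of_le hl.le, mul_assoc, integral_const_mul]
  have hIn : ∀ s : ℝ, Integrable fun y =>
      k y * ∫ x in (0 : ℝ)..l, oddExt l q (x + s * y) * sinMode l n x := fun s => by
    have := (hprod s).integral_prod_right
    simp only [Function.uncurry, mul_assoc, integral_const_mul] at this
    simpa only [intervalIntegral.integral_of_le hl.le] using this
  -- Two expressions of the same average, one for each sign of σ; their sum has the symmetric form
  -- needed below.
  have hA : kernelAvg l k q σ = fun x => ∫ y, k y * oddExt l q (x + (-σ) * y) := by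
    funext x; simp only [kernelAvg, neg_mul, ← sub_eq_add_neg]
  have hA' : kernelAvg l k q σ = fun x => ∫ y, k y * oddExt l q (x + σ * y) := by
    funext x
    rw [kernelAvg, ← integral_neg_eq_self]
    simp only [hke, mul_neg, sub_neg_eq_add]
  have e1 := hsw (-σ)
  have e2 := hsw σ
  have hsum : ∀ y, k y * (∫ x in (0 : ℝ)..l, oddExt l q (x + (-σ) * y) * sinMode l n x) +
      k y * (∫ x in (0 : ℝ)..l, oddExt l q (x + σ * y) * sinMode l n x) =
      k y * Real.cos (gam l (n + 1) * σ * y) * (2 * ∫ x in (0 : ℝ)..l, q x * sinMode l n x) := by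
    intro y
    have hI : ∀ c : ℝ, IntervalIntegrable (fun x => oddExt l q (x + c) * sinMode l n x)
        volume 0 l := fun c => by
      refine (intervalIntegrable_const (c := M)).mono_fun
        ((hm.comp (measurable_id.add_const c)).mul
          (continuous_sinMode n).measurable).aestronglyMeasurable
        (ae_of_all _ fun x => ?_)
      simp only [norm_mul, Real.norm_eq_abs]
      calc |oddExt l q (x + c)| * |sinMode l n x| ≤ M * 1 :=
            mul_le_mul (hb _) (abs_sinMode_le n x) (abs_nonneg _) hM0
        _ ≤ |M| := by rw [mul_one]; exact le_abs_self _
    rw [mul_assoc (gam l (n + 1)), mul_assoc (k y), ← integral_oddExt_shift hl hM0 hq hM n (σ * y),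
      ← mul_add, ← intervalIntegral.integral_add (hI _) (hI _)]
    congr 1
    refine intervalIntegral.integral_congr fun x _ => ?_
    simp only [neg_mul, ← sub_eq_add_neg]; ring
  have h2 : 2 * ∫ x in (0 : ℝ)..l, kernelAvg l k q σ x * sinMode l n x =
      (∫ y, k y * Real.cos (gam l (n + 1) * σ * y)) *
        (2 * ∫ x in (0 : ℝ)..l, q x * sinMode l n x) := by
    rw [two_mul]
    nth_rewrite 1 [hA]
    rw [hA', e1, e2, ← integral_add (hIn _) (hIn _)]
    simp_rw [hsum]
    rw [integral_mul_const]
  rw [sinCoeff, sinCoeff]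
  linear_combination (1 / l) * h2

/-- Continuity of `kernelAvg` at the points where the translates of the odd extension are almost
everywhere continuous. -/
lemma continuousWithinAt_kernelAvg_of_ae (hl : 0 < l) {k : ℝ → ℝ} {Q : ℝ → ℝ → ℝ} {A : Set ℝ}
    {M : ℝ} (hM0 : 0 ≤ M) (hk : Integrable k)
    (hQ : ∀ τ ∈ A, ContinuousOn (fun ξ => Q ξ τ) (Ioo 0 l))
    (hM : ∀ ξ ∈ Ioo 0 l, ∀ τ ∈ A, |Q ξ τ| ≤ M) {σ x τ : ℝ}
    (hae : ∀ᵐ y, ContinuousWithinAt (fun p : ℝ × ℝ => oddExt l (fun ξ => Q ξ p.2) p.1)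
      (univ ×ˢ A) (x - σ * y, τ)) :
    ContinuousWithinAt (fun p : ℝ × ℝ × ℝ => kernelAvg l k (fun ξ => Q ξ p.2.2) p.2.1 p.1)
      (univ ×ˢ univ ×ˢ A) (x, σ, τ) := by
  refine tendsto_integral_filter_of_dominated_convergence (fun y => M * |k y|) ?_ ?_
    (hk.abs.const_mul M) ?_
  · filter_upwards [self_mem_nhdsWithin] with p hp
    exact hk.aestronglyMeasurable.mul ((measurable_oddExt hl (hQ _ hp.2.2)).comp
      (by fun_prop : Measurable fun y : ℝ => p.1 - p.2.1 * y)).aestronglyMeasurable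
  · filter_upwards [self_mem_nhdsWithin] with p hp
    refine ae_of_all _ fun y => ?_
    rw [norm_mul, Real.norm_eq_abs, Real.norm_eq_abs, mul_comm]
    exact mul_le_mul_of_nonneg_right (abs_oddExt_le hl hM0 (fun ξ hξ => hM ξ hξ _ hp.2.2) _)
      (abs_nonneg _)
  · filter_upwards [hae] with y hy
    refine Tendsto.const_mul _ ?_
    have hc : Continuous fun p : ℝ × ℝ × ℝ => (p.1 - p.2.1 * y, p.2.2) := by fun_prop
    have h3 : Tendsto (fun p : ℝ × ℝ × ℝ => (p.1 - p.2.1 * y, p.2.2))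
        (𝓝[univ ×ˢ univ ×ˢ A] (x, σ, τ)) (𝓝[univ ×ˢ A] (x - σ * y, τ)) :=
      tendsto_nhdsWithin_iff.2 ⟨(hc.tendsto (x, σ, τ)).mono_left nhdsWithin_le_nhds, by
        filter_upwards [self_mem_nhdsWithin] with p hp using ⟨mem_univ _, hp.2.2⟩⟩
    have h4 := hy.tendsto.comp h3
    exact h4

/-- For σ ≠ 0 almost every y avoids the jumps. For σ = 0 all sample points collapse to x, which must
then be interior. -/
lemma continuousWithinAt_kernelAvg (hl : 0 < l) {k : ℝ → ℝ} {Q : ℝ → ℝ → ℝ} {A : Set ℝ}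
    {M : ℝ} (hM0 : 0 ≤ M) (hk : Integrable k)
    (hQ : ContinuousOn (fun p : ℝ × ℝ => Q p.1 p.2) (Ioo 0 l ×ˢ A))
    (hM : ∀ ξ ∈ Ioo 0 l, ∀ τ ∈ A, |Q ξ τ| ≤ M) {σ x τ : ℝ} (hτ : τ ∈ A)
    (h : σ ≠ 0 ∨ x ∈ Ioo 0 l) :
    ContinuousWithinAt (fun p : ℝ × ℝ × ℝ => kernelAvg l k (fun ξ => Q ξ p.2.2) p.2.1 p.1)
      (univ ×ˢ univ ×ˢ A) (x, σ, τ) := by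
  refine continuousWithinAt_kernelAvg_of_ae hl hM0 hk (fun τ hτ => ?_) hM ?_
  · exact hQ.comp (by fun_prop : Continuous fun ξ : ℝ => (ξ, τ)).continuousOn fun ξ hξ => ⟨hξ, hτ⟩
  · by_cases hσ : σ = 0
    · refine ae_of_all _ fun y => ?_
      rw [hσ, zero_mul, sub_zero]
      exact continuousWithinAt_oddExt hl hQ
        (sin_pos_of_mem_Ioo hl (h.resolve_left (not_not_intro hσ))).ne' hτ
    · filter_upwards [ae_sin_sub_mul_ne_zero hl x hσ] with y hy
      exact continuousWithinAt_oddExt hl hQ hy hτ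

lemma continuous_kernelAvg (hl : 0 < l) {k q : ℝ → ℝ} {M : ℝ} (hM0 : 0 ≤ M) (hk : Integrable k)
    (hq : ContinuousOn q (Ioo 0 l)) (hM : ∀ ξ ∈ Ioo 0 l, |q ξ| ≤ M) {σ : ℝ} (hσ : σ ≠ 0) :
    Continuous (kernelAvg l k q σ) := by
  rw [continuous_iff_continuousAt]
  intro x
  have := continuousWithinAt_kernelAvg (Q := fun ξ _ => q ξ) (A := univ) (τ := 0) (x := x) hl hM0 hk
    (hq.comp continuousOn_fst fun p hp => hp.1) (fun ξ hξ _ _ => hM ξ hξ) (mem_univ _) (Or.inl hσ)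
  rw [univ_prod_univ, univ_prod_univ, continuousWithinAt_univ] at this
  exact ContinuousAt.comp (f := fun x : ℝ => (x, σ, (0 : ℝ)))
    (g := fun p : ℝ × ℝ × ℝ => kernelAvg l k q p.2.1 p.1) this (by fun_prop)

lemma abs_kernelAvg_le (hl : 0 < l) {k q : ℝ → ℝ} {M : ℝ} (hM0 : 0 ≤ M) (hk : Integrable k)
    (hM : ∀ ξ ∈ Ioo 0 l, |q ξ| ≤ M) (σ x : ℝ) :
    |kernelAvg l k q σ x| ≤ M * ∫ y, |k y| := by
  rw [← integral_const_mul, ← Real.norm_eq_abs]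
  refine norm_integral_le_of_norm_le (hk.abs.const_mul M) (ae_of_all _ fun y => ?_)
  rw [norm_mul, Real.norm_eq_abs, Real.norm_eq_abs, mul_comm]
  exact mul_le_mul_of_nonneg_right (abs_oddExt_le hl hM0 hM _) (abs_nonneg _)

/-- The sine series of an average against an even kernel. -/
theorem kernelAvg_eq_sineSeries (hl : 0 < l) {k q : ℝ → ℝ} {M : ℝ} (hM0 : 0 ≤ M)
    (hk : Integrable k) (hke : ∀ y, k (-y) = k y)
    (hq : ContinuousOn q (Ioo 0 l)) (hM : ∀ ξ ∈ Ioo 0 l, |q ξ| ≤ M) {σ : ℝ} (hσ : σ ≠ 0)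
    (hs : Summable fun n : ℕ =>
      (∫ y, k y * Real.cos (gam l (n + 1) * σ * y)) * sinCoeff l q n) {x : ℝ}
    (hx : x ∈ Icc 0 l) :
    kernelAvg l k q σ x = sineSeries l
      (fun n => (∫ y, k y * Real.cos (gam l (n + 1) * σ * y)) * sinCoeff l q n) x := by
  have hcoeff := sinCoeff_kernelAvg hl hM0 hk hke hq hM σ
  -- The average is continuous and its coefficients are summable, so it equals its sine series; no
  -- Poisson summation is needed.
  have h := eq_sineSeries hl (continuous_kernelAvg hl hM0 hk hq hM hσ).continuousOn
    (hs.congr fun n => (hcoeff n).symm) hx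
  rw [h]
  congr 1
  funext n
  exact hcoeff n

end

/-! ### Gaussian kernels and the Dirichlet heat semigroup -/

section


variable {l : ℝ}

/-- The standard Gaussian density. -/
def gauss (y : ℝ) : ℝ := (√(2 * Real.pi))⁻¹ * Real.exp (-(1 / 2) * y ^ 2)

/-- The second derivative of the standard Gaussian density. -/
def gaussDD (y : ℝ) : ℝ := (y ^ 2 - 1) * gauss y

lemma gauss_pos (y : ℝ) : 0 < gauss y := by unfold gauss; positivity

lemma gauss_neg (y : ℝ) : gauss (-y) = gauss y := by simp [gauss]

lemma gaussDD_neg (y : ℝ) : gaussDD (-y) = gaussDD y := by simp [gaussDD, gauss_neg]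

lemma integrable_pow_mul_gauss (n : ℕ) : Integrable fun y => y ^ n * gauss y := by
  have h := integrable_rpow_mul_exp_neg_mul_sq (b := 1 / 2) (by norm_num) (s := n)
    (by have : (0 : ℝ) ≤ n := n.cast_nonneg
        linarith)
  refine (h.const_mul (√(2 * Real.pi))⁻¹).congr (ae_of_all _ fun y => ?_)
  simp only [Real.rpow_natCast, gauss]; ring

lemma integrable_gauss : Integrable gauss := by
  simpa using integrable_pow_mul_gauss 0

lemma integrable_gaussDD : Integrable gaussDD := by
  refine ((integrable_pow_mul_gauss 2).sub integrable_gauss).congr (ae_of_all _ fun y => ?_)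
  simp only [gaussDD, Pi.sub_apply]; ring

/-- Real part of the Fourier transform of the complex Gaussian. -/
lemma integral_gauss_mul_cos (c : ℝ) :
    ∫ y, gauss y * Real.cos (c * y) = Real.exp (-(c ^ 2 / 2)) := by
  have h := fourierIntegral_gaussian (b := 1 / 2) (by norm_num) (c : ℂ)
  have h2 : (((√(2 * Real.pi) : ℝ)) : ℂ) = (Real.pi / (1 / 2 : ℂ)) ^ (1 / 2 : ℂ) := by
    rw [Real.sqrt_eq_rpow, Complex.ofReal_cpow (by positivity)]
    push_cast; congr 1; ring
  rw [← h2] at h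
  have hint : Integrable fun y : ℝ =>
      Complex.exp (Complex.I * c * y) * Complex.exp (-(1 / 2) * (y : ℂ) ^ 2) := by
    have hg := (integrable_gauss.const_mul (√(2 * Real.pi))).ofReal (𝕜 := ℂ)
    refine hg.mono (by fun_prop) (ae_of_all _ fun y => ?_)
    have e1 : Complex.I * c * y = ((c * y : ℝ) : ℂ) * Complex.I := by push_cast; ring
    have e2 : (-(1 / 2) * (y : ℂ) ^ 2) = ((-(1 / 2) * y ^ 2 : ℝ) : ℂ) := by push_cast; ring
    rw [norm_mul, e1, Complex.norm_exp_ofReal_mul_I, e2, ← Complex.ofReal_exp, one_mul, gauss]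
    have : √(2 * Real.pi) ≠ 0 := by positivity
    rw [mul_inv_cancel_left₀ this]
    exact le_rfl
  have h3 := congrArg Complex.re h
  rw [← RCLike.re_eq_complex_re, ← integral_re hint] at h3
  have e3 : ∀ y : ℝ, RCLike.re (Complex.exp (Complex.I * c * y) *
      Complex.exp (-(1 / 2) * (y : ℂ) ^ 2)) = √(2 * Real.pi) * (gauss y * Real.cos (c * y)) := by
    intro y
    have e1 : Complex.I * c * y = ((c * y : ℝ) : ℂ) * Complex.I := by push_cast; ring
    have e2 : (-(1 / 2) * (y : ℂ) ^ 2) = ((-(1 / 2) * y ^ 2 : ℝ) : ℂ) := by push_cast; ring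
    rw [e1, e2, ← Complex.ofReal_exp, RCLike.re_eq_complex_re, Complex.re_mul_ofReal,
      Complex.exp_ofReal_mul_I_re, gauss]
    have : √(2 * Real.pi) ≠ 0 := by positivity
    field_simp
  simp_rw [e3] at h3
  rw [integral_const_mul, RCLike.re_eq_complex_re] at h3
  have e4 : (-(c : ℂ) ^ 2 / (4 * (1 / 2))) = ((-(c ^ 2 / 2) : ℝ) : ℂ) := by push_cast; ring
  rw [e4, ← Complex.ofReal_exp, ← Complex.ofReal_mul, Complex.ofReal_re] at h3
  exact mul_left_cancel₀ (by positivity) h3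

lemma integral_gauss : ∫ y, gauss y = 1 := by
  simpa using integral_gauss_mul_cos 0

lemma hasDerivAt_gauss (y : ℝ) : HasDerivAt gauss (-(y * gauss y)) y := by
  have h := (((hasDerivAt_id y).pow 2).const_mul (-(1 / 2 : ℝ))).exp.const_mul (√(2 * Real.pi))⁻¹
  convert! h using 1
  simp only [gauss, Pi.pow_apply, id]; ring

/-- Two integrations by parts move both derivatives of the Gaussian onto the cosine. -/
lemma integral_gaussDD_mul_cos (c : ℝ) :
    ∫ y, gaussDD y * Real.cos (c * y) = -(c ^ 2 * Real.exp (-(c ^ 2 / 2))) := by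
  have hcos : ∀ y, HasDerivAt (fun y => Real.cos (c * y)) (-(c * Real.sin (c * y))) y := fun y => by
    convert! ((hasDerivAt_id y).const_mul c).cos using 1; simp; ring
  have hsin : ∀ y, HasDerivAt (fun y => Real.sin (c * y)) (c * Real.cos (c * y)) y := fun y => by
    convert! ((hasDerivAt_id y).const_mul c).sin using 1; simp; ring
  have hg1 : ∀ y, HasDerivAt (fun y => -(y * gauss y)) (gaussDD y) y := fun y => by
    convert! ((hasDerivAt_id y).mul (hasDerivAt_gauss y)).neg using 1
    simp only [gaussDD, id]; ring
  -- The single bound |c| + 1 covers the cosine, the sine and their multiples by c.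
  have hbd : ∀ {f g : ℝ → ℝ}, Integrable f → Continuous g → (∀ y, |g y| ≤ |c| + 1) →
      Integrable (g * f) := fun {f g} hf hg hb =>
    hf.bdd_mul hg.aestronglyMeasurable (ae_of_all _ hb)
  have b1 : ∀ y, |Real.cos (c * y)| ≤ |c| + 1 := fun y =>
    (Real.abs_cos_le_one _).trans (by linarith [abs_nonneg c])
  have b2 : ∀ y, |Real.sin (c * y)| ≤ |c| + 1 := fun y =>
    (Real.abs_sin_le_one _).trans (by linarith [abs_nonneg c])
  have b3 : ∀ y, |-(c * Real.sin (c * y))| ≤ |c| + 1 := fun y => by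
    rw [abs_neg, abs_mul]
    nlinarith [abs_nonneg c, Real.abs_sin_le_one (c * y)]
  have b4 : ∀ y, |c * Real.cos (c * y)| ≤ |c| + 1 := fun y => by
    rw [abs_mul]
    nlinarith [abs_nonneg c, Real.abs_cos_le_one (c * y)]
  have i1 : Integrable fun y => -(y * gauss y) := by simpa using (integrable_pow_mul_gauss 1).neg
  have s1 := integral_mul_deriv_eq_deriv_mul_of_integrable (u := fun y => Real.cos (c * y))
    (v := fun y => -(y * gauss y)) (fun y _ => hcos y) (fun y _ => hg1 y)
    (hbd integrable_gaussDD (by fun_prop) b1) (hbd i1 (by fun_prop) b3) (hbd i1 (by fun_prop) b1)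
  have s2 := integral_mul_deriv_eq_deriv_mul_of_integrable (u := fun y => Real.sin (c * y))
    (v := gauss) (fun y _ => hsin y) (fun y _ => hasDerivAt_gauss y)
    (hbd i1 (by fun_prop) b2) (hbd integrable_gauss (by fun_prop) b4)
    (hbd integrable_gauss (by fun_prop) b2)
  have s3 : ∫ y, gaussDD y * Real.cos (c * y) = ∫ y, Real.cos (c * y) * gaussDD y := by
    simp_rw [mul_comm]
  have s4 : ∫ y, -(c * Real.sin (c * y)) * -(y * gauss y) =
      -c * ∫ y, Real.sin (c * y) * -(y * gauss y) := by
    rw [← integral_const_mul]; congr 1; funext y; ring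
  have s5 : ∫ y, c * Real.cos (c * y) * gauss y = c * Real.exp (-(c ^ 2 / 2)) := by
    rw [← integral_gauss_mul_cos, ← integral_const_mul]; congr 1; funext y; ring
  rw [s3, s1, s4, s2, s5]; ring

lemma integral_gaussDD : ∫ y, gaussDD y = 0 := by
  simpa using integral_gaussDD_mul_cos 0

/-- The moment that absorbs a Hölder modulus of exponent 1/2. Both √|y| / 2 and |y² − 1| are at most
y² + 1, which leaves a polynomial times the Gaussian. -/
lemma integrable_sqrt_mul_gaussDD : Integrable fun y => √|y| * |gaussDD y| := by
  have h : Integrable fun y => 2 * (y ^ 4 * gauss y) + 4 * (y ^ 2 * gauss y) + 2 * gauss y :=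
    (((integrable_pow_mul_gauss 4).const_mul 2).add ((integrable_pow_mul_gauss 2).const_mul 4)).add
      (integrable_gauss.const_mul 2)
  refine h.mono (Continuous.aestronglyMeasurable (by unfold gaussDD gauss; fun_prop))
    (ae_of_all _ fun y => ?_)
  have hg := gauss_pos y
  have h1 : √|y| ≤ 2 * (y ^ 2 + 1) := by
    rw [Real.sqrt_le_left (by positivity)]
    nlinarith [sq_abs y, sq_nonneg (|y| - 1), abs_nonneg y, sq_nonneg y]
  have h2 : |y ^ 2 - 1| ≤ y ^ 2 + 1 := by
    rw [abs_le]; constructor <;> nlinarith [sq_nonneg y]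
  have h3 : 0 ≤ 2 * (y ^ 4 * gauss y) + 4 * (y ^ 2 * gauss y) + 2 * gauss y := by positivity
  rw [Real.norm_eq_abs, Real.norm_eq_abs, abs_of_nonneg h3, abs_of_nonneg (by positivity),
    gaussDD, abs_mul, abs_of_pos hg]
  calc √|y| * (|y ^ 2 - 1| * gauss y) ≤ 2 * (y ^ 2 + 1) * ((y ^ 2 + 1) * gauss y) := by gcongr
    _ = _ := by ring

lemma exp_neg_le_inv {y : ℝ} (hy : 0 < y) : Real.exp (-y) ≤ 1 / y := by
  rw [Real.exp_neg, one_div]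
  exact inv_anti₀ hy (by linarith [Real.add_one_le_exp y])

lemma exp_neg_le_inv_sq {y : ℝ} (hy : 0 < y) : Real.exp (-y) ≤ 2 / y ^ 2 := by
  rw [Real.exp_neg, ← inv_div]
  refine inv_anti₀ (by positivity) ?_
  linarith [Real.quadratic_le_exp_of_nonneg hy.le]

/-- The decay factor of the `n`-th mode of the heat equation `u_t = κ u_xx`. -/
def decay (l κ : ℝ) (n : ℕ) (s : ℝ) : ℝ := Real.exp (-(κ * gam l (n + 1) ^ 2 * s))

lemma decay_pos (κ : ℝ) (n : ℕ) (s : ℝ) : 0 < decay l κ n s := Real.exp_pos _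

lemma decay_le_one {κ : ℝ} (hκ : 0 ≤ κ) (n : ℕ) {s : ℝ} (hs : 0 ≤ s) : decay l κ n s ≤ 1 := by
  rw [decay, Real.exp_le_one_iff]; have := sq_nonneg (gam l (n + 1)); simp; positivity

lemma decay_anti {κ : ℝ} (hκ : 0 ≤ κ) (n : ℕ) {s t : ℝ} (hst : s ≤ t) :
    decay l κ n t ≤ decay l κ n s := by
  unfold decay
  gcongr

lemma decay_add (κ : ℝ) (n : ℕ) (s t : ℝ) :
    decay l κ n (s + t) = decay l κ n s * decay l κ n t := by
  simp only [decay, ← Real.exp_add]; ring_nf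

lemma continuous_decay (κ : ℝ) (n : ℕ) : Continuous (decay l κ n) := by unfold decay; fun_prop

lemma decay_le (hl : 0 < l) {κ : ℝ} (hκ : 0 < κ) (n : ℕ) {s : ℝ} (hs : 0 < s) :
    decay l κ n s ≤ 1 / (κ * s) / gam l (n + 1) ^ 2 := by
  have hg := gam_pos hl n
  refine (exp_neg_le_inv (by positivity)).trans (le_of_eq ?_)
  field_simp

/-- The quadratic bound exp(−y) ≤ 2/y² pays for the factor γ² and still leaves a summable γ⁻². -/
lemma sq_mul_decay_le (hl : 0 < l) {κ : ℝ} (hκ : 0 < κ) (n : ℕ) {s : ℝ} (hs : 0 < s) :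
    gam l (n + 1) ^ 2 * decay l κ n s ≤ 2 / (κ * s) ^ 2 / gam l (n + 1) ^ 2 := by
  have hg := gam_pos hl n
  refine (mul_le_mul_of_nonneg_left (exp_neg_le_inv_sq (by positivity)) (sq_nonneg _)).trans
    (le_of_eq ?_)
  field_simp

lemma summable_sq_mul_decay (hl : 0 < l) {κ : ℝ} (hκ : 0 < κ) {s : ℝ} (hs : 0 < s) :
    Summable fun n => gam l (n + 1) ^ 2 * decay l κ n s :=
  summable_of_le_inv_gam_sq hl fun n => by
    rw [abs_of_nonneg (mul_nonneg (sq_nonneg _) (decay_pos _ _ _).le)]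
    exact sq_mul_decay_le hl hκ n hs

lemma summable_decay (hl : 0 < l) {κ : ℝ} (hκ : 0 < κ) {s : ℝ} (hs : 0 < s) :
    Summable fun n => decay l κ n s :=
  summable_of_le_inv_gam_sq hl fun n => by
    rw [abs_of_pos (decay_pos _ _ _)]
    exact decay_le hl hκ n hs

/-- The Dirichlet heat semigroup of `u_t = κ u_xx` on `(0, l)`. -/
def heatFlow (l κ : ℝ) (q : ℝ → ℝ) (s x : ℝ) : ℝ := kernelAvg l gauss q (√(2 * κ * s)) x

/-- The second space derivative of the Dirichlet heat semigroup. -/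
def heatFlowXX (l κ : ℝ) (q : ℝ → ℝ) (s x : ℝ) : ℝ :=
  (2 * κ * s)⁻¹ * kernelAvg l gaussDD q (√(2 * κ * s)) x

section HeatFlow

variable {κ M : ℝ} {q : ℝ → ℝ}

/-- At scale zero the average runs over a constant and the Gaussian has mass one. The initial value
is the odd extension, hence zero at the end points whatever the data are there. -/
lemma heatFlow_zero (x : ℝ) : heatFlow l κ q 0 x = oddExt l q x := by
  simp only [heatFlow, kernelAvg, mul_zero, Real.sqrt_zero, zero_mul, sub_zero]
  rw [integral_mul_const, integral_gauss, one_mul]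

lemma heatFlow_eq (hl : 0 < l) (hκ : 0 < κ) (hM0 : 0 ≤ M) (hq : ContinuousOn q (Ioo 0 l))
    (hM : ∀ ξ ∈ Ioo 0 l, |q ξ| ≤ M) {s : ℝ} (hs : 0 < s) {x : ℝ} (hx : x ∈ Icc 0 l) :
    heatFlow l κ q s x = sineSeries l (fun n => decay l κ n s * sinCoeff l q n) x := by
  -- At scale σ = √(2κs) the cosine transform exp(−γ²σ²/2) is exactly the decay factor of the mode.
  have hc : ∀ n, ∫ y, gauss y * Real.cos (gam l (n + 1) * √(2 * κ * s) * y) = decay l κ n s := by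
    intro n
    rw [integral_gauss_mul_cos, decay, mul_pow, Real.sq_sqrt (by positivity)]
    ring_nf
  rw [heatFlow, kernelAvg_eq_sineSeries hl hM0 integrable_gauss gauss_neg hq hM (by positivity) _ hx]
  · simp_rw [hc]
  · simp_rw [hc]
    refine Summable.of_norm_bounded ((summable_decay hl hκ hs).mul_right (2 * M)) fun n => ?_
    rw [norm_mul, Real.norm_eq_abs, Real.norm_eq_abs, abs_of_pos (decay_pos _ _ _)]
    exact mul_le_mul_of_nonneg_left (abs_sinCoeff_le hl hM n) (decay_pos _ _ _).le

lemma heatFlowXX_eq (hl : 0 < l) (hκ : 0 < κ) (hM0 : 0 ≤ M) (hq : ContinuousOn q (Ioo 0 l))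
    (hM : ∀ ξ ∈ Ioo 0 l, |q ξ| ≤ M) {s : ℝ} (hs : 0 < s) {x : ℝ} (hx : x ∈ Icc 0 l) :
    heatFlowXX l κ q s x =
      sineSeries l (fun n => -(gam l (n + 1) ^ 2) * decay l κ n s * sinCoeff l q n) x := by
  have hc : ∀ n, ∫ y, gaussDD y * Real.cos (gam l (n + 1) * √(2 * κ * s) * y) =
      (2 * κ * s) * (-(gam l (n + 1) ^ 2) * decay l κ n s) := by
    intro n
    rw [integral_gaussDD_mul_cos, decay, mul_pow, Real.sq_sqrt (by positivity)]
    ring_nf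
  rw [heatFlowXX,
    kernelAvg_eq_sineSeries hl hM0 integrable_gaussDD gaussDD_neg hq hM (by positivity) _ hx]
  · simp_rw [hc, sineSeries]
    rw [← tsum_mul_left]
    refine tsum_congr fun n => ?_
    field_simp
  · simp_rw [hc]
    refine Summable.of_norm_bounded
      ((summable_sq_mul_decay hl hκ hs).mul_right (2 * κ * s * (2 * M))) fun n => ?_
    have h1 := abs_sinCoeff_le hl hM n
    have h2 := decay_pos (l := l) κ n s
    rw [Real.norm_eq_abs, show 2 * κ * s * (-(gam l (n + 1) ^ 2) * decay l κ n s) * sinCoeff l q n =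
      -(gam l (n + 1) ^ 2 * decay l κ n s * (2 * κ * s)) * sinCoeff l q n by ring, abs_mul, abs_neg,
      abs_of_nonneg (by positivity), ← mul_assoc _ (2 * κ * s) (2 * M)]
    gcongr

lemma abs_heatFlow_le (hl : 0 < l) (hM0 : 0 ≤ M) (hM : ∀ ξ ∈ Ioo 0 l, |q ξ| ≤ M) (s x : ℝ) :
    |heatFlow l κ q s x| ≤ M := by
  have h := abs_kernelAvg_le hl hM0 integrable_gauss hM (√(2 * κ * s)) x
  simp_rw [abs_of_pos (gauss_pos _), integral_gauss, mul_one] at h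
  exact h

/-- The crude rate 1/s is not integrable at s = 0; it serves where s is bounded below. -/
lemma abs_heatFlowXX_le (hl : 0 < l) (hκ : 0 < κ) (hM0 : 0 ≤ M)
    (hM : ∀ ξ ∈ Ioo 0 l, |q ξ| ≤ M) {s : ℝ} (hs : 0 < s) (x : ℝ) :
    |heatFlowXX l κ q s x| ≤ M * (∫ y, |gaussDD y|) / (2 * κ) * s⁻¹ := by
  have h := abs_kernelAvg_le hl hM0 integrable_gaussDD hM (√(2 * κ * s)) x
  rw [heatFlowXX, abs_mul, abs_of_pos (by positivity : 0 < (2 * κ * s)⁻¹)]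
  calc _ ≤ (2 * κ * s)⁻¹ * (M * ∫ y, |gaussDD y|) := by gcongr
    _ = _ := by field_simp

/-- `gaussDD` has mean zero, so the value at x may be subtracted inside the average. The Hölder
modulus then gains √σ over the prefactor σ⁻², and σ^(-3/2) is of order s^(-3/4), which is
integrable. -/
lemma abs_heatFlowXX_le_of_holder (hl : 0 < l) (hκ : 0 < κ) (hM0 : 0 ≤ M)
    (hq : ContinuousOn q (Ioo 0 l)) (hM : ∀ ξ ∈ Ioo 0 l, |q ξ| ≤ M) {L x : ℝ}
    (hL : ∀ z, |oddExt l q (x - z) - oddExt l q x| ≤ L * √|z|) {s : ℝ} (hs : 0 < s) :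
    |heatFlowXX l κ q s x| ≤
      L * (∫ y, √|y| * |gaussDD y|) * (2 * κ) ^ (-(3 / 4) : ℝ) * s ^ (-(3 / 4) : ℝ) := by
  have hm := measurable_oddExt hl hq
  have hb := abs_oddExt_le hl hM0 hM
  set σ := √(2 * κ * s) with hσ
  have hint : Integrable fun y => gaussDD y * oddExt l q (x - σ * y) := by
    refine integrable_gaussDD.mul_bdd
      (hm.comp (by fun_prop : Measurable fun y : ℝ => x - σ * y)).aestronglyMeasurable
      (ae_of_all _ fun y => hb _)
  have h1 : kernelAvg l gaussDD q σ x =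
      ∫ y, gaussDD y * (oddExt l q (x - σ * y) - oddExt l q x) := by
    simp_rw [mul_sub]
    rw [integral_sub hint (integrable_gaussDD.mul_const _), integral_mul_const, integral_gaussDD,
      zero_mul, sub_zero, kernelAvg]
  have h2 : |kernelAvg l gaussDD q σ x| ≤ ∫ y, L * √σ * (√|y| * |gaussDD y|) := by
    rw [h1, ← Real.norm_eq_abs]
    refine norm_integral_le_of_norm_le (integrable_sqrt_mul_gaussDD.const_mul _)
      (ae_of_all _ fun y => ?_)
    rw [norm_mul, Real.norm_eq_abs, Real.norm_eq_abs]
    calc |gaussDD y| * |oddExt l q (x - σ * y) - oddExt l q x|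
        ≤ |gaussDD y| * (L * √|σ * y|) := mul_le_mul_of_nonneg_left (hL _) (abs_nonneg _)
      _ = _ := by
        rw [abs_mul, abs_of_nonneg (Real.sqrt_nonneg _ : 0 ≤ σ), Real.sqrt_mul (Real.sqrt_nonneg _)]
        ring
  rw [integral_const_mul] at h2
  have h3 : (2 * κ * s)⁻¹ * √σ = (2 * κ) ^ (-(3 / 4) : ℝ) * s ^ (-(3 / 4) : ℝ) := by
    rw [← Real.mul_rpow (by positivity) hs.le, hσ, Real.sqrt_eq_rpow, Real.sqrt_eq_rpow,
      ← Real.rpow_mul (by positivity), ← Real.rpow_neg_one, ← Real.rpow_add (by positivity)]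
    norm_num
  rw [heatFlowXX, abs_mul, abs_of_pos (by positivity : 0 < (2 * κ * s)⁻¹)]
  calc _ ≤ (2 * κ * s)⁻¹ * (L * √σ * ∫ y, √|y| * |gaussDD y|) := by gcongr
    _ = L * (∫ y, √|y| * |gaussDD y|) * ((2 * κ * s)⁻¹ * √σ) := by ring
    _ = _ := by rw [h3]; ring

/-- Increments that may leave the region of regularity have size at least δ, and for them the
trivial bound 2M is at most (2M/√δ) √|z|. A local modulus thus becomes one for all increments based
at x. -/
lemma oddExt_holder (hl : 0 < l) (hM0 : 0 ≤ M) (hM : ∀ ξ ∈ Ioo 0 l, |q ξ| ≤ M) {a b L x δ : ℝ}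
    (ha : 0 < a) (hb : b < l) (hL0 : 0 ≤ L)
    (hL : ∀ y ∈ Icc a b, ∀ z ∈ Icc a b, |q y - q z| ≤ L * √|y - z|) (hδ : 0 < δ)
    (hx : x ∈ Icc (a + δ) (b - δ)) (z : ℝ) :
    |oddExt l q (x - z) - oddExt l q x| ≤ (L + 2 * M / √δ) * √|z| := by
  have hodd := abs_oddExt_le hl hM0 hM
  by_cases hz : |z| ≤ δ
  · have hz' := abs_le.1 hz
    have m1 : x ∈ Icc a b := ⟨by linarith [hx.1], by linarith [hx.2]⟩
    have m2 : x - z ∈ Icc a b := ⟨by linarith [hx.1], by linarith [hx.2]⟩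
    rw [oddExt_of_mem_Ioo hl q ⟨ha.trans_le m1.1, m1.2.trans_lt hb⟩,
      oddExt_of_mem_Ioo hl q ⟨ha.trans_le m2.1, m2.2.trans_lt hb⟩]
    refine (hL _ m2 _ m1).trans ?_
    rw [sub_sub_cancel_left, abs_neg]
    have : 0 ≤ 2 * M / √δ := by positivity
    exact mul_le_mul_of_nonneg_right (by linarith) (Real.sqrt_nonneg _)
  · push Not at hz
    have h1 : |oddExt l q (x - z) - oddExt l q x| ≤ 2 * M := by
      refine (abs_sub _ _).trans ?_
      linarith [hodd (x - z), hodd x]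
    have h2 : √δ ≤ √|z| := Real.sqrt_le_sqrt hz.le
    have h3 : 0 < √δ := Real.sqrt_pos.2 hδ
    calc _ ≤ 2 * M := h1
      _ = 2 * M / √δ * √δ := by field_simp
      _ ≤ (L + 2 * M / √δ) * √|z| := by gcongr; linarith

end HeatFlow

lemma continuousWithinAt_heatFlow (hl : 0 < l) {κ : ℝ} (hκ : 0 < κ) {Q : ℝ → ℝ → ℝ} {A : Set ℝ}
    {M : ℝ} (hM0 : 0 ≤ M) (hQ : ContinuousOn (fun p : ℝ × ℝ => Q p.1 p.2) (Ioo 0 l ×ˢ A))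
    (hM : ∀ ξ ∈ Ioo 0 l, ∀ τ ∈ A, |Q ξ τ| ≤ M) {s x τ : ℝ} (hτ : τ ∈ A)
    (h : 0 < s ∨ x ∈ Ioo 0 l) :
    ContinuousWithinAt (fun p : ℝ × ℝ × ℝ => heatFlow l κ (fun ξ => Q ξ p.2.2) p.2.1 p.1)
      (univ ×ˢ univ ×ˢ A) (x, s, τ) := by
  have h1 := continuousWithinAt_kernelAvg (Q := Q) (σ := √(2 * κ * s)) (x := x) hl hM0
    integrable_gauss hQ hM hτ (h.imp_left fun hs => by positivity)
  have hc : Continuous fun p : ℝ × ℝ × ℝ => (p.1, √(2 * κ * p.2.1), p.2.2) := by fun_prop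
  have h3 : Tendsto (fun p : ℝ × ℝ × ℝ => (p.1, √(2 * κ * p.2.1), p.2.2))
      (𝓝[univ ×ˢ univ ×ˢ A] (x, s, τ)) (𝓝[univ ×ˢ univ ×ˢ A] (x, √(2 * κ * s), τ)) :=
    tendsto_nhdsWithin_iff.2 ⟨(hc.tendsto (x, s, τ)).mono_left nhdsWithin_le_nhds, by
      filter_upwards [self_mem_nhdsWithin] with p hp using ⟨mem_univ _, mem_univ _, hp.2.2⟩⟩
  unfold heatFlow
  exact Tendsto.comp (f := fun p : ℝ × ℝ × ℝ => (p.1, √(2 * κ * p.2.1), p.2.2))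
    (g := fun p : ℝ × ℝ × ℝ => kernelAvg l gauss (fun ξ => Q ξ p.2.2) p.2.1 p.1) h1 h3

lemma continuousWithinAt_heatFlowXX (hl : 0 < l) {κ : ℝ} (hκ : 0 < κ) {Q : ℝ → ℝ → ℝ} {A : Set ℝ}
    {M : ℝ} (hM0 : 0 ≤ M) (hQ : ContinuousOn (fun p : ℝ × ℝ => Q p.1 p.2) (Ioo 0 l ×ˢ A))
    (hM : ∀ ξ ∈ Ioo 0 l, ∀ τ ∈ A, |Q ξ τ| ≤ M) {s x τ : ℝ} (hτ : τ ∈ A) (hs : 0 < s) :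
    ContinuousWithinAt (fun p : ℝ × ℝ × ℝ => heatFlowXX l κ (fun ξ => Q ξ p.2.2) p.2.1 p.1)
      (univ ×ˢ univ ×ˢ A) (x, s, τ) := by
  have h1 := continuousWithinAt_kernelAvg (Q := Q) (σ := √(2 * κ * s)) (x := x) hl hM0
    integrable_gaussDD hQ hM hτ (Or.inl (by positivity))
  have hc : Continuous fun p : ℝ × ℝ × ℝ => (p.1, √(2 * κ * p.2.1), p.2.2) := by fun_prop
  have h3 : Tendsto (fun p : ℝ × ℝ × ℝ => (p.1, √(2 * κ * p.2.1), p.2.2))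
      (𝓝[univ ×ˢ univ ×ˢ A] (x, s, τ)) (𝓝[univ ×ˢ univ ×ˢ A] (x, √(2 * κ * s), τ)) :=
    tendsto_nhdsWithin_iff.2 ⟨(hc.tendsto (x, s, τ)).mono_left nhdsWithin_le_nhds, by
      filter_upwards [self_mem_nhdsWithin] with p hp using ⟨mem_univ _, mem_univ _, hp.2.2⟩⟩
  have h4 : ContinuousAt (fun p : ℝ × ℝ × ℝ => (2 * κ * p.2.1)⁻¹) (x, s, τ) :=
    ContinuousAt.inv₀ (by fun_prop) (by positivity)
  have h5 := Tendsto.comp (f := fun p : ℝ × ℝ × ℝ => (p.1, √(2 * κ * p.2.1), p.2.2))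
    (g := fun p : ℝ × ℝ × ℝ => kernelAvg l gaussDD (fun ξ => Q ξ p.2.2) p.2.1 p.1) h1 h3
  unfold heatFlowXX
  exact Tendsto.mul (h4.tendsto.mono_left nhdsWithin_le_nhds) h5

/-- When the data vanish at the end points the odd extension is continuous everywhere, so the
restriction to positive time or interior x is not needed. This gives continuity of u_t at the
corners. -/
lemma continuous_heatFlow_of_continuous (hl : 0 < l) {κ : ℝ} {q : ℝ → ℝ} {M : ℝ} (hM0 : 0 ≤ M)
    (hq : ContinuousOn q (Icc 0 l)) (h0 : q 0 = 0) (h1 : q l = 0)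
    (hM : ∀ ξ ∈ Ioo 0 l, |q ξ| ≤ M) :
    Continuous fun p : ℝ × ℝ => heatFlow l κ q p.2 p.1 := by
  have hc := continuous_oddExt hl hq h0 h1
  have hcont : Continuous fun p : ℝ × ℝ × ℝ => kernelAvg l gauss q p.2.1 p.1 := by
    rw [continuous_iff_continuousAt]
    rintro ⟨x, σ, τ⟩
    have := continuousWithinAt_kernelAvg_of_ae (k := gauss) (Q := fun ξ _ => q ξ) (A := univ)
      (τ := τ) (x := x) (σ := σ) hl hM0 integrable_gauss
      (fun _ _ => hq.mono Ioo_subset_Icc_self) (fun ξ hξ _ _ => hM ξ hξ)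
      (ae_of_all _ fun y => Continuous.continuousWithinAt
        (f := fun p : ℝ × ℝ => oddExt l q p.1) (hc.comp continuous_fst))
    rwa [univ_prod_univ, univ_prod_univ, continuousWithinAt_univ] at this
  unfold heatFlow
  exact Continuous.comp (f := fun p : ℝ × ℝ => (p.1, √(2 * κ * p.2), (0 : ℝ))) hcont (by fun_prop)

end

/-! ### Primitives and limits of twice differentiable functions -/

section


/-- The nearest point of `[a, b]`. -/
def clamp (a b x : ℝ) : ℝ := max a (min b x)

lemma continuous_clamp (a b : ℝ) : Continuous (clamp a b) := by unfold clamp; fun_prop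

lemma clamp_mem {a b : ℝ} (hab : a ≤ b) (x : ℝ) : clamp a b x ∈ Icc a b :=
  ⟨le_max_left _ _, max_le hab (min_le_left _ _)⟩

lemma clamp_of_mem {a b x : ℝ} (hx : x ∈ Icc a b) : clamp a b x = x := by
  rw [clamp, min_eq_right hx.2, max_eq_right hx.1]

lemma continuous_comp_clamp {f : ℝ → ℝ} {a b : ℝ} (hab : a ≤ b) (hf : ContinuousOn f (Icc a b)) :
    Continuous fun x => f (clamp a b x) :=
  hf.comp_continuous (continuous_clamp a b) (clamp_mem hab)

lemma integral_comp_clamp {f : ℝ → ℝ} {a b x : ℝ} (hx : x ∈ Icc a b) :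
    ∫ y in a..x, f (clamp a b y) = ∫ y in a..x, f y := by
  refine intervalIntegral.integral_congr fun y hy => ?_
  rw [uIcc_of_le hx.1] at hy
  simp only [clamp_of_mem ⟨hy.1, hy.2.trans hx.2⟩]

/-- The fundamental theorem of calculus with one-sided derivatives at the end points. -/
lemma hasDerivWithinAt_of_eq_integral {F f : ℝ → ℝ} {a b : ℝ} (hab : a ≤ b)
    (hf : ContinuousOn f (Icc a b)) (hF : ∀ s ∈ Icc a b, F s = F a + ∫ y in a..s, f y) {t : ℝ}
    (ht : t ∈ Icc a b) : HasDerivWithinAt F (f t) (Icc a b) t := by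
  have hc := continuous_comp_clamp hab hf
  have h := ((hc.integral_hasStrictDerivAt a t).hasDerivAt.const_add (F a)).hasDerivWithinAt
    (s := Icc a b)
  rw [clamp_of_mem ht] at h
  refine h.congr (fun s hs => ?_) ?_
  · rw [integral_comp_clamp hs, hF s hs]
  · rw [integral_comp_clamp ht, hF t ht]

lemma continuousOn_primitive {f : ℝ → ℝ} {a b : ℝ} (hab : a ≤ b) (hf : ContinuousOn f (Icc a b)) :
    ContinuousOn (fun x => ∫ y in a..x, f y) (Icc a b) := by
  have hc := continuous_comp_clamp hab hf
  have h : Continuous fun x => ∫ y in a..x, f (clamp a b y) :=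
    intervalIntegral.continuous_primitive (fun u v => hc.intervalIntegrable u v) a
  exact h.continuousOn.congr fun x hx => (integral_comp_clamp hx).symm

lemma tendsto_primitive {p : ℕ → ℝ → ℝ} {q : ℝ → ℝ} {a b C : ℝ}
    (hp : ∀ j, ContinuousOn (p j) (Icc a b)) (hC : ∀ j, ∀ x ∈ Icc a b, |p j x| ≤ C)
    (hlim : ∀ x ∈ Icc a b, Tendsto (fun j => p j x) atTop (𝓝 (q x))) {x : ℝ} (hx : x ∈ Icc a b) :
    Tendsto (fun j => ∫ y in a..x, p j y) atTop (𝓝 (∫ y in a..x, q y)) := by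
  have hsub : ∀ y ∈ uIoc a x, y ∈ Icc a b := fun y hy => by
    rw [uIoc_of_le hx.1] at hy; exact ⟨hy.1.le, hy.2.trans hx.2⟩
  refine intervalIntegral.tendsto_integral_filter_of_dominated_convergence (fun _ => C)
    (Eventually.of_forall fun j => ?_) (Eventually.of_forall fun j => ?_)
    intervalIntegrable_const ?_
  · exact ((hp j).mono hsub).aestronglyMeasurable measurableSet_uIoc
  · exact ae_of_all _ fun y hy => hC j y (hsub y hy)
  · exact ae_of_all _ fun y hy => hlim y (hsub y hy)

/-- If `f_j → g` pointwise and `f_j'' → q` boundedly, then `g` is a second primitive of `q`. -/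
lemma eq_second_primitive_of_tendsto {f f' p : ℕ → ℝ → ℝ} {g q : ℝ → ℝ} {a b C : ℝ} (hab : a < b)
    (hf : ∀ j x, HasDerivAt (f j) (f' j x) x) (hf' : ∀ j x, HasDerivAt (f' j) (p j x) x)
    (hp : ∀ j, Continuous (p j)) (hC : ∀ j, ∀ x ∈ Icc a b, |p j x| ≤ C)
    (hlim : ∀ x ∈ Icc a b, Tendsto (fun j => p j x) atTop (𝓝 (q x)))
    (hg : ∀ x ∈ Icc a b, Tendsto (fun j => f j x) atTop (𝓝 (g x))) {x : ℝ} (hx : x ∈ Icc a b) :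
    g x = g a + (x - a) * ((g b - g a - ∫ y in a..b, ∫ z in a..y, q z) / (b - a)) +
      ∫ y in a..x, ∫ z in a..y, q z := by
  have hpI : ∀ j, Continuous fun y => ∫ z in a..y, p j z := fun j =>
    intervalIntegral.continuous_primitive (fun u v => (hp j).intervalIntegrable u v) a
  have hf'c : ∀ j, Continuous (f' j) := fun j =>
    continuous_iff_continuousAt.2 fun x => (hf' j x).continuousAt
  have h1 : ∀ j y, f' j y = f' j a + ∫ z in a..y, p j z := fun j y => by
    rw [intervalIntegral.integral_eq_sub_of_hasDerivAt (fun z _ => hf' j z)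
      ((hp j).intervalIntegrable _ _)]; ring
  have h2 : ∀ j y, f j y = f j a + (y - a) * f' j a + ∫ z in a..y, ∫ w in a..z, p j w := by
    intro j y
    have h3 := intervalIntegral.integral_eq_sub_of_hasDerivAt (a := a) (b := y)
      (fun z _ => hf j z) ((hf'c j).intervalIntegrable _ _)
    rw [intervalIntegral.integral_congr (g := fun z => f' j a + ∫ w in a..z, p j w)
      (fun z _ => h1 j z), intervalIntegral.integral_add intervalIntegrable_const
      ((hpI j).intervalIntegrable _ _), intervalIntegral.integral_const, smul_eq_mul] at h3
    linarith
  have ha : a ∈ Icc a b := ⟨le_rfl, hab.le⟩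
  have hb : b ∈ Icc a b := ⟨hab.le, le_rfl⟩
  have hC0 : 0 ≤ C := (abs_nonneg _).trans (hC 0 a ha)
  have hI1 : ∀ y ∈ Icc a b, Tendsto (fun j => ∫ z in a..y, p j z) atTop (𝓝 (∫ z in a..y, q z)) :=
    fun y hy => tendsto_primitive (fun j => (hp j).continuousOn) hC hlim hy
  have hI2 : ∀ y ∈ Icc a b, Tendsto (fun j => ∫ z in a..y, ∫ w in a..z, p j w) atTop
      (𝓝 (∫ z in a..y, ∫ w in a..z, q w)) := fun y hy => by
    refine tendsto_primitive (C := C * (b - a)) (fun j => (hpI j).continuousOn) (fun j z hz => ?_)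
      hI1 hy
    have := intervalIntegral.norm_integral_le_of_norm_le_const (a := a) (b := z) (f := p j) (C := C)
      fun w hw => by
        rw [uIoc_of_le hz.1] at hw
        exact hC j w ⟨hw.1.le, hw.2.trans hz.2⟩
    rw [Real.norm_eq_abs, abs_of_nonneg (sub_nonneg.2 hz.1)] at this
    exact this.trans (mul_le_mul_of_nonneg_left (by linarith [hz.2]) hC0)
  -- Convergence of the slopes at a is not assumed: evaluating the second-primitive formula at b
  -- expresses them through quantities already known to converge.
  have hm : Tendsto (fun j => f' j a) atTop
      (𝓝 ((g b - g a - ∫ y in a..b, ∫ z in a..y, q z) / (b - a))) := by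
    refine Tendsto.congr (fun j => ?_) ((((hg b hb).sub (hg a ha)).sub (hI2 b hb)).div_const (b - a))
    rw [h2 j b]
    have : b - a ≠ 0 := by linarith
    field_simp; ring
  refine tendsto_nhds_unique (hg x hx) ?_
  refine Tendsto.congr (fun j => (h2 j x).symm) ?_
  exact ((hg a ha).add (hm.const_mul _)).add (hI2 x hx)

/-- Derivatives of a second primitive. -/
lemma hasDerivAt_of_eq_second_primitive {g q : ℝ → ℝ} {a b m : ℝ} (hab : a ≤ b)
    (hq : ContinuousOn q (Icc a b))
    (hg : ∀ x ∈ Icc a b, g x = g a + (x - a) * m + ∫ y in a..x, ∫ z in a..y, q z) {x : ℝ}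
    (hx : x ∈ Ioo a b) :
    HasDerivAt g (m + ∫ z in a..x, q z) x ∧ HasDerivAt (fun x => m + ∫ z in a..x, q z) (q x) x := by
  have hx' := Ioo_subset_Icc_self hx
  have hn : Icc a b ∈ 𝓝 x := Icc_mem_nhds hx.1 hx.2
  constructor
  · have h1 := (hasDerivWithinAt_of_eq_integral (F := fun x => ∫ y in a..x, ∫ z in a..y, q z) hab
      (continuousOn_primitive hab hq) (fun s hs => by simp) hx').hasDerivAt hn
    have h2 : HasDerivAt (fun x => g a + (x - a) * m) m x := by
      simpa using (((hasDerivAt_id x).sub_const a).mul_const m).const_add (g a)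
    refine (h2.add h1).congr_of_eventuallyEq ?_
    filter_upwards [hn] with y hy using hg y hy
  · exact ((hasDerivWithinAt_of_eq_integral (F := fun x => ∫ y in a..x, q y) hab hq
      (fun s hs => by simp) hx').hasDerivAt hn).const_add m

/-- Joint continuity of the primitives of a family of functions. -/
lemma continuousOn_parametric_primitive {P : ℝ → ℝ → ℝ} {a b c d : ℝ} (hab : a ≤ b) (hcd : c ≤ d)
    (hP : ContinuousOn (fun p : ℝ × ℝ => P p.1 p.2) (Icc a b ×ˢ Icc c d)) :
    ContinuousOn (fun p : ℝ × ℝ => ∫ y in a..p.1, P y p.2) (Icc a b ×ˢ Icc c d) := by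
  -- Clamping both variables extends the integrand continuously to the whole plane without changing
  -- it on the rectangle.
  have h1 : Continuous (Function.uncurry fun t y : ℝ => P (clamp a b y) (clamp c d t)) :=
    hP.comp_continuous (((continuous_clamp a b).comp continuous_snd).prodMk
      ((continuous_clamp c d).comp continuous_fst)) fun p => ⟨clamp_mem hab _, clamp_mem hcd _⟩
  have h2 := (intervalIntegral.continuous_parametric_primitive_of_continuous (μ := volume) (a₀ := a)
    h1).comp continuous_swap
  refine h2.continuousOn.congr fun p hp => ?_
  simp only [Function.comp_apply, Prod.fst_swap, Prod.snd_swap, clamp_of_mem hp.2]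
  exact (integral_comp_clamp (f := fun y => P y p.2) hp.1).symm

end

/-! ### Duhamel's integral for a locally Hölder source -/

section


variable {l : ℝ}

/-- Bounded continuous source terms on the strip that are locally Hölder continuous in space. -/
structure HeatSource (l T M : ℝ) (Q : ℝ → ℝ → ℝ) : Prop where
  nonneg : 0 ≤ M
  cont : ContinuousOn (fun p : ℝ × ℝ => Q p.1 p.2) (Ioo 0 l ×ˢ Ioc 0 T)
  bound : ∀ ξ ∈ Ioo 0 l, ∀ τ ∈ Ioc 0 T, |Q ξ τ| ≤ M
  holder : ∀ a b τ₀ : ℝ, 0 < a → b < l → 0 < τ₀ → ∃ L, 0 ≤ L ∧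
    ∀ τ ∈ Icc τ₀ T, ∀ y ∈ Icc a b, ∀ z ∈ Icc a b, |Q y τ - Q z τ| ≤ L * √|y - z|

lemma continuousOn_slice {Q : ℝ → ℝ → ℝ} {A : Set ℝ}
    (hQ : ContinuousOn (fun p : ℝ × ℝ => Q p.1 p.2) (Ioo 0 l ×ˢ A)) {τ : ℝ}
    (hτ : τ ∈ A) : ContinuousOn (fun ξ => Q ξ τ) (Ioo 0 l) :=
  hQ.comp (by fun_prop : Continuous fun ξ : ℝ => (ξ, τ)).continuousOn fun _ hξ => ⟨hξ, hτ⟩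

lemma continuousOn_sinCoeff (hl : 0 < l) {M : ℝ} {Q : ℝ → ℝ → ℝ} {A : Set ℝ}
    (hQ : ContinuousOn (fun p : ℝ × ℝ => Q p.1 p.2) (Ioo 0 l ×ˢ A))
    (hM : ∀ ξ ∈ Ioo 0 l, ∀ τ ∈ A, |Q ξ τ| ≤ M) (n : ℕ) :
    ContinuousOn (fun τ => sinCoeff l (fun ξ => Q ξ τ) n) A := by
  intro τ hτ
  refine Tendsto.const_mul _ ?_
  have hae : ∀ᵐ ξ : ℝ, ξ ∈ uIoc 0 l → ξ ∈ Ioo 0 l := by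
    filter_upwards [Measure.ae_ne volume l] with ξ hξ hξ'
    rw [uIoc_of_le hl.le] at hξ'
    exact ⟨hξ'.1, lt_of_le_of_ne hξ'.2 hξ⟩
  refine intervalIntegral.tendsto_integral_filter_of_dominated_convergence (fun _ => M) ?_ ?_
    intervalIntegrable_const ?_
  · filter_upwards [self_mem_nhdsWithin] with t ht
    exact (intervalIntegrable_mul_sinMode (intervalIntegrable_of_bounded hl.le
      (continuousOn_slice hQ ht) fun ξ hξ => hM ξ hξ t ht) n).def'.aestronglyMeasurable
  · filter_upwards [self_mem_nhdsWithin] with t ht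
    filter_upwards [hae] with ξ hξ hξ'
    exact (abs_mul_sinMode_le _ n ξ).trans (hM ξ (hξ hξ') t ht)
  · filter_upwards [hae] with ξ hξ hξ'
    refine Tendsto.mul_const _ ?_
    exact (hQ.comp (by fun_prop : Continuous fun τ : ℝ => (ξ, τ)).continuousOn
      fun τ hτ => ⟨hξ hξ', hτ⟩) τ hτ

/-- The regularized Duhamel integral `∫_0^t ∂_xx S(s + η) Q(t - s) ds`. -/
def duhamelXX (l κ : ℝ) (Q : ℝ → ℝ → ℝ) (η x t : ℝ) : ℝ :=
  ∫ s in (0 : ℝ)..t, heatFlowXX l κ (fun ξ => Q ξ (t - s)) (s + η) x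

namespace HeatSource

variable {T M κ : ℝ} {Q : ℝ → ℝ → ℝ}

/-- A domination uniform in η ≥ 0 comes from splitting the time range. If t − s ≥ t₀/2, the source
is sampled at times where its Hölder constant is uniform and the rate s^(-3/4) holds. Otherwise s ≥
t₀/2 and the crude rate is bounded. -/
lemma abs_heatFlowXX_le (hl : 0 < l) (hκ : 0 < κ) (h : HeatSource l T M Q) {a b t₀ : ℝ}
    (ha : 0 < a) (hb : b < l) (ht₀ : 0 < t₀) :
    ∃ C, 0 ≤ C ∧ ∀ x ∈ Icc a b, ∀ t ∈ Icc t₀ T, ∀ s ∈ Ioo 0 t, ∀ η, 0 ≤ η →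
      |heatFlowXX l κ (fun ξ => Q ξ (t - s)) (s + η) x| ≤ C * s ^ (-(3 / 4) : ℝ) := by
  obtain ⟨L, hL0, hL⟩ := h.holder (a / 2) ((b + l) / 2) (t₀ / 2) (by linarith) (by linarith)
    (by linarith)
  -- The Hölder modulus is taken on the larger interval [a/2, (b+l)/2], from whose ends [a, b] keeps
  -- distance δ.
  set δ := min (a / 2) ((l - b) / 2)
  have hδ : 0 < δ := lt_min (by linarith) (by linarith)
  set K₁ := ∫ y, √|y| * |gaussDD y|
  have hK₁ : 0 ≤ K₁ := integral_nonneg fun y => by positivity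
  set K₂ := ∫ y, |gaussDD y|
  have hK₂ : 0 ≤ K₂ := integral_nonneg fun y => by positivity
  have hM0 := h.nonneg
  set C₁ := (L + 2 * M / √δ) * K₁ * (2 * κ) ^ (-(3 / 4) : ℝ)
  set C₂ := M * K₂ / (2 * κ) * (t₀ / 2)⁻¹ * T ^ (3 / 4 : ℝ)
  have hC₁ : 0 ≤ C₁ := by positivity
  by_cases hT : T ≤ 0
  · refine ⟨0, le_rfl, fun x hx t ht s hs => ?_⟩
    linarith [ht.1, ht.2, hs.1]
  push Not at hT
  have hC₂ : 0 ≤ C₂ := by positivity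
  refine ⟨C₁ + C₂, by positivity, fun x hx t ht s hs η hη => ?_⟩
  have hs0 : 0 < s := hs.1
  have hts : t - s ∈ Ioc 0 T := ⟨by linarith [hs.2], by linarith [ht.2]⟩
  have hq := continuousOn_slice h.cont hts
  have hqb : ∀ ξ ∈ Ioo 0 l, |Q ξ (t - s)| ≤ M := fun ξ hξ => h.bound ξ hξ _ hts
  have hpos : 0 ≤ s ^ (-(3 / 4) : ℝ) := by positivity
  rcases le_total (t₀ / 2) (t - s) with hc | hc
  · have hx' : x ∈ Icc (a / 2 + δ) ((b + l) / 2 - δ) := by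
      have h1 : δ ≤ a / 2 := min_le_left _ _
      have h2 : δ ≤ (l - b) / 2 := min_le_right _ _
      exact ⟨by linarith [hx.1], by linarith [hx.2]⟩
    have h1 := abs_heatFlowXX_le_of_holder (s := s + η) hl hκ hM0 hq hqb
      (oddExt_holder hl hM0 hqb (by linarith) (by linarith) hL0 (hL _ ⟨hc, hts.2⟩) hδ hx')
      (by linarith)
    refine h1.trans ?_
    have h2 : (s + η) ^ (-(3 / 4) : ℝ) ≤ s ^ (-(3 / 4) : ℝ) :=
      Real.rpow_le_rpow_of_nonpos hs0 (by linarith) (by norm_num)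
    calc C₁ * (s + η) ^ (-(3 / 4) : ℝ) ≤ C₁ * s ^ (-(3 / 4) : ℝ) := by gcongr
      _ ≤ _ := by gcongr; linarith
  · have h1 := StripProblem.abs_heatFlowXX_le (s := s + η) hl hκ hM0 hqb (by linarith) x
    refine h1.trans ?_
    have h2 : (s + η)⁻¹ ≤ (t₀ / 2)⁻¹ := inv_anti₀ (by linarith) (by linarith [ht.1])
    -- Since s ≤ T, the constant bound can be written with the same weight s^(-3/4).
    have h3 : 1 ≤ T ^ (3 / 4 : ℝ) * s ^ (-(3 / 4) : ℝ) := by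
      rw [Real.rpow_neg hs0.le, ← div_eq_mul_inv, one_le_div (by positivity)]
      exact Real.rpow_le_rpow hs0.le (by linarith [hs.2, ht.2]) (by norm_num)
    calc M * K₂ / (2 * κ) * (s + η)⁻¹ ≤ M * K₂ / (2 * κ) * (t₀ / 2)⁻¹ * 1 := by
          rw [mul_one]; gcongr
      _ ≤ M * K₂ / (2 * κ) * (t₀ / 2)⁻¹ * (T ^ (3 / 4 : ℝ) * s ^ (-(3 / 4) : ℝ)) := by
          gcongr
      _ = C₂ * s ^ (-(3 / 4) : ℝ) := by ring
      _ ≤ _ := by gcongr; linarith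

lemma tendsto_heatFlowXX (hl : 0 < l) (hκ : 0 < κ) (h : HeatSource l T M Q) {x t η s : ℝ}
    (hs : s ∈ Ioo 0 t) (ht : t ≤ T) (hη : 0 ≤ η) :
    ContinuousWithinAt (fun p : ℝ × ℝ × ℝ × ℝ =>
      heatFlowXX l κ (fun ξ => Q ξ (p.2.1 - p.2.2.2)) (p.2.2.2 + p.2.2.1) p.1)
      {p | p.2.2.2 ∈ Ioo 0 p.2.1 ∧ p.2.1 ≤ T} (x, t, η, s) := by
  have h1 := continuousWithinAt_heatFlowXX (Q := Q) (s := s + η) (x := x) (τ := t - s) hl hκ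
    h.nonneg h.cont h.bound ⟨by linarith [hs.2], by linarith [hs.1]⟩ (by linarith [hs.1])
  have hc : Continuous fun p : ℝ × ℝ × ℝ × ℝ => (p.1, p.2.2.2 + p.2.2.1, p.2.1 - p.2.2.2) := by
    fun_prop
  have h3 : Tendsto (fun p : ℝ × ℝ × ℝ × ℝ => (p.1, p.2.2.2 + p.2.2.1, p.2.1 - p.2.2.2))
      (𝓝[{p | p.2.2.2 ∈ Ioo 0 p.2.1 ∧ p.2.1 ≤ T}] (x, t, η, s))
      (𝓝[univ ×ˢ univ ×ˢ Ioc 0 T] (x, s + η, t - s)) :=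
    tendsto_nhdsWithin_iff.2 ⟨(hc.tendsto (x, t, η, s)).mono_left nhdsWithin_le_nhds, by
      filter_upwards [self_mem_nhdsWithin] with p hp
      exact ⟨mem_univ _, mem_univ _, by linarith [hp.1.2], by linarith [hp.1.1, hp.2]⟩⟩
  exact Tendsto.comp (f := fun p : ℝ × ℝ × ℝ × ℝ => (p.1, p.2.2.2 + p.2.2.1, p.2.1 - p.2.2.2))
    (g := fun p : ℝ × ℝ × ℝ => heatFlowXX l κ (fun ξ => Q ξ p.2.2) p.2.1 p.1) h1 h3

lemma continuousOn_heatFlowXX (hl : 0 < l) (hκ : 0 < κ) (h : HeatSource l T M Q) {x t η : ℝ}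
    (ht : t ≤ T) (hη : 0 ≤ η) :
    ContinuousOn (fun s => heatFlowXX l κ (fun ξ => Q ξ (t - s)) (s + η) x) (Ioo 0 t) := by
  intro s hs
  have hc : Continuous fun s : ℝ => (x, t, η, s) := by fun_prop
  exact Tendsto.comp (f := fun s : ℝ => (x, t, η, s)) (g := fun p : ℝ × ℝ × ℝ × ℝ =>
      heatFlowXX l κ (fun ξ => Q ξ (p.2.1 - p.2.2.2)) (p.2.2.2 + p.2.2.1) p.1)
    (h.tendsto_heatFlowXX hl hκ hs ht hη)
    (tendsto_nhdsWithin_iff.2 ⟨(hc.tendsto s).mono_left nhdsWithin_le_nhds, by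
      filter_upwards [self_mem_nhdsWithin] with p hp using ⟨hp, ht⟩⟩)

/-- With the variable upper limit moved into the integrand, dominated convergence applies over a
fixed measure space. -/
lemma duhamelXX_eq_integral_indicator {η x t : ℝ} (ht : 0 ≤ t) :
    duhamelXX l κ Q η x t = ∫ s, (Ioo 0 t).indicator
      (fun s => heatFlowXX l κ (fun ξ => Q ξ (t - s)) (s + η) x) s := by
  rw [duhamelXX, intervalIntegral.integral_of_le ht, integral_Ioc_eq_integral_Ioo,
    integral_indicator measurableSet_Ioo]

lemma integrable_indicator_rpow (T : ℝ) :
    Integrable ((Ioo 0 T).indicator fun s : ℝ => s ^ (-(3 / 4) : ℝ)) := by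
  rw [integrable_indicator_iff measurableSet_Ioo]
  rcases le_total T 0 with hT | hT
  · rw [Ioo_eq_empty (by simpa using hT)]; exact integrableOn_empty
  · rw [← intervalIntegrable_iff_integrableOn_Ioo_of_le hT]
    exact intervalIntegral.intervalIntegrable_rpow' (by norm_num)

/-- Joint continuity of the regularized Duhamel integral, up to `η = 0`. -/
lemma continuousOn_duhamelXX (hl : 0 < l) (hκ : 0 < κ) (h : HeatSource l T M Q) :
    ContinuousOn (fun p : ℝ × ℝ × ℝ => duhamelXX l κ Q p.2.2 p.1 p.2.1)
      (Ioo 0 l ×ˢ Ioc 0 T ×ˢ Ici 0) := by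
  rintro ⟨x₀, t₀, η₀⟩ ⟨hx₀, ht₀, hη₀⟩
  simp only [mem_Ici] at hx₀ ht₀ hη₀
  obtain ⟨C, hC0, hC⟩ := h.abs_heatFlowXX_le hl hκ (a := x₀ / 2) (b := (x₀ + l) / 2)
    (t₀ := t₀ / 2) (by linarith [hx₀.1]) (by linarith [hx₀.2]) (by linarith [ht₀.1])
  have hev : ∀ᶠ p : ℝ × ℝ × ℝ in 𝓝[Ioo 0 l ×ˢ Ioc 0 T ×ˢ Ici 0] (x₀, t₀, η₀),
      p.1 ∈ Icc (x₀ / 2) ((x₀ + l) / 2) ∧ p.2.1 ∈ Icc (t₀ / 2) T ∧ 0 ≤ p.2.2 := by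
    have e1 : ∀ᶠ p : ℝ × ℝ × ℝ in 𝓝 (x₀, t₀, η₀), p.1 ∈ Icc (x₀ / 2) ((x₀ + l) / 2) :=
      continuous_fst.continuousAt.eventually
        (Icc_mem_nhds (by simp only; linarith [hx₀.1]) (by simp only; linarith [hx₀.2]))
    have e2 : ∀ᶠ p : ℝ × ℝ × ℝ in 𝓝 (x₀, t₀, η₀), t₀ / 2 < p.2.1 :=
      (continuous_fst.comp continuous_snd).continuousAt.eventually_const_lt
        (by simp only [Function.comp_apply]; linarith [ht₀.1])
    filter_upwards [nhdsWithin_le_nhds e1, nhdsWithin_le_nhds e2, self_mem_nhdsWithin] with p h1 h2 h3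
    exact ⟨h1, ⟨h2.le, h3.2.1.2⟩, h3.2.2⟩
  have hlim : Tendsto (fun p : ℝ × ℝ × ℝ => ∫ s, (Ioo 0 p.2.1).indicator
      (fun s => heatFlowXX l κ (fun ξ => Q ξ (p.2.1 - s)) (s + p.2.2) p.1) s)
      (𝓝[Ioo 0 l ×ˢ Ioc 0 T ×ˢ Ici 0] (x₀, t₀, η₀))
      (𝓝 (∫ s, (Ioo 0 t₀).indicator
      (fun s => heatFlowXX l κ (fun ξ => Q ξ (t₀ - s)) (s + η₀) x₀) s)) := by
    refine tendsto_integral_filter_of_dominated_convergence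
      (fun s => C * (Ioo 0 T).indicator (fun s : ℝ => s ^ (-(3 / 4) : ℝ)) s) ?_ ?_
      ((integrable_indicator_rpow T).const_mul C) ?_
    · filter_upwards [hev] with p hp
      rw [aestronglyMeasurable_indicator_iff measurableSet_Ioo]
      exact (h.continuousOn_heatFlowXX hl hκ hp.2.1.2 hp.2.2).aestronglyMeasurable measurableSet_Ioo
    · filter_upwards [hev] with p hp
      refine ae_of_all _ fun s => ?_
      by_cases hs : s ∈ Ioo 0 p.2.1
      · rw [indicator_of_mem hs, indicator_of_mem (show s ∈ Ioo 0 T from ⟨hs.1, hs.2.trans_le hp.2.1.2⟩)]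
        exact hC _ hp.1 _ hp.2.1 s hs _ hp.2.2
      · rw [indicator_of_notMem hs, norm_zero]
        refine mul_nonneg hC0 (indicator_nonneg (fun s hs => ?_) s)
        have := hs.1
        positivity
    -- As t varies, the indicator can jump in the limit only at s = t₀, a null set; elsewhere it is
    -- eventually constant.
    · filter_upwards [Measure.ae_ne volume t₀] with s hst
      have hct : ContinuousAt (fun p : ℝ × ℝ × ℝ => p.2.1) (x₀, t₀, η₀) := by fun_prop
      rcases lt_or_gt_of_ne hst with hlt | hgt
      · by_cases hs0 : 0 < s
        · have e3 : ∀ᶠ p : ℝ × ℝ × ℝ in 𝓝[Ioo 0 l ×ˢ Ioc 0 T ×ˢ Ici 0] (x₀, t₀, η₀), s < p.2.1 :=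
            nhdsWithin_le_nhds (hct.eventually_const_lt hlt)
          rw [indicator_of_mem (show s ∈ Ioo 0 t₀ from ⟨hs0, hlt⟩)]
          have hc : Continuous fun p : ℝ × ℝ × ℝ => (p.1, p.2.1, p.2.2, s) := by fun_prop
          have h5 := Tendsto.comp (f := fun p : ℝ × ℝ × ℝ => (p.1, p.2.1, p.2.2, s))
            (g := fun p : ℝ × ℝ × ℝ × ℝ =>
              heatFlowXX l κ (fun ξ => Q ξ (p.2.1 - p.2.2.2)) (p.2.2.2 + p.2.2.1) p.1)
            (x := 𝓝[Ioo 0 l ×ˢ Ioc 0 T ×ˢ Ici 0] (x₀, t₀, η₀))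
            (h.tendsto_heatFlowXX (x := x₀) hl hκ ⟨hs0, hlt⟩ ht₀.2 hη₀)
            (tendsto_nhdsWithin_iff.2
              ⟨(hc.tendsto (x₀, t₀, η₀)).mono_left nhdsWithin_le_nhds, by
              filter_upwards [hev, e3] with p hp hp' using ⟨⟨hs0, hp'⟩, hp.2.1.2⟩⟩)
          refine Tendsto.congr' ?_ h5
          filter_upwards [e3] with p hp
          rw [indicator_of_mem (show s ∈ Ioo 0 p.2.1 from ⟨hs0, hp⟩)]; rfl
        · have hn : ∀ t : ℝ, s ∉ Ioo 0 t := fun t ht => hs0 ht.1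
          simp only [indicator_of_notMem (hn _)]
          exact tendsto_const_nhds
      · have e3 : ∀ᶠ p : ℝ × ℝ × ℝ in 𝓝[Ioo 0 l ×ˢ Ioc 0 T ×ˢ Ici 0] (x₀, t₀, η₀), p.2.1 < s :=
          nhdsWithin_le_nhds (hct.eventually_lt_const hgt)
        have hn : ∀ t : ℝ, t < s → s ∉ Ioo 0 t := fun t hts ht => (ht.2.trans hts).false
        rw [indicator_of_notMem (hn _ hgt)]
        refine Tendsto.congr' ?_ tendsto_const_nhds
        filter_upwards [e3] with p hp
        rw [indicator_of_notMem (hn _ hp)]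
  rw [ContinuousWithinAt]
  simp only [duhamelXX_eq_integral_indicator ht₀.1.le]
  refine Tendsto.congr' ?_ hlim
  filter_upwards [hev] with p hp
  rw [duhamelXX_eq_integral_indicator (by linarith [hp.2.1.1, ht₀.1])]

end HeatSource

end

/-! ### Modes of the heat equation and their damped second derivative -/

section


variable {l : ℝ}

/-- The cosine series with coefficients `c`. -/
def cosSeries (l : ℝ) (c : ℕ → ℝ) (x : ℝ) : ℝ := ∑' n, c n * Real.cos (gam l (n + 1) * x)

lemma hasDerivAt_sineSeries {c : ℕ → ℝ} (hc : Summable c)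
    (hc' : Summable fun n => gam l (n + 1) * c n) (x : ℝ) :
    HasDerivAt (sineSeries l c) (cosSeries l (fun n => gam l (n + 1) * c n) x) x := by
  refine hasDerivAt_tsum (u := fun n => |gam l (n + 1) * c n|)
    (g := fun n x => c n * sinMode l n x)
    (g' := fun n x => gam l (n + 1) * c n * Real.cos (gam l (n + 1) * x)) hc'.abs (fun n y => ?_)
    (fun n y => ?_) (summable_mul_sinMode hc 0) x
  · convert! (((hasDerivAt_id y).const_mul (gam l (n + 1))).sin).const_mul (c n) using 1
    simp only [id]; ring
  · simp only [norm_mul]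
    rw [← norm_mul]
    exact mul_le_of_le_one_right (norm_nonneg _) (Real.abs_cos_le_one _)

lemma hasDerivAt_cosSeries {c : ℕ → ℝ} (hc : Summable c)
    (hc' : Summable fun n => gam l (n + 1) * c n) (x : ℝ) :
    HasDerivAt (cosSeries l c) (sineSeries l (fun n => -(gam l (n + 1) * c n)) x) x := by
  refine hasDerivAt_tsum (u := fun n => |gam l (n + 1) * c n|)
    (g := fun n x => c n * Real.cos (gam l (n + 1) * x))
    (g' := fun n x => -(gam l (n + 1) * c n) * sinMode l n x) hc'.abs (fun n y => ?_)
    (fun n y => ?_) (y₀ := 0) (by simpa using hc) x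
  · convert! (((hasDerivAt_id y).const_mul (gam l (n + 1))).cos).const_mul (c n) using 1
    simp only [id, sinMode]; ring
  · simp only [norm_mul, norm_neg]
    rw [← norm_mul]
    exact mul_le_of_le_one_right (norm_nonneg _) (abs_sinMode_le _ _)

lemma summable_gam_mul (hl : 0 < l) {c : ℕ → ℝ} (hc : Summable c)
    (hc' : Summable fun n => gam l (n + 1) ^ 2 * c n) : Summable fun n => gam l (n + 1) * c n := by
  refine Summable.of_norm_bounded (hc.abs.add hc'.abs) fun n => ?_
  have hg := gam_pos hl n
  rw [norm_mul, Real.norm_eq_abs, Real.norm_eq_abs, abs_mul, abs_of_pos hg, abs_of_pos (pow_pos hg 2)]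
  nlinarith [abs_nonneg (c n), mul_nonneg (abs_nonneg (c n)) (sq_nonneg (gam l (n + 1) - 1))]

/-- Second derivative of a sine series. -/
lemma hasDerivAt_sineSeries_two (hl : 0 < l) {c : ℕ → ℝ} (hc : Summable c)
    (hc' : Summable fun n => gam l (n + 1) ^ 2 * c n) (x : ℝ) :
    HasDerivAt (sineSeries l c) (cosSeries l (fun n => gam l (n + 1) * c n) x) x ∧
      HasDerivAt (cosSeries l (fun n => gam l (n + 1) * c n))
        (sineSeries l (fun n => -(gam l (n + 1) ^ 2) * c n) x) x := by
  have h1 := summable_gam_mul hl hc hc'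
  refine ⟨hasDerivAt_sineSeries hc h1 x, ?_⟩
  convert hasDerivAt_cosSeries h1 (hc'.congr fun n => by ring) x using 2
  funext n; ring

/-- Solutions of the modal equations `w_n' = -κ γ_n² w_n + Q_n` of the heat equation. -/
structure HeatModes (l T κ M B : ℝ) (Q : ℝ → ℝ → ℝ) (w : ℕ → ℝ → ℝ) : Prop
    extends HeatSource l T M Q where
  contModes : ∀ n, ContinuousOn (w n) (Icc 0 T)
  initial : ∀ n, |w n 0| ≤ B
  hasDeriv : ∀ n, ∀ t ∈ Ioo 0 T,
    HasDerivAt (w n) (-(κ * gam l (n + 1) ^ 2) * w n t + sinCoeff l (fun ξ => Q ξ t) n) t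

/-- The second space derivative of the sum of the modes, regularized by the heat flow. -/
def modesXX (l κ : ℝ) (Q : ℝ → ℝ → ℝ) (w : ℕ → ℝ → ℝ) (η x t : ℝ) : ℝ :=
  sineSeries l (fun n => -(gam l (n + 1) ^ 2) * decay l κ n (t + η) * w n 0) x +
    duhamelXX l κ Q η x t

lemma tendsto_decay_zero (κ : ℝ) (n : ℕ) {η : ℕ → ℝ} (hη : Tendsto η atTop (𝓝 0)) :
    Tendsto (fun j => decay l κ n (η j)) atTop (𝓝 1) := by
  have h := ((continuous_decay (l := l) κ n).tendsto 0).comp hη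
  have h0 : decay l κ n 0 = 1 := by simp [decay]
  rwa [h0] at h

/-- Integration in time gains γ⁻², which makes modes driven by a merely bounded source summable. -/
lemma integral_decay_le (hl : 0 < l) {κ : ℝ} (hκ : 0 < κ) (n : ℕ) (t : ℝ) :
    ∫ s in (0 : ℝ)..t, decay l κ n s ≤ 1 / κ / gam l (n + 1) ^ 2 := by
  have hg := gam_pos hl n
  have hd : ∀ s ∈ uIcc 0 t, HasDerivAt (fun s => -(decay l κ n s / (κ * gam l (n + 1) ^ 2)))
      (decay l κ n s) s := fun s _ => by
    have h1 := (((hasDerivAt_id s).const_mul (κ * gam l (n + 1) ^ 2)).neg).exp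
    convert! (h1.div_const (κ * gam l (n + 1) ^ 2)).neg using 1
    simp only [decay, id, Pi.neg_apply]; field_simp
  rw [intervalIntegral.integral_eq_sub_of_hasDerivAt hd
    ((continuous_decay κ n).intervalIntegrable _ _)]
  have h0 : decay l κ n 0 = 1 := by simp [decay]
  have h1 : 0 ≤ decay l κ n t / (κ * gam l (n + 1) ^ 2) :=
    div_nonneg (decay_pos _ _ _).le (by positivity)
  rw [h0, div_div]; linarith

namespace HeatModes

variable {T M B κ : ℝ} {Q : ℝ → ℝ → ℝ} {w : ℕ → ℝ → ℝ}

lemma abs_sinCoeff_le (hl : 0 < l) (h : HeatModes l T κ M B Q w) (n : ℕ) {t : ℝ}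
    (ht : t ∈ Ioc 0 T) : |sinCoeff l (fun ξ => Q ξ t) n| ≤ 2 * M :=
  StripProblem.abs_sinCoeff_le hl (fun ξ hξ => h.bound ξ hξ t ht) n

lemma continuousOn_sinCoeff (hl : 0 < l) (h : HeatModes l T κ M B Q w) (n : ℕ) :
    ContinuousOn (fun τ => sinCoeff l (fun ξ => Q ξ τ) n) (Ioc 0 T) :=
  StripProblem.continuousOn_sinCoeff hl h.cont h.bound n

lemma continuousOn_decay_mul (hl : 0 < l) (h : HeatModes l T κ M B Q w) (n : ℕ) {t : ℝ}
    (ht : t ∈ Ioc 0 T) :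
    ContinuousOn (fun s => decay l κ n s * sinCoeff l (fun ξ => Q ξ (t - s)) n) (Ioo 0 t) :=
  (continuous_decay κ n).continuousOn.mul ((h.continuousOn_sinCoeff hl n).comp
    (by fun_prop : Continuous fun s : ℝ => t - s).continuousOn
    fun s hs => ⟨by linarith [hs.2], by linarith [hs.1, ht.2]⟩)

lemma abs_decay_mul_le (hl : 0 < l) (h : HeatModes l T κ M B Q w) (n : ℕ) {t s : ℝ}
    (ht : t ∈ Ioc 0 T) (hs : s ∈ Ioo 0 t) :
    |decay l κ n s * sinCoeff l (fun ξ => Q ξ (t - s)) n| ≤ decay l κ n s * (2 * M) := by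
  rw [abs_mul, abs_of_pos (decay_pos _ _ _)]
  exact mul_le_mul_of_nonneg_left (h.abs_sinCoeff_le hl n
    ⟨by linarith [hs.2], by linarith [hs.1, ht.2]⟩) (decay_pos _ _ _).le

lemma intervalIntegrable_decay_mul (hl : 0 < l) (hκ : 0 < κ) (h : HeatModes l T κ M B Q w) (n : ℕ)
    {t : ℝ} (ht : t ∈ Ioc 0 T) :
    IntervalIntegrable (fun s => decay l κ n s * sinCoeff l (fun ξ => Q ξ (t - s)) n)
      volume 0 t :=
  intervalIntegrable_of_bounded (M := 2 * M) ht.1.le (h.continuousOn_decay_mul hl n ht)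
    fun s hs => (h.abs_decay_mul_le hl n ht hs).trans (mul_le_of_le_one_left
      (by linarith [h.nonneg]) (decay_le_one hκ.le n hs.1.le))

/-- Duhamel's formula for the modes. -/
lemma eq_duhamel (hl : 0 < l) (hκ : 0 < κ) (h : HeatModes l T κ M B Q w) (n : ℕ) {t : ℝ}
    (ht : t ∈ Ioc 0 T) :
    w n t = decay l κ n t * w n 0 +
      ∫ s in (0 : ℝ)..t, decay l κ n s * sinCoeff l (fun ξ => Q ξ (t - s)) n := by
  have h1 : ∫ s in (0 : ℝ)..t, decay l κ n s * sinCoeff l (fun ξ => Q ξ (t - s)) n =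
      ∫ s in (0 : ℝ)..t, decay l κ n (t - s) * sinCoeff l (fun ξ => Q ξ s) n := by
    have := intervalIntegral.integral_comp_sub_left (a := 0) (b := t)
      (fun s => decay l κ n s * sinCoeff l (fun ξ => Q ξ (t - s)) n) t
    simp only [sub_sub_cancel, sub_zero, sub_self] at this
    exact this.symm
  have hint : IntervalIntegrable (fun s => decay l κ n (t - s) * sinCoeff l (fun ξ => Q ξ s) n)
      volume 0 t := by
    have := ((h.intervalIntegrable_decay_mul hl hκ n ht).comp_sub_left t).symm
    simpa only [sub_sub_cancel, sub_zero, sub_self] using this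
  -- The integrating factor decay(t − s) cancels the damping term, leaving only the source in the
  -- derivative.
  have h2 := intervalIntegral.integral_eq_sub_of_hasDerivAt_of_le ht.1.le
    (f := fun s => decay l κ n (t - s) * w n s)
    (f' := fun s => decay l κ n (t - s) * sinCoeff l (fun ξ => Q ξ s) n)
    (((continuous_decay κ n).comp (by fun_prop : Continuous fun s : ℝ => t - s)).continuousOn.mul
      ((h.contModes n).mono (Icc_subset_Icc_right ht.2))) (fun s hs => by
        have hd : HasDerivAt (fun s => decay l κ n (t - s))
            (κ * gam l (n + 1) ^ 2 * decay l κ n (t - s)) s := by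
          convert! (((hasDerivAt_id s).const_sub t).const_mul (κ * gam l (n + 1) ^ 2)).neg.exp
            using 1
          simp only [decay, id, Pi.neg_apply]; ring
        convert! hd.mul (h.hasDeriv n s ⟨hs.1, hs.2.trans_le ht.2⟩) using 1
        ring) hint
  have h0 : decay l κ n 0 = 1 := by simp [decay]
  simp only [sub_self, sub_zero, h0, one_mul] at h2
  rw [h1, h2]; ring

lemma abs_le (hl : 0 < l) (hκ : 0 < κ) (h : HeatModes l T κ M B Q w) (n : ℕ) {t : ℝ}
    (ht : t ∈ Ioc 0 T) :
    |w n t| ≤ decay l κ n t * B + 2 * M * (1 / κ / gam l (n + 1) ^ 2) := by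
  rw [h.eq_duhamel hl hκ n ht]
  refine (abs_add_le _ _).trans (add_le_add ?_ ?_)
  · rw [abs_mul, abs_of_pos (decay_pos _ _ _)]
    exact mul_le_mul_of_nonneg_left (h.initial n) (decay_pos _ _ _).le
  · have h1 : |∫ s in (0 : ℝ)..t, decay l κ n s * sinCoeff l (fun ξ => Q ξ (t - s)) n| ≤
        ∫ s in (0 : ℝ)..t, decay l κ n s * (2 * M) := by
      rw [← Real.norm_eq_abs]
      refine intervalIntegral.norm_integral_le_of_norm_le ht.1.le ?_
        (((continuous_decay κ n).mul continuous_const).intervalIntegrable _ _)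
      filter_upwards [Measure.ae_ne volume t] with s hs hs'
      exact h.abs_decay_mul_le hl n ht ⟨hs'.1, lt_of_le_of_ne hs'.2 hs⟩
    rw [intervalIntegral.integral_mul_const, mul_comm] at h1
    exact h1.trans (mul_le_mul_of_nonneg_left (integral_decay_le hl hκ n t)
      (by linarith [h.nonneg]))

lemma abs_le_inv (hl : 0 < l) (hκ : 0 < κ) (h : HeatModes l T κ M B Q w) (n : ℕ) {t : ℝ}
    (ht : t ∈ Ioc 0 T) : |w n t| ≤ (B / (κ * t) + 2 * M / κ) / gam l (n + 1) ^ 2 := by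
  have hB : 0 ≤ B := (abs_nonneg _).trans (h.initial 0)
  have h1 := mul_le_mul_of_nonneg_right (decay_le hl hκ n ht.1) hB
  refine (h.abs_le hl hκ n ht).trans ((add_le_add_left h1 _).trans (le_of_eq ?_))
  ring

lemma summable (hl : 0 < l) (hκ : 0 < κ) (h : HeatModes l T κ M B Q w) {t : ℝ}
    (ht : t ∈ Ioc 0 T) : Summable fun n => w n t :=
  summable_of_le_inv_gam_sq hl fun n => h.abs_le_inv hl hκ n ht

lemma exists_bound (hl : 0 < l) (hκ : 0 < κ) (h : HeatModes l T κ M B Q w) :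
    ∃ W, 0 ≤ W ∧ ∀ n, ∀ t ∈ Ioc 0 T, |w n t| ≤ W := by
  have hB : 0 ≤ B := (abs_nonneg _).trans (h.initial 0)
  have hM := h.nonneg
  obtain ⟨C, hC⟩ := (summable_inv_gam_sq hl).tendsto_atTop_zero.bddAbove_range
  have hC0 : 0 ≤ C := le_trans (by positivity) (hC ⟨0, rfl⟩)
  refine ⟨B + 2 * M * (1 / κ * C), by positivity, fun n t ht => (h.abs_le hl hκ n ht).trans ?_⟩
  have h1 : decay l κ n t * B ≤ B := mul_le_of_le_one_left hB (decay_le_one hκ.le n ht.1.le)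
  have h2 : (gam l (n + 1) ^ 2)⁻¹ ≤ C := hC ⟨n, rfl⟩
  rw [div_eq_mul_inv (1 / κ)]
  gcongr

/-- The regularized second derivative, as a sine series. -/
lemma modesXX_eq (hl : 0 < l) (hκ : 0 < κ) (h : HeatModes l T κ M B Q w) {η x t : ℝ} (hη : 0 < η)
    (hx : x ∈ Icc 0 l) (ht : t ∈ Ioc 0 T) :
    modesXX l κ Q w η x t =
      sineSeries l (fun n => -(gam l (n + 1) ^ 2) * (decay l κ n η * w n t)) x := by
  have hM := h.nonneg
  have hB : 0 ≤ B := (abs_nonneg _).trans (h.initial 0)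
  set F : ℕ → ℝ → ℝ := fun n s => -(gam l (n + 1) ^ 2) * decay l κ n η *
    (decay l κ n s * sinCoeff l (fun ξ => Q ξ (t - s)) n) * sinMode l n x with hF
  have hsum : HasSum (fun n => ∫ s in (0 : ℝ)..t, F n s) (duhamelXX l κ Q η x t) := by
    have hae : ∀ᵐ s : ℝ, s ∈ uIoc 0 t → s ∈ Ioo 0 t := by
      filter_upwards [Measure.ae_ne volume t] with ξ hξ hξ'
      rw [uIoc_of_le ht.1.le] at hξ'
      exact ⟨hξ'.1, lt_of_le_of_ne hξ'.2 hξ⟩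
    have hb : ∀ n, ∀ s ∈ Ioo 0 t, ‖F n s‖ ≤ gam l (n + 1) ^ 2 * decay l κ n η * (2 * M) := by
      intro n s hs
      refine (abs_mul_sinMode_le _ n x).trans ?_
      rw [abs_mul, abs_mul, abs_neg, abs_of_pos (decay_pos _ _ η), abs_of_nonneg (sq_nonneg _)]
      have h1 := (h.abs_decay_mul_le hl n ht hs).trans (mul_le_of_le_one_left
        (by linarith) (decay_le_one hκ.le n hs.1.le))
      have h2 := decay_pos (l := l) κ n η
      gcongr
    -- This is where η > 0 is used: the damping makes γ² times the modes summable uniformly in s,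
    -- including s near 0.
    have hs1 : Summable fun n => gam l (n + 1) ^ 2 * decay l κ n η * (2 * M) :=
      (summable_sq_mul_decay hl hκ hη).mul_right _
    refine intervalIntegral.hasSum_integral_of_dominated_convergence
      (fun n _ => gam l (n + 1) ^ 2 * decay l κ n η * (2 * M)) (fun n => ?_) (fun n => ?_)
      (ae_of_all _ fun s _ => hs1) intervalIntegrable_const ?_
    · exact (((h.intervalIntegrable_decay_mul hl hκ n ht).const_mul _).mul_const
        _).def'.aestronglyMeasurable
    · filter_upwards [hae] with s hs hs' using hb n s (hs hs')
    · filter_upwards [hae] with s hs hs'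
      have hs0 := hs hs'
      have hts : t - s ∈ Ioc 0 T := ⟨by linarith [hs0.2], by linarith [hs0.1, ht.2]⟩
      have hsm : Summable fun n => F n s := Summable.of_norm_bounded hs1 fun n => hb n s hs0
      suffices hval : heatFlowXX l κ (fun ξ => Q ξ (t - s)) (s + η) x = ∑' n, F n s by
        rw [hval]; exact hsm.hasSum
      rw [heatFlowXX_eq hl hκ hM (continuousOn_slice h.cont hts)
        (fun ξ hξ => h.bound ξ hξ _ hts) (by linarith [hs0.1]) hx, sineSeries]
      refine tsum_congr fun n => ?_
      simp only [hF, decay_add]; ring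
  have h1 : HasSum (fun n => -(gam l (n + 1) ^ 2) * decay l κ n (t + η) * w n 0 * sinMode l n x)
      (sineSeries l (fun n => -(gam l (n + 1) ^ 2) * decay l κ n (t + η) * w n 0) x) := by
    refine (summable_mul_sinMode ?_ x).hasSum
    refine Summable.of_norm_bounded ((summable_sq_mul_decay hl hκ
      (by linarith [ht.1] : 0 < t + η)).mul_right B) fun n => ?_
    rw [Real.norm_eq_abs, abs_mul, abs_mul, abs_neg, abs_of_pos (decay_pos _ _ _),
      abs_of_nonneg (sq_nonneg _)]
    exact mul_le_mul_of_nonneg_left (h.initial n)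
      (mul_nonneg (sq_nonneg _) (decay_pos _ _ _).le)
  rw [modesXX, ← (h1.add hsum).tsum_eq, sineSeries]
  refine tsum_congr fun n => ?_
  rw [h.eq_duhamel hl hκ n ht]
  simp only [hF]
  rw [intervalIntegral.integral_mul_const, intervalIntegral.integral_const_mul, decay_add]
  ring

/-- The contribution of the initial values is continuous because t + η stays above (t₀ + η₀)/2 > 0
nearby, which gives a fixed summable majorant; the Duhamel part is continuous by the Hölder
estimate. -/
lemma continuousOn_modesXX (hl : 0 < l) (hκ : 0 < κ) (h : HeatModes l T κ M B Q w) :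
    ContinuousOn (fun p : ℝ × ℝ × ℝ => modesXX l κ Q w p.2.2 p.1 p.2.1)
      (Ioo 0 l ×ˢ Ioc 0 T ×ˢ Ici 0) := by
  refine ContinuousOn.add ?_ (h.toHeatSource.continuousOn_duhamelXX hl hκ)
  rintro ⟨x₀, t₀, η₀⟩ ⟨hx₀, ht₀, hη₀⟩
  simp only [mem_Ici] at hx₀ ht₀ hη₀
  have ht₀' : 0 < (t₀ + η₀) / 2 := by linarith [ht₀.1]
  have hopen : IsOpen {p : ℝ × ℝ × ℝ | (t₀ + η₀) / 2 < p.2.1 + p.2.2} :=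
    isOpen_lt continuous_const (by fun_prop)
  refine ContinuousAt.continuousWithinAt (ContinuousOn.continuousAt (s := {p : ℝ × ℝ × ℝ |
    (t₀ + η₀) / 2 < p.2.1 + p.2.2}) ?_ (hopen.mem_nhds (by simp only [mem_ofPred_eq]; linarith)))
  refine continuousOn_tsum (u := fun n => gam l (n + 1) ^ 2 * decay l κ n ((t₀ + η₀) / 2) * B)
    (fun n => ?_) ((summable_sq_mul_decay hl hκ ht₀').mul_right B) (fun n p hp => ?_)
  · refine Continuous.continuousOn ?_
    exact ((continuous_const.mul ((continuous_decay κ n).comp (by fun_prop))).mul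
      continuous_const).mul ((continuous_sinMode n).comp continuous_fst)
  · refine (abs_mul_sinMode_le _ n _).trans ?_
    rw [abs_mul, abs_mul, abs_neg, abs_of_pos (decay_pos _ _ _), abs_of_nonneg (sq_nonneg _)]
    have h1 := h.initial n
    have h2 := decay_anti (l := l) hκ.le n (le_of_lt hp)
    have h3 := decay_pos (l := l) κ n (p.2.1 + p.2.2)
    have h4 := decay_pos (l := l) κ n ((t₀ + η₀) / 2)
    gcongr

lemma continuousOn_modesXX_zero (hl : 0 < l) (hκ : 0 < κ) (h : HeatModes l T κ M B Q w) :
    ContinuousOn (fun p : ℝ × ℝ => modesXX l κ Q w 0 p.1 p.2) (Ioo 0 l ×ˢ Ioc 0 T) :=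
  ContinuousOn.comp (f := fun p : ℝ × ℝ => (p.1, p.2, (0 : ℝ)))
    (g := fun p : ℝ × ℝ × ℝ => modesXX l κ Q w p.2.2 p.1 p.2.1)
    (h.continuousOn_modesXX hl hκ) (by fun_prop) fun _ hp => ⟨hp.1, hp.2, self_mem_Ici⟩

/-- A uniform bound of the regularized second derivatives on compact subsets. -/
lemma exists_bound_modesXX (hl : 0 < l) (hκ : 0 < κ) (h : HeatModes l T κ M B Q w) {a b t₀ : ℝ}
    (ha : 0 < a) (hb : b < l) (ht₀ : 0 < t₀) :
    ∃ C, ∀ x ∈ Icc a b, ∀ t ∈ Icc t₀ T, ∀ η ∈ Icc (0 : ℝ) 1, |modesXX l κ Q w η x t| ≤ C := by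
  have hK : IsCompact (Icc a b ×ˢ Icc t₀ T ×ˢ Icc (0 : ℝ) 1) :=
    isCompact_Icc.prod (isCompact_Icc.prod isCompact_Icc)
  have hsub : Icc a b ×ˢ Icc t₀ T ×ˢ Icc (0 : ℝ) 1 ⊆ Ioo 0 l ×ˢ Ioc 0 T ×ˢ Ici 0 :=
    fun p hp => ⟨⟨ha.trans_le hp.1.1, hp.1.2.trans_lt hb⟩,
      ⟨ht₀.trans_le hp.2.1.1, hp.2.1.2⟩, hp.2.2.1⟩
  obtain ⟨C, hC⟩ := hK.exists_bound_of_continuousOn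
    (f := fun p : ℝ × ℝ × ℝ => modesXX l κ Q w p.2.2 p.1 p.2.1)
    ((h.continuousOn_modesXX hl hκ).mono hsub)
  refine ⟨C, fun x hx t ht η hη => ?_⟩
  have h1 := hC (x, t, η) ⟨hx, ht, hη⟩
  rwa [Real.norm_eq_abs] at h1

end HeatModes

end

/-! ### The sum of the modes solves the heat equation classically -/

section


variable {l : ℝ}

namespace HeatModes

variable {T M B κ : ℝ} {Q : ℝ → ℝ → ℝ} {w : ℕ → ℝ → ℝ}

/-- The damping factors are at most one, so the undamped summable modes dominate. -/
lemma tendsto_regularized (hl : 0 < l) (hκ : 0 < κ) (h : HeatModes l T κ M B Q w) {η : ℕ → ℝ}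
    (hη : ∀ j, 0 < η j) (hη0 : Tendsto η atTop (𝓝 0)) {t : ℝ} (ht : t ∈ Ioc 0 T) (x : ℝ) :
    Tendsto (fun j => sineSeries l (fun n => decay l κ n (η j) * w n t) x) atTop
      (𝓝 (sineSeries l (fun n => w n t) x)) := by
  refine tendsto_tsum_of_dominated_convergence (h.summable hl hκ ht).abs (fun n => ?_)
    (Eventually.of_forall fun j n => ?_)
  · have := ((tendsto_decay_zero (l := l) κ n hη0).mul_const (w n t)).mul_const (sinMode l n x)
    rwa [one_mul] at this
  · refine (abs_mul_sinMode_le _ n x).trans ?_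
    rw [abs_mul, abs_of_pos (decay_pos _ _ _)]
    exact mul_le_of_le_one_left (abs_nonneg _) (decay_le_one hκ.le n (hη j).le)

lemma modes_sub_eq_integral (hl : 0 < l) (h : HeatModes l T κ M B Q w) (n : ℕ) {t₀ t : ℝ}
    (ht₀ : 0 < t₀) (htt : t₀ ≤ t) (ht : t ≤ T) :
    w n t - w n t₀ = ∫ τ in t₀..t,
      (-(κ * gam l (n + 1) ^ 2) * w n τ + sinCoeff l (fun ξ => Q ξ τ) n) := by
  refine (intervalIntegral.integral_eq_sub_of_hasDerivAt_of_le htt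
    ((h.contModes n).mono (Icc_subset_Icc ht₀.le ht))
    (fun τ hτ => h.hasDeriv n τ ⟨ht₀.trans hτ.1, hτ.2.trans_le ht⟩)
    (ContinuousOn.intervalIntegrable_of_Icc htt ?_)).symm
  exact (continuousOn_const.mul ((h.contModes n).mono (Icc_subset_Icc ht₀.le ht))).add
    ((h.continuousOn_sinCoeff hl n).mono fun τ hτ => ⟨ht₀.trans_le hτ.1, hτ.2.trans ht⟩)

/-- For η > 0 the damped modal equations have a majorant independent of time, so they can be summed
under the time integral. The Laplacian becomes `modesXX`, and damping the source coefficients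
amounts to applying the heat flow for time η. -/
lemma regularized_sub_eq_integral (hl : 0 < l) (hκ : 0 < κ) (h : HeatModes l T κ M B Q w)
    {η t₀ t x : ℝ} (hη : 0 < η) (ht₀ : 0 < t₀) (htt : t₀ ≤ t) (ht : t ≤ T) (hx : x ∈ Icc 0 l) :
    sineSeries l (fun n => decay l κ n η * w n t) x -
        sineSeries l (fun n => decay l κ n η * w n t₀) x =
      ∫ τ in t₀..t, (κ * modesXX l κ Q w η x τ + heatFlow l κ (fun ξ => Q ξ τ) η x) := by
  have hM := h.nonneg
  have hτ : ∀ τ ∈ uIoc t₀ t, τ ∈ Ioc 0 T := fun τ hτ => by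
    rw [uIoc_of_le htt] at hτ; exact ⟨ht₀.trans hτ.1, hτ.2.trans ht⟩
  obtain ⟨W, hW0, hW⟩ := h.exists_bound hl hκ
  set F : ℕ → ℝ → ℝ := fun n τ => decay l κ n η *
    (-(κ * gam l (n + 1) ^ 2) * w n τ + sinCoeff l (fun ξ => Q ξ τ) n) * sinMode l n x with hF
  set b : ℕ → ℝ := fun n => κ * W * (gam l (n + 1) ^ 2 * decay l κ n η) + 2 * M * decay l κ n η
  have hb : Summable b := ((summable_sq_mul_decay hl hκ hη).mul_left _).add
    ((summable_decay hl hκ hη).mul_left _)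
  have hFb : ∀ n, ∀ τ ∈ uIoc t₀ t, ‖F n τ‖ ≤ b n := fun n τ ht' => by
    refine (abs_mul_sinMode_le _ n x).trans ?_
    rw [abs_mul, abs_of_pos (decay_pos _ _ _)]
    have h1 : |-(κ * gam l (n + 1) ^ 2) * w n τ + sinCoeff l (fun ξ => Q ξ τ) n| ≤
        κ * gam l (n + 1) ^ 2 * W + 2 * M := by
      refine (abs_add_le _ _).trans (add_le_add ?_ (h.abs_sinCoeff_le hl n (hτ τ ht')))
      rw [abs_mul, abs_neg, abs_of_nonneg (by positivity)]
      exact mul_le_mul_of_nonneg_left (hW n τ (hτ τ ht')) (by positivity)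
    calc _ ≤ decay l κ n η * (κ * gam l (n + 1) ^ 2 * W + 2 * M) :=
          mul_le_mul_of_nonneg_left h1 (decay_pos _ _ _).le
      _ = b n := by simp only [b]; ring
  have hsum : HasSum (fun n => ∫ τ in t₀..t, F n τ)
      (∫ τ in t₀..t, (κ * modesXX l κ Q w η x τ + heatFlow l κ (fun ξ => Q ξ τ) η x)) := by
    refine intervalIntegral.hasSum_integral_of_dominated_convergence (fun n _ => b n) (fun n => ?_)
      (fun n => ae_of_all _ (hFb n)) (ae_of_all _ fun τ _ => hb) intervalIntegrable_const
      (ae_of_all _ fun τ ht' => ?_)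
    · refine ContinuousOn.aestronglyMeasurable (s := uIoc t₀ t) ?_ measurableSet_uIoc
      exact (continuousOn_const.mul ((continuousOn_const.mul ((h.contModes n).mono
        fun τ ht' => Ioc_subset_Icc_self (hτ τ ht'))).add
        ((h.continuousOn_sinCoeff hl n).mono hτ))).mul continuousOn_const
    · have hmem := hτ τ ht'
      have hs : Summable fun n => F n τ := Summable.of_norm_bounded hb fun n => hFb n τ ht'
      suffices hval : κ * modesXX l κ Q w η x τ + heatFlow l κ (fun ξ => Q ξ τ) η x =
          ∑' n, F n τ by rw [hval]; exact hs.hasSum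
      have hs2 : Summable fun n =>
          decay l κ n η * sinCoeff l (fun ξ => Q ξ τ) n * sinMode l n x := by
        refine Summable.of_norm_bounded ((summable_decay hl hκ hη).mul_left (2 * M)) fun n => ?_
        refine (abs_mul_sinMode_le _ n x).trans ?_
        rw [abs_mul, abs_of_pos (decay_pos _ _ _), mul_comm]
        exact mul_le_mul_of_nonneg_right (h.abs_sinCoeff_le hl n hmem) (decay_pos _ _ _).le
      have hs1 : Summable fun n =>
          κ * (-(gam l (n + 1) ^ 2) * (decay l κ n η * w n τ) * sinMode l n x) := by
        refine (hs.sub hs2).congr fun n => ?_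
        simp only [hF]; ring
      rw [h.modesXX_eq hl hκ hη hx hmem, heatFlow_eq hl hκ hM (continuousOn_slice h.cont hmem)
        (fun ξ hξ => h.bound ξ hξ _ hmem) hη hx, sineSeries, sineSeries, ← tsum_mul_left,
        ← hs1.tsum_add hs2]
      refine tsum_congr fun n => ?_
      simp only [hF]; ring
  have hsm : ∀ s ∈ Ioc 0 T, Summable fun n => decay l κ n η * w n s * sinMode l n x :=
    fun s hs => by
      refine Summable.of_norm_bounded ((summable_decay hl hκ hη).mul_left W) fun n => ?_
      refine (abs_mul_sinMode_le _ n x).trans ?_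
      rw [abs_mul, abs_of_pos (decay_pos _ _ _), mul_comm]
      exact mul_le_mul_of_nonneg_right (hW n s hs) (decay_pos _ _ _).le
  rw [← hsum.tsum_eq, sineSeries, sineSeries,
    ← (hsm t ⟨ht₀.trans_le htt, ht⟩).tsum_sub (hsm t₀ ⟨ht₀, htt.trans ht⟩)]
  refine tsum_congr fun n => ?_
  simp only [hF]
  rw [intervalIntegral.integral_mul_const, intervalIntegral.integral_const_mul,
    ← h.modes_sub_eq_integral hl n ht₀ htt ht]
  ring

lemma continuousOn_time (hl : 0 < l) (hκ : 0 < κ) (h : HeatModes l T κ M B Q w) {x : ℝ}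
    (hx : x ∈ Ioo 0 l) : ContinuousOn (fun τ => κ * modesXX l κ Q w 0 x τ + Q x τ) (Ioc 0 T) := by
  have hc : ContinuousOn (fun τ : ℝ => (x, τ)) (Ioc 0 T) := by fun_prop
  exact (continuousOn_const.mul (ContinuousOn.comp (f := fun τ : ℝ => (x, τ))
    (g := fun p : ℝ × ℝ => modesXX l κ Q w 0 p.1 p.2) (h.continuousOn_modesXX_zero hl hκ) hc
    fun τ hτ => ⟨hx, hτ⟩)).add (ContinuousOn.comp (f := fun τ : ℝ => (x, τ))
    (g := fun p : ℝ × ℝ => Q p.1 p.2) h.cont hc fun τ hτ => ⟨hx, hτ⟩)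

/-- Limit η = 1/(j+1) → 0 in the damped identity. Since x is interior, `modesXX` is bounded for
times in [t₀, T] and η in [0, 1], and the heat flow of the source returns its value at x. -/
lemma sub_eq_integral (hl : 0 < l) (hκ : 0 < κ) (h : HeatModes l T κ M B Q w) {t₀ t x : ℝ}
    (ht₀ : 0 < t₀) (htt : t₀ ≤ t) (ht : t ≤ T) (hx : x ∈ Ioo 0 l) :
    sineSeries l (fun n => w n t) x - sineSeries l (fun n => w n t₀) x =
      ∫ τ in t₀..t, (κ * modesXX l κ Q w 0 x τ + Q x τ) := by
  set η : ℕ → ℝ := fun j => 1 / ((j : ℝ) + 1)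
  have hη : ∀ j, 0 < η j := fun j => by positivity
  have hη1 : ∀ j, η j ≤ 1 := fun j => by
    have : (0 : ℝ) ≤ j := j.cast_nonneg
    simp only [η]; rw [div_le_one (by positivity)]; linarith
  have hη0 : Tendsto η atTop (𝓝 0) := tendsto_one_div_add_atTop_nhds_zero_nat
  have hx' := Ioo_subset_Icc_self hx
  have hM := h.nonneg
  have hτ : ∀ τ ∈ uIoc t₀ t, τ ∈ Ioc 0 T := fun τ hτ => by
    rw [uIoc_of_le htt] at hτ; exact ⟨ht₀.trans hτ.1, hτ.2.trans ht⟩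
  obtain ⟨C, hC⟩ := h.exists_bound_modesXX hl hκ hx.1 hx.2 ht₀
  have hc : ContinuousOn (fun τ : ℝ => (x, τ)) (Ioc 0 T) := by fun_prop
  have hcη : ∀ j, ContinuousOn (fun τ => κ * modesXX l κ Q w (η j) x τ +
      heatFlow l κ (fun ξ => Q ξ τ) (η j) x) (Ioc 0 T) := fun j => by
    refine (continuousOn_const.mul (ContinuousOn.comp (f := fun τ : ℝ => (x, τ, η j))
      (g := fun p : ℝ × ℝ × ℝ => modesXX l κ Q w p.2.2 p.1 p.2.1)
      (h.continuousOn_modesXX hl hκ) (by fun_prop) fun τ hτ => ⟨hx, hτ, (hη j).le⟩)).add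
      fun τ hτ => ?_
    refine Tendsto.comp (f := fun τ : ℝ => (x, η j, τ))
      (g := fun p : ℝ × ℝ × ℝ => heatFlow l κ (fun ξ => Q ξ p.2.2) p.2.1 p.1)
      (continuousWithinAt_heatFlow hl hκ hM h.cont h.bound hτ (Or.inl (hη j)))
      (tendsto_nhdsWithin_iff.2 ⟨(Continuous.tendsto (by fun_prop) τ).mono_left
        nhdsWithin_le_nhds, ?_⟩)
    filter_upwards [self_mem_nhdsWithin] with s hs using ⟨mem_univ _, mem_univ _, hs⟩
  have hI : Tendsto (fun j => ∫ τ in t₀..t, (κ * modesXX l κ Q w (η j) x τ +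
      heatFlow l κ (fun ξ => Q ξ τ) (η j) x)) atTop
      (𝓝 (∫ τ in t₀..t, (κ * modesXX l κ Q w 0 x τ + Q x τ))) := by
    refine intervalIntegral.tendsto_integral_filter_of_dominated_convergence
      (fun _ => κ * C + M) (Eventually.of_forall fun j => ?_) (Eventually.of_forall fun j => ?_)
      intervalIntegrable_const (ae_of_all _ fun τ ht' => ?_)
    · exact ((hcη j).mono hτ).aestronglyMeasurable measurableSet_uIoc
    · refine ae_of_all _ fun τ ht' => (norm_add_le _ _).trans (add_le_add ?_ ?_)
      · rw [norm_mul, Real.norm_eq_abs, Real.norm_eq_abs, abs_of_pos hκ]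
        rw [uIoc_of_le htt] at ht'
        exact mul_le_mul_of_nonneg_left (hC x ⟨le_rfl, le_rfl⟩ τ
          ⟨ht'.1.le, ht'.2.trans ht⟩ _ ⟨(hη j).le, hη1 j⟩) hκ.le
      · exact abs_heatFlow_le hl hM (fun ξ hξ => h.bound ξ hξ _ (hτ τ ht')) _ _
    · have hmem := hτ τ ht'
      refine Tendsto.add (Tendsto.const_mul _ ?_) ?_
      · refine Tendsto.comp (f := fun j => (x, τ, η j))
          (g := fun p : ℝ × ℝ × ℝ => modesXX l κ Q w p.2.2 p.1 p.2.1)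
          ((h.continuousOn_modesXX hl hκ) (x, τ, 0) ⟨hx, hmem, self_mem_Ici⟩)
          (tendsto_nhdsWithin_iff.2 ⟨?_, Eventually.of_forall fun j => ⟨hx, hmem, (hη j).le⟩⟩)
        exact tendsto_const_nhds.prodMk_nhds (tendsto_const_nhds.prodMk_nhds hη0)
      · have h1 := continuousWithinAt_heatFlow (s := 0) (x := x) hl hκ hM h.cont h.bound hmem
          (Or.inr hx)
        have h2 := Tendsto.comp (f := fun j => (x, η j, τ))
          (g := fun p : ℝ × ℝ × ℝ => heatFlow l κ (fun ξ => Q ξ p.2.2) p.2.1 p.1) h1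
          (tendsto_nhdsWithin_iff.2
            ⟨tendsto_const_nhds.prodMk_nhds (hη0.prodMk_nhds tendsto_const_nhds),
              Eventually.of_forall fun j => ⟨mem_univ _, mem_univ _, hmem⟩⟩)
        simp only [heatFlow_zero, oddExt_of_mem_Ioo hl _ hx] at h2
        exact h2
  refine tendsto_nhds_unique ?_ hI
  refine Tendsto.congr (fun j => h.regularized_sub_eq_integral hl hκ (hη j) ht₀ htt ht hx') ?_
  exact (h.tendsto_regularized hl hκ hη hη0 ⟨ht₀.trans_le htt, ht⟩ x).sub
    (h.tendsto_regularized hl hκ hη hη0 ⟨ht₀, htt.trans ht⟩ x)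

/-- The sum of the modes satisfies the heat equation in time. -/
lemma hasDerivWithinAt_time (hl : 0 < l) (hκ : 0 < κ) (h : HeatModes l T κ M B Q w) {x t : ℝ}
    (hx : x ∈ Ioo 0 l) (ht : t ∈ Ioc 0 T) :
    HasDerivWithinAt (fun s => sineSeries l (fun n => w n s) x)
      (κ * modesXX l κ Q w 0 x t + Q x t) (Icc 0 T) t := by
  -- The integral representation starts at a positive time because continuity of the integrand is
  -- not available at t = 0.
  have ht₀ : 0 < t / 2 := by linarith [ht.1]
  have h1 := hasDerivWithinAt_of_eq_integral (F := fun s => sineSeries l (fun n => w n s) x)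
    (f := fun τ => κ * modesXX l κ Q w 0 x τ + Q x τ) (a := t / 2) (b := T) (t := t)
    (by linarith [ht.2]) ((h.continuousOn_time hl hκ hx).mono fun s hs => ⟨ht₀.trans_le hs.1, hs.2⟩)
    (fun s hs => by rw [← h.sub_eq_integral hl hκ ht₀ hs.1 hs.2 hx]; ring)
    ⟨by linarith [ht.1], ht.2⟩
  refine h1.mono_of_mem_nhdsWithin ?_
  filter_upwards [self_mem_nhdsWithin, nhdsWithin_le_nhds (Ioi_mem_nhds (by linarith [ht.1] :
    t / 2 < t))] with s hs hs' using ⟨le_of_lt hs', hs.2⟩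

/-- The sum of the modes is twice differentiable in space. -/
lemma eq_second_primitive (hl : 0 < l) (hκ : 0 < κ) (h : HeatModes l T κ M B Q w) {a b t x : ℝ}
    (ha : 0 < a) (hab : a < b) (hb : b < l) (ht : t ∈ Ioc 0 T) (hx : x ∈ Icc a b) :
    sineSeries l (fun n => w n t) x = sineSeries l (fun n => w n t) a +
      (x - a) * ((sineSeries l (fun n => w n t) b - sineSeries l (fun n => w n t) a -
        ∫ y in a..b, ∫ z in a..y, modesXX l κ Q w 0 z t) / (b - a)) +
      ∫ y in a..x, ∫ z in a..y, modesXX l κ Q w 0 z t := by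
  set η : ℕ → ℝ := fun j => 1 / ((j : ℝ) + 1)
  have hη : ∀ j, 0 < η j := fun j => by positivity
  have hη1 : ∀ j, η j ≤ 1 := fun j => by
    have : (0 : ℝ) ≤ j := j.cast_nonneg
    simp only [η]; rw [div_le_one (by positivity)]; linarith
  have hη0 : Tendsto η atTop (𝓝 0) := tendsto_one_div_add_atTop_nhds_zero_nat
  obtain ⟨C, hC⟩ := h.exists_bound_modesXX hl hκ ha hb ht.1
  obtain ⟨W, hW0, hW⟩ := h.exists_bound hl hκ
  have hmem : ∀ y ∈ Icc a b, y ∈ Ioo 0 l := fun y hy => ⟨ha.trans_le hy.1, hy.2.trans_lt hb⟩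
  have hs0 : ∀ j, Summable fun n => decay l κ n (η j) * w n t := fun j =>
    Summable.of_norm_bounded ((summable_decay hl hκ (hη j)).mul_left W) fun n => by
      rw [norm_mul, mul_comm, Real.norm_eq_abs, Real.norm_eq_abs, abs_of_pos (decay_pos _ _ _)]
      exact mul_le_mul_of_nonneg_right (hW n t ht) (decay_pos _ _ _).le
  -- The damping justifies two term-by-term space derivatives for each j, although not for the limit
  -- itself.
  have hs2 : ∀ j, Summable fun n => gam l (n + 1) ^ 2 * (decay l κ n (η j) * w n t) := fun j =>
    Summable.of_norm_bounded ((summable_sq_mul_decay hl hκ (hη j)).mul_left W) fun n => by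
      rw [← mul_assoc, norm_mul, mul_comm, Real.norm_eq_abs, Real.norm_eq_abs,
        abs_of_nonneg (mul_nonneg (sq_nonneg _) (decay_pos _ _ _).le)]
      exact mul_le_mul_of_nonneg_right (hW n t ht)
        (mul_nonneg (sq_nonneg _) (decay_pos _ _ _).le)
  have heq : ∀ j, ∀ y ∈ Icc a b, modesXX l κ Q w (η j) y t = sineSeries l
      (fun n => -(gam l (n + 1) ^ 2) * (decay l κ n (η j) * w n t)) y := fun j y hy =>
    h.modesXX_eq hl hκ (hη j) (Ioo_subset_Icc_self (hmem y hy)) ht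
  refine eq_second_primitive_of_tendsto hab
    (f := fun j => sineSeries l (fun n => decay l κ n (η j) * w n t))
    (f' := fun j => cosSeries l (fun n => gam l (n + 1) * (decay l κ n (η j) * w n t)))
    (p := fun j => sineSeries l (fun n => -(gam l (n + 1) ^ 2) * (decay l κ n (η j) * w n t)))
    (C := C)
    (fun j y => (hasDerivAt_sineSeries_two hl (hs0 j) (hs2 j) y).1)
    (fun j y => (hasDerivAt_sineSeries_two hl (hs0 j) (hs2 j) y).2)
    (fun j => continuous_sineSeries ((hs2 j).neg.congr fun n => by ring))
    (fun j y hy => ?_) (fun y hy => ?_) (fun y hy => h.tendsto_regularized hl hκ hη hη0 ht y) hx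
  · rw [← heq j y hy]
    exact hC y hy t ⟨le_rfl, ht.2⟩ _ ⟨(hη j).le, hη1 j⟩
  · refine Tendsto.congr (fun j => heq j y hy) ?_
    exact Tendsto.comp (f := fun j => (y, t, η j))
      (g := fun p : ℝ × ℝ × ℝ => modesXX l κ Q w p.2.2 p.1 p.2.1)
      ((h.continuousOn_modesXX hl hκ) (y, t, 0) ⟨hmem y hy, ht, self_mem_Ici⟩)
      (tendsto_nhdsWithin_iff.2 ⟨tendsto_const_nhds.prodMk_nhds
        (tendsto_const_nhds.prodMk_nhds hη0),
        Eventually.of_forall fun j => ⟨hmem y hy, ht, (hη j).le⟩⟩)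

/-- The sum of the modes is a classical solution of the heat equation with source `Q`. -/
theorem exists_space_derivatives (hl : 0 < l) (hκ : 0 < κ) (h : HeatModes l T κ M B Q w) :
    ∃ Wx : ℝ → ℝ → ℝ, ContinuousOn (fun p : ℝ × ℝ => Wx p.1 p.2) (Ioo 0 l ×ˢ Ioc 0 T) ∧
      ∀ x ∈ Ioo 0 l, ∀ t ∈ Ioc 0 T,
        HasDerivAt (sineSeries l fun n => w n t) (Wx x t) x ∧
        HasDerivAt (fun y => Wx y t) (modesXX l κ Q w 0 x t) x := by
  set m : ℝ → ℝ → ℝ → ℝ := fun a b t =>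
    (sineSeries l (fun n => w n t) b - sineSeries l (fun n => w n t) a -
        ∫ y in a..b, ∫ z in a..y, modesXX l κ Q w 0 z t) / (b - a) with hm
  have hcz := h.continuousOn_modesXX_zero hl hκ
  have hslice : ∀ a b : ℝ, 0 < a → b < l → ∀ t ∈ Ioc 0 T,
      ContinuousOn (fun z => modesXX l κ Q w 0 z t) (Icc a b) := fun a b ha hb t ht =>
    (continuousOn_slice hcz ht).mono (Icc_subset_Ioo ha hb)
  have hd : ∀ a b : ℝ, 0 < a → b < l → ∀ t ∈ Ioc 0 T, ∀ x ∈ Ioo a b,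
      HasDerivAt (sineSeries l fun n => w n t)
        (m a b t + ∫ z in a..x, modesXX l κ Q w 0 z t) x ∧
      HasDerivAt (fun x => m a b t + ∫ z in a..x, modesXX l κ Q w 0 z t)
        (modesXX l κ Q w 0 x t) x := fun a b ha hb t ht x hx =>
    hasDerivAt_of_eq_second_primitive (hx.1.trans hx.2).le (hslice a b ha hb t ht)
      (fun y hy => h.eq_second_primitive hl hκ ha (hx.1.trans hx.2) hb ht hy) hx
  -- The local formula for the first derivative depends on the auxiliary interval [a, b]; `deriv`
  -- names the one function that all these formulas compute.
  refine ⟨fun x t => deriv (sineSeries l fun n => w n t) x, ?_, fun x hx t ht => ?_⟩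
  · rintro ⟨x₀, t₀⟩ ⟨hx₀, ht₀⟩
    simp only at hx₀ ht₀
    set a := x₀ / 2
    set b := (x₀ + l) / 2
    have ha : 0 < a := by simp only [a]; linarith [hx₀.1]
    have hb : b < l := by simp only [b]; linarith [hx₀.2]
    have hax : a < x₀ := by simp only [a]; linarith [hx₀.1]
    have hxb : x₀ < b := by simp only [b]; linarith [hx₀.2]
    have hab : a ≤ b := (hax.trans hxb).le
    have ht2 : 0 < t₀ / 2 := by linarith [ht₀.1]
    have htT : t₀ / 2 ≤ T := by linarith [ht₀.2]
    have hsub : Icc a b ×ˢ Icc (t₀ / 2) T ⊆ Ioo 0 l ×ˢ Ioc 0 T := fun p hp =>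
      ⟨⟨ha.trans_le hp.1.1, hp.1.2.trans_lt hb⟩, ⟨ht2.trans_le hp.2.1, hp.2.2⟩⟩
    have hP1 := continuousOn_parametric_primitive hab htT (hcz.mono hsub)
    have hP2 := continuousOn_parametric_primitive (P := fun y t => ∫ z in a..y,
      modesXX l κ Q w 0 z t) hab htT hP1
    -- The slope constant is built from values of the sum at a and b, continuous in time by the time
    -- derivative already obtained.
    have hmc : ContinuousOn (fun t => m a b t) (Icc (t₀ / 2) T) := by
      have hw : ∀ y ∈ Ioo 0 l, ContinuousOn (fun t => sineSeries l (fun n => w n t) y)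
          (Icc (t₀ / 2) T) := fun y hy t ht =>
        ((h.hasDerivWithinAt_time hl hκ hy ⟨ht2.trans_le ht.1, ht.2⟩).continuousWithinAt).mono
          (Icc_subset_Icc_left ht2.le)
      refine (((hw b ⟨ha.trans_le hab, hb⟩).sub (hw a ⟨ha, hab.trans_lt hb⟩)).sub ?_).div_const _
      exact ContinuousOn.comp (f := fun t : ℝ => (b, t)) (g := fun p : ℝ × ℝ => ∫ y in a..p.1,
        ∫ z in a..y, modesXX l κ Q w 0 z p.2) hP2 (by fun_prop) fun t ht => ⟨⟨hab, le_rfl⟩, ht⟩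
    have hW : ContinuousOn (fun p : ℝ × ℝ => m a b p.2 + ∫ z in a..p.1, modesXX l κ Q w 0 z p.2)
        (Icc a b ×ˢ Icc (t₀ / 2) T) :=
      (hmc.comp continuousOn_snd fun p hp => hp.2).add hP1
    have hev : ∀ᶠ p : ℝ × ℝ in 𝓝 (x₀, t₀), p.1 ∈ Ioo a b ∧ t₀ / 2 < p.2 :=
      (continuous_fst.continuousAt.eventually (Ioo_mem_nhds hax hxb)).and
        (continuous_snd.continuousAt.eventually (Ioi_mem_nhds (by simp only; linarith)))
    have hev' : ∀ᶠ p : ℝ × ℝ in 𝓝[Ioo 0 l ×ˢ Ioc 0 T] (x₀, t₀),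
        p.1 ∈ Ioo a b ∧ p.2 ∈ Icc (t₀ / 2) T := by
      filter_upwards [nhdsWithin_le_nhds hev, self_mem_nhdsWithin] with p hp hp'
      exact ⟨hp.1, hp.2.le, hp'.2.2⟩
    have hc0 := (hW (x₀, t₀) ⟨⟨hax.le, hxb.le⟩, by linarith, ht₀.2⟩).mono_of_mem_nhdsWithin
      (s := Ioo 0 l ×ˢ Ioc 0 T) (by
        filter_upwards [hev'] with p hp using ⟨Ioo_subset_Icc_self hp.1, hp.2⟩)
    refine hc0.congr_of_eventuallyEq ?_ (hd a b ha hb t₀ ht₀ x₀ ⟨hax, hxb⟩).1.deriv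
    filter_upwards [hev'] with p hp
    exact (hd a b ha hb p.2 ⟨ht2.trans_le hp.2.1, hp.2.2⟩ p.1 hp.1).1.deriv
  · have ha : 0 < x / 2 := by linarith [hx.1]
    have hb : (x + l) / 2 < l := by linarith [hx.2]
    have hxm : x ∈ Ioo (x / 2) ((x + l) / 2) := ⟨by linarith [hx.1], by linarith [hx.2]⟩
    obtain ⟨h1, h2⟩ := hd _ _ ha hb t ht x hxm
    refine ⟨h1.differentiableAt.hasDerivAt, h2.congr_of_eventuallyEq ?_⟩
    filter_upwards [Ioo_mem_nhds hxm.1 hxm.2] with y hy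
    exact (hd _ _ ha hb t ht y hy).1.deriv

end HeatModes

end

/-! ### Modal Green functions: equation, uniform bounds, convolutions -/

section


/-- `cosh (ω t)` with `ω ^ 2 = d`. -/
def coshc (d t : ℝ) : ℝ :=
  if 0 < d then Real.cosh (√d * t)
  else if d = 0 then 1
  else Real.cos (√(-d) * t)

lemma hasDerivAt_sinhc (d t : ℝ) : HasDerivAt (sinhc d) (coshc d t) t := by
  unfold sinhc coshc
  by_cases h1 : 0 < d
  · simp only [h1, if_true]
    have hs : √d ≠ 0 := by positivity
    convert! (((hasDerivAt_id t).const_mul √d).sinh).div_const √d using 1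
    simp only [id]; field_simp
  by_cases h2 : d = 0
  · simp only [h2, lt_irrefl, if_false, if_true]; exact hasDerivAt_id t
  · simp only [h1, h2, if_false]
    have h3 : 0 < -d := by
      rcases lt_trichotomy d 0 with h | h | h
      · linarith
      · exact absurd h h2
      · exact absurd h h1
    have hs : √(-d) ≠ 0 := by positivity
    convert! (((hasDerivAt_id t).const_mul √(-d)).sin).div_const √(-d) using 1
    simp only [id]; field_simp

lemma hasDerivAt_coshc (d t : ℝ) : HasDerivAt (coshc d) (d * sinhc d t) t := by
  unfold sinhc coshc
  by_cases h1 : 0 < d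
  · simp only [h1, if_true]
    have hs : √d ≠ 0 := by positivity
    convert! ((hasDerivAt_id t).const_mul √d).cosh using 1
    have hd := Real.mul_self_sqrt h1.le
    simp only [id]; field_simp; linear_combination -(Real.sinh (√d * t)) * hd
  by_cases h2 : d = 0
  · simp only [h2, lt_irrefl, if_false, if_true, zero_mul]; exact hasDerivAt_const t 1
  · simp only [h1, h2, if_false]
    have h3 : 0 < -d := by
      rcases lt_trichotomy d 0 with h | h | h
      · linarith
      · exact absurd h h2
      · exact absurd h h1
    have hs : √(-d) ≠ 0 := by positivity
    convert! ((hasDerivAt_id t).const_mul √(-d)).cos using 1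
    have hd := Real.mul_self_sqrt h3.le
    simp only [id]; field_simp; linear_combination (Real.sin (√(-d) * t)) * hd

lemma sinhc_zero (d : ℝ) : sinhc d 0 = 0 := by
  unfold sinhc; split_ifs <;> simp

lemma coshc_zero (d : ℝ) : coshc d 0 = 1 := by
  unfold coshc; split_ifs <;> simp

/-- The addition theorem, valid for every sign of d, is what separates t from τ in the convolution
kernels. -/
lemma sinhc_sub (d t τ : ℝ) :
    sinhc d (t - τ) = sinhc d t * coshc d τ - coshc d t * sinhc d τ := by
  unfold sinhc coshc
  split_ifs with h1 h2
  · rw [mul_sub, Real.sinh_sub]; ring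
  · ring
  · rw [mul_sub, Real.sin_sub]; ring

lemma coshc_sub (d t τ : ℝ) :
    coshc d (t - τ) = coshc d t * coshc d τ - d * (sinhc d t * sinhc d τ) := by
  unfold sinhc coshc
  split_ifs with h1 h2
  · have hs : √d ≠ 0 := by positivity
    have hd := Real.sq_sqrt h1.le
    rw [mul_sub, Real.cosh_sub]
    field_simp
    rw [hd]; ring
  · rw [h2]; ring
  · have h3 : 0 < -d := by
      rcases lt_trichotomy d 0 with h | h | h
      · linarith
      · exact absurd h h2
      · exact absurd h h1
    have hs : √(-d) ≠ 0 := by positivity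
    have hd := Real.sq_sqrt h3.le
    rw [mul_sub, Real.cos_sub]
    field_simp
    rw [hd]; ring

variable {l α ε lam : ℝ}

/-- The derivative of `Gn`. -/
def GnD (l α ε lam : ℝ) (n : ℕ) (t : ℝ) : ℝ :=
  Real.exp (-(gn l α ε lam n) * t) *
    (coshc (omegaSq l α ε lam n) t - gn l α ε lam n * sinhc (omegaSq l α ε lam n) t)

lemma hasDerivAt_exp_gn (n : ℕ) (t : ℝ) : HasDerivAt (fun t => Real.exp (-(gn l α ε lam n) * t))
    (-(gn l α ε lam n) * Real.exp (-(gn l α ε lam n) * t)) t := by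
  convert! ((hasDerivAt_id t).const_mul (-(gn l α ε lam n))).exp using 1
  simp only [id]; ring

lemma hasDerivAt_Gn (n : ℕ) (t : ℝ) :
    HasDerivAt (Gn l α ε lam n) (GnD l α ε lam n t) t := by
  convert! (hasDerivAt_exp_gn n t).mul (hasDerivAt_sinhc (omegaSq l α ε lam n) t) using 1
  rw [GnD]; ring

/-- The modal equation y'' + 2 g y' + b y = 0, a consequence of ω² = g² − b. -/
lemma hasDerivAt_GnD (n : ℕ) (t : ℝ) :
    HasDerivAt (GnD l α ε lam n)
      (-(2 * gn l α ε lam n) * GnD l α ε lam n t - bn l lam n * Gn l α ε lam n t) t := by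
  convert! (hasDerivAt_exp_gn n t).mul ((hasDerivAt_coshc (omegaSq l α ε lam n) t).sub
    ((hasDerivAt_sinhc (omegaSq l α ε lam n) t).const_mul (gn l α ε lam n))) using 1
  simp only [GnD, Gn, omegaSq, Pi.sub_apply]; ring

lemma Gn_zero (n : ℕ) : Gn l α ε lam n 0 = 0 := by simp [Gn, sinhc_zero]

lemma GnD_zero (n : ℕ) : GnD l α ε lam n 0 = 1 := by simp [GnD, sinhc_zero, coshc_zero]

lemma continuous_Gn (n : ℕ) : Continuous (Gn l α ε lam n) :=
  continuous_iff_continuousAt.2 fun t => (hasDerivAt_Gn n t).continuousAt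

lemma continuous_GnD (n : ℕ) : Continuous (GnD l α ε lam n) :=
  continuous_iff_continuousAt.2 fun t => (hasDerivAt_GnD n t).continuousAt

lemma abs_le_of_abs_deriv_le {f f' g g' : ℝ → ℝ} (hf : ∀ t, HasDerivAt f (f' t) t)
    (hg : ∀ t, HasDerivAt g (g' t) t) (h0 : |f 0| ≤ g 0) {T : ℝ}
    (hfg : ∀ t ∈ Icc 0 T, |f' t| ≤ g' t) {t : ℝ} (ht : t ∈ Icc 0 T) : |f t| ≤ g t :=
  image_norm_le_of_norm_deriv_right_le_deriv_boundary
    (fun t _ => (hf t).continuousAt.continuousWithinAt) (fun t _ => (hf t).hasDerivWithinAt) h0 hg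
    (fun t ht => hfg t (Ico_subset_Icc_self ht)) ht

/-- Bounds of a solution of `z' = -κ γ² z + c₁ z + c₂ y`, `y' = (z - y) / κ` with `y 0 = 0`,
`z 0 = κ` that are uniform in `γ`. -/
lemma exists_bound_stiff_system {κ : ℝ} (hκ : 0 < κ) (c₁ c₂ T : ℝ) :
    ∃ C, 0 ≤ C ∧ ∀ (γ : ℝ) (y z : ℝ → ℝ), 0 < γ →
      (∀ t, HasDerivAt y ((z t - y t) / κ) t) →
      (∀ t, HasDerivAt z (-(κ * γ ^ 2) * z t + (c₁ * z t + c₂ * y t)) t) →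
      y 0 = 0 → z 0 = κ → ∀ t ∈ Icc 0 T, |y t| ≤ C / γ ^ 2 ∧ |y t| ≤ C ∧ |z t| ≤ C ∧
        |z t - κ * Real.exp (-(κ * γ ^ 2 * t))| ≤ C / γ ^ 2 := by
  -- `K` bounds the growth rate of the energy z² + y², `B` bounds both unknowns, `B'` bounds the
  -- coupling c₁z + c₂y, and `C'` bounds γ²y. The absolute value of T keeps the constants
  -- nonnegative even when the time interval is empty.
  set K := 2 * |c₁| + |c₂| + 1 / κ
  set B := κ * Real.exp (K * |T|)
  set B' := (|c₁| + |c₂|) * B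
  set C' := Real.exp (|T| / κ) / κ * (1 + B' * |T| / κ)
  have hK : 0 ≤ K := by positivity
  have hB : 0 ≤ B := by positivity
  have hB' : 0 ≤ B' := by positivity
  have hC' : 0 ≤ C' := by positivity
  refine ⟨B + B' / κ + C', by positivity, fun γ y z hγ hy hz hy0 hz0 => ?_⟩
  have hγ2 : 0 < γ ^ 2 := by positivity
  have hkg : 0 < κ * γ ^ 2 := by positivity
  -- The stiff term contributes −2κγ²z² to the energy balance and has the good sign, so the growth
  -- rate does not depend on γ.
  have henergy : Antitone fun t => (z t ^ 2 + y t ^ 2) * Real.exp (-(K * t)) := by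
    have hd : ∀ t, HasDerivAt (fun t => (z t ^ 2 + y t ^ 2) * Real.exp (-(K * t)))
        ((2 * z t * (-(κ * γ ^ 2) * z t + (c₁ * z t + c₂ * y t)) +
          2 * y t * ((z t - y t) / κ) - K * (z t ^ 2 + y t ^ 2)) * Real.exp (-(K * t))) t := by
      intro t
      convert! (((hz t).pow 2).add ((hy t).pow 2)).mul (((hasDerivAt_id t).const_mul K).neg.exp)
        using 1
      simp only [id, Pi.add_apply, Pi.pow_apply, Pi.neg_apply]; push_cast; ring
    refine antitone_of_deriv_nonpos (fun t => (hd t).differentiableAt) fun t => ?_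
    rw [(hd t).deriv]
    refine mul_nonpos_of_nonpos_of_nonneg ?_ (Real.exp_pos _).le
    have e1 : 2 * c₁ * z t ^ 2 ≤ 2 * |c₁| * (z t ^ 2 + y t ^ 2) := by
      have := le_abs_self c₁
      nlinarith [sq_nonneg (z t), sq_nonneg (y t), abs_nonneg c₁]
    have e2 : 2 * c₂ * (z t * y t) ≤ |c₂| * (z t ^ 2 + y t ^ 2) := by
      rcases abs_cases c₂ with ⟨h, h'⟩ | ⟨h, h'⟩ <;> rw [h]
      · nlinarith [mul_nonneg h' (sq_nonneg (z t - y t))]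
      · nlinarith [mul_nonneg (by linarith : 0 ≤ -c₂) (sq_nonneg (z t + y t))]
    have hi : 0 < 1 / κ := by positivity
    have e3 : 2 * y t * ((z t - y t) / κ) ≤ 1 / κ * (z t ^ 2 + y t ^ 2) := by
      have : 2 * y t * ((z t - y t) / κ) = 1 / κ * (2 * y t * z t - 2 * y t ^ 2) := by ring
      rw [this]
      refine mul_le_mul_of_nonneg_left ?_ hi.le
      nlinarith [sq_nonneg (z t - y t), sq_nonneg (y t)]
    have e4 : 0 ≤ 2 * (κ * γ ^ 2) * z t ^ 2 := by positivity
    simp only [K]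
    linarith
  have hE : ∀ t ∈ Icc 0 T, z t ^ 2 + y t ^ 2 ≤ B ^ 2 := by
    intro t ht
    have h1 := henergy ht.1
    simp only [hz0, hy0, mul_zero, neg_zero, Real.exp_zero, mul_one] at h1
    rw [Real.exp_neg, ← div_eq_mul_inv, div_le_iff₀ (Real.exp_pos _)] at h1
    have h2 : K * t ≤ K * |T| := mul_le_mul_of_nonneg_left (ht.2.trans (le_abs_self T)) hK
    have h3 : Real.exp (K * t) ≤ Real.exp (K * |T|) := Real.exp_le_exp.2 h2
    have h4 : 1 ≤ Real.exp (K * |T|) := Real.one_le_exp (by positivity)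
    calc z t ^ 2 + y t ^ 2 ≤ (κ ^ 2 + 0 ^ 2) * Real.exp (K * t) := h1
      _ = κ ^ 2 * Real.exp (K * t) := by ring
      _ ≤ κ ^ 2 * (Real.exp (K * |T|) * Real.exp (K * |T|)) := by gcongr; nlinarith
      _ = B ^ 2 := by simp only [B]; ring
  have hzB : ∀ t ∈ Icc 0 T, |z t| ≤ B := fun t ht =>
    abs_le_of_sq_le_sq (by nlinarith [hE t ht, sq_nonneg (y t)]) hB
  have hyB : ∀ t ∈ Icc 0 T, |y t| ≤ B := fun t ht =>
    abs_le_of_sq_le_sq (by nlinarith [hE t ht, sq_nonneg (z t)]) hB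
  -- With the integrating factor exp(κγ²t), a forcing bounded by `B'` produces a deviation of at
  -- most B'/(κγ²) from the free decay.
  have hz1 : ∀ t ∈ Icc 0 T, |z t - κ * Real.exp (-(κ * γ ^ 2 * t))| ≤ B' / κ / γ ^ 2 := by
    intro t ht
    have hex : ∀ t, HasDerivAt (fun t => Real.exp (κ * γ ^ 2 * t))
        (κ * γ ^ 2 * Real.exp (κ * γ ^ 2 * t)) t := fun t => by
      convert! ((hasDerivAt_id t).const_mul (κ * γ ^ 2)).exp using 1
      simp only [id]; ring
    have h1 := abs_le_of_abs_deriv_le (T := T) (t := t)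
      (f := fun t => Real.exp (κ * γ ^ 2 * t) * z t - κ)
      (f' := fun t => Real.exp (κ * γ ^ 2 * t) * (c₁ * z t + c₂ * y t))
      (g := fun t => B' / (κ * γ ^ 2) * (Real.exp (κ * γ ^ 2 * t) - 1))
      (g' := fun t => B' * Real.exp (κ * γ ^ 2 * t))
      (fun t => by
        convert! ((hex t).mul (hz t)).sub_const κ using 1
        ring)
      (fun t => by
        convert! ((hex t).sub_const 1).const_mul (B' / (κ * γ ^ 2)) using 1
        field_simp)
      (by simp [hz0]) (fun s hs => by
        rw [abs_mul, Real.abs_exp, mul_comm]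
        refine mul_le_mul_of_nonneg_right ?_ (Real.exp_pos _).le
        refine (abs_add_le _ _).trans ?_
        rw [abs_mul, abs_mul]
        have := hzB s hs
        have := hyB s hs
        calc |c₁| * |z s| + |c₂| * |y s| ≤ |c₁| * B + |c₂| * B := by gcongr
          _ = B' := by simp only [B']; ring) ht
    have h2 : z t - κ * Real.exp (-(κ * γ ^ 2 * t)) =
        Real.exp (-(κ * γ ^ 2 * t)) * (Real.exp (κ * γ ^ 2 * t) * z t - κ) := by
      rw [mul_sub, ← mul_assoc, ← Real.exp_add]; simp; ring
    rw [h2, abs_mul, Real.abs_exp]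
    calc _ ≤ Real.exp (-(κ * γ ^ 2 * t)) *
          (B' / (κ * γ ^ 2) * (Real.exp (κ * γ ^ 2 * t) - 1)) := by gcongr
      _ = B' / (κ * γ ^ 2) * (1 - Real.exp (-(κ * γ ^ 2 * t))) := by
        have : Real.exp (-(κ * γ ^ 2 * t)) * Real.exp (κ * γ ^ 2 * t) = 1 := by
          rw [← Real.exp_add]; simp
        linear_combination (B' / (κ * γ ^ 2)) * this
      _ ≤ B' / (κ * γ ^ 2) * 1 := by
        gcongr; linarith [Real.exp_pos (-(κ * γ ^ 2 * t))]
      _ = B' / κ / γ ^ 2 := by rw [mul_one, div_div]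
  -- The variable y is an exponentially weighted time integral of z. Both parts of z integrate to
  -- O(γ⁻²): the free decay gives (1 − exp(−κγ²t))/γ², and the remainder is already of that order.
  have hy1 : ∀ t ∈ Icc 0 T, |y t| ≤ C' / γ ^ 2 := by
    intro t ht
    have hT : 0 ≤ T := ht.1.trans ht.2
    have h1 := abs_le_of_abs_deriv_le (T := T) (t := t)
      (f := fun t => Real.exp (t / κ) * y t)
      (f' := fun t => Real.exp (t / κ) * z t / κ)
      (g := fun t => Real.exp (|T| / κ) / κ *
        ((1 - Real.exp (-(κ * γ ^ 2 * t))) / γ ^ 2 + B' / κ / γ ^ 2 * t))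
      (g' := fun t => Real.exp (|T| / κ) / κ *
        (κ * Real.exp (-(κ * γ ^ 2 * t)) + B' / κ / γ ^ 2))
      (fun t => by
        convert! (((hasDerivAt_id t).div_const κ).exp).mul (hy t) using 1
        simp only [id]; field_simp; ring)
      (fun t => by
        convert! (((((((hasDerivAt_id t).const_mul (κ * γ ^ 2)).neg.exp).const_sub 1).div_const
          (γ ^ 2)).add ((hasDerivAt_id t).const_mul (B' / κ / γ ^ 2))).const_mul
          (Real.exp (|T| / κ) / κ)) using 1
        simp only [id, Pi.neg_apply]; field_simp)
      (by simp [hy0]) (fun s hs => by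
        have h3 : |z s| ≤ κ * Real.exp (-(κ * γ ^ 2 * s)) + B' / κ / γ ^ 2 := by
          have h4 := abs_add_le (z s - κ * Real.exp (-(κ * γ ^ 2 * s)))
            (κ * Real.exp (-(κ * γ ^ 2 * s)))
          rw [sub_add_cancel, abs_of_pos (by positivity : 0 < κ * Real.exp (-(κ * γ ^ 2 * s)))] at h4
          linarith [hz1 s hs]
        have h5 : Real.exp (s / κ) ≤ Real.exp (|T| / κ) := by
          gcongr; exact hs.2.trans (le_abs_self T)
        rw [abs_div, abs_mul, Real.abs_exp, abs_of_pos hκ]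
        calc Real.exp (s / κ) * |z s| / κ ≤ Real.exp (|T| / κ) *
              (κ * Real.exp (-(κ * γ ^ 2 * s)) + B' / κ / γ ^ 2) / κ := by gcongr
          _ = _ := by ring) ht
    have h2 : |y t| ≤ |Real.exp (t / κ) * y t| := by
      rw [abs_mul, Real.abs_exp]
      exact le_mul_of_one_le_left (abs_nonneg _)
        (Real.one_le_exp (div_nonneg ht.1 hκ.le))
    refine h2.trans (h1.trans ?_)
    have h3 : t ≤ |T| := ht.2.trans (le_abs_self T)
    calc _ ≤ Real.exp (|T| / κ) / κ * (1 / γ ^ 2 + B' / κ / γ ^ 2 * |T|) := by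
          gcongr; linarith [Real.exp_pos (-(κ * γ ^ 2 * t))]
      _ = C' / γ ^ 2 := by simp only [C']; field_simp
  intro t ht
  have hBk : 0 ≤ B' / κ := by positivity
  refine ⟨(hy1 t ht).trans ?_, (hyB t ht).trans ?_, (hzB t ht).trans ?_, (hz1 t ht).trans ?_⟩
  · gcongr; linarith
  · linarith
  · linarith
  · gcongr; linarith

/-- Uniform bounds of the modal Green functions on bounded time intervals. -/
lemma exists_bound_Gn (hl : 0 < l) (hε : 0 < ε) (α lam T : ℝ) :
    ∃ C, 0 ≤ C ∧ ∀ n, ∀ t ∈ Icc 0 T,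
      |Gn l α ε lam (n + 1) t| ≤ C / gam l (n + 1) ^ 2 ∧
      |GnD l α ε lam (n + 1) t| ≤ C ∧
      |ε * GnD l α ε lam (n + 1) t + Gn l α ε lam (n + 1) t - ε * decay l ε n t| ≤
        C / gam l (n + 1) ^ 2 := by
  -- Applied with y = G_n and z = ε G_n' + G_n. Eliminating G_n' = (z − y)/ε from the modal equation
  -- gives these two coupling constants, with −ελ²/4 coming from b_n = γ_n² + λ²/4.
  obtain ⟨C, hC0, hC⟩ := exists_bound_stiff_system hε ((1 - ε * α) / ε - ε * lam ^ 2 / 4)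
    (-(1 - ε * α) / ε) T
  refine ⟨C + 2 * C / ε, by positivity, fun n t ht => ?_⟩
  have hg := gam_pos hl n
  have h := hC (gam l (n + 1)) (Gn l α ε lam (n + 1))
    (fun t => ε * GnD l α ε lam (n + 1) t + Gn l α ε lam (n + 1) t) hg
    (fun t => by
      convert hasDerivAt_Gn (n + 1) t using 1
      field_simp; ring)
    (fun t => by
      convert! ((hasDerivAt_GnD (n + 1) t).const_mul ε).add (hasDerivAt_Gn (n + 1) t) using 1
      simp only [gn, bn]; field_simp; ring)
    (Gn_zero _) (by simp only [Gn_zero, GnD_zero]; ring) t ht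
  have hCe : 0 ≤ 2 * C / ε := by positivity
  refine ⟨h.1.trans ?_, ?_, h.2.2.2.trans ?_⟩
  · gcongr; linarith
  · have h1 : GnD l α ε lam (n + 1) t =
        (ε * GnD l α ε lam (n + 1) t + Gn l α ε lam (n + 1) t - Gn l α ε lam (n + 1) t) / ε := by
      field_simp; ring
    rw [h1, abs_div, abs_of_pos hε]
    have h2 := (abs_sub _ _).trans (add_le_add h.2.2.1 h.2.1)
    calc _ ≤ (C + C) / ε := by gcongr
      _ ≤ _ := by rw [← two_mul]; linarith
  · gcongr; linarith

/-- The convolution of `K` and `F` on the half line. -/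
def conv (K F : ℝ → ℝ) (t : ℝ) : ℝ := ∫ τ in (0 : ℝ)..t, F τ * K (t - τ)

lemma abs_conv_le {K F b : ℝ → ℝ} {M T t : ℝ} (hM : ∀ τ ∈ Ioc 0 T, |F τ| ≤ M)
    (hK : ∀ s ∈ Icc 0 T, |K s| ≤ b s) (hb : Continuous b) (ht : t ∈ Icc 0 T) :
    |conv K F t| ≤ M * ∫ s in (0 : ℝ)..t, b s := by
  have h1 : ∫ s in (0 : ℝ)..t, b s = ∫ s in (0 : ℝ)..t, b (t - s) := by
    rw [intervalIntegral.integral_comp_sub_left b t, sub_self, sub_zero]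
  rw [h1, ← intervalIntegral.integral_const_mul, conv, ← Real.norm_eq_abs]
  refine intervalIntegral.norm_integral_le_of_norm_le ht.1 (ae_of_all _ fun τ hτ => ?_)
    ((continuous_const.mul (hb.comp (by fun_prop))).intervalIntegrable _ _)
  rw [norm_mul, Real.norm_eq_abs, Real.norm_eq_abs]
  have h2 := hM τ ⟨hτ.1, hτ.2.trans ht.2⟩
  exact mul_le_mul h2 (hK _ ⟨by linarith [hτ.2], by linarith [hτ.1, ht.2]⟩) (abs_nonneg _)
    ((abs_nonneg _).trans h2)

/-- A separated kernel takes t out of the integrand, so differentiating a convolution reduces to the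
product rule and the fundamental theorem of calculus. -/
lemma conv_eq_of_separable {K F p₁ p₂ q₁ q₂ : ℝ → ℝ} {t : ℝ}
    (hK : ∀ t τ, K (t - τ) = p₁ t * q₁ τ - p₂ t * q₂ τ) (hq₁ : Continuous q₁)
    (hq₂ : Continuous q₂) (hF : IntervalIntegrable F volume 0 t) :
    conv K F t = p₁ t * (∫ τ in (0 : ℝ)..t, F τ * q₁ τ) -
      p₂ t * ∫ τ in (0 : ℝ)..t, F τ * q₂ τ := by
  have h1 := (hF.mul_continuousOn hq₁.continuousOn).const_mul (p₁ t)
  have h2 := (hF.mul_continuousOn hq₂.continuousOn).const_mul (p₂ t)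
  rw [← intervalIntegral.integral_const_mul, ← intervalIntegral.integral_const_mul,
    ← intervalIntegral.integral_sub h1 h2, conv]
  refine intervalIntegral.integral_congr fun τ _ => ?_
  simp only [hK]; ring

/-- The convolutions with `Gn` and `GnD` solve the inhomogeneous modal equation. -/
lemma conv_Gn (n : ℕ) {F : ℝ → ℝ} {M T : ℝ} (hT : 0 < T) (hF : ContinuousOn F (Ioc 0 T))
    (hM : ∀ τ ∈ Ioc 0 T, |F τ| ≤ M) :
    ContinuousOn (conv (Gn l α ε lam n) F) (Icc 0 T) ∧
    ContinuousOn (conv (GnD l α ε lam n) F) (Icc 0 T) ∧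
    ∀ t ∈ Ioo 0 T, HasDerivAt (conv (Gn l α ε lam n) F) (conv (GnD l α ε lam n) F t) t ∧
      HasDerivAt (conv (GnD l α ε lam n) F) (-(2 * gn l α ε lam n) * conv (GnD l α ε lam n) F t
        - bn l lam n * conv (Gn l α ε lam n) F t + F t) t := by
  set g := gn l α ε lam n with hg
  set d := omegaSq l α ε lam n with hd
  have hbd : bn l lam n = g ^ 2 - d := by rw [hd, omegaSq, hg]; ring
  have hexp : ∀ t, HasDerivAt (fun t => Real.exp (-g * t)) (-g * Real.exp (-g * t)) t :=
    fun t => hasDerivAt_exp_gn n t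
  set s := sinhc d
  set c := coshc d
  have hs := hasDerivAt_sinhc d
  have hc := hasDerivAt_coshc d
  have hsc : Continuous s := continuous_iff_continuousAt.2 fun t => (hs t).continuousAt
  have hcc : Continuous c := continuous_iff_continuousAt.2 fun t => (hc t).continuousAt
  set q₁ : ℝ → ℝ := fun τ => Real.exp (g * τ) * c τ with hq₁
  set q₂ : ℝ → ℝ := fun τ => Real.exp (g * τ) * s τ with hq₂
  have hq₁c : Continuous q₁ := by fun_prop
  have hq₂c : Continuous q₂ := by fun_prop
  set p₁ : ℝ → ℝ := fun t => Real.exp (-g * t) * s t with hp₁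
  set p₂ : ℝ → ℝ := fun t => Real.exp (-g * t) * c t with hp₂
  set p₁' : ℝ → ℝ := fun t => Real.exp (-g * t) * (c t - g * s t) with hp₁'
  set p₂' : ℝ → ℝ := fun t => Real.exp (-g * t) * (d * s t - g * c t) with hp₂'
  have hee : ∀ t τ : ℝ, Real.exp (-g * (t - τ)) = Real.exp (-g * t) * Real.exp (g * τ) :=
    fun t τ => by rw [← Real.exp_add]; ring_nf
  have hG : ∀ t τ, Gn l α ε lam n (t - τ) = p₁ t * q₁ τ - p₂ t * q₂ τ := fun t τ => by
    simp only [Gn, sinhc_sub, ← hg, ← hd, hee, p₁, p₂, q₁, q₂, s, c]; ring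
  have hGD : ∀ t τ, GnD l α ε lam n (t - τ) = p₁' t * q₁ τ - p₂' t * q₂ τ := fun t τ => by
    simp only [GnD, sinhc_sub, coshc_sub, ← hg, ← hd, hee, p₁', p₂', q₁, q₂, s, c]; ring
  have d1 : ∀ t, HasDerivAt p₁ (p₁' t) t := fun t => by
    convert! (hexp t).mul (hs t) using 1
    simp only [p₁']; ring
  have d2 : ∀ t, HasDerivAt p₂ (p₂' t) t := fun t => by
    convert! (hexp t).mul (hc t) using 1
    simp only [p₂']; ring
  have d1' : ∀ t, HasDerivAt p₁' (-(2 * g) * p₁' t - bn l lam n * p₁ t) t := fun t => by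
    convert! (hexp t).mul ((hc t).sub ((hs t).const_mul g)) using 1
    simp only [p₁', p₁, hbd, Pi.sub_apply, s, c]; ring
  have d2' : ∀ t, HasDerivAt p₂' (-(2 * g) * p₂' t - bn l lam n * p₂ t) t := fun t => by
    convert! (hexp t).mul (((hs t).const_mul d).sub ((hc t).const_mul g)) using 1
    simp only [p₂', p₂, hbd, Pi.sub_apply, s, c]; ring
  have cont : ∀ {f f' : ℝ → ℝ}, (∀ t, HasDerivAt f (f' t) t) → Continuous f := fun h =>
    continuous_iff_continuousAt.2 fun t => (h t).continuousAt
  have hFI : IntervalIntegrable F volume 0 T :=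
    intervalIntegrable_of_bounded hT.le (hF.mono Ioo_subset_Ioc_self)
      fun τ hτ => hM τ (Ioo_subset_Ioc_self hτ)
  have hFt : ∀ t ∈ Icc 0 T, IntervalIntegrable F volume 0 t := fun t ht =>
    hFI.mono_set (by rw [uIcc_of_le ht.1, uIcc_of_le hT.le]; exact Icc_subset_Icc_right ht.2)
  have hIc : ∀ {q : ℝ → ℝ}, Continuous q →
      ContinuousOn (fun t => ∫ τ in (0 : ℝ)..t, F τ * q τ) (Icc 0 T) := fun {q} hq => by
    have := intervalIntegral.continuousOn_primitive_interval' (a := 0)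
      (hFI.mul_continuousOn hq.continuousOn) left_mem_uIcc
    rwa [uIcc_of_le hT.le] at this
  have hId : ∀ {q : ℝ → ℝ}, Continuous q → ∀ t ∈ Ioo 0 T,
      HasDerivAt (fun t => ∫ τ in (0 : ℝ)..t, F τ * q τ) (F t * q t) t := fun {q} hq t ht => by
    have hco : ContinuousOn (fun τ => F τ * q τ) (Ioo 0 T) :=
      (hF.mono Ioo_subset_Ioc_self).mul hq.continuousOn
    exact intervalIntegral.integral_hasDerivAt_right
      ((hFt t (Ioo_subset_Icc_self ht)).mul_continuousOn hq.continuousOn)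
      (hco.stronglyMeasurableAtFilter isOpen_Ioo t ht) (hco.continuousAt (isOpen_Ioo.mem_nhds ht))
  have e0 : ∀ t ∈ Icc 0 T, conv (Gn l α ε lam n) F t = p₁ t * (∫ τ in (0 : ℝ)..t, F τ * q₁ τ) -
      p₂ t * ∫ τ in (0 : ℝ)..t, F τ * q₂ τ := fun t ht =>
    conv_eq_of_separable hG hq₁c hq₂c (hFt t ht)
  have e1 : ∀ t ∈ Icc 0 T, conv (GnD l α ε lam n) F t = p₁' t * (∫ τ in (0 : ℝ)..t, F τ * q₁ τ) -
      p₂' t * ∫ τ in (0 : ℝ)..t, F τ * q₂ τ := fun t ht =>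
    conv_eq_of_separable hGD hq₁c hq₂c (hFt t ht)
  refine ⟨ContinuousOn.congr (((cont d1).continuousOn.mul (hIc hq₁c)).sub
      ((cont d2).continuousOn.mul (hIc hq₂c))) e0,
    ContinuousOn.congr (((cont d1').continuousOn.mul (hIc hq₁c)).sub
      ((cont d2').continuousOn.mul (hIc hq₂c))) e1, fun t ht => ?_⟩
  have ht' := Ioo_subset_Icc_self ht
  have hn := Icc_mem_nhds ht.1 ht.2
  -- On the diagonal the kernels equal G_n(0) = 0 and G_n'(0) = 1: the source drops out of the first
  -- derivative and enters the second with coefficient one.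
  have hz : p₁ t * q₁ t - p₂ t * q₂ t = 0 := by rw [← hG, sub_self, Gn_zero]
  have ho : p₁' t * q₁ t - p₂' t * q₂ t = 1 := by rw [← hGD, sub_self, GnD_zero]
  constructor
  · refine HasDerivAt.congr_of_eventuallyEq ?_ (eventually_of_mem hn e0)
    convert! ((d1 t).mul (hId hq₁c t ht)).sub ((d2 t).mul (hId hq₂c t ht)) using 1
    rw [e1 t ht']; linear_combination -(F t) * hz
  · refine HasDerivAt.congr_of_eventuallyEq ?_ (eventually_of_mem hn e1)
    convert! ((d1' t).mul (hId hq₁c t ht)).sub ((d2' t).mul (hId hq₂c t ht)) using 1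
    rw [e1 t ht', e0 t ht']; linear_combination -(F t) * ho

end

/-! ### The Green function formulas as sine series -/

section


variable {l : ℝ}

/-- Two integrations by parts. -/
lemma exists_abs_sinCoeff_le (hl : 0 < l) {q : ℝ → ℝ} (hq : ContDiffOn ℝ 2 q (Icc 0 l))
    (h0 : q 0 = 0) (h1 : q l = 0) :
    ∃ C, 0 ≤ C ∧ ∀ n, |sinCoeff l q n| ≤ C / gam l (n + 1) ^ 2 := by
  have hu := uniqueDiffOn_Icc hl
  set q' := derivWithin q (Icc 0 l) with hq'
  set q'' := derivWithin q' (Icc 0 l) with hq''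
  have hd1 : ContDiffOn ℝ 1 q' (Icc 0 l) := hq.derivWithin hu (by norm_num)
  have hc2 : ContinuousOn q'' (Icc 0 l) := (hd1.derivWithin (m := 0) hu (by norm_num)).continuousOn
  obtain ⟨M, hM⟩ := isCompact_Icc.exists_bound_of_continuousOn hc2
  have hM0 : 0 ≤ M := (norm_nonneg _).trans (hM 0 ⟨le_rfl, hl.le⟩)
  refine ⟨2 * M, by positivity, fun n => ?_⟩
  have hg := gam_pos hl n
  set γ := gam l (n + 1) with hγ
  have hder : ∀ {p : ℝ → ℝ}, ContDiffOn ℝ 1 p (Icc 0 l) → ∀ x ∈ Ioo 0 l,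
      HasDerivAt p (derivWithin p (Icc 0 l) x) x := fun {p} hp x hx =>
    ((hp.differentiableOn one_ne_zero) x (Ioo_subset_Icc_self hx)).hasDerivWithinAt.hasDerivAt
      (Icc_mem_nhds hx.1 hx.2)
  have hi : ∀ {p : ℝ → ℝ}, ContinuousOn p (Icc 0 l) → IntervalIntegrable p volume 0 l :=
    fun hp => ContinuousOn.intervalIntegrable (by rwa [uIcc_of_le hl.le])
  have hsin : Continuous fun x => Real.sin (γ * x) := by fun_prop
  have hcos : Continuous fun x => Real.cos (γ * x) := by fun_prop
  have hI1 : IntervalIntegrable (fun x => q x * sinMode l n x) volume 0 l :=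
    intervalIntegrable_mul_sinMode (hi hq.continuousOn) n
  have hI2 : IntervalIntegrable (fun x => q'' x * sinMode l n x) volume 0 l :=
    intervalIntegrable_mul_sinMode (hi hc2) n
  have hsl : Real.sin (γ * l) = 0 := sinMode_right hl n
  -- The derivative of −q cos(γx)/γ + q' sin(γx)/γ² is q sin(γx) + γ⁻² q'' sin(γx). Its end-point
  -- values vanish, the first term because q does and the second because the sine does.
  have h := intervalIntegral.integral_eq_sub_of_hasDerivAt_of_le hl.le
    (f := fun x => -(q x * Real.cos (γ * x)) / γ + q' x * Real.sin (γ * x) / γ ^ 2)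
    (f' := fun x => q x * sinMode l n x + (γ ^ 2)⁻¹ * (q'' x * sinMode l n x))
    ((((hq.continuousOn.mul hcos.continuousOn).neg).div_const γ).add
      ((hd1.continuousOn.mul hsin.continuousOn).div_const (γ ^ 2)))
    (fun x hx => by
      convert! (((hder (hq.of_le (by norm_num)) x hx).mul
        (((hasDerivAt_id x).const_mul γ).cos)).neg.div_const γ).add
        (((hder hd1 x hx).mul (((hasDerivAt_id x).const_mul γ).sin)).div_const (γ ^ 2)) using 1
      simp only [id, sinMode, ← hγ, ← hq', ← hq'']
      field_simp; ring)
    (hI1.add (hI2.const_mul _))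
  rw [intervalIntegral.integral_add hI1 (hI2.const_mul _), intervalIntegral.integral_const_mul] at h
  simp only [h0, h1, hsl, mul_zero, zero_mul, Real.sin_zero, sub_zero, neg_zero, zero_div,
    add_zero] at h
  have h2 : sinCoeff l q n = -((γ ^ 2)⁻¹ * sinCoeff l q'' n) := by
    simp only [sinCoeff]; linear_combination (2 / l) * h
  have h3 := abs_sinCoeff_le hl (fun ξ hξ => hM ξ (Ioo_subset_Icc_self hξ)) n
  rw [h2, abs_neg, abs_mul, abs_of_pos (by positivity : 0 < (γ ^ 2)⁻¹), inv_mul_eq_div]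
  gcongr

lemma integral_mul_sineSeries (hl : 0 < l) {q : ℝ → ℝ} {M : ℝ} (hq : ContinuousOn q (Ioo 0 l))
    (hM : ∀ ξ ∈ Ioo 0 l, |q ξ| ≤ M) {d : ℕ → ℝ} (hd : Summable d) :
    2 / l * ∫ ξ in (0 : ℝ)..l, q ξ * sineSeries l d ξ = ∑' n, d n * sinCoeff l q n := by
  have hae : ∀ᵐ ξ : ℝ, ξ ∈ uIoc 0 l → ξ ∈ Ioo 0 l := by
    filter_upwards [Measure.ae_ne volume l] with ξ hξ hξ'
    rw [uIoc_of_le hl.le] at hξ'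
    exact ⟨hξ'.1, lt_of_le_of_ne hξ'.2 hξ⟩
  have hI := intervalIntegrable_of_bounded hl.le hq hM
  have h := intervalIntegral.hasSum_integral_of_dominated_convergence (μ := volume)
    (a := (0 : ℝ)) (b := l) (F := fun n ξ => d n * (q ξ * sinMode l n ξ))
    (f := fun ξ => q ξ * sineSeries l d ξ) (fun n _ => |d n| * M)
    (fun n => ((intervalIntegrable_mul_sinMode hI n).const_mul _).def'.aestronglyMeasurable)
    (fun n => by
      filter_upwards [hae] with ξ hξ hξ'
      rw [Real.norm_eq_abs, abs_mul]
      exact mul_le_mul_of_nonneg_left ((abs_mul_sinMode_le _ n ξ).trans (hM ξ (hξ hξ')))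
        (abs_nonneg _))
    (ae_of_all _ fun x _ => hd.abs.mul_right M) intervalIntegrable_const
    (ae_of_all _ fun ξ _ => by
      have h := (summable_mul_sinMode (l := l) hd ξ).hasSum.mul_left (q ξ)
      have e : (fun n => q ξ * (d n * sinMode l n ξ)) = fun n => d n * (q ξ * sinMode l n ξ) :=
        funext fun n => by ring
      rw [e] at h
      exact h)
  rw [← h.tsum_eq, ← tsum_mul_left]
  refine tsum_congr fun n => ?_
  rw [intervalIntegral.integral_const_mul, sinCoeff]; ring

/-- Termwise differentiation in time of a sine series, when the derivatives are dominated in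
`L¹`. -/
lemma hasDerivWithinAt_sineSeries_time {T x : ℝ} {p p' : ℕ → ℝ → ℝ} {B : ℕ → ℝ} {W : ℝ → ℝ}
    (hT : 0 ≤ T) (hp : ∀ n, ContinuousOn (p n) (Icc 0 T))
    (hp' : ∀ n, ContinuousOn (p' n) (Icc 0 T))
    (hd : ∀ n, ∀ t ∈ Ioo 0 T, HasDerivAt (p n) (p' n t) t)
    (hB : ∀ n, ∫ s in (0 : ℝ)..T, |p' n s| ≤ B n) (hBs : Summable B)
    (h0 : Summable fun n => p n 0) (hW : ContinuousOn W (Icc 0 T))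
    (hWp : ∀ t ∈ Ioc 0 T, W t = sineSeries l (fun n => p' n t) x) {t : ℝ} (ht : t ∈ Icc 0 T) :
    HasDerivWithinAt (fun s => sineSeries l (fun n => p n s) x) (W t) (Icc 0 T) t := by
  refine hasDerivWithinAt_of_eq_integral hT hW (fun s hs => ?_) ht
  have hI : ∀ n, IntervalIntegrable (p' n) volume 0 s := fun n =>
    ContinuousOn.intervalIntegrable (by
      rw [uIcc_of_le hs.1]; exact (hp' n).mono (Icc_subset_Icc_right hs.2))
  have hftc : ∀ n, p n s = p n 0 + ∫ y in (0 : ℝ)..s, p' n y := fun n => by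
    rw [intervalIntegral.integral_eq_sub_of_hasDerivAt_of_le hs.1
      ((hp n).mono (Icc_subset_Icc_right hs.2))
      (fun y hy => hd n y ⟨hy.1, hy.2.trans_le hs.2⟩) (hI n)]; ring
  have habs : ∀ n, ∫ y in (0 : ℝ)..s, |p' n y| ≤ B n := fun n => by
    refine le_trans ?_ (hB n)
    refine intervalIntegral.integral_mono_interval le_rfl hs.1 hs.2
      (ae_of_all _ fun _ => abs_nonneg _) (ContinuousOn.intervalIntegrable ?_)
    rw [uIcc_of_le hT]; exact (hp' n).abs
  have hIm : ∀ n, IntervalIntegrable (fun y => p' n y * sinMode l n x) volume 0 s :=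
    fun n => (hI n).mul_const _
  -- Only the time integrals of |p'_n| are summable, since the derivatives may have an initial
  -- layer; the exchange of sum and integral therefore uses L¹ norms, and the series identity for
  -- `W` is not needed at t = 0.
  have hS := MeasureTheory.hasSum_integral_of_summable_integral_norm
    (μ := volume.restrict (Ioc 0 s)) (F := fun n y => p' n y * sinMode l n x)
    (fun n => ((intervalIntegrable_iff_integrableOn_Ioc_of_le hs.1).1 (hIm n)))
    (Summable.of_nonneg_of_le (fun n => integral_nonneg fun _ => norm_nonneg _) (fun n => by
      refine le_trans ?_ (habs n)
      rw [← intervalIntegral.integral_of_le hs.1]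
      refine intervalIntegral.integral_mono_on hs.1 (hIm n).norm (hI n).abs fun y _ =>
        abs_mul_sinMode_le _ n x) hBs)
  have h1 : ∫ y in Ioc 0 s, ∑' n, p' n y * sinMode l n x = ∫ y in (0 : ℝ)..s, W y := by
    rw [intervalIntegral.integral_of_le hs.1]
    refine setIntegral_congr_fun measurableSet_Ioc fun y hy => ?_
    exact (hWp y ⟨hy.1, hy.2.trans hs.2⟩).symm
  rw [h1] at hS
  have h2 := (summable_mul_sinMode (l := l) h0 x).hasSum.add hS
  have h3 : (fun n => p n s * sinMode l n x) = fun n => p n 0 * sinMode l n x +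
      ∫ y in Ioc 0 s, p' n y * sinMode l n x := by
    funext n
    rw [hftc n, add_mul, ← intervalIntegral.integral_mul_const,
      intervalIntegral.integral_of_le hs.1]
  rw [← h3] at h2
  exact h2.tsum_eq

section Explicit

variable {α ε lam : ℝ}

lemma exists_abs_Gn_le (hl : 0 < l) (hε : 0 < ε) (α lam T : ℝ) :
    ∃ C, 0 ≤ C ∧ ∀ n, ∀ t ∈ Icc 0 T, |Gn l α ε lam (n + 1) t| ≤ C / gam l (n + 1) ^ 2 := by
  obtain ⟨C, hC0, hC⟩ := exists_bound_Gn hl hε α lam T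
  exact ⟨C, hC0, fun n t ht => (hC n t ht).1⟩

lemma summable_Gn (hl : 0 < l) (hε : 0 < ε) {t : ℝ} (ht : 0 ≤ t) :
    Summable fun n => Gn l α ε lam (n + 1) t := by
  obtain ⟨C, -, hC⟩ := exists_abs_Gn_le hl hε α lam t
  exact summable_of_le_inv_gam_sq hl fun n => hC n t ⟨ht, le_rfl⟩

lemma green_eq (x ξ t : ℝ) : green l α ε lam x ξ t = 2 / l * Real.exp (lam / 2 * (x - ξ)) *
    sineSeries l (fun n => Gn l α ε lam (n + 1) t * sinMode l n x) ξ := by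
  unfold green sineSeries
  congr 1
  refine tsum_congr fun n => ?_
  simp only [greenTerm, sinMode]; ring

lemma summable_Gn_mul_sinMode (hl : 0 < l) (hε : 0 < ε) (x : ℝ) {t : ℝ} (ht : 0 ≤ t) :
    Summable fun n => Gn l α ε lam (n + 1) t * sinMode l n x :=
  summable_mul_sinMode (summable_Gn hl hε ht) x

lemma summable_greenTerm (hl : 0 < l) (hε : 0 < ε) (x ξ : ℝ) {t : ℝ} (ht : 0 ≤ t) :
    Summable (greenTerm l α ε lam x ξ t) := by
  refine (summable_mul_sinMode (l := l) (summable_Gn_mul_sinMode (α := α) (lam := lam) hl hε x ht)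
    ξ).congr fun n => ?_
  simp only [greenTerm, sinMode]; ring

lemma continuous_green (hl : 0 < l) (hε : 0 < ε) (x : ℝ) {t : ℝ} (ht : 0 ≤ t) :
    Continuous fun ξ => green l α ε lam x ξ t := by
  have := continuous_sineSeries (l := l)
    (summable_Gn_mul_sinMode (α := α) (lam := lam) hl hε x ht)
  simp only [green_eq]
  fun_prop

/-- The function `exp (-λ ξ / 2) q ξ`. -/
def untwist (lam : ℝ) (q : ℝ → ℝ) (ξ : ℝ) : ℝ := Real.exp (-(lam / 2 * ξ)) * q ξ

lemma exp_mul_untwist (q : ℝ → ℝ) (ξ : ℝ) : Real.exp (lam / 2 * ξ) * untwist lam q ξ = q ξ := by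
  rw [untwist, ← mul_assoc, ← Real.exp_add]; simp

lemma exp_neg_le_one (hlam : 0 ≤ lam) {ξ : ℝ} (hξ : 0 ≤ ξ) : Real.exp (-(lam / 2 * ξ)) ≤ 1 := by
  rw [Real.exp_le_one_iff]; simp; positivity

lemma continuousOn_untwist {q : ℝ → ℝ} {s : Set ℝ} (hq : ContinuousOn q s) :
    ContinuousOn (untwist lam q) s :=
  (by fun_prop : Continuous fun ξ : ℝ => Real.exp (-(lam / 2 * ξ))).continuousOn.mul hq

lemma abs_untwist_le (hlam : 0 ≤ lam) {q : ℝ → ℝ} {ξ M : ℝ} (hξ : 0 ≤ ξ) (hM : |q ξ| ≤ M) :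
    |untwist lam q ξ| ≤ M := by
  rw [untwist, abs_mul, Real.abs_exp]
  exact (mul_le_of_le_one_left (abs_nonneg _) (exp_neg_le_one hlam hξ)).trans hM

/-- The factor exp(λ(x − ξ)/2) splits: its ξ part removes the twist from the data under the
integral, and its x part stays in front of the sine series. -/
lemma integral_mul_green (hl : 0 < l) (hε : 0 < ε) (hlam : 0 ≤ lam) {q : ℝ → ℝ} {M : ℝ}
    (hq : ContinuousOn q (Ioo 0 l)) (hM : ∀ ξ ∈ Ioo 0 l, |q ξ| ≤ M) (x : ℝ) {t : ℝ} (ht : 0 ≤ t) :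
    ∫ ξ in (0 : ℝ)..l, q ξ * green l α ε lam x ξ t = Real.exp (lam / 2 * x) *
      sineSeries l (fun n => Gn l α ε lam (n + 1) t * sinCoeff l (untwist lam q) n) x := by
  have h := integral_mul_sineSeries hl (continuousOn_untwist (lam := lam) hq)
    (fun ξ hξ => abs_untwist_le hlam hξ.1.le (hM ξ hξ))
    (summable_Gn_mul_sinMode (α := α) (lam := lam) hl hε x ht)
  have h1 : sineSeries l (fun n => Gn l α ε lam (n + 1) t * sinCoeff l (untwist lam q) n) x =
      ∑' n, Gn l α ε lam (n + 1) t * sinMode l n x * sinCoeff l (untwist lam q) n :=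
    tsum_congr fun n => by ring
  rw [h1, ← h, ← mul_assoc, ← intervalIntegral.integral_const_mul]
  refine intervalIntegral.integral_congr fun ξ _ => ?_
  simp only [green_eq, untwist]
  rw [mul_sub, Real.exp_sub, Real.exp_neg]
  field_simp

lemma intervalIntegrable_mul_green (hl : 0 < l) (hε : 0 < ε) {q : ℝ → ℝ} {M : ℝ}
    (hq : ContinuousOn q (Ioo 0 l)) (hM : ∀ ξ ∈ Ioo 0 l, |q ξ| ≤ M) (x : ℝ) {t : ℝ} (ht : 0 ≤ t) :
    IntervalIntegrable (fun ξ => q ξ * green l α ε lam x ξ t) volume 0 l :=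
  (intervalIntegrable_of_bounded hl.le hq hM).mul_continuousOn
    (continuous_green hl hε x ht).continuousOn

/-- The bound G_n = O(γ_n⁻²), uniform in time, dominates the series in τ, so summation commutes with
the time integral and produces convolutions with `Gn`. -/
lemma integral_source_green (hl : 0 < l) (hε : 0 < ε) (hlam : 0 ≤ lam) {f : ℝ → ℝ → ℝ} {M T : ℝ}
    (hM0 : 0 ≤ M)
    (hf : ContinuousOn (fun p : ℝ × ℝ => f p.1 p.2) (Omega l T))
    (hM : ∀ p ∈ Omega l T, |f p.1 p.2| ≤ M) (x : ℝ) {t : ℝ} (ht : t ∈ Icc 0 T) :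
    IntervalIntegrable
      (fun τ => ∫ ξ in (0 : ℝ)..l, f ξ τ * green l α ε lam x ξ (t - τ)) volume 0 t ∧
    uSource l α ε lam f x t = -(Real.exp (lam / 2 * x) * sineSeries l (fun n =>
      conv (Gn l α ε lam (n + 1)) (fun τ => sinCoeff l (untwist lam fun ξ => f ξ τ) n) t) x) := by
  obtain ⟨C, hC0, hC⟩ := exists_abs_Gn_le hl hε α lam T
  have hFc : ∀ n, ContinuousOn (fun τ => sinCoeff l (untwist lam fun ξ => f ξ τ) n) (Ioc 0 T) :=
    continuousOn_sinCoeff hl (Q := fun ξ τ => untwist lam (fun ξ => f ξ τ) ξ) (M := M)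
      ((by fun_prop : Continuous fun p : ℝ × ℝ => Real.exp (-(lam / 2 * p.1))).continuousOn.mul hf)
      fun ξ hξ τ hτ => abs_untwist_le hlam hξ.1.le (hM (ξ, τ) ⟨hξ, hτ⟩)
  have hFb : ∀ n, ∀ τ ∈ Ioc 0 T, |sinCoeff l (untwist lam fun ξ => f ξ τ) n| ≤ 2 * M :=
    fun n τ hτ => abs_sinCoeff_le hl (fun ξ hξ => abs_untwist_le hlam hξ.1.le
      (hM (ξ, τ) ⟨hξ, hτ⟩)) n
  set F : ℕ → ℝ → ℝ := fun n τ => sinCoeff l (untwist lam fun ξ => f ξ τ) n with hF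
  have heq : ∀ τ ∈ Ioc 0 t, ∫ ξ in (0 : ℝ)..l, f ξ τ * green l α ε lam x ξ (t - τ) =
      Real.exp (lam / 2 * x) *
        sineSeries l (fun n => Gn l α ε lam (n + 1) (t - τ) * F n τ) x := fun τ hτ =>
    integral_mul_green hl hε hlam (continuousOn_slice hf ⟨hτ.1, hτ.2.trans ht.2⟩)
      (fun ξ hξ => hM (ξ, τ) ⟨hξ, hτ.1, hτ.2.trans ht.2⟩) x (by linarith [hτ.2])
  have hterm : ∀ n, ∀ τ ∈ Ioc 0 t, |F n τ * Gn l α ε lam (n + 1) (t - τ)| ≤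
      2 * M * C / gam l (n + 1) ^ 2 := fun n τ hτ => by
    rw [abs_mul, mul_div_assoc]
    exact mul_le_mul (hFb n τ ⟨hτ.1, hτ.2.trans ht.2⟩)
      (hC n _ ⟨by linarith [hτ.2], by linarith [hτ.1, ht.2]⟩) (abs_nonneg _) (by positivity)
  have hbs : Summable fun n => 2 * M * C / gam l (n + 1) ^ 2 :=
    (summable_inv_gam_sq hl).mul_left _
  have hcn : ∀ n, ContinuousOn (fun τ => F n τ * Gn l α ε lam (n + 1) (t - τ) * sinMode l n x)
      (Ioc 0 t) := fun n =>
    (((hFc n).mono (Ioc_subset_Ioc_right ht.2)).mul ((continuous_Gn (n + 1)).comp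
      (by fun_prop : Continuous fun τ => t - τ)).continuousOn).mul_const _
  have hser : ∀ τ, sineSeries l (fun n => Gn l α ε lam (n + 1) (t - τ) * F n τ) x =
      ∑' n, F n τ * Gn l α ε lam (n + 1) (t - τ) * sinMode l n x := fun τ =>
    tsum_congr fun n => by ring
  have hb : ∀ n, ∀ τ ∈ Ioc 0 t, ‖F n τ * Gn l α ε lam (n + 1) (t - τ) * sinMode l n x‖ ≤
      2 * M * C / gam l (n + 1) ^ 2 := fun n τ hτ =>
    (abs_mul_sinMode_le _ n x).trans (hterm n τ hτ)
  have hcs : ContinuousOn (fun τ => ∑' n, F n τ * Gn l α ε lam (n + 1) (t - τ) * sinMode l n x)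
      (Ioc 0 t) := continuousOn_tsum hcn hbs hb
  have hint : IntervalIntegrable
      (fun τ => ∑' n, F n τ * Gn l α ε lam (n + 1) (t - τ) * sinMode l n x) volume 0 t :=
    intervalIntegrable_of_bounded ht.1 (hcs.mono Ioo_subset_Ioc_self) fun τ hτ =>
      tsum_of_norm_bounded hbs.hasSum fun n => hb n τ (Ioo_subset_Ioc_self hτ)
  have hui : uIoc 0 t = Ioc 0 t := uIoc_of_le ht.1
  constructor
  · refine (hint.const_mul (Real.exp (lam / 2 * x))).congr fun τ hτ => ?_
    rw [hui] at hτ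
    simp only [heq τ hτ, hser]
  · have hS := intervalIntegral.hasSum_integral_of_dominated_convergence (μ := volume)
      (a := (0 : ℝ)) (b := t)
      (F := fun n τ => F n τ * Gn l α ε lam (n + 1) (t - τ) * sinMode l n x)
      (f := fun τ => ∑' n, F n τ * Gn l α ε lam (n + 1) (t - τ) * sinMode l n x)
      (fun n _ => 2 * M * C / gam l (n + 1) ^ 2)
      (fun n => by rw [hui]; exact (hcn n).aestronglyMeasurable measurableSet_Ioc)
      (fun n => ae_of_all _ fun τ hτ => hb n τ (hui ▸ hτ))
      (ae_of_all _ fun _ _ => hbs) intervalIntegrable_const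
      (ae_of_all _ fun τ hτ => (Summable.of_norm_bounded hbs fun n => hb n τ (hui ▸ hτ)).hasSum)
    rw [uSource, sineSeries]
    congr 1
    simp only [conv]
    simp_rw [← intervalIntegral.integral_mul_const]
    rw [hS.tsum_eq, ← intervalIntegral.integral_const_mul]
    refine intervalIntegral.integral_congr_ae (ae_of_all _ fun τ hτ => ?_)
    rw [heq τ (hui ▸ hτ), hser]

end Explicit

end

/-! ### Modal propagators and coefficient bounds -/

section


variable {l T α ε lam A M : ℝ} {H : ℝ → ℝ} {a₀ : ℕ → ℝ} {F : ℝ → ℝ → ℝ}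

lemma exists_inv_gam_sq_le (hl : 0 < l) : ∃ D, 0 ≤ D ∧ ∀ n, (gam l (n + 1) ^ 2)⁻¹ ≤ D := by
  obtain ⟨D, hD⟩ := (summable_inv_gam_sq hl).tendsto_atTop_zero.bddAbove_range
  exact ⟨D, le_trans (by positivity) (hD ⟨0, rfl⟩), fun n => hD ⟨n, rfl⟩⟩

/-- The modal propagator of the initial position. -/
def Kn (l α ε lam : ℝ) (n : ℕ) (t : ℝ) : ℝ :=
  GnD l α ε lam n t + (α + ε * bn l lam n) * Gn l α ε lam n t

lemma continuous_Kn (n : ℕ) : Continuous (Kn l α ε lam n) :=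
  (continuous_GnD n).add (continuous_const.mul (continuous_Gn n))

/-- G_n = O(γ_n⁻²) compensates the growth of b_n, so the propagator of the initial position is
bounded uniformly in n. -/
lemma exists_bound_Kn (hl : 0 < l) (hε : 0 < ε) (α lam T : ℝ) :
    ∃ C, 0 ≤ C ∧ ∀ n, ∀ t ∈ Icc 0 T,
      |bn l lam (n + 1) * Gn l α ε lam (n + 1) t| ≤ C ∧ |Kn l α ε lam (n + 1) t| ≤ C := by
  obtain ⟨C, hC0, hC⟩ := exists_bound_Gn hl hε α lam T
  obtain ⟨D, hD0, hD⟩ := exists_inv_gam_sq_le hl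
  set E := C * (1 + lam ^ 2 / 4 * D)
  have hE : 0 ≤ E := by positivity
  refine ⟨E + (C + |α| * (C * D) + ε * E), by positivity, fun n t ht => ?_⟩
  have hg := gam_pos hl n
  have hG := (hC n t ht).1
  have h1 : |bn l lam (n + 1) * Gn l α ε lam (n + 1) t| ≤ E := by
    have hb : 0 ≤ bn l lam (n + 1) := by unfold bn; positivity
    rw [abs_mul, abs_of_nonneg hb]
    calc _ ≤ bn l lam (n + 1) * (C / gam l (n + 1) ^ 2) := by gcongr
      _ = C * (1 + lam ^ 2 / 4 * (gam l (n + 1) ^ 2)⁻¹) := by unfold bn; field_simp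
      _ ≤ _ := by simp only [E]; gcongr; exact hD n
  have h2 : |Gn l α ε lam (n + 1) t| ≤ C * D := hG.trans (by
    rw [div_eq_mul_inv]; gcongr; exact hD n)
  have h3 : 0 ≤ |α| * (C * D) := by positivity
  have h4 : 0 ≤ ε * E := by positivity
  refine ⟨by linarith, ?_⟩
  have h5 : Kn l α ε lam (n + 1) t = GnD l α ε lam (n + 1) t + α * Gn l α ε lam (n + 1) t +
      ε * (bn l lam (n + 1) * Gn l α ε lam (n + 1) t) := by unfold Kn; ring
  have h6 : |α * Gn l α ε lam (n + 1) t| ≤ |α| * (C * D) := by rw [abs_mul]; gcongr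
  have h7 : |ε * (bn l lam (n + 1) * Gn l α ε lam (n + 1) t)| ≤ ε * E := by
    rw [abs_mul, abs_of_pos hε]; gcongr
  rw [h5]
  refine (abs_add_three _ _ _).trans ?_
  have := (hC n t ht).2.1
  linarith

/-- The sine coefficients of the solution, up to the factor `exp (λ x / 2)`. -/
def modeV (l α ε lam : ℝ) (H : ℝ → ℝ) (a₀ : ℕ → ℝ) (F : ℝ → ℝ → ℝ) (n : ℕ) (t : ℝ) : ℝ :=
  Gn l α ε lam (n + 1) t * sinCoeff l H n + Kn l α ε lam (n + 1) t * a₀ n -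
    conv (Gn l α ε lam (n + 1)) (fun τ => sinCoeff l (fun ξ => F ξ τ) n) t

/-- The time derivative of `modeV`. -/
def modeP (l α ε lam : ℝ) (H : ℝ → ℝ) (a₀ : ℕ → ℝ) (F : ℝ → ℝ → ℝ) (n : ℕ) (t : ℝ) : ℝ :=
  GnD l α ε lam (n + 1) t * sinCoeff l H n - bn l lam (n + 1) * Gn l α ε lam (n + 1) t * a₀ n -
    conv (GnD l α ε lam (n + 1)) (fun τ => sinCoeff l (fun ξ => F ξ τ) n) t

/-- The sine coefficients of `ε ∂_t u + u`. -/
def modeW (l α ε lam : ℝ) (H : ℝ → ℝ) (a₀ : ℕ → ℝ) (F : ℝ → ℝ → ℝ) (n : ℕ) (t : ℝ) : ℝ :=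
  ε * modeP l α ε lam H a₀ F n t + modeV l α ε lam H a₀ F n t

/-- Initial data and source of the strip problem after the substitution
`u = exp (λ x / 2) v`. -/
structure StripData (l T ε A M : ℝ) (H : ℝ → ℝ) (a₀ : ℕ → ℝ) (F : ℝ → ℝ → ℝ) : Prop where
  pos_l : 0 < l
  pos_T : 0 < T
  pos_ε : 0 < ε
  contH : ContinuousOn H (Icc 0 l)
  boundH : ∀ ξ ∈ Icc 0 l, |H ξ| ≤ A
  bound₀ : ∀ n, |a₀ n| ≤ A / gam l (n + 1) ^ 2
  source : HeatSource l T M F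

namespace StripData

lemma nonneg (h : StripData l T ε A M H a₀ F) : 0 ≤ A :=
  (abs_nonneg _).trans (h.boundH 0 ⟨le_rfl, h.pos_l.le⟩)

lemma boundH' (h : StripData l T ε A M H a₀ F) : ∀ ξ ∈ Ioo 0 l, |H ξ| ≤ A := fun ξ hξ =>
  h.boundH ξ (Ioo_subset_Icc_self hξ)

lemma contH' (h : StripData l T ε A M H a₀ F) : ContinuousOn H (Ioo 0 l) :=
  h.contH.mono Ioo_subset_Icc_self

lemma abs_sourceCoeff_le (h : StripData l T ε A M H a₀ F) (n : ℕ) :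
    ∀ τ ∈ Ioc 0 T, |sinCoeff l (fun ξ => F ξ τ) n| ≤ 2 * M := fun τ hτ =>
  abs_sinCoeff_le h.pos_l (fun ξ hξ => h.source.bound ξ hξ τ hτ) n

lemma conv_sourceCoeff (h : StripData l T ε A M H a₀ F) (α lam : ℝ) (n : ℕ) :
    ContinuousOn (conv (Gn l α ε lam (n + 1)) fun τ => sinCoeff l (fun ξ => F ξ τ) n) (Icc 0 T) ∧
    ContinuousOn (conv (GnD l α ε lam (n + 1)) fun τ => sinCoeff l (fun ξ => F ξ τ) n) (Icc 0 T) ∧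
    ∀ t ∈ Ioo 0 T,
      HasDerivAt (conv (Gn l α ε lam (n + 1)) fun τ => sinCoeff l (fun ξ => F ξ τ) n)
        (conv (GnD l α ε lam (n + 1)) (fun τ => sinCoeff l (fun ξ => F ξ τ) n) t) t ∧
      HasDerivAt (conv (GnD l α ε lam (n + 1)) fun τ => sinCoeff l (fun ξ => F ξ τ) n)
        (-(2 * gn l α ε lam (n + 1)) *
            conv (GnD l α ε lam (n + 1)) (fun τ => sinCoeff l (fun ξ => F ξ τ) n) t
          - bn l lam (n + 1) * conv (Gn l α ε lam (n + 1)) (fun τ => sinCoeff l (fun ξ => F ξ τ) n) t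
          + sinCoeff l (fun ξ => F ξ t) n) t :=
  conv_Gn (l := l) (α := α) (ε := ε) (lam := lam) (n + 1) h.pos_T
    (continuousOn_sinCoeff h.pos_l h.source.cont h.source.bound n) (h.abs_sourceCoeff_le n)

lemma continuousOn_modeV (h : StripData l T ε A M H a₀ F) (n : ℕ) :
    ContinuousOn (modeV l α ε lam H a₀ F n) (Icc 0 T) :=
  (((continuous_Gn _).mul continuous_const).add
    ((continuous_Kn _).mul continuous_const)).continuousOn.sub (h.conv_sourceCoeff α lam n).1

lemma continuousOn_modeP (h : StripData l T ε A M H a₀ F) (n : ℕ) :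
    ContinuousOn (modeP l α ε lam H a₀ F n) (Icc 0 T) :=
  (((continuous_GnD _).mul continuous_const).sub
    ((continuous_const.mul (continuous_Gn _)).mul continuous_const)).continuousOn.sub
      (h.conv_sourceCoeff α lam n).2.1

lemma continuousOn_modeW (h : StripData l T ε A M H a₀ F) (n : ℕ) :
    ContinuousOn (modeW l α ε lam H a₀ F n) (Icc 0 T) :=
  ((h.continuousOn_modeP n).const_mul ε).add (h.continuousOn_modeV n)

lemma hasDerivAt_modeV (h : StripData l T ε A M H a₀ F) (n : ℕ) {t : ℝ} (ht : t ∈ Ioo 0 T) :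
    HasDerivAt (modeV l α ε lam H a₀ F n) (modeP l α ε lam H a₀ F n t) t := by
  have hG := hasDerivAt_Gn (l := l) (α := α) (ε := ε) (lam := lam) (n + 1) t
  have hD := hasDerivAt_GnD (l := l) (α := α) (ε := ε) (lam := lam) (n + 1) t
  convert! ((hG.mul_const (sinCoeff l H n)).add
    ((hD.add (hG.const_mul (α + ε * bn l lam (n + 1)))).mul_const (a₀ n))).sub
    ((h.conv_sourceCoeff α lam n).2.2 t ht).1 using 1
  simp only [modeP, gn]; ring

lemma hasDerivAt_modeP (h : StripData l T ε A M H a₀ F) (n : ℕ) {t : ℝ} (ht : t ∈ Ioo 0 T) :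
    HasDerivAt (modeP l α ε lam H a₀ F n) (-(2 * gn l α ε lam (n + 1)) * modeP l α ε lam H a₀ F n t
      - bn l lam (n + 1) * modeV l α ε lam H a₀ F n t - sinCoeff l (fun ξ => F ξ t) n) t := by
  have hG := hasDerivAt_Gn (l := l) (α := α) (ε := ε) (lam := lam) (n + 1) t
  have hD := hasDerivAt_GnD (l := l) (α := α) (ε := ε) (lam := lam) (n + 1) t
  convert! ((hD.mul_const (sinCoeff l H n)).sub
    ((hG.const_mul (bn l lam (n + 1))).mul_const (a₀ n))).sub
    ((h.conv_sourceCoeff α lam n).2.2 t ht).2 using 1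
  simp only [modeP, modeV, Kn, gn]; ring

/-- Substituting ∂_t v = (w − v)/ε into the second-order mode leaves a heat mode of rate εγ² with
lower-order terms whose coefficients do not grow with n. -/
lemma hasDerivAt_modeW (h : StripData l T ε A M H a₀ F) (n : ℕ) {t : ℝ} (ht : t ∈ Ioo 0 T) :
    HasDerivAt (modeW l α ε lam H a₀ F n) (-(ε * gam l (n + 1) ^ 2) * modeW l α ε lam H a₀ F n t +
      (((1 - ε * α) / ε - ε * lam ^ 2 / 4) * modeW l α ε lam H a₀ F n t -
        (1 - ε * α) / ε * modeV l α ε lam H a₀ F n t - ε * sinCoeff l (fun ξ => F ξ t) n)) t := by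
  have hε := h.pos_ε
  convert! ((h.hasDerivAt_modeP (α := α) (lam := lam) n ht).const_mul ε).add
    (h.hasDerivAt_modeV (α := α) (lam := lam) n ht) using 1
  simp only [modeW, gn, bn]; field_simp; ring

lemma modeV_zero (n : ℕ) : modeV l α ε lam H a₀ F n 0 = a₀ n := by
  simp [modeV, conv, Kn, Gn_zero, GnD_zero]

lemma modeP_zero (n : ℕ) : modeP l α ε lam H a₀ F n 0 = sinCoeff l H n := by
  simp [modeP, conv, Gn_zero, GnD_zero]

/-- The initial position already has coefficients O(γ⁻²) and its propagator is bounded; the source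
gains γ⁻² from integration in time. In w the initial velocity is multiplied by ε G_n' + G_n, whose
only part larger than O(γ⁻²) is the decay factor subtracted here. -/
lemma exists_bound_modes (h : StripData l T ε A M H a₀ F) (α lam : ℝ) :
    ∃ C, 0 ≤ C ∧ ∀ n, ∀ t ∈ Icc 0 T, |modeV l α ε lam H a₀ F n t| ≤ C / gam l (n + 1) ^ 2 ∧
      |modeW l α ε lam H a₀ F n t - ε * (decay l ε n t * sinCoeff l H n)| ≤
        C / gam l (n + 1) ^ 2 := by
  have hl := h.pos_l
  have hε := h.pos_ε
  have hA := h.nonneg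
  have hM := h.source.nonneg
  have hT := h.pos_T
  obtain ⟨C, hC0, hC⟩ := exists_bound_Gn hl hε α lam T
  obtain ⟨E, hE0, hE⟩ := exists_bound_Kn hl hε α lam T
  refine ⟨2 * A * C + E * A + ε * E * A + 2 * M * (T * C) + 2 * M * (1 + 2 * C * T),
    by positivity, fun n t ht => ?_⟩
  have hg := gam_pos hl n
  set γ := gam l (n + 1) with hγ
  set i := (γ ^ 2)⁻¹ with hi
  have hi0 : 0 < i := by positivity
  obtain ⟨hG, hGD, hGW⟩ := hC n t ht
  obtain ⟨hB, hK⟩ := hE n t ht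
  have h1 : |sinCoeff l H n| ≤ 2 * A := abs_sinCoeff_le hl h.boundH' n
  have h0 := h.bound₀ n
  have hint : ∀ c : ℝ, 0 ≤ c → ∫ _ in (0 : ℝ)..t, c * i ≤ T * c * i := fun c hc => by
    rw [intervalIntegral.integral_const, smul_eq_mul, sub_zero, ← mul_assoc]
    gcongr; exact ht.2
  rw [div_eq_mul_inv, ← hi] at hG hGW h0
  have hcG : |conv (Gn l α ε lam (n + 1)) (fun τ => sinCoeff l (fun ξ => F ξ τ) n) t| ≤
      2 * M * (T * C) * i := by
    refine (abs_conv_le (h.abs_sourceCoeff_le n) (fun s hs => (hC n s hs).1) continuous_const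
      ht).trans ?_
    rw [mul_assoc (2 * M)]
    gcongr
    simp only [div_eq_mul_inv]
    exact hint C hC0
  have hcD : ε * |conv (GnD l α ε lam (n + 1)) (fun τ => sinCoeff l (fun ξ => F ξ τ) n) t| ≤
      2 * M * (1 + 2 * C * T) * i := by
    -- Solving the combined estimate for G_n' gives the decay factor plus O(γ⁻²), and both parts
    -- have time integral O(γ⁻²).
    have hd : ∀ s ∈ Icc 0 T, |GnD l α ε lam (n + 1) s| ≤ decay l ε n s + 2 * C / ε * i := by
      intro s hs
      obtain ⟨hG, -, hGW⟩ := hC n s hs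
      have hp := decay_pos (l := l) ε n s
      have e : GnD l α ε lam (n + 1) s =
          ((ε * GnD l α ε lam (n + 1) s + Gn l α ε lam (n + 1) s - ε * decay l ε n s) -
            Gn l α ε lam (n + 1) s + ε * decay l ε n s) / ε := by field_simp; ring
      rw [e, abs_div, abs_of_pos hε, div_le_iff₀ hε]
      refine (abs_add_le _ _).trans ((add_le_add_left (abs_sub _ _) _).trans ?_)
      rw [abs_of_pos (by positivity : 0 < ε * decay l ε n s)]
      rw [div_eq_mul_inv, ← hi] at hG hGW
      calc _ ≤ C * i + C * i + ε * decay l ε n s := by gcongr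
        _ = _ := by field_simp; ring
    have hdc := continuous_decay (l := l) ε n
    have := abs_conv_le (h.abs_sourceCoeff_le n) hd (hdc.add continuous_const) ht
    rw [intervalIntegral.integral_add (hdc.intervalIntegrable _ _)
      intervalIntegrable_const] at this
    have h3 := integral_decay_le hl hε n t
    rw [← hγ, div_eq_mul_inv (1 / ε), ← hi] at h3
    calc _ ≤ ε * (2 * M * (1 / ε * i + T * (2 * C / ε) * i)) := by
          gcongr
          refine this.trans ?_
          gcongr
          exact hint _ (by positivity)
      _ = _ := by field_simp
  have hGa : |Gn l α ε lam (n + 1) t * sinCoeff l H n| ≤ 2 * A * C * i := by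
    rw [abs_mul]
    calc _ ≤ C * i * (2 * A) := by gcongr
      _ = _ := by ring
  have hKa : |Kn l α ε lam (n + 1) t * a₀ n| ≤ E * A * i := by
    rw [abs_mul, mul_assoc]; gcongr
  have hBa : |ε * (bn l lam (n + 1) * Gn l α ε lam (n + 1) t * a₀ n)| ≤ ε * E * A * i := by
    rw [abs_mul, abs_of_pos hε, abs_mul, mul_assoc, mul_assoc]; gcongr
  have hWa : |(ε * GnD l α ε lam (n + 1) t + Gn l α ε lam (n + 1) t - ε * decay l ε n t) *
      sinCoeff l H n| ≤ 2 * A * C * i := by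
    rw [abs_mul]
    calc _ ≤ C * i * (2 * A) := by gcongr
      _ = _ := by ring
  have hcD' : |ε * conv (GnD l α ε lam (n + 1)) (fun τ => sinCoeff l (fun ξ => F ξ τ) n) t| ≤
      2 * M * (1 + 2 * C * T) * i := by rwa [abs_mul, abs_of_pos hε]
  have p1 : 0 ≤ 2 * A * C * i := by positivity
  have p2 : 0 ≤ E * A * i := by positivity
  have p3 : 0 ≤ ε * E * A * i := by positivity
  have p4 : 0 ≤ 2 * M * (T * C) * i := by positivity
  have p5 : 0 ≤ 2 * M * (1 + 2 * C * T) * i := by positivity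
  rw [div_eq_mul_inv, ← hi]
  constructor
  · have := (abs_sub _ _).trans (add_le_add ((abs_add_le _ _).trans (add_le_add hGa hKa)) hcG)
    rw [modeV]
    linarith
  · have e : modeW l α ε lam H a₀ F n t - ε * (decay l ε n t * sinCoeff l H n) =
        (ε * GnD l α ε lam (n + 1) t + Gn l α ε lam (n + 1) t - ε * decay l ε n t) *
          sinCoeff l H n + Kn l α ε lam (n + 1) t * a₀ n
        - ε * (bn l lam (n + 1) * Gn l α ε lam (n + 1) t * a₀ n)
        - ε * conv (GnD l α ε lam (n + 1)) (fun τ => sinCoeff l (fun ξ => F ξ τ) n) t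
        - conv (Gn l α ε lam (n + 1)) (fun τ => sinCoeff l (fun ξ => F ξ τ) n) t := by
      simp only [modeW, modeP, modeV]; ring
    rw [e]
    have := (abs_sub _ _).trans (add_le_add ((abs_sub _ _).trans (add_le_add ((abs_sub _ _).trans
      (add_le_add ((abs_add_le _ _).trans (add_le_add hWa hKa)) hBa)) hcD')) hcG)
    linarith

end StripData

end

/-! ### The fields v, w and the source of the heat equation for w -/

section


section SineSeries

variable {l : ℝ}

lemma continuousOn_sineSeries_param (hl : 0 < l) {c : ℕ → ℝ → ℝ} {S : Set ℝ} {C : ℝ}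
    (hc : ∀ n, ContinuousOn (c n) S) (hC : ∀ n, ∀ t ∈ S, |c n t| ≤ C / gam l (n + 1) ^ 2) :
    ContinuousOn (fun p : ℝ × ℝ => sineSeries l (fun n => c n p.2) p.1) (univ ×ˢ S) := by
  have hs : Summable fun n => C / gam l (n + 1) ^ 2 := (summable_inv_gam_sq hl).mul_left C
  have hcn : ∀ n, ContinuousOn (fun p : ℝ × ℝ => c n p.2 * sinMode l n p.1) (univ ×ˢ S) := by
    intro n
    have h1 : ContinuousOn (fun p : ℝ × ℝ => c n p.2) (univ ×ˢ S) :=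
      ContinuousOn.comp (f := Prod.snd) (g := c n) (hc n) continuousOn_snd fun p hp => hp.2
    have h2 : Continuous fun p : ℝ × ℝ => sinMode l n p.1 :=
      Continuous.comp (f := Prod.fst) (g := sinMode l n) (continuous_sinMode n) continuous_fst
    exact h1.mul h2.continuousOn
  have hb : ∀ n, ∀ p ∈ (univ ×ˢ S : Set (ℝ × ℝ)), ‖c n p.2 * sinMode l n p.1‖ ≤
      C / gam l (n + 1) ^ 2 := fun n p hp => (abs_mul_sinMode_le _ n _).trans (hC n p.2 hp.2)
  exact continuousOn_tsum (f := fun n (p : ℝ × ℝ) => c n p.2 * sinMode l n p.1) hcn hs hb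

lemma summable_sqrt_gam_div (hl : 0 < l) :
    Summable fun n => √(gam l (n + 1)) / gam l (n + 1) ^ 2 := by
  have h1 : Summable fun n : ℕ => 1 / ((n : ℝ) ^ (3 / 2 : ℝ)) :=
    Real.summable_one_div_nat_rpow.2 (by norm_num)
  have h2 := (summable_nat_add_iff 1).2 h1
  refine (h2.mul_left ((Real.pi / l) ^ (-(3 / 2) : ℝ))).congr fun n => ?_
  have hg := gam_pos hl n
  have e : √(gam l (n + 1)) / gam l (n + 1) ^ 2 = gam l (n + 1) ^ (-(3 / 2) : ℝ) := by
    rw [Real.sqrt_eq_rpow, ← Real.rpow_natCast (gam l (n + 1)) 2, ← Real.rpow_sub hg]; norm_num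
  have hpl : 0 ≤ Real.pi / l := by positivity
  rw [e, show gam l (n + 1) = Real.pi / l * ((n + 1 : ℕ) : ℝ) by unfold gam; ring,
    Real.mul_rpow hpl (by positivity), Real.rpow_neg (by positivity : (0 : ℝ) ≤ ((n + 1 : ℕ) : ℝ)),
    one_div]

/-- Interpolation between the Lipschitz bound for small increments and the trivial bound 2 for large
ones. -/
lemma abs_sin_sub_sin_le_sqrt (a b : ℝ) : |Real.sin a - Real.sin b| ≤ 2 * √|a - b| := by
  have h1 : |Real.sin a - Real.sin b| ≤ |a - b| := by
    have := Real.lipschitzWith_sin.dist_le_mul a b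
    simpa [Real.dist_eq] using this
  have h2 : |Real.sin a - Real.sin b| ≤ 2 := (abs_sub _ _).trans (by
    have := Real.abs_sin_le_one a
    have := Real.abs_sin_le_one b
    linarith)
  have h3 := Real.sqrt_nonneg |a - b|
  have h4 := Real.sq_sqrt (abs_nonneg (a - b))
  rcases le_or_gt 1 √|a - b| with h | h
  · linarith
  · nlinarith

/-- Sine series with coefficients `O (γ_n⁻²)` are Hölder continuous. -/
lemma exists_holder_sineSeries (hl : 0 < l) : ∃ K, 0 ≤ K ∧ ∀ (C : ℝ) (c : ℕ → ℝ), 0 ≤ C →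
    (∀ n, |c n| ≤ C / gam l (n + 1) ^ 2) →
    ∀ y z, |sineSeries l c y - sineSeries l c z| ≤ C * K * √|y - z| := by
  have hs := summable_sqrt_gam_div hl
  refine ⟨2 * ∑' n, √(gam l (n + 1)) / gam l (n + 1) ^ 2,
    mul_nonneg two_pos.le (tsum_nonneg fun _ => by positivity), fun C c hC hc y z => ?_⟩
  have hcs := summable_of_le_inv_gam_sq hl hc
  rw [sineSeries, sineSeries,
    ← (summable_mul_sinMode hcs y).tsum_sub (summable_mul_sinMode hcs z)]
  refine (tsum_of_norm_bounded (f := fun n => c n * sinMode l n y - c n * sinMode l n z) (((hs.hasSum.mul_left 2).mul_left C).mul_right √|y - z|)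
    fun n => ?_)
  have hg := gam_pos hl n
  rw [← mul_sub, norm_mul]
  have h1 := abs_sin_sub_sin_le_sqrt (gam l (n + 1) * y) (gam l (n + 1) * z)
  rw [← mul_sub, abs_mul, abs_of_pos hg, Real.sqrt_mul hg.le] at h1
  calc ‖c n‖ * ‖sinMode l n y - sinMode l n z‖ ≤
        C / gam l (n + 1) ^ 2 * (2 * (√(gam l (n + 1)) * √|y - z|)) :=
        mul_le_mul (hc n) h1 (norm_nonneg _) (by positivity)
    _ = _ := by ring

end SineSeries

variable {l T α ε lam A M : ℝ} {H : ℝ → ℝ} {a₀ : ℕ → ℝ} {F : ℝ → ℝ → ℝ}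

/-- The solution, up to the factor `exp (λ x / 2)`. -/
def fieldV (l α ε lam : ℝ) (H : ℝ → ℝ) (a₀ : ℕ → ℝ) (F : ℝ → ℝ → ℝ) (x t : ℝ) : ℝ :=
  sineSeries l (fun n => modeV l α ε lam H a₀ F n t) x

/-- The coefficients of `fieldW` without their initial layer. -/
def modeR (l α ε lam : ℝ) (H : ℝ → ℝ) (a₀ : ℕ → ℝ) (F : ℝ → ℝ → ℝ) (n : ℕ) (t : ℝ) : ℝ :=
  modeW l α ε lam H a₀ F n t - ε * (decay l ε n t * sinCoeff l H n)

/-- The function `ε ∂_t u + u`, up to the factor `exp (λ x / 2)`. -/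
def fieldW (l α ε lam : ℝ) (H : ℝ → ℝ) (a₀ : ℕ → ℝ) (F : ℝ → ℝ → ℝ) (x t : ℝ) : ℝ :=
  ε * heatFlow l ε H t x + sineSeries l (fun n => modeR l α ε lam H a₀ F n t) x

/-- The source of the heat equation for `fieldW`. -/
def fieldQ (l α ε lam : ℝ) (H : ℝ → ℝ) (a₀ : ℕ → ℝ) (F : ℝ → ℝ → ℝ) (x t : ℝ) : ℝ :=
  ((1 - ε * α) / ε - ε * lam ^ 2 / 4) * fieldW l α ε lam H a₀ F x t -
    (1 - ε * α) / ε * fieldV l α ε lam H a₀ F x t - ε * F x t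

namespace StripData

lemma summable_modeV (h : StripData l T ε A M H a₀ F) {t : ℝ} (ht : t ∈ Icc 0 T) :
    Summable fun n => modeV l α ε lam H a₀ F n t := by
  obtain ⟨C, -, hC⟩ := h.exists_bound_modes α lam
  exact summable_of_le_inv_gam_sq h.pos_l fun n => (hC n t ht).1

lemma summable_modeR (h : StripData l T ε A M H a₀ F) {t : ℝ} (ht : t ∈ Icc 0 T) :
    Summable fun n => modeR l α ε lam H a₀ F n t := by
  obtain ⟨C, -, hC⟩ := h.exists_bound_modes α lam
  exact summable_of_le_inv_gam_sq h.pos_l fun n => (hC n t ht).2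

lemma exists_abs_modeW_le (h : StripData l T ε A M H a₀ F) (α lam : ℝ) :
    ∃ C, 0 ≤ C ∧ ∀ n, ∀ t ∈ Icc 0 T, |modeW l α ε lam H a₀ F n t| ≤
      2 * A * ε * decay l ε n t + C / gam l (n + 1) ^ 2 := by
  obtain ⟨C, hC0, hC⟩ := h.exists_bound_modes α lam
  refine ⟨C, hC0, fun n t ht => ?_⟩
  have h1 := abs_add_le (modeW l α ε lam H a₀ F n t - ε * (decay l ε n t * sinCoeff l H n))
    (ε * (decay l ε n t * sinCoeff l H n))
  rw [sub_add_cancel] at h1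
  have h2 : |ε * (decay l ε n t * sinCoeff l H n)| ≤ 2 * A * ε * decay l ε n t := by
    have hd := decay_pos (l := l) ε n t
    have hε := h.pos_ε
    rw [abs_mul, abs_mul, abs_of_pos hd, abs_of_pos hε]
    calc _ ≤ ε * (decay l ε n t * (2 * A)) := by
          gcongr; exact abs_sinCoeff_le h.pos_l h.boundH' n
      _ = _ := by ring
  linarith [(hC n t ht).2]

/-- Away from t = 0 the initial layer is itself O(γ⁻²). -/
lemma exists_abs_modeW_le_inv (h : StripData l T ε A M H a₀ F) (α lam : ℝ) {τ : ℝ} (hτ : 0 < τ) :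
    ∃ C, 0 ≤ C ∧ ∀ n, ∀ t ∈ Icc τ T,
      |modeW l α ε lam H a₀ F n t| ≤ C / gam l (n + 1) ^ 2 := by
  obtain ⟨C, hC0, hC⟩ := h.exists_abs_modeW_le α lam
  have hA := h.nonneg
  have hε := h.pos_ε
  refine ⟨2 * A * ε * (1 / (ε * τ)) + C, by positivity, fun n t ht => ?_⟩
  refine (hC n t ⟨hτ.le.trans ht.1, ht.2⟩).trans ?_
  rw [add_div, mul_div_assoc]
  gcongr
  exact (decay_anti hε.le n ht.1).trans (decay_le h.pos_l hε n hτ)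

lemma summable_modeW (h : StripData l T ε A M H a₀ F) {t : ℝ} (ht : t ∈ Ioc 0 T) :
    Summable fun n => modeW l α ε lam H a₀ F n t := by
  obtain ⟨C, -, hC⟩ := h.exists_abs_modeW_le_inv α lam ht.1
  exact summable_of_le_inv_gam_sq h.pos_l fun n => hC n t ⟨le_rfl, ht.2⟩

/-- Restricted to t > 0: at t = 0 the sine series of a merely continuous `H` need not converge,
which is why `fieldW` is defined through the heat flow. -/
lemma fieldW_eq (h : StripData l T ε A M H a₀ F) {x t : ℝ} (hx : x ∈ Icc 0 l) (ht : t ∈ Ioc 0 T) :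
    fieldW l α ε lam H a₀ F x t = sineSeries l (fun n => modeW l α ε lam H a₀ F n t) x := by
  have hd : Summable fun n => decay l ε n t * sinCoeff l H n := by
    have h1 := ((h.summable_modeW (α := α) (lam := lam) ht).sub
      (h.summable_modeR (α := α) (lam := lam) (Ioc_subset_Icc_self ht))).mul_left ε⁻¹
    refine h1.congr fun n => ?_
    have := h.pos_ε
    simp only [modeR]; field_simp; ring
  rw [fieldW, heatFlow_eq h.pos_l h.pos_ε h.nonneg h.contH' h.boundH' ht.1 hx, sineSeries,
    sineSeries, sineSeries, ← tsum_mul_left,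
    ← ((summable_mul_sinMode hd x).mul_left ε).tsum_add
      (summable_mul_sinMode (h.summable_modeR (Ioc_subset_Icc_self ht)) x)]
  refine tsum_congr fun n => ?_
  simp only [modeR]; ring

lemma fieldV_zero (x : ℝ) : fieldV l α ε lam H a₀ F x 0 = sineSeries l a₀ x := by
  simp only [fieldV, modeV_zero]

/-- With the layer removed, the coefficient of w at t = 0 is that of the initial position alone. -/
lemma fieldW_zero (x : ℝ) :
    fieldW l α ε lam H a₀ F x 0 = ε * oddExt l H x + sineSeries l a₀ x := by
  rw [fieldW, heatFlow_zero]
  congr 2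
  funext n
  simp [modeR, modeW, modeV_zero, modeP_zero, decay]

lemma fieldW_left (h : StripData l T ε A M H a₀ F) {t : ℝ} (ht : t ∈ Icc 0 T) :
    fieldW l α ε lam H a₀ F 0 t = 0 := by
  rcases eq_or_lt_of_le ht.1 with rfl | h0
  · rw [fieldW_zero, oddExt_zero, sineSeries_zero]; simp
  · rw [h.fieldW_eq ⟨le_rfl, h.pos_l.le⟩ ⟨h0, ht.2⟩, sineSeries_zero]

lemma fieldW_right (h : StripData l T ε A M H a₀ F) {t : ℝ} (ht : t ∈ Icc 0 T) :
    fieldW l α ε lam H a₀ F l t = 0 := by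
  rcases eq_or_lt_of_le ht.1 with rfl | h0
  · rw [fieldW_zero, oddExt_right h.pos_l, sineSeries_right h.pos_l]; simp
  · rw [h.fieldW_eq ⟨h.pos_l.le, le_rfl⟩ ⟨h0, ht.2⟩, sineSeries_right h.pos_l]

lemma continuousOn_fieldV (h : StripData l T ε A M H a₀ F) :
    ContinuousOn (fun p : ℝ × ℝ => fieldV l α ε lam H a₀ F p.1 p.2) (univ ×ˢ Icc 0 T) := by
  obtain ⟨C, -, hC⟩ := h.exists_bound_modes α lam
  exact continuousOn_sineSeries_param h.pos_l h.continuousOn_modeV fun n t ht => (hC n t ht).1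

lemma continuousOn_sineSeries_modeR (h : StripData l T ε A M H a₀ F) :
    ContinuousOn (fun p : ℝ × ℝ => sineSeries l (fun n => modeR l α ε lam H a₀ F n p.2) p.1)
      (univ ×ˢ Icc 0 T) := by
  obtain ⟨C, -, hC⟩ := h.exists_bound_modes α lam
  exact continuousOn_sineSeries_param h.pos_l (fun n => (h.continuousOn_modeW n).sub
    ((continuous_const.mul ((continuous_decay ε n).mul continuous_const)).continuousOn))
    fun n t ht => (hC n t ht).2

/-- The heat flow is continuous at positive times and at interior points; within the closed strip
this omits only the corners. -/
lemma continuousOn_fieldW (h : StripData l T ε A M H a₀ F) :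
    ContinuousOn (fun p : ℝ × ℝ => fieldW l α ε lam H a₀ F p.1 p.2)
      (closedStrip l T \ corners l) := by
  refine ContinuousOn.add (ContinuousOn.const_mul ?_ ε)
    (h.continuousOn_sineSeries_modeR.mono fun p hp => ⟨mem_univ _, hp.1.2⟩)
  rintro ⟨x, t⟩ ⟨⟨hx, ht⟩, hc⟩
  have hor : 0 < t ∨ x ∈ Ioo 0 l := by
    rcases eq_or_lt_of_le ht.1 with h0 | h0
    · right
      simp only [corners, mem_insert_iff, mem_singleton_iff, Prod.mk.injEq] at hc
      have h0' : t = 0 := h0.symm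
      exact ⟨lt_of_le_of_ne hx.1 fun e => hc (Or.inl ⟨e.symm, h0'⟩),
        lt_of_le_of_ne hx.2 fun e => hc (Or.inr ⟨e, h0'⟩)⟩
    · exact Or.inl h0
  have h1 := continuousWithinAt_heatFlow (Q := fun ξ _ => H ξ) (A := univ) (s := t) (x := x)
    (τ := 0) h.pos_l h.pos_ε h.nonneg
    (ContinuousOn.comp (f := fun p : ℝ × ℝ => p.1) (g := H) h.contH' continuousOn_fst
      fun p hp => hp.1) (fun ξ hξ _ _ => h.boundH' ξ hξ) (mem_univ _) hor
  exact ContinuousWithinAt.comp (x := (x, t)) (f := fun p : ℝ × ℝ => (p.1, p.2, (0 : ℝ)))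
    (g := fun p : ℝ × ℝ × ℝ => heatFlow l ε H p.2.1 p.1) h1
    (by fun_prop : Continuous fun p : ℝ × ℝ => (p.1, p.2, (0 : ℝ))).continuousWithinAt
    fun p _ => ⟨mem_univ _, mem_univ _, mem_univ _⟩

lemma continuousOn_fieldW_of_zero (h : StripData l T ε A M H a₀ F) (h0 : H 0 = 0) (h1 : H l = 0) :
    ContinuousOn (fun p : ℝ × ℝ => fieldW l α ε lam H a₀ F p.1 p.2) (closedStrip l T) :=
  ContinuousOn.add (ContinuousOn.const_mul (continuous_heatFlow_of_continuous h.pos_l h.nonneg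
    h.contH h0 h1 h.boundH').continuousOn ε)
    (h.continuousOn_sineSeries_modeR.mono fun _ hp => ⟨mem_univ _, hp.2⟩)

lemma exists_bound_fields (h : StripData l T ε A M H a₀ F) (α lam : ℝ) :
    ∃ B, 0 ≤ B ∧ ∀ x, ∀ t ∈ Icc 0 T,
      |fieldV l α ε lam H a₀ F x t| ≤ B ∧ |fieldW l α ε lam H a₀ F x t| ≤ B := by
  obtain ⟨C, hC0, hC⟩ := h.exists_bound_modes α lam
  have hs := (summable_inv_gam_sq h.pos_l).mul_left C
  have hS : ∀ {c : ℕ → ℝ}, (∀ n, |c n| ≤ C / gam l (n + 1) ^ 2) → ∀ x,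
      |sineSeries l c x| ≤ ∑' n, C * (gam l (n + 1) ^ 2)⁻¹ := fun {c} hc x =>
    tsum_of_norm_bounded (f := fun n => c n * sinMode l n x) hs.hasSum fun n => (abs_mul_sinMode_le _ n x).trans (hc n)
  have hS0 : 0 ≤ ∑' n, C * (gam l (n + 1) ^ 2)⁻¹ := tsum_nonneg fun n => by positivity
  have hA := h.nonneg
  have hε := h.pos_ε
  have hp : 0 ≤ ε * A := by positivity
  refine ⟨ε * A + ∑' n, C * (gam l (n + 1) ^ 2)⁻¹, by positivity, fun x t ht =>
    ⟨(hS (fun n => (hC n t ht).1) x).trans (by linarith), ?_⟩⟩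
  refine (abs_add_le _ _).trans (add_le_add ?_ (hS (fun n => (hC n t ht).2) x))
  rw [abs_mul, abs_of_pos hε]
  gcongr
  exact abs_heatFlow_le h.pos_l hA h.boundH' t x

lemma continuousOn_omega_fieldW (h : StripData l T ε A M H a₀ F) :
    ContinuousOn (fun p : ℝ × ℝ => fieldW l α ε lam H a₀ F p.1 p.2) (Ioo 0 l ×ˢ Ioc 0 T) :=
  h.continuousOn_fieldW.mono fun p hp => ⟨⟨Ioo_subset_Icc_self hp.1, Ioc_subset_Icc_self hp.2⟩, by
    rintro (e | e) <;> exact hp.2.1.ne' (by rw [e])⟩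

lemma continuousOn_omega_fieldV (h : StripData l T ε A M H a₀ F) :
    ContinuousOn (fun p : ℝ × ℝ => fieldV l α ε lam H a₀ F p.1 p.2) (Ioo 0 l ×ˢ Ioc 0 T) :=
  h.continuousOn_fieldV.mono fun _ hp => ⟨mem_univ _, Ioc_subset_Icc_self hp.2⟩

lemma sinCoeff_fieldQ (h : StripData l T ε A M H a₀ F) (n : ℕ) {t : ℝ} (ht : t ∈ Ioc 0 T) :
    sinCoeff l (fun ξ => fieldQ l α ε lam H a₀ F ξ t) n =
      ((1 - ε * α) / ε - ε * lam ^ 2 / 4) * modeW l α ε lam H a₀ F n t -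
        (1 - ε * α) / ε * modeV l α ε lam H a₀ F n t - ε * sinCoeff l (fun ξ => F ξ t) n := by
  obtain ⟨B, -, hB⟩ := h.exists_bound_fields α lam
  have ht' := Ioc_subset_Icc_self ht
  have hW := intervalIntegrable_of_bounded h.pos_l.le
    (continuousOn_slice (h.continuousOn_omega_fieldW (α := α) (lam := lam)) ht)
    fun ξ _ => (hB ξ t ht').2
  have hV := intervalIntegrable_of_bounded h.pos_l.le
    (continuousOn_slice (h.continuousOn_omega_fieldV (α := α) (lam := lam)) ht)
    fun ξ _ => (hB ξ t ht').1
  have hF := intervalIntegrable_of_bounded h.pos_l.le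
    (continuousOn_slice h.source.cont ht) fun ξ hξ => h.source.bound ξ hξ t ht
  simp only [fieldQ]
  rw [sinCoeff_sub ((hW.const_mul _).sub (hV.const_mul _)) (hF.const_mul _),
    sinCoeff_sub (hW.const_mul _) (hV.const_mul _), sinCoeff_const_mul, sinCoeff_const_mul,
    sinCoeff_const_mul, sinCoeff_congr h.pos_l (fun x hx => h.fieldW_eq (Ioo_subset_Icc_self hx) ht),
    sinCoeff_sineSeries h.pos_l (h.summable_modeW ht)]
  simp only [fieldV]
  rw [sinCoeff_sineSeries h.pos_l (h.summable_modeV ht')]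

/-- At positive times v and w have coefficients O(γ⁻²), hence are Hölder of exponent 1/2 uniformly
for τ ≥ τ₀. The lower-order terms can therefore be treated as part of a given Hölder source in the
heat equation for w. -/
lemma heatSource_fieldQ (h : StripData l T ε A M H a₀ F) (α lam : ℝ) :
    ∃ M', HeatSource l T M' (fieldQ l α ε lam H a₀ F) := by
  obtain ⟨B, hB0, hB⟩ := h.exists_bound_fields α lam
  have hε := h.pos_ε
  have hM := h.source.nonneg
  set c₁ := (1 - ε * α) / ε - ε * lam ^ 2 / 4 with hc₁
  set c₂ := (1 - ε * α) / ε with hc₂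
  refine ⟨|c₁| * B + |c₂| * B + ε * M, by positivity, ?_, fun ξ hξ τ hτ => ?_,
    fun a b τ₀ ha hb hτ₀ => ?_⟩
  · exact ((h.continuousOn_omega_fieldW.const_mul _).sub
      (h.continuousOn_omega_fieldV.const_mul _)).sub (h.source.cont.const_mul ε)
  · have ht := hB ξ τ (Ioc_subset_Icc_self hτ)
    rw [fieldQ]
    refine (abs_sub _ _).trans (add_le_add ((abs_sub _ _).trans (add_le_add ?_ ?_)) ?_)
    · rw [abs_mul]; exact mul_le_mul_of_nonneg_left ht.2 (abs_nonneg _)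
    · rw [abs_mul]; exact mul_le_mul_of_nonneg_left ht.1 (abs_nonneg _)
    · rw [abs_mul, abs_of_pos hε]; exact mul_le_mul_of_nonneg_left (h.source.bound ξ hξ τ hτ) hε.le
  · obtain ⟨K, hK0, hK⟩ := exists_holder_sineSeries h.pos_l
    obtain ⟨C, hC0, hC⟩ := h.exists_bound_modes α lam
    obtain ⟨C', hC'0, hC'⟩ := h.exists_abs_modeW_le_inv α lam hτ₀
    obtain ⟨L, hL0, hL⟩ := h.source.holder a b τ₀ ha hb hτ₀
    refine ⟨|c₁| * (C' * K) + |c₂| * (C * K) + ε * L, by positivity, fun τ hτ y hy z hz => ?_⟩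
    have hτ' : τ ∈ Ioc 0 T := ⟨hτ₀.trans_le hτ.1, hτ.2⟩
    have hy' : y ∈ Icc 0 l := ⟨ha.le.trans hy.1, hy.2.trans hb.le⟩
    have hz' : z ∈ Icc 0 l := ⟨ha.le.trans hz.1, hz.2.trans hb.le⟩
    have e : fieldQ l α ε lam H a₀ F y τ - fieldQ l α ε lam H a₀ F z τ =
        c₁ * (fieldW l α ε lam H a₀ F y τ - fieldW l α ε lam H a₀ F z τ) -
        c₂ * (fieldV l α ε lam H a₀ F y τ - fieldV l α ε lam H a₀ F z τ) -
        ε * (F y τ - F z τ) := by simp only [fieldQ]; ring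
    rw [e, h.fieldW_eq hy' hτ', h.fieldW_eq hz' hτ']
    refine (abs_sub _ _).trans ((add_le_add ((abs_sub _ _).trans (add_le_add
      (b := |c₁| * (C' * K * √|y - z|)) (d := |c₂| * (C * K * √|y - z|)) ?_ ?_))
      (d := ε * (L * √|y - z|)) ?_).trans (le_of_eq (by ring)))
    · rw [abs_mul]
      exact mul_le_mul_of_nonneg_left (hK C' _ hC'0 (fun n => hC' n τ hτ) y z) (abs_nonneg _)
    · rw [abs_mul]
      exact mul_le_mul_of_nonneg_left
        (hK C _ hC0 (fun n => (hC n τ (Ioc_subset_Icc_self hτ')).1) y z) (abs_nonneg _)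
    · rw [abs_mul, abs_of_pos hε]
      exact mul_le_mul_of_nonneg_left (hL τ hτ y hy z hz) hε.le

lemma heatModes (h : StripData l T ε A M H a₀ F) (α lam : ℝ) :
    ∃ M' B, HeatModes l T ε M' B (fieldQ l α ε lam H a₀ F) (modeW l α ε lam H a₀ F) := by
  obtain ⟨M', hM'⟩ := h.heatSource_fieldQ α lam
  obtain ⟨C, hC0, hC⟩ := h.exists_abs_modeW_le α lam
  obtain ⟨D, -, hD⟩ := exists_inv_gam_sq_le h.pos_l
  refine ⟨M', 2 * A * ε + C * D, hM', h.continuousOn_modeW, fun n => ?_, fun n t ht => ?_⟩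
  · refine (hC n 0 ⟨le_rfl, h.pos_T.le⟩).trans ?_
    rw [div_eq_mul_inv]
    refine add_le_add (le_of_eq ?_) (mul_le_mul_of_nonneg_left (hD n) hC0)
    simp [decay]
  · rw [h.sinCoeff_fieldQ n (Ioo_subset_Ioc_self ht)]
    exact h.hasDerivAt_modeW n ht

/-- The term-by-term derivative has coefficients (w_n − v_n)/ε. They are not summable uniformly down
to t = 0, but their integrals in time are O(γ⁻²), which suffices. -/
lemma hasDerivWithinAt_fieldV (h : StripData l T ε A M H a₀ F) {x t : ℝ} (hx : x ∈ Icc 0 l)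
    (ht : t ∈ Icc 0 T) :
    HasDerivWithinAt (fun s => fieldV l α ε lam H a₀ F x s)
      ((fieldW l α ε lam H a₀ F x t - fieldV l α ε lam H a₀ F x t) / ε) (Icc 0 T) t := by
  have hl := h.pos_l
  have hε := h.pos_ε
  have hT := h.pos_T
  have hA := h.nonneg
  obtain ⟨C, hC0, hC⟩ := h.exists_bound_modes α lam
  obtain ⟨C', hC'0, hC'⟩ := h.exists_abs_modeW_le α lam
  -- On the lateral sides w vanishes identically, so even there it is continuous in time down to t =
  -- 0, although joint continuity may fail at the corner.
  have hcW : ContinuousOn (fun s => fieldW l α ε lam H a₀ F x s) (Icc 0 T) := by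
    rcases eq_or_lt_of_le hx.1 with rfl | h0
    · exact continuousOn_const.congr fun s hs => h.fieldW_left hs
    rcases eq_or_lt_of_le hx.2 with rfl | h1
    · exact continuousOn_const.congr fun s hs => h.fieldW_right hs
    · exact ContinuousOn.comp (f := fun s : ℝ => (x, s))
        (g := fun p : ℝ × ℝ => fieldW l α ε lam H a₀ F p.1 p.2) h.continuousOn_fieldW
        (by fun_prop) fun s hs => ⟨⟨hx, hs⟩, by
          rintro (e | e)
          · exact h0.ne' (congrArg Prod.fst e)
          · exact h1.ne (congrArg Prod.fst e)⟩
  have hcV : ContinuousOn (fun s => fieldV l α ε lam H a₀ F x s) (Icc 0 T) :=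
    ContinuousOn.comp (f := fun s : ℝ => (x, s))
      (g := fun p : ℝ × ℝ => fieldV l α ε lam H a₀ F p.1 p.2) h.continuousOn_fieldV
      (by fun_prop) fun s hs => ⟨mem_univ _, hs⟩
  have hP : ∀ n s, modeP l α ε lam H a₀ F n s =
      (modeW l α ε lam H a₀ F n s - modeV l α ε lam H a₀ F n s) / ε := fun n s => by
    simp only [modeW]; field_simp; ring
  refine hasDerivWithinAt_sineSeries_time (p := modeV l α ε lam H a₀ F)
    (p' := modeP l α ε lam H a₀ F)
    (W := fun t => (fieldW l α ε lam H a₀ F x t - fieldV l α ε lam H a₀ F x t) / ε)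
    (B := fun n => (2 * A + (C' + C) * T) / ε * (gam l (n + 1) ^ 2)⁻¹) hT.le h.continuousOn_modeV
    h.continuousOn_modeP (fun n t ht => h.hasDerivAt_modeV n ht) (fun n => ?_)
    ((summable_inv_gam_sq hl).mul_left _) (h.summable_modeV ⟨le_rfl, hT.le⟩)
    ((hcW.sub hcV).div_const ε) (fun s hs => ?_) ht
  · have hdc := continuous_decay (l := l) ε n
    have h1 : ∀ s ∈ Icc 0 T, |modeP l α ε lam H a₀ F n s| ≤
        2 * A * decay l ε n s + (C' + C) / ε * (gam l (n + 1) ^ 2)⁻¹ := fun s hs => by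
      rw [hP, abs_div, abs_of_pos hε, div_le_iff₀ hε]
      refine ((abs_sub _ _).trans (add_le_add (hC' n s hs) (hC n s hs).1)).trans (le_of_eq ?_)
      field_simp
      ring
    have hdI : IntervalIntegrable (fun s => 2 * A * decay l ε n s) volume 0 T :=
      (continuous_const.mul hdc).intervalIntegrable _ _
    have h2 := intervalIntegral.integral_mono_on (μ := volume) hT.le
      (ContinuousOn.intervalIntegrable (by
        rw [uIcc_of_le hT.le]; exact (h.continuousOn_modeP (α := α) (lam := lam) n).abs))
      (hdI.add intervalIntegrable_const) h1
    refine h2.trans ?_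
    rw [intervalIntegral.integral_add hdI intervalIntegrable_const, intervalIntegral.integral_const_mul,
      intervalIntegral.integral_const, smul_eq_mul, sub_zero]
    have h3 := mul_le_mul_of_nonneg_left (integral_decay_le hl hε n T)
      (by positivity : 0 ≤ 2 * A)
    refine (add_le_add_left h3 _).trans (le_of_eq ?_)
    rw [div_eq_mul_inv (1 / ε)]
    field_simp
  · have hs' := Ioc_subset_Icc_self hs
    rw [h.fieldW_eq hx hs, fieldV, sineSeries, sineSeries, sineSeries,
      ← (summable_mul_sinMode (h.summable_modeW hs) x).tsum_sub
        (summable_mul_sinMode (h.summable_modeV hs') x), ← tsum_div_const]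
    refine tsum_congr fun n => ?_
    rw [hP]; ring

end StripData

end

/-! ### Verification of the strip equation -/

section


variable {l T α ε lam A M : ℝ} {H : ℝ → ℝ} {a₀ : ℕ → ℝ} {F : ℝ → ℝ → ℝ}

lemma hasDerivAt_twist {S : ℝ → ℝ} {S' x : ℝ} (lam : ℝ) (hS : HasDerivAt S S' x) :
    HasDerivAt (fun y => Real.exp (lam / 2 * y) * S y)
      (Real.exp (lam / 2 * x) * (lam / 2 * S x + S')) x := by
  convert! (((hasDerivAt_id x).const_mul (lam / 2)).exp).mul hS using 1
  simp only [id]; ring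

lemma continuous_twist (lam : ℝ) : Continuous fun x : ℝ => Real.exp (lam / 2 * x) := by fun_prop

lemma dt_eq_of_hasDerivWithinAt (hT : 0 < T) {u : ℝ → ℝ → ℝ} {x t d : ℝ}
    (h : HasDerivWithinAt (fun s => u x s) d (Icc 0 T) t) (ht : t ∈ Icc 0 T) : dt T u x t = d :=
  h.derivWithin (uniqueDiffOn_Icc hT t ht)

lemma dx_eq_of_hasDerivWithinAt (hl : 0 < l) {u : ℝ → ℝ → ℝ} {x t d : ℝ}
    (h : HasDerivWithinAt (fun y => u y t) d (Icc 0 l) x) (hx : x ∈ Icc 0 l) : dx l u x t = d :=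
  h.derivWithin (uniqueDiffOn_Icc hl x hx)

namespace StripData

section Solution

variable {u : ℝ → ℝ → ℝ}

lemma hasDerivWithinAt_twist_fieldV (h : StripData l T ε A M H a₀ F)
    (hu : ∀ x ∈ Icc 0 l, ∀ t ∈ Icc 0 T,
      u x t = Real.exp (lam / 2 * x) * fieldV l α ε lam H a₀ F x t)
    {x t : ℝ} (hx : x ∈ Icc 0 l) (ht : t ∈ Icc 0 T) :
    HasDerivWithinAt (fun s => u x s) (Real.exp (lam / 2 * x) *
      ((fieldW l α ε lam H a₀ F x t - fieldV l α ε lam H a₀ F x t) / ε)) (Icc 0 T) t :=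
  ((h.hasDerivWithinAt_fieldV hx ht).const_mul _).congr (fun s hs => hu x hx s hs) (hu x hx t ht)

lemma dt_twist_fieldV (h : StripData l T ε A M H a₀ F)
    (hu : ∀ x ∈ Icc 0 l, ∀ t ∈ Icc 0 T,
      u x t = Real.exp (lam / 2 * x) * fieldV l α ε lam H a₀ F x t)
    {x t : ℝ} (hx : x ∈ Icc 0 l) (ht : t ∈ Icc 0 T) :
    dt T u x t = Real.exp (lam / 2 * x) *
      ((fieldW l α ε lam H a₀ F x t - fieldV l α ε lam H a₀ F x t) / ε) :=
  dt_eq_of_hasDerivWithinAt h.pos_T (h.hasDerivWithinAt_twist_fieldV hu hx ht) ht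

lemma visc_twist_fieldV (h : StripData l T ε A M H a₀ F)
    (hu : ∀ x ∈ Icc 0 l, ∀ t ∈ Icc 0 T,
      u x t = Real.exp (lam / 2 * x) * fieldV l α ε lam H a₀ F x t)
    {x t : ℝ} (hx : x ∈ Icc 0 l) (ht : t ∈ Icc 0 T) :
    visc T ε u x t = Real.exp (lam / 2 * x) * fieldW l α ε lam H a₀ F x t := by
  have hε := h.pos_ε
  rw [visc, h.dt_twist_fieldV hu hx ht, hu x hx t ht]
  field_simp; ring

lemma isSolution (h : StripData l T ε A M H a₀ F)
    (hu : ∀ x ∈ Icc 0 l, ∀ t ∈ Icc 0 T,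
      u x t = Real.exp (lam / 2 * x) * fieldV l α ε lam H a₀ F x t)
    {f : ℝ → ℝ → ℝ} {h0 h1 : ℝ → ℝ}
    (hf : ∀ x ∈ Ioo 0 l, ∀ t ∈ Ioc 0 T, Real.exp (lam / 2 * x) * F x t = f x t)
    (hh0 : ∀ x ∈ Icc 0 l, Real.exp (lam / 2 * x) * sineSeries l a₀ x = h0 x)
    (hh1 : ∀ x ∈ Ioo 0 l, Real.exp (lam / 2 * x) * H x = h1 x) :
    IsSolution l T α ε lam f h0 h1 u := by
  have hl := h.pos_l
  have hε := h.pos_ε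
  have hT := h.pos_T
  set E : ℝ → ℝ := fun x => Real.exp (lam / 2 * x) with hE
  have hEc : Continuous E := continuous_twist lam
  have hEc2 : ∀ s : Set (ℝ × ℝ), ContinuousOn (fun p : ℝ × ℝ => E p.1) s := fun s =>
    (hEc.comp continuous_fst).continuousOn
  set V := fieldV l α ε lam H a₀ F with hV
  set W := fieldW l α ε lam H a₀ F with hW
  set Q := fieldQ l α ε lam H a₀ F with hQ
  obtain ⟨M', B, hm⟩ := h.heatModes α lam
  set w := modeW l α ε lam H a₀ F with hw
  set X : ℝ → ℝ → ℝ := modesXX l ε Q w 0 with hX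
  obtain ⟨Wx, hWxc, hWx⟩ := hm.exists_space_derivatives hl hε
  obtain ⟨C, hC0, hC⟩ := h.exists_bound_fields α lam
  have hXc : ContinuousOn (fun p : ℝ × ℝ => X p.1 p.2) (Ioo 0 l ×ˢ Ioc 0 T) :=
    hm.continuousOn_modesXX_zero hl hε
  have hWc : ContinuousOn (fun p : ℝ × ℝ => W p.1 p.2) (Ioo 0 l ×ˢ Ioc 0 T) :=
    h.continuousOn_omega_fieldW
  have hVc : ContinuousOn (fun p : ℝ × ℝ => V p.1 p.2) (Ioo 0 l ×ˢ Ioc 0 T) :=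
    h.continuousOn_omega_fieldV
  have hQc : ContinuousOn (fun p : ℝ × ℝ => Q p.1 p.2) (Ioo 0 l ×ˢ Ioc 0 T) := hm.cont
  have hdt := fun (x : ℝ) (hx : x ∈ Icc 0 l) (t : ℝ) (ht : t ∈ Icc 0 T) =>
    h.dt_twist_fieldV hu hx ht
  have hvisc := fun (x : ℝ) (hx : x ∈ Icc 0 l) (t : ℝ) (ht : t ∈ Icc 0 T) =>
    h.visc_twist_fieldV hu hx ht
  have hVc' : ContinuousOn (fun p : ℝ × ℝ => V p.1 p.2) (closedStrip l T) :=
    h.continuousOn_fieldV.mono fun p hp => ⟨mem_univ _, hp.2⟩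
  -- The field and the sum of its modes agree at positive times, which suffices for a derivative at
  -- t > 0.
  have hWt : ∀ x ∈ Ioo 0 l, ∀ t ∈ Ioc 0 T,
      HasDerivWithinAt (fun s => W x s) (ε * X x t + Q x t) (Icc 0 T) t := fun x hx t ht => by
    refine (hm.hasDerivWithinAt_time hl hε hx ht).congr_of_eventuallyEq ?_
      (h.fieldW_eq (Ioo_subset_Icc_self hx) ht)
    filter_upwards [self_mem_nhdsWithin, mem_nhdsWithin_of_mem_nhds (Ioi_mem_nhds ht.1)] with s h1 h2
    exact h.fieldW_eq (Ioo_subset_Icc_self hx) ⟨h2, h1.2⟩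
  have hdtt : ∀ x ∈ Ioo 0 l, ∀ t ∈ Ioc 0 T, HasDerivWithinAt (fun s => dt T u x s)
      (E x * (((ε * X x t + Q x t) - (W x t - V x t) / ε) / ε)) (Icc 0 T) t := fun x hx t ht => by
    have hx' := Ioo_subset_Icc_self hx
    have ht' := Ioc_subset_Icc_self ht
    exact ((((hWt x hx t ht).sub (h.hasDerivWithinAt_fieldV hx' ht')).div_const ε).const_mul
      (E x)).congr (fun s hs => hdt x hx' s hs) (hdt x hx' t ht')
  have hvx : ∀ x ∈ Ioo 0 l, ∀ t ∈ Ioc 0 T, HasDerivWithinAt (fun y => visc T ε u y t)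
      (E x * (lam / 2 * W x t + Wx x t)) (Icc 0 l) x := fun x hx t ht => by
    have h1 := (hasDerivAt_twist lam (hWx x hx t ht).1).hasDerivWithinAt (s := Icc 0 l)
    have ht' := Ioc_subset_Icc_self ht
    have e : ∀ y ∈ Icc 0 l, visc T ε u y t =
        Real.exp (lam / 2 * y) * sineSeries l (fun n => w n t) y := fun y hy => by
      rw [hvisc y hy t ht', h.fieldW_eq hy ht]
    rw [← h.fieldW_eq (Ioo_subset_Icc_self hx) ht] at h1
    exact h1.congr e (e x (Ioo_subset_Icc_self hx))
  have hdx : ∀ x ∈ Ioo 0 l, ∀ t ∈ Ioc 0 T,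
      dx l (visc T ε u) x t = E x * (lam / 2 * W x t + Wx x t) := fun x hx t ht =>
    dx_eq_of_hasDerivWithinAt hl (hvx x hx t ht) (Ioo_subset_Icc_self hx)
  have hvxx : ∀ x ∈ Ioo 0 l, ∀ t ∈ Ioc 0 T, HasDerivWithinAt (fun y => dx l (visc T ε u) y t)
      (E x * (lam / 2 * (lam / 2 * W x t + Wx x t) + (lam / 2 * Wx x t + X x t)))
      (Icc 0 l) x := fun x hx t ht => by
    have h1 := hasDerivAt_twist lam (((hWx x hx t ht).1.const_mul (lam / 2)).add (hWx x hx t ht).2)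
    have h2 : HasDerivAt (fun y => dx l (visc T ε u) y t) _ x := h1.congr_of_eventuallyEq (by
      filter_upwards [isOpen_Ioo.mem_nhds hx] with y hy
      rw [hdx y hy t ht]
      simp only [Pi.add_apply, hE]
      rw [← h.fieldW_eq (Ioo_subset_Icc_self hy) ht])
    simp only [Pi.add_apply] at h2
    rw [← h.fieldW_eq (Ioo_subset_Icc_self hx) ht] at h2
    exact h2.hasDerivWithinAt
  have hdtt_eq : ∀ x ∈ Ioo 0 l, ∀ t ∈ Ioc 0 T, dt T (dt T u) x t =
      E x * (((ε * X x t + Q x t) - (W x t - V x t) / ε) / ε) := fun x hx t ht =>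
    dt_eq_of_hasDerivWithinAt hT (hdtt x hx t ht) (Ioc_subset_Icc_self ht)
  have hdxx_eq : ∀ x ∈ Ioo 0 l, ∀ t ∈ Ioc 0 T, dx l (dx l (visc T ε u)) x t =
      E x * (lam / 2 * (lam / 2 * W x t + Wx x t) + (lam / 2 * Wx x t + X x t)) :=
    fun x hx t ht => dx_eq_of_hasDerivWithinAt hl (hvxx x hx t ht) (Ioo_subset_Icc_self hx)
  have hbE : ∃ K, ∀ x ∈ Icc 0 l, |E x| ≤ K := isCompact_Icc.exists_bound_of_continuousOn
    hEc.continuousOn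
  exact
  { continuousOn := ((hEc2 _).mul hVc').congr fun p hp => hu p.1 hp.1 p.2 hp.2
    hasDt := fun p hp => (h.hasDerivWithinAt_twist_fieldV hu hp.1 hp.2).differentiableWithinAt
    continuousOn_dt := ((hEc2 _).mul ((h.continuousOn_fieldW.sub
      (hVc'.mono sdiff_subset)).div_const ε)).congr fun p hp => hdt p.1 hp.1.1 p.2 hp.1.2
    bounded_dt := by
      obtain ⟨K, hK⟩ := hbE
      refine ⟨K * ((C + C) / ε), fun p hp => ?_⟩
      rw [hdt p.1 hp.1 p.2 hp.2, abs_mul, abs_div, abs_of_pos hε]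
      have h1 := hC p.1 p.2 hp.2
      have hK' := hK p.1 hp.1
      have hK0 := (abs_nonneg _).trans hK'
      gcongr
      exact (abs_sub _ _).trans (add_le_add h1.2 h1.1)
    hasDtt := fun p hp => (hdtt p.1 hp.1 p.2 hp.2).differentiableWithinAt
    continuousOn_dtt := ((hEc2 _).mul ((((hXc.const_mul ε).add hQc).sub
      ((hWc.sub hVc).div_const ε)).div_const ε)).congr fun p hp => hdtt_eq p.1 hp.1 p.2 hp.2
    hasDx := fun p hp => (hvx p.1 hp.1 p.2 hp.2).differentiableWithinAt
    continuousOn_dx := ((hEc2 _).mul ((hWc.const_mul _).add hWxc)).congr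
      fun p hp => hdx p.1 hp.1 p.2 hp.2
    hasDxx := fun p hp => (hvxx p.1 hp.1 p.2 hp.2).differentiableWithinAt
    continuousOn_dxx := ((hEc2 _).mul ((((hWc.const_mul _).add hWxc).const_mul _).add
      ((hWxc.const_mul _).add hXc))).congr fun p hp => hdxx_eq p.1 hp.1 p.2 hp.2
    equation := by
      rintro ⟨x, t⟩ ⟨hx, ht⟩
      have hx' := Ioo_subset_Icc_self hx
      have ht' := Ioc_subset_Icc_self ht
      have e : dt T (fun y s => dt T u y s + α * u y s) x t =
          E x * (((ε * X x t + Q x t) - (W x t - V x t) / ε) / ε) +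
            α * (E x * ((W x t - V x t) / ε)) :=
        dt_eq_of_hasDerivWithinAt hT ((hdtt x hx t ht).add
          ((h.hasDerivWithinAt_twist_fieldV hu hx' ht').const_mul α)) ht'
      -- With w_t = ε w_xx + Q, v_t = (w − v)/ε and this formula for Q, the equation becomes an
      -- algebraic identity in which the first-order terms from the exponential cancel against the
      -- drift.
      have hq : Q x t = ((1 - ε * α) / ε - ε * lam ^ 2 / 4) * W x t -
        (1 - ε * α) / ε * V x t - ε * F x t := rfl
      simp only [stripOp]
      rw [e, hdx x hx t ht, hdxx_eq x hx t ht, ← hf x hx t ht, hq]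
      simp only [hE]
      field_simp
      ring
    initial := fun x hx => by
      rw [hu x hx 0 ⟨le_rfl, hT.le⟩, hV, fieldV_zero, hh0 x hx]
    initial_dt := fun x hx => by
      rw [hdt x (Ioo_subset_Icc_self hx) 0 ⟨le_rfl, hT.le⟩, fieldV_zero, fieldW_zero,
        oddExt_of_mem_Ioo hl H hx, ← hh1 x hx]
      field_simp; ring
    boundary := fun t ht => by
      have ht' := Ioc_subset_Icc_self ht
      rw [hu 0 ⟨le_rfl, hl.le⟩ t ht', hu l ⟨hl.le, le_rfl⟩ t ht', hV, fieldV, fieldV, sineSeries_zero,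
        sineSeries_right hl]
      simp }

lemma continuousOn_dt_of_zero (h : StripData l T ε A M H a₀ F)
    (hu : ∀ x ∈ Icc 0 l, ∀ t ∈ Icc 0 T,
      u x t = Real.exp (lam / 2 * x) * fieldV l α ε lam H a₀ F x t)
    (h0 : H 0 = 0) (h1 : H l = 0) :
    ContinuousOn (fun p : ℝ × ℝ => dt T u p.1 p.2) (closedStrip l T) ∧
      ∀ x ∈ Icc 0 l, dt T u x 0 = Real.exp (lam / 2 * x) * H x := by
  have hε := h.pos_ε
  refine ⟨(((continuous_twist lam).comp continuous_fst).continuousOn.mul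
    (((h.continuousOn_fieldW_of_zero h0 h1).sub (h.continuousOn_fieldV.mono
      fun p hp => ⟨mem_univ _, hp.2⟩)).div_const ε)).congr
      fun p hp => h.dt_twist_fieldV hu hp.1 hp.2, fun x hx => ?_⟩
  rw [h.dt_twist_fieldV hu hx ⟨le_rfl, h.pos_T.le⟩, fieldV_zero, fieldW_zero,
    oddExt_of_mem_Icc h.pos_l h0 h1 hx]
  field_simp; ring

end Solution

end StripData

end

/-! ### Derivatives and sine series of the explicit solution -/

section


variable {l T α ε lam A M : ℝ}

section Data

variable {h : ℝ → ℝ}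

lemma uData_eq (hl : 0 < l) (hε : 0 < ε) (hlam : 0 ≤ lam) (hh : ContinuousOn h (Icc 0 l)) (x : ℝ)
    {t : ℝ} (ht : 0 ≤ t) : uData l α ε lam h x t = Real.exp (lam / 2 * x) *
      sineSeries l (fun n => Gn l α ε lam (n + 1) t * sinCoeff l (untwist lam h) n) x := by
  obtain ⟨B, hB⟩ := isCompact_Icc.exists_bound_of_continuousOn hh
  exact integral_mul_green hl hε hlam (hh.mono Ioo_subset_Icc_self)
    (fun ξ hξ => hB ξ (Ioo_subset_Icc_self hξ)) x ht

lemma contDiffOn_untwist {n : ℕ∞} {q : ℝ → ℝ} {s : Set ℝ} (hq : ContDiffOn ℝ n q s) :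
    ContDiffOn ℝ n (untwist lam q) s :=
  ((contDiff_const.mul contDiff_id).neg.exp).contDiffOn.mul hq

lemma abs_mul_le_of_abs_le {a b C : ℝ} (h : |a| ≤ C) : |a * b| ≤ C * |b| := by
  rw [abs_mul]; gcongr

lemma hasDerivWithinAt_uData (hl : 0 < l) (hT : 0 < T) (hε : 0 < ε) (hlam : 0 ≤ lam)
    (hh : ContinuousOn h (Icc 0 l)) (ha : Summable (sinCoeff l (untwist lam h))) (x : ℝ) {t : ℝ}
    (ht : t ∈ Icc 0 T) : HasDerivWithinAt (fun s => uData l α ε lam h x s)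
      (Real.exp (lam / 2 * x) *
        sineSeries l (fun n => GnD l α ε lam (n + 1) t * sinCoeff l (untwist lam h) n) x)
      (Icc 0 T) t := by
  set a := sinCoeff l (untwist lam h) with ha'
  obtain ⟨C, hC0, hC⟩ := exists_bound_Gn hl hε α lam T
  have hb : ∀ n, ∀ t ∈ Icc 0 T, |GnD l α ε lam (n + 1) t * a n| ≤ C * |a n| := fun n t ht =>
    abs_mul_le_of_abs_le (hC n t ht).2.1
  have hs : Summable fun n => C * |a n| := ha.abs.mul_left C
  have hc : ∀ n, Continuous fun t => GnD l α ε lam (n + 1) t * a n := fun n =>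
    (continuous_GnD _).mul continuous_const
  have hW : ContinuousOn (fun t => sineSeries l (fun n => GnD l α ε lam (n + 1) t * a n) x)
      (Icc 0 T) :=
    continuousOn_tsum (f := fun n t => GnD l α ε lam (n + 1) t * a n * sinMode l n x)
      (fun n => ((hc n).mul continuous_const).continuousOn) hs
      fun n t ht => (abs_mul_sinMode_le _ n x).trans (hb n t ht)
  refine ((hasDerivWithinAt_sineSeries_time (x := x)
    (p := fun n t => Gn l α ε lam (n + 1) t * a n) (p' := fun n t => GnD l α ε lam (n + 1) t * a n)
    (B := fun n => T * (C * |a n|)) hT.le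
    (fun n => ((continuous_Gn _).mul continuous_const).continuousOn) (fun n => (hc n).continuousOn)
    (fun n t _ => (hasDerivAt_Gn (n + 1) t).mul_const (a n)) (fun n => ?_) (hs.mul_left T)
    (summable_zero.congr fun n => by simp [Gn_zero]) hW (fun _ _ => rfl) ht).const_mul
      (Real.exp (lam / 2 * x))).congr (fun s hs => uData_eq hl hε hlam hh x hs.1)
      (uData_eq hl hε hlam hh x ht.1)
  have h2 := intervalIntegral.integral_mono_on (μ := volume) hT.le
    ((hc n).abs.intervalIntegrable 0 T) intervalIntegrable_const (fun s hs => hb n s hs)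
  rwa [intervalIntegral.integral_const, smul_eq_mul, sub_zero] at h2

lemma summable_Gn_mul (hl : 0 < l) (hε : 0 < ε) {a : ℕ → ℝ} {B : ℝ} (ha : ∀ n, |a n| ≤ B) {t : ℝ}
    (ht : 0 ≤ t) : Summable fun n => Gn l α ε lam (n + 1) t * a n := by
  obtain ⟨C, hC0, hC⟩ := exists_abs_Gn_le hl hε α lam t
  have hB : 0 ≤ B := (abs_nonneg _).trans (ha 0)
  refine summable_of_le_inv_gam_sq (C := C * B) hl fun n => ?_
  rw [abs_mul, mul_div_right_comm]
  exact mul_le_mul (hC n t ⟨ht, le_rfl⟩) (ha n) (abs_nonneg _) (by positivity)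

lemma summable_sq_mul_Gn_mul (hl : 0 < l) (hε : 0 < ε) {a : ℕ → ℝ} (ha : Summable a) {t : ℝ}
    (ht : 0 ≤ t) : Summable fun n => gam l (n + 1) ^ 2 * (Gn l α ε lam (n + 1) t * a n) := by
  obtain ⟨C, hC0, hC⟩ := exists_abs_Gn_le hl hε α lam t
  refine Summable.of_norm_bounded (ha.abs.mul_left C) fun n => ?_
  have hg := gam_pos hl n
  have h1 := hC n t ⟨ht, le_rfl⟩
  rw [Real.norm_eq_abs, abs_mul, abs_mul, abs_of_pos (by positivity : 0 < gam l (n + 1) ^ 2),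
    ← mul_assoc]
  gcongr
  rwa [le_div_iff₀' (by positivity)] at h1

/-- Since γ_n² G_n is bounded, the summability of the data coefficients is enough for two space
derivatives term by term, including at t = 0 and at the end points. -/
lemma hasDerivAt_uData (hl : 0 < l) (hε : 0 < ε) (hlam : 0 ≤ lam)
    (hh : ContinuousOn h (Icc 0 l)) (ha : Summable (sinCoeff l (untwist lam h))) {t : ℝ}
    (ht : 0 ≤ t) : ∃ S S₁ S₂ : ℝ → ℝ,
      (S = sineSeries l fun n => Gn l α ε lam (n + 1) t * sinCoeff l (untwist lam h) n) ∧
      (S₂ = sineSeries l fun n =>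
        -(gam l (n + 1) ^ 2) * (Gn l α ε lam (n + 1) t * sinCoeff l (untwist lam h) n)) ∧
      (∀ x, HasDerivAt (fun y => uData l α ε lam h y t)
        (Real.exp (lam / 2 * x) * (lam / 2 * S x + S₁ x)) x) ∧
      ∀ x, HasDerivAt (fun x => Real.exp (lam / 2 * x) * (lam / 2 * S x + S₁ x))
        (Real.exp (lam / 2 * x) * (lam / 2 * (lam / 2 * S x + S₁ x) +
          (lam / 2 * S₁ x + S₂ x))) x := by
  obtain ⟨B, hB⟩ := ha.tendsto_atTop_zero.abs.bddAbove_range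
  have hd := hasDerivAt_sineSeries_two hl
    (summable_Gn_mul (α := α) (lam := lam) hl hε (fun n => hB ⟨n, rfl⟩) ht)
    (summable_sq_mul_Gn_mul (α := α) (lam := lam) hl hε ha ht)
  refine ⟨_, _, _, rfl, rfl, fun x => ?_, fun x => hasDerivAt_twist lam
    (((hd x).1.const_mul (lam / 2)).add (hd x).2)⟩
  have e : (fun y => uData l α ε lam h y t) = fun y => Real.exp (lam / 2 * y) *
      sineSeries l (fun n => Gn l α ε lam (n + 1) t * sinCoeff l (untwist lam h) n) y :=
    funext fun y => uData_eq hl hε hlam hh y ht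
  rw [e]
  exact hasDerivAt_twist lam (hd x).1

/-- On exp(λx/2) sin(γx) the operator λ∂_x − ∂_xx acts as multiplication by γ² + λ²/4, so the
spatial part of the star operator multiplies the n-th mode by α + ε b_n. -/
lemma hasDx_uData (hl : 0 < l) (hε : 0 < ε) (hlam : 0 ≤ lam)
    (hh : ContinuousOn h (Icc 0 l)) (ha : Summable (sinCoeff l (untwist lam h))) {x t : ℝ}
    (hx : x ∈ Icc 0 l) (ht : 0 ≤ t) :
    HasDx l (uData l α ε lam h) x t ∧ HasDx l (dx l (uData l α ε lam h)) x t ∧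
    α * uData l α ε lam h x t + ε * lam * dx l (uData l α ε lam h) x t -
        ε * dx l (dx l (uData l α ε lam h)) x t = Real.exp (lam / 2 * x) *
      sineSeries l (fun n => (α + ε * bn l lam (n + 1)) *
        (Gn l α ε lam (n + 1) t * sinCoeff l (untwist lam h) n)) x := by
  obtain ⟨S, S₁, S₂, hS, hS₂, hd₁, hd₂⟩ := hasDerivAt_uData (α := α) hl hε hlam hh ha ht
  have e₁ : ∀ y ∈ Icc 0 l, dx l (uData l α ε lam h) y t =
      Real.exp (lam / 2 * y) * (lam / 2 * S y + S₁ y) := fun y hy =>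
    dx_eq_of_hasDerivWithinAt hl (hd₁ y).hasDerivWithinAt hy
  have h₂ := ((hd₂ x).hasDerivWithinAt (s := Icc 0 l)).congr e₁ (e₁ x hx)
  refine ⟨(hd₁ x).hasDerivWithinAt.differentiableWithinAt, h₂.differentiableWithinAt, ?_⟩
  obtain ⟨B, hB⟩ := ha.tendsto_atTop_zero.abs.bddAbove_range
  have s1 := summable_mul_sinMode (l := l)
    (summable_Gn_mul (α := α) (lam := lam) hl hε (fun n => hB ⟨n, rfl⟩) ht) x
  have s2 := summable_mul_sinMode (l := l)
    (summable_sq_mul_Gn_mul (α := α) (lam := lam) hl hε ha ht) x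
  have e3 : sineSeries l (fun n => (α + ε * bn l lam (n + 1)) *
      (Gn l α ε lam (n + 1) t * sinCoeff l (untwist lam h) n)) x =
      (α + ε * lam ^ 2 / 4) * S x - ε * S₂ x := by
    rw [hS, hS₂, sineSeries, sineSeries, sineSeries, ← tsum_mul_left, ← tsum_mul_left,
      ← (s1.mul_left _).tsum_sub ((s2.neg.congr fun n => by ring).mul_left _)]
    refine tsum_congr fun n => ?_
    unfold bn; ring
  rw [e3, e₁ x hx, dx_eq_of_hasDerivWithinAt hl h₂ hx, uData_eq hl hε hlam hh x ht, ← hS]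
  ring

/-- Adding the time derivative to the spatial multiplier α + ε b_n reproduces the propagator `Kn`,
whose data are 1 and 0. -/
lemma uStar_eq (hl : 0 < l) (hT : 0 < T) (hε : 0 < ε) (hlam : 0 ≤ lam)
    (hh : ContinuousOn h (Icc 0 l)) (ha : Summable (sinCoeff l (untwist lam h))) {x t : ℝ}
    (hx : x ∈ Icc 0 l) (ht : t ∈ Icc 0 T) :
    uStar l T α ε lam h x t = Real.exp (lam / 2 * x) *
      sineSeries l (fun n => Kn l α ε lam (n + 1) t * sinCoeff l (untwist lam h) n) x := by
  have h1 := (hasDx_uData (α := α) hl hε hlam hh ha hx ht.1).2.2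
  have h2 := dt_eq_of_hasDerivWithinAt hT
    (hasDerivWithinAt_uData (α := α) hl hT hε hlam hh ha x ht) ht
  obtain ⟨C, hC0, hC⟩ := exists_bound_Gn hl hε α lam T
  obtain ⟨C', hC'0, hC'⟩ := exists_bound_Kn hl hε α lam T
  have s1 : Summable fun n => GnD l α ε lam (n + 1) t * sinCoeff l (untwist lam h) n :=
    Summable.of_norm_bounded (ha.abs.mul_left C) fun n => abs_mul_le_of_abs_le (hC n t ht).2.1
  have s2 : Summable fun n => Kn l α ε lam (n + 1) t * sinCoeff l (untwist lam h) n :=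
    Summable.of_norm_bounded (ha.abs.mul_left C') fun n => abs_mul_le_of_abs_le (hC' n t ht).2
  have s3 : Summable fun n => (α + ε * bn l lam (n + 1)) *
      (Gn l α ε lam (n + 1) t * sinCoeff l (untwist lam h) n) :=
    (s2.sub s1).congr fun n => by unfold Kn; ring
  have e : uStar l T α ε lam h x t = dt T (uData l α ε lam h) x t +
      (α * uData l α ε lam h x t + ε * lam * dx l (uData l α ε lam h) x t -
        ε * dx l (dx l (uData l α ε lam h)) x t) := by unfold uStar; ring
  rw [e, h1, h2, ← mul_add, sineSeries, sineSeries, sineSeries,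
    ← (summable_mul_sinMode s1 x).tsum_add (summable_mul_sinMode s3 x)]
  congr 1
  refine tsum_congr fun n => ?_
  unfold Kn; ring

end Data

/-- A bounded continuous source with continuous space derivative is locally Hölder. -/
lemma heatSource_untwist (hlam : 0 ≤ lam) {f : ℝ → ℝ → ℝ} (hM0 : 0 ≤ M)
    (hf : ContinuousOn (fun p : ℝ × ℝ => f p.1 p.2) (Omega l T))
    (hM : ∀ p ∈ Omega l T, |f p.1 p.2| ≤ M)
    (hfx : ∀ p ∈ Omega l T, HasDx l f p.1 p.2)
    (hfxc : ContinuousOn (fun p : ℝ × ℝ => dx l f p.1 p.2) (Omega l T)) :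
    HeatSource l T M (fun ξ τ => untwist lam (fun ξ => f ξ τ) ξ) := by
  have hec : Continuous fun p : ℝ × ℝ => Real.exp (-(lam / 2 * p.1)) := by fun_prop
  refine ⟨hM0, hec.continuousOn.mul hf,
    fun ξ hξ τ hτ => abs_untwist_le hlam hξ.1.le (hM (ξ, τ) ⟨hξ, hτ⟩), fun a b τ₀ ha hb hτ₀ => ?_⟩
  have hsub : Icc a b ×ˢ Icc τ₀ T ⊆ Omega l T := fun p hp =>
    ⟨⟨ha.trans_le hp.1.1, hp.1.2.trans_lt hb⟩, hτ₀.trans_le hp.2.1, hp.2.2⟩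
  have hg : ContinuousOn (fun p : ℝ × ℝ => Real.exp (-(lam / 2 * p.1)) *
      (dx l f p.1 p.2 - lam / 2 * f p.1 p.2)) (Icc a b ×ˢ Icc τ₀ T) :=
    (hec.continuousOn.mul (hfxc.sub (hf.const_mul _))).mono hsub
  obtain ⟨K, hK⟩ := (isCompact_Icc.prod isCompact_Icc).exists_bound_of_continuousOn hg
  -- The mean value inequality gives the Lipschitz constant |K| on [a, b], and |y − z| ≤ √(b−a)
  -- √|y−z| there.
  refine ⟨|K| * √(b - a), by positivity, fun τ hτ y hy z hz => ?_⟩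
  have hd : ∀ x ∈ Icc a b, HasDerivWithinAt (untwist lam fun ξ => f ξ τ)
      (Real.exp (-(lam / 2 * x)) * (dx l f x τ - lam / 2 * f x τ)) (Icc a b) x := fun x hx => by
    have hxo := hsub (mk_mem_prod hx hτ)
    have h1 : HasDerivAt (fun y => f y τ) (dx l f x τ) x :=
      (hfx (x, τ) hxo).hasDerivWithinAt.hasDerivAt (Icc_mem_nhds hxo.1.1 hxo.1.2)
    refine HasDerivAt.hasDerivWithinAt ?_
    convert! (((hasDerivAt_id x).const_mul (lam / 2)).neg.exp).mul h1 using 1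
    simp only [id, Pi.neg_apply]; ring
  have h1 := (convex_Icc a b).norm_image_sub_le_of_norm_hasDerivWithin_le hd
    (fun x hx => (hK (x, τ) ⟨hx, hτ⟩).trans (le_abs_self K)) hz hy
  rw [Real.norm_eq_abs, Real.norm_eq_abs] at h1
  refine h1.trans ?_
  have h2 : |y - z| ≤ b - a := abs_sub_le_iff.2
    ⟨by linarith [hy.2, hz.1], by linarith [hz.2, hy.1]⟩
  rw [mul_assoc]
  refine mul_le_mul_of_nonneg_left ?_ (abs_nonneg K)
  calc |y - z| = √|y - z| * √|y - z| := (Real.mul_self_sqrt (abs_nonneg _)).symm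
    _ ≤ √(b - a) * √|y - z| := by gcongr

section Explicit

variable {f : ℝ → ℝ → ℝ} {h0 h1 : ℝ → ℝ}

lemma exists_stripData (hl : 0 < l) (hT : 0 < T) (hε : 0 < ε)
    (hh1 : ContinuousOn h1 (Icc 0 l)) (hh0 : ContDiffOn ℝ 2 h0 (Icc 0 l)) (h00 : h0 0 = 0)
    (h0l : h0 l = 0) (hF : HeatSource l T M (fun ξ τ => untwist lam (fun ξ => f ξ τ) ξ)) :
    ∃ A, StripData l T ε A M (untwist lam h1) (sinCoeff l (untwist lam h0))
      (fun ξ τ => untwist lam (fun ξ => f ξ τ) ξ) := by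
  obtain ⟨C, hC0, hC⟩ := exists_abs_sinCoeff_le hl (contDiffOn_untwist (n := 2) (lam := lam) hh0)
    (by simp [untwist, h00]) (by simp [untwist, h0l])
  obtain ⟨B, hB⟩ := isCompact_Icc.exists_bound_of_continuousOn (continuousOn_untwist (lam := lam) hh1)
  have hB0 : 0 ≤ B := (norm_nonneg _).trans (hB 0 ⟨le_rfl, hl.le⟩)
  refine ⟨B + C, hl, hT, hε, continuousOn_untwist hh1, fun ξ hξ => (hB ξ hξ).trans (by linarith),
    fun n => (hC n).trans ?_, hF⟩
  have hg := gam_pos hl n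
  gcongr
  linarith

lemma explicitSolution_eq (hlam : 0 ≤ lam)
    (h : StripData l T ε A M (untwist lam h1) (sinCoeff l (untwist lam h0))
      (fun ξ τ => untwist lam (fun ξ => f ξ τ) ξ))
    (hh1 : ContinuousOn h1 (Icc 0 l)) (hh0 : ContinuousOn h0 (Icc 0 l))
    (hf : ContinuousOn (fun p : ℝ × ℝ => f p.1 p.2) (Omega l T))
    (hM : ∀ p ∈ Omega l T, |f p.1 p.2| ≤ M) {x t : ℝ} (hx : x ∈ Icc 0 l) (ht : t ∈ Icc 0 T) :
    explicitSolution l T α ε lam f h0 h1 x t = Real.exp (lam / 2 * x) *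
      fieldV l α ε lam (untwist lam h1) (sinCoeff l (untwist lam h0))
        (fun ξ τ => untwist lam (fun ξ => f ξ τ) ξ) x t := by
  have hl := h.pos_l
  have hε := h.pos_ε
  have ha := summable_of_le_inv_gam_sq hl h.bound₀
  obtain ⟨C', hC'0, hC'⟩ := exists_bound_Kn hl hε α lam T
  have s1 := summable_Gn_mul (α := α) (lam := lam) hl hε (abs_sinCoeff_le hl h.boundH') ht.1
  have s2 : Summable fun n => Kn l α ε lam (n + 1) t * sinCoeff l (untwist lam h0) n :=
    Summable.of_norm_bounded (ha.abs.mul_left C') fun n => abs_mul_le_of_abs_le (hC' n t ht).2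
  -- Summability of the convolution terms is read off from that of `modeV` by subtracting the two
  -- data terms.
  have s3 : Summable fun n => conv (Gn l α ε lam (n + 1))
      (fun τ => sinCoeff l (untwist lam fun ξ => f ξ τ) n) t :=
    ((s1.add s2).sub (h.summable_modeV (α := α) (lam := lam) ht)).congr fun n => by
      simp only [modeV]; ring
  rw [explicitSolution, uData_eq hl hε hlam hh1 x ht.1, uStar_eq hl h.pos_T hε hlam hh0 ha hx ht,
    (integral_source_green hl hε hlam h.source.nonneg hf hM x ht).2, ← mul_add, ← sub_eq_add_neg,
    ← mul_sub, fieldV, sineSeries, sineSeries, sineSeries, sineSeries,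
    ← (summable_mul_sinMode s1 x).tsum_add (summable_mul_sinMode s2 x),
    ← ((summable_mul_sinMode s1 x).add (summable_mul_sinMode s2 x)).tsum_sub
      (summable_mul_sinMode s3 x)]
  congr 1
  refine tsum_congr fun n => ?_
  simp only [modeV]; ring

lemma explicitWellDefined (hlam : 0 ≤ lam)
    (h : StripData l T ε A M (untwist lam h1) (sinCoeff l (untwist lam h0))
      (fun ξ τ => untwist lam (fun ξ => f ξ τ) ξ))
    (hh1 : ContinuousOn h1 (Icc 0 l)) (hh0 : ContinuousOn h0 (Icc 0 l))
    (hf : ContinuousOn (fun p : ℝ × ℝ => f p.1 p.2) (Omega l T))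
    (hM : ∀ p ∈ Omega l T, |f p.1 p.2| ≤ M) : ExplicitWellDefined l T α ε lam f h0 h1 := by
  have hl := h.pos_l
  have hε := h.pos_ε
  have ha := summable_of_le_inv_gam_sq hl h.bound₀
  have hI : ∀ {q : ℝ → ℝ}, ContinuousOn q (Icc 0 l) → ∀ p ∈ closedStrip l T,
      IntervalIntegrable (fun ξ => q ξ * green l α ε lam p.1 ξ p.2) volume 0 l := fun hq p hp => by
    obtain ⟨B, hB⟩ := isCompact_Icc.exists_bound_of_continuousOn hq
    exact intervalIntegrable_mul_green hl hε (hq.mono Ioo_subset_Icc_self)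
      (fun ξ hξ => hB ξ (Ioo_subset_Icc_self hξ)) p.1 hp.2.1
  exact
  { summable := fun x ξ t ht => summable_greenTerm hl hε x ξ ht
    integrable_h0 := hI hh0
    integrable_h1 := hI hh1
    integrable_f := fun p hp τ hτ => by
      have hτ' : τ ∈ Ioc 0 T := ⟨hτ.1, hτ.2.trans hp.2.2⟩
      exact intervalIntegrable_mul_green hl hε (continuousOn_slice hf hτ')
        (fun ξ hξ => hM (ξ, τ) ⟨hξ, hτ'⟩) p.1 (by linarith [hτ.2])
    integrable_f' := fun p hp =>
      (integral_source_green hl hε hlam h.source.nonneg hf hM p.1 hp.2).1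
    hasDt := fun p hp =>
      (hasDerivWithinAt_uData hl h.pos_T hε hlam hh0 ha p.1 hp.2).differentiableWithinAt
    hasDx := fun p hp => (hasDx_uData hl hε hlam hh0 ha hp.1 hp.2.1).1
    hasDxx := fun p hp => (hasDx_uData hl hε hlam hh0 ha hp.1 hp.2.1).2.1 }

end Explicit

end

/-! ### Modal equations of an arbitrary solution, by shrinking the interval -/

section


variable {l : ℝ}

lemma integrableOn_prod_of_bounded {F : ℝ → ℝ → ℝ} {s t M : ℝ} (hl : 0 ≤ l) (hst : s ≤ t)
    (hF : ContinuousOn (fun p : ℝ × ℝ => F p.1 p.2) (Ioo 0 l ×ˢ Icc s t))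
    (hM : ∀ ξ ∈ Ioo 0 l, ∀ τ ∈ Icc s t, |F ξ τ| ≤ M) :
    IntegrableOn (Function.uncurry F) (uIoc 0 l ×ˢ uIoc s t) := by
  have h1 : (volume : Measure (ℝ × ℝ)).restrict (uIoc 0 l ×ˢ uIoc s t) =
      (volume : Measure (ℝ × ℝ)).restrict (Ioo 0 l ×ˢ Ioo s t) := by
    rw [uIoc_of_le hl, uIoc_of_le hst, Measure.volume_eq_prod, ← Measure.prod_restrict,
      ← Measure.prod_restrict, restrict_Ioo_eq_restrict_Ioc, restrict_Ioo_eq_restrict_Ioc]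
  rw [IntegrableOn, h1]
  have hms : MeasurableSet (Ioo 0 l ×ˢ Ioo s t) := measurableSet_Ioo.prod measurableSet_Ioo
  have : IsFiniteMeasure ((volume : Measure (ℝ × ℝ)).restrict (Ioo 0 l ×ˢ Ioo s t)) := by
    rw [Measure.volume_eq_prod, ← Measure.prod_restrict]; infer_instance
  refine Integrable.of_bound ((hF.mono (prod_mono le_rfl Ioo_subset_Icc_self)).aestronglyMeasurable
    hms) M ((ae_restrict_iff' hms).2 (ae_of_all _ fun p hp => hM p.1 hp.1 p.2
      (Ioo_subset_Icc_self hp.2)))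

/-- Sine coefficients commute with integration in time. -/
lemma sinCoeff_integral (hl : 0 < l) {F : ℝ → ℝ → ℝ} {s t M : ℝ} (hst : s ≤ t)
    (hF : ContinuousOn (fun p : ℝ × ℝ => F p.1 p.2) (Ioo 0 l ×ˢ Icc s t))
    (hM : ∀ ξ ∈ Ioo 0 l, ∀ τ ∈ Icc s t, |F ξ τ| ≤ M) (n : ℕ) :
    sinCoeff l (fun ξ => ∫ τ in s..t, F ξ τ) n = ∫ τ in s..t, sinCoeff l (fun ξ => F ξ τ) n := by
  have h := intervalIntegral_intervalIntegral_swap (F := fun ξ τ => F ξ τ * sinMode l n ξ)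
    (integrableOn_prod_of_bounded hl.le hst
      (hF.mul ((continuous_sinMode n).comp continuous_fst).continuousOn)
      fun ξ hξ τ hτ => (abs_mul_sinMode_le _ n ξ).trans (hM ξ hξ τ hτ))
  simp only [sinCoeff, intervalIntegral.integral_const_mul, ← h]
  simp only [intervalIntegral.integral_mul_const]

/-- The dilation by `θ` around the midpoint of `[0, l]`. -/
def shrink (l θ ξ : ℝ) : ℝ := l / 2 + θ * (ξ - l / 2)

lemma shrink_one (ξ : ℝ) : shrink l 1 ξ = ξ := by unfold shrink; ring

lemma hasDerivAt_shrink (θ ξ : ℝ) : HasDerivAt (shrink l θ) θ ξ := by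
  convert! (((hasDerivAt_id ξ).sub_const (l / 2)).const_mul θ).const_add (l / 2) using 1
  ring

lemma continuous_shrink : Continuous fun p : ℝ × ℝ => shrink l p.1 p.2 := by
  unfold shrink; fun_prop

lemma shrink_mem_Ioo {θ ξ : ℝ} (hθ : θ ∈ Ioc 0 1) (hξ : ξ ∈ Ioo 0 l) : shrink l θ ξ ∈ Ioo 0 l := by
  unfold shrink
  have h1 := hξ.1
  have h2 := hξ.2
  constructor
  · nlinarith [mul_pos hθ.1 h1, mul_nonneg (sub_nonneg.2 hθ.2) (h1.trans h2).le]
  · nlinarith [mul_pos hθ.1 (sub_pos.2 h2), mul_nonneg (sub_nonneg.2 hθ.2) (h1.trans h2).le]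

lemma shrink_mem_Ioo_of_lt (hl : 0 < l) {θ ξ : ℝ} (hθ : θ ∈ Ioo 0 1) (hξ : ξ ∈ Icc 0 l) :
    shrink l θ ξ ∈ Ioo 0 l := by
  unfold shrink
  have h1 := mul_nonneg hθ.1.le hξ.1
  have h2 := mul_nonneg hθ.1.le (sub_nonneg.2 hξ.2)
  have h3 := mul_pos (sub_pos.2 hθ.2) hl
  constructor <;> nlinarith

lemma shrink_mem_Icc (hl : 0 < l) {θ ξ : ℝ} (hθ : θ ∈ Ioc 0 1) (hξ : ξ ∈ Icc 0 l) :
    shrink l θ ξ ∈ Icc 0 l := by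
  rcases eq_or_lt_of_le hθ.2 with rfl | h
  · rwa [shrink_one]
  · exact Ioo_subset_Icc_self (shrink_mem_Ioo_of_lt hl ⟨hθ.1, h⟩ hξ)

/-- Classical solutions of `∂_t g = ∂_xx w + r` in the open strip, with Dirichlet conditions
for `w`. -/
structure StripEquation (l T C : ℝ) (g w wx wxx r : ℝ → ℝ → ℝ) : Prop where
  continuousOn_g : ContinuousOn (fun p : ℝ × ℝ => g p.1 p.2) (Ioo 0 l ×ˢ Icc 0 T)
  bound_g : ∀ x ∈ Ioo 0 l, ∀ t ∈ Icc 0 T, |g x t| ≤ C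
  continuousOn_w : ContinuousOn (fun p : ℝ × ℝ => w p.1 p.2) (Icc 0 l ×ˢ Ioc 0 T)
  bound_w : ∀ x ∈ Icc 0 l, ∀ t ∈ Ioc 0 T, |w x t| ≤ C
  boundary : ∀ t ∈ Ioc 0 T, w 0 t = 0 ∧ w l t = 0
  continuousOn_wxx : ContinuousOn (fun p : ℝ × ℝ => wxx p.1 p.2) (Ioo 0 l ×ˢ Ioc 0 T)
  continuousOn_r : ContinuousOn (fun p : ℝ × ℝ => r p.1 p.2) (Ioo 0 l ×ˢ Ioc 0 T)
  bound_r : ∀ x ∈ Ioo 0 l, ∀ t ∈ Ioc 0 T, |r x t| ≤ C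
  hasDeriv_g : ∀ x ∈ Ioo 0 l, ∀ t ∈ Ioc 0 T,
    HasDerivWithinAt (fun s => g x s) (wxx x t + r x t) (Icc 0 T) t
  hasDeriv_w : ∀ x ∈ Ioo 0 l, ∀ t ∈ Ioc 0 T, HasDerivAt (fun y => w y t) (wx x t) x
  hasDeriv_wx : ∀ x ∈ Ioo 0 l, ∀ t ∈ Ioc 0 T, HasDerivAt (fun y => wx y t) (wxx x t) x

namespace StripEquation

variable {T C : ℝ} {g w wx wxx r : ℝ → ℝ → ℝ}

/-- Twofold integration by parts on the shrunk interval. -/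
lemma sinCoeff_wxx_shrink (hl : 0 < l) (h : StripEquation l T C g w wx wxx r) (n : ℕ) {θ t : ℝ}
    (hθ : θ ∈ Ioo 0 1) (ht : t ∈ Ioc 0 T) :
    sinCoeff l (fun ξ => wxx (shrink l θ ξ) t) n = θ⁻¹ ^ 2 *
      (2 / l * (-gam l (n + 1) * (w (shrink l θ l) t * Real.cos (gam l (n + 1) * l) -
        w (shrink l θ 0) t)) - gam l (n + 1) ^ 2 * sinCoeff l (fun ξ => w (shrink l θ ξ) t) n) := by
  set γ := gam l (n + 1) with hγ
  have hθ0 := hθ.1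
  have hsl : Real.sin (γ * l) = 0 := sinMode_right hl n
  have hm : ∀ ξ ∈ Icc 0 l, shrink l θ ξ ∈ Ioo 0 l := fun ξ hξ => shrink_mem_Ioo_of_lt hl hθ hξ
  have hsh : Continuous (shrink l θ) := continuous_iff_continuousAt.2 fun ξ =>
    (hasDerivAt_shrink θ ξ).continuousAt
  have hdw : ∀ ξ ∈ Icc 0 l, HasDerivAt (fun ξ => w (shrink l θ ξ) t) (wx (shrink l θ ξ) t * θ) ξ :=
    fun ξ hξ => (h.hasDeriv_w _ (hm ξ hξ) t ht).comp ξ (hasDerivAt_shrink θ ξ)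
  have hdx : ∀ ξ ∈ Icc 0 l, HasDerivAt (fun ξ => wx (shrink l θ ξ) t)
      (wxx (shrink l θ ξ) t * θ) ξ :=
    fun ξ hξ => (h.hasDeriv_wx _ (hm ξ hξ) t ht).comp ξ (hasDerivAt_shrink θ ξ)
  have hcw : ContinuousOn (fun ξ => w (shrink l θ ξ) t) (Icc 0 l) := fun ξ hξ =>
    (hdw ξ hξ).continuousAt.continuousWithinAt
  have hcx : ContinuousOn (fun ξ => wx (shrink l θ ξ) t) (Icc 0 l) := fun ξ hξ =>
    (hdx ξ hξ).continuousAt.continuousWithinAt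
  have hcxx : ContinuousOn (fun ξ => wxx (shrink l θ ξ) t) (Icc 0 l) :=
    ContinuousOn.comp (g := fun y => wxx y t) (f := shrink l θ)
      (continuousOn_slice h.continuousOn_wxx ht) hsh.continuousOn hm
  have hi : ∀ {p : ℝ → ℝ}, ContinuousOn p (Icc 0 l) →
      IntervalIntegrable (fun ξ => p ξ * sinMode l n ξ) volume 0 l := fun hp =>
    intervalIntegrable_mul_sinMode (ContinuousOn.intervalIntegrable (by rwa [uIcc_of_le hl.le])) n
  have hsin : Continuous fun x => Real.sin (γ * x) := by fun_prop
  have hcos : Continuous fun x => Real.cos (γ * x) := by fun_prop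
  -- The end-point terms containing w_x vanish with the sine. Those containing w remain, because w
  -- is known to vanish at 0 and l but not at the shrunk end points. The chain rule accounts for the
  -- powers of θ.
  have h1 := intervalIntegral.integral_eq_sub_of_hasDerivAt_of_le hl.le
    (f := fun ξ => wx (shrink l θ ξ) t * Real.sin (γ * ξ) / θ -
      γ * (w (shrink l θ ξ) t * Real.cos (γ * ξ)) / θ ^ 2)
    (f' := fun ξ => wxx (shrink l θ ξ) t * sinMode l n ξ +
      γ ^ 2 / θ ^ 2 * (w (shrink l θ ξ) t * sinMode l n ξ))
    (((hcx.mul hsin.continuousOn).div_const θ).sub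
      ((continuousOn_const.mul (hcw.mul hcos.continuousOn)).div_const (θ ^ 2)))
    (fun ξ hξ => by
      have hξ' := Ioo_subset_Icc_self hξ
      convert! (((hdx ξ hξ').mul (((hasDerivAt_id ξ).const_mul γ).sin)).div_const θ).sub
        ((((hdw ξ hξ').mul (((hasDerivAt_id ξ).const_mul γ).cos)).const_mul γ).div_const (θ ^ 2))
        using 1
      simp only [id, sinMode, ← hγ]
      field_simp; ring)
    ((hi hcxx).add ((hi hcw).const_mul _))
  rw [intervalIntegral.integral_add (hi hcxx) ((hi hcw).const_mul _),
    intervalIntegral.integral_const_mul] at h1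
  simp only [hsl, mul_zero, Real.sin_zero, Real.cos_zero, zero_div, zero_sub, mul_one] at h1
  have h2 : ∫ ξ in (0 : ℝ)..l, wxx (shrink l θ ξ) t * sinMode l n ξ =
      -(γ ^ 2 / θ ^ 2 * ∫ ξ in (0 : ℝ)..l, w (shrink l θ ξ) t * sinMode l n ξ) +
      (-(γ * (w (shrink l θ l) t * Real.cos (γ * l)) / θ ^ 2) -
        -(γ * w (shrink l θ 0) t / θ ^ 2)) := by rw [← h1]; ring
  simp only [sinCoeff]
  rw [h2]
  field_simp
  ring

lemma continuousOn_comp_shrink {q : ℝ → ℝ → ℝ} {t : ℝ}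
    (hq : ContinuousOn (fun x => q x t) (Ioo 0 l)) :
    ContinuousOn (fun p : ℝ × ℝ => q (shrink l p.2 p.1) t) (Ioo 0 l ×ˢ Ioc 0 1) :=
  ContinuousOn.comp (g := fun x => q x t) (f := fun p : ℝ × ℝ => shrink l p.2 p.1) hq
    (continuous_shrink.comp continuous_swap).continuousOn fun _ hp => shrink_mem_Ioo hp.2 hp.1

lemma tendsto_sinCoeff_shrink (hl : 0 < l) {q : ℝ → ℝ → ℝ} {t B : ℝ}
    (hq : ContinuousOn (fun x => q x t) (Ioo 0 l)) (hB : ∀ x ∈ Ioo 0 l, |q x t| ≤ B) (n : ℕ) :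
    Tendsto (fun θ => sinCoeff l (fun ξ => q (shrink l θ ξ) t) n) (𝓝[Ioo 0 1] 1)
      (𝓝 (sinCoeff l (fun ξ => q ξ t) n)) := by
  have h1 := continuousOn_sinCoeff hl (Q := fun ξ θ => q (shrink l θ ξ) t)
    (continuousOn_comp_shrink hq) (fun ξ hξ θ hθ => hB _ (shrink_mem_Ioo hθ hξ)) n 1
    ⟨one_pos, le_rfl⟩
  simp only [ContinuousWithinAt, shrink_one] at h1
  exact h1.mono_left (nhdsWithin_mono _ Ioo_subset_Ioc_self)

/-- For θ < 1 and positive times the shrunk rectangle is compact in the region where w_xx is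
continuous, so the fundamental theorem in time and Fubini apply with a bound that may depend on θ.
-/
lemma sub_eq_integral_shrink (hl : 0 < l) (h : StripEquation l T C g w wx wxx r) (n : ℕ)
    {θ s t : ℝ} (hθ : θ ∈ Ioo 0 1) (hs : 0 < s) (hst : s ≤ t) (ht : t ≤ T) :
    sinCoeff l (fun ξ => g (shrink l θ ξ) t) n - sinCoeff l (fun ξ => g (shrink l θ ξ) s) n =
      ∫ τ in s..t, sinCoeff l (fun ξ => wxx (shrink l θ ξ) τ + r (shrink l θ ξ) τ) n ∧
    ContinuousOn (fun τ => sinCoeff l (fun ξ => wxx (shrink l θ ξ) τ + r (shrink l θ ξ) τ) n)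
      (Icc s t) := by
  have hm : ∀ ξ ∈ Icc 0 l, shrink l θ ξ ∈ Ioo 0 l := fun ξ hξ => shrink_mem_Ioo_of_lt hl hθ hξ
  have hsub : Icc s t ⊆ Ioc 0 T := fun τ hτ => ⟨hs.trans_le hτ.1, hτ.2.trans ht⟩
  have hc0 : ContinuousOn (fun p : ℝ × ℝ => wxx p.1 p.2 + r p.1 p.2) (Ioo 0 l ×ˢ Ioc 0 T) :=
    h.continuousOn_wxx.add h.continuousOn_r
  have hsh : Continuous (shrink l θ) := continuous_iff_continuousAt.2 fun ξ =>
    (hasDerivAt_shrink θ ξ).continuousAt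
  have hc : ContinuousOn (fun p : ℝ × ℝ => wxx (shrink l θ p.1) p.2 + r (shrink l θ p.1) p.2)
      (Icc 0 l ×ˢ Icc s t) :=
    ContinuousOn.comp (g := fun p : ℝ × ℝ => wxx p.1 p.2 + r p.1 p.2)
      (f := fun p : ℝ × ℝ => (shrink l θ p.1, p.2)) hc0
      ((hsh.comp continuous_fst).prodMk continuous_snd).continuousOn
      fun p hp => ⟨hm p.1 hp.1, hsub hp.2⟩
  obtain ⟨B, hB⟩ := (isCompact_Icc.prod isCompact_Icc).exists_bound_of_continuousOn hc
  have hc' := hc.mono (prod_mono (Ioo_subset_Icc_self (a := (0 : ℝ)) (b := l)) (le_refl (Icc s t)))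
  have hB' : ∀ ξ ∈ Ioo 0 l, ∀ τ ∈ Icc s t,
      |wxx (shrink l θ ξ) τ + r (shrink l θ ξ) τ| ≤ B := fun ξ hξ τ hτ =>
    hB (ξ, τ) ⟨Ioo_subset_Icc_self hξ, hτ⟩
  refine ⟨?_, continuousOn_sinCoeff hl
    (Q := fun ξ τ => wxx (shrink l θ ξ) τ + r (shrink l θ ξ) τ) hc' hB' n⟩
  rw [← sinCoeff_integral hl hst (F := fun ξ τ => wxx (shrink l θ ξ) τ + r (shrink l θ ξ) τ)
    hc' hB' n]
  have hgI : ∀ τ ∈ Icc 0 T, IntervalIntegrable (fun ξ => g (shrink l θ ξ) τ) volume 0 l := by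
    intro τ hτ
    refine ContinuousOn.intervalIntegrable ?_
    rw [uIcc_of_le hl.le]
    exact ContinuousOn.comp (g := fun y => g y τ) (f := shrink l θ)
      (continuousOn_slice h.continuousOn_g hτ) hsh.continuousOn hm
  rw [← sinCoeff_sub (hgI t ⟨(hs.trans_le hst).le, ht⟩) (hgI s ⟨hs.le, hst.trans ht⟩)]
  refine sinCoeff_congr hl (fun ξ hξ => ?_) n
  have hξ' := hm ξ (Ioo_subset_Icc_self hξ)
  refine (intervalIntegral.integral_eq_sub_of_hasDerivAt_of_le hst
    (f := fun τ => g (shrink l θ ξ) τ) (fun τ hτ => ?_) (fun τ hτ => ?_) ?_).symm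
  · exact ((h.hasDeriv_g _ hξ' τ (hsub hτ)).continuousWithinAt).mono
      (hsub.trans Ioc_subset_Icc_self)
  · exact (h.hasDeriv_g _ hξ' τ (hsub (Ioo_subset_Icc_self hτ))).hasDerivAt
      (Icc_mem_nhds (hs.trans hτ.1) (hτ.2.trans_le ht))
  · refine ContinuousOn.intervalIntegrable ?_
    rw [uIcc_of_le hst]
    exact ContinuousOn.comp (g := fun p : ℝ × ℝ => wxx p.1 p.2 + r p.1 p.2)
      (f := fun τ : ℝ => (shrink l θ ξ, τ)) hc0 (by fun_prop) fun τ hτ => ⟨hξ', hsub hτ⟩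

lemma bound_w' (h : StripEquation l T C g w wx wxx r) {t : ℝ} (ht : t ∈ Ioc 0 T) :
    ∀ x ∈ Ioo 0 l, |w x t| ≤ C := fun x hx => h.bound_w x (Ioo_subset_Icc_self hx) t ht

lemma continuousOn_w' (h : StripEquation l T C g w wx wxx r) :
    ContinuousOn (fun p : ℝ × ℝ => w p.1 p.2) (Ioo 0 l ×ˢ Ioc 0 T) :=
  h.continuousOn_w.mono (prod_mono Ioo_subset_Icc_self le_rfl)

/-- The modal equation, integrated from a positive time. -/
lemma sub_eq_integral_of_pos (hl : 0 < l) (h : StripEquation l T C g w wx wxx r) (n : ℕ)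
    {s t : ℝ} (hs : 0 < s) (hst : s ≤ t) (ht : t ≤ T) :
    sinCoeff l (fun ξ => g ξ t) n - sinCoeff l (fun ξ => g ξ s) n =
      ∫ τ in s..t, (-(gam l (n + 1) ^ 2) * sinCoeff l (fun ξ => w ξ τ) n +
        sinCoeff l (fun ξ => r ξ τ) n) := by
  set γ := gam l (n + 1) with hγ
  have hg0 : 0 < γ := gam_pos hl n
  have hsub : Icc s t ⊆ Ioc 0 T := fun τ hτ => ⟨hs.trans_le hτ.1, hτ.2.trans ht⟩
  have hsm : s ∈ Icc 0 T := ⟨hs.le, hst.trans ht⟩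
  have htm : t ∈ Icc 0 T := ⟨(hs.trans_le hst).le, ht⟩
  have hlim := (tendsto_sinCoeff_shrink hl (continuousOn_slice h.continuousOn_g htm)
    (fun x hx => h.bound_g x hx t htm) n).sub
    (tendsto_sinCoeff_shrink hl (continuousOn_slice h.continuousOn_g hsm)
    (fun x hx => h.bound_g x hx s hsm) n)
  have hne : (𝓝[Ioo (0 : ℝ) 1] 1).NeBot := by
    rw [← mem_closure_iff_nhdsWithin_neBot, closure_Ioo zero_ne_one]; exact ⟨zero_le_one, le_rfl⟩
  have hself : ∀ᶠ θ in 𝓝[Ioo (0 : ℝ) 1] 1, θ ∈ Ioo (0 : ℝ) 1 := self_mem_nhdsWithin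
  -- After the integration by parts only w and r appear, and these are bounded independently of θ,
  -- unlike w_xx.
  set D : ℝ → ℝ → ℝ := fun θ τ => θ⁻¹ ^ 2 *
      (2 / l * (-γ * (w (shrink l θ l) τ * Real.cos (γ * l) -
        w (shrink l θ 0) τ)) - γ ^ 2 * sinCoeff l (fun ξ => w (shrink l θ ξ) τ) n) +
      sinCoeff l (fun ξ => r (shrink l θ ξ) τ) n with hD
  have hDeq : ∀ θ ∈ Ioo (0 : ℝ) 1, ∀ τ ∈ Icc s t,
      sinCoeff l (fun ξ => wxx (shrink l θ ξ) τ + r (shrink l θ ξ) τ) n = D θ τ := by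
    intro θ hθ τ hτ
    have hci : ∀ {q : ℝ → ℝ → ℝ},
        ContinuousOn (fun p : ℝ × ℝ => q p.1 p.2) (Ioo 0 l ×ˢ Ioc 0 T) →
        IntervalIntegrable (fun ξ => q (shrink l θ ξ) τ) volume 0 l := fun {q} hq => by
      refine ContinuousOn.intervalIntegrable ?_
      rw [uIcc_of_le hl.le]
      exact ContinuousOn.comp (g := fun y => q y τ) (f := shrink l θ)
        (continuousOn_slice hq (hsub hτ)) (by unfold shrink; fun_prop)
        fun ξ hξ => shrink_mem_Ioo_of_lt hl hθ hξ
    rw [sinCoeff_add (hci h.continuousOn_wxx) (hci h.continuousOn_r),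
      h.sinCoeff_wxx_shrink hl n hθ (hsub hτ)]
  have hbθ : ∀ θ ∈ Ioo (0 : ℝ) 1, 1 / 2 < θ → ∀ τ ∈ Icc s t,
      |D θ τ| ≤ 4 * (2 / l * (γ * (C + C)) + γ ^ 2 * (2 * C)) + 2 * C := by
    intro θ hθ h2 τ hτ
    have hθ' : θ ∈ Ioc (0 : ℝ) 1 := Ioo_subset_Ioc_self hθ
    have b1 := h.bound_w _ (shrink_mem_Icc hl hθ' (⟨hl.le, le_rfl⟩ : l ∈ Icc 0 l)) τ (hsub hτ)
    have b2 := h.bound_w _ (shrink_mem_Icc hl hθ' (⟨le_rfl, hl.le⟩ : (0 : ℝ) ∈ Icc 0 l)) τ (hsub hτ)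
    have b3 := abs_sinCoeff_le hl (q := fun ξ => w (shrink l θ ξ) τ)
      (fun ξ hξ => h.bound_w' (hsub hτ) _ (shrink_mem_Ioo hθ' hξ)) n
    have b4 := abs_sinCoeff_le hl (q := fun ξ => r (shrink l θ ξ) τ)
      (fun ξ hξ => h.bound_r _ (shrink_mem_Ioo hθ' hξ) τ (hsub hτ)) n
    have hC0 : 0 ≤ C := (abs_nonneg _).trans b1
    -- From θ > 1/2, which holds near the limit θ = 1.
    have b5 : θ⁻¹ ^ 2 ≤ 4 := by
      have : θ⁻¹ ≤ 2 := by
        rw [inv_le_comm₀ hθ.1 two_pos]; linarith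
      have h0 : 0 ≤ θ⁻¹ := (inv_pos.2 hθ.1).le
      nlinarith
    have b6 : |w (shrink l θ l) τ * Real.cos (γ * l) - w (shrink l θ 0) τ| ≤ C + C := by
      refine (abs_sub _ _).trans (add_le_add ?_ b2)
      rw [abs_mul]
      exact (mul_le_of_le_one_right (abs_nonneg _) (Real.abs_cos_le_one _)).trans b1
    refine (abs_add_le _ _).trans (add_le_add ?_ b4)
    rw [abs_mul, abs_of_nonneg (by positivity : 0 ≤ θ⁻¹ ^ 2)]
    refine mul_le_mul b5 ((abs_sub _ _).trans (add_le_add ?_ ?_)) (abs_nonneg _) (by norm_num)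
    · rw [abs_mul, abs_mul, abs_neg, abs_of_pos hg0, abs_of_pos (by positivity : 0 < 2 / l)]
      gcongr
    · rw [abs_mul, abs_of_pos (by positivity : 0 < γ ^ 2)]
      gcongr
  -- Continuity of w up to the lateral boundary and its zero boundary values remove the boundary
  -- terms as θ → 1.
  have hlimD : ∀ τ ∈ Icc s t, Tendsto (fun θ => D θ τ) (𝓝[Ioo 0 1] 1)
      (𝓝 (-(γ ^ 2) * sinCoeff l (fun ξ => w ξ τ) n + sinCoeff l (fun ξ => r ξ τ) n)) := by
    intro τ hτ
    have t1 := tendsto_sinCoeff_shrink hl (continuousOn_slice h.continuousOn_w' (hsub hτ))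
      (h.bound_w' (hsub hτ)) n
    have t2 := tendsto_sinCoeff_shrink hl (continuousOn_slice h.continuousOn_r (hsub hτ))
      (fun x hx => h.bound_r x hx τ (hsub hτ)) n
    have t3 : ∀ ξ ∈ Icc 0 l, Tendsto (fun θ => w (shrink l θ ξ) τ) (𝓝[Ioo 0 1] 1)
        (𝓝 (w ξ τ)) := by
      intro ξ hξ
      have hcw : ContinuousOn (fun x => w x τ) (Icc 0 l) :=
        ContinuousOn.comp (g := fun p : ℝ × ℝ => w p.1 p.2) (f := fun x : ℝ => (x, τ))
          h.continuousOn_w (by fun_prop) fun x hx => ⟨hx, hsub hτ⟩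
      have hc1 : ContinuousOn (fun θ => w (shrink l θ ξ) τ) (Ioc 0 1) :=
        ContinuousOn.comp (g := fun x => w x τ) (f := fun θ => shrink l θ ξ) hcw
          (by unfold shrink; fun_prop) fun θ hθ => shrink_mem_Icc hl hθ hξ
      have h1 := hc1 1 ⟨one_pos, le_rfl⟩
      simp only [ContinuousWithinAt, shrink_one] at h1
      exact h1.mono_left (nhdsWithin_mono _ Ioo_subset_Ioc_self)
    have t4 : Tendsto (fun θ : ℝ => θ⁻¹ ^ 2) (𝓝[Ioo 0 1] 1) (𝓝 ((1 : ℝ)⁻¹ ^ 2)) :=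
      ((tendsto_id.mono_left nhdsWithin_le_nhds).inv₀ one_ne_zero).pow 2
    have t5 := ((t4.mul ((((((t3 l ⟨hl.le, le_rfl⟩).mul_const (Real.cos (γ * l))).sub
      (t3 0 ⟨le_rfl, hl.le⟩)).const_mul (-γ)).const_mul (2 / l)).sub (t1.const_mul (γ ^ 2)))).add t2)
    rw [(h.boundary τ (hsub hτ)).1, (h.boundary τ (hsub hτ)).2] at t5
    convert t5 using 2
    simp
  have hR : Tendsto (fun θ => ∫ τ in s..t, D θ τ) (𝓝[Ioo 0 1] 1)
      (𝓝 (∫ τ in s..t, (-(γ ^ 2) * sinCoeff l (fun ξ => w ξ τ) n +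
        sinCoeff l (fun ξ => r ξ τ) n))) := by
    have hui : uIoc s t ⊆ Icc s t := by rw [uIoc_of_le hst]; exact Ioc_subset_Icc_self
    refine intervalIntegral.tendsto_integral_filter_of_dominated_convergence
      (fun _ => 4 * (2 / l * (γ * (C + C)) + γ ^ 2 * (2 * C)) + 2 * C) ?_ ?_
      intervalIntegrable_const (ae_of_all _ fun τ hτ => hlimD τ (hui hτ))
    · filter_upwards [hself] with θ hθ
      have h1 := ((h.sub_eq_integral_shrink hl n hθ hs hst ht).2.congr
        fun τ hτ => (hDeq θ hθ τ hτ).symm).aestronglyMeasurable (μ := volume) measurableSet_Icc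
      exact h1.mono_measure (Measure.restrict_mono hui le_rfl)
    · filter_upwards [hself, mem_nhdsWithin_of_mem_nhds
        (Ioi_mem_nhds (by norm_num : (1 / 2 : ℝ) < 1))] with θ hθ h2
      exact ae_of_all _ fun τ hτ => hbθ θ hθ h2 τ (hui hτ)
  refine tendsto_nhds_unique (hlim.congr' ?_) hR
  filter_upwards [hself] with θ hθ
  rw [(h.sub_eq_integral_shrink hl n hθ hs hst ht).1]
  refine intervalIntegral.integral_congr fun τ hτ => ?_
  rw [uIcc_of_le hst] at hτ
  exact hDeq θ hθ τ hτ

/-- The modal equation, integrated in time. -/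
theorem sub_eq_integral (hl : 0 < l) (h : StripEquation l T C g w wx wxx r) (n : ℕ)
    {t : ℝ} (ht : t ∈ Icc 0 T) :
    sinCoeff l (fun ξ => g ξ t) n - sinCoeff l (fun ξ => g ξ 0) n =
      ∫ τ in (0 : ℝ)..t, (-(gam l (n + 1) ^ 2) * sinCoeff l (fun ξ => w ξ τ) n +
        sinCoeff l (fun ξ => r ξ τ) n) := by
  rcases eq_or_lt_of_le ht.1 with rfl | h0
  · simp
  have hT : 0 ≤ T := ht.1.trans ht.2
  set N : ℝ → ℝ := fun τ => -(gam l (n + 1) ^ 2) * sinCoeff l (fun ξ => w ξ τ) n +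
        sinCoeff l (fun ξ => r ξ τ) n with hN
  have hNc : ContinuousOn N (Ioc 0 T) :=
    ((continuousOn_sinCoeff hl h.continuousOn_w'
      (fun ξ hξ τ hτ => h.bound_w' hτ ξ hξ) n).const_mul _).add
      (continuousOn_sinCoeff hl h.continuousOn_r h.bound_r n)
  have hNI : IntervalIntegrable N volume 0 T := by
    refine intervalIntegrable_of_bounded (M := gam l (n + 1) ^ 2 * (2 * C) + 2 * C) hT
      (hNc.mono Ioo_subset_Ioc_self) fun τ hτ => ?_
    have hτ' := Ioo_subset_Ioc_self hτ
    refine (abs_add_le _ _).trans (add_le_add ?_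
      (abs_sinCoeff_le hl (fun ξ hξ => h.bound_r ξ hξ τ hτ') n))
    rw [abs_mul, abs_neg, abs_of_nonneg (sq_nonneg _)]
    exact mul_le_mul_of_nonneg_left (abs_sinCoeff_le hl (h.bound_w' hτ') n) (sq_nonneg _)
  have hP : ContinuousOn (fun s => ∫ τ in (0 : ℝ)..s, N τ) (Icc 0 T) := by
    have := intervalIntegral.continuousOn_primitive_interval' hNI left_mem_uIcc
    rwa [uIcc_of_le hT] at this
  -- This difference is continuous on [0, T] and, by the identity from positive times, constant on
  -- (0, t]; its value at 0 is therefore the same.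
  have hJ : ContinuousOn (fun s => sinCoeff l (fun ξ => g ξ s) n - ∫ τ in (0 : ℝ)..s, N τ)
      (Icc 0 T) := (continuousOn_sinCoeff hl h.continuousOn_g h.bound_g n).sub hP
  have hne : (𝓝[Ioc (0 : ℝ) t] 0).NeBot := by
    rw [← mem_closure_iff_nhdsWithin_neBot, closure_Ioc h0.ne]; exact ⟨le_rfl, h0.le⟩
  have hlim := (hJ 0 ⟨le_rfl, hT⟩).mono_left
    (nhdsWithin_mono 0 (fun s hs => ⟨hs.1.le, hs.2.trans ht.2⟩ : Ioc 0 t ⊆ Icc 0 T))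
  have hcst : Tendsto (fun s => sinCoeff l (fun ξ => g ξ s) n - ∫ τ in (0 : ℝ)..s, N τ)
      (𝓝[Ioc (0 : ℝ) t] 0)
      (𝓝 (sinCoeff l (fun ξ => g ξ t) n - ∫ τ in (0 : ℝ)..t, N τ)) := by
    refine tendsto_const_nhds.congr' ?_
    filter_upwards [self_mem_nhdsWithin] with s hs
    have h1 := h.sub_eq_integral_of_pos hl n hs.1 hs.2 ht.2
    have hI : ∀ b ∈ Icc 0 T, IntervalIntegrable N volume 0 b := fun b hb =>
      hNI.mono_set (by rw [uIcc_of_le hb.1, uIcc_of_le hT]; exact Icc_subset_Icc_right hb.2)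
    have h2 := intervalIntegral.integral_interval_sub_left (hI t ht)
      (hI s ⟨hs.1.le, hs.2.trans ht.2⟩)
    linarith
  have := tendsto_nhds_unique hlim hcst
  simp only [intervalIntegral.integral_same, sub_zero] at this
  linarith

end StripEquation

end

/-! ### Uniqueness of solutions -/

section


variable {l T α ε lam M : ℝ} {f v v₁ v₂ : ℝ → ℝ → ℝ} {h0 h1 : ℝ → ℝ}

/-- A linear homogeneous second-order modal equation in integrated form has only the zero
solution. -/
lemma eq_zero_of_integral_eq {Y P : ℝ → ℝ} {b : ℝ} (hT : 0 < T) (hY : ContinuousOn Y (Icc 0 T))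
    (hP : ContinuousOn P (Icc 0 T)) (hYP : ∀ t ∈ Icc 0 T, Y t = ∫ τ in (0 : ℝ)..t, P τ)
    (hPY : ∀ t ∈ Icc 0 T, P t + α * Y t = ∫ τ in (0 : ℝ)..t, -b * (ε * P τ + Y τ)) :
    ∀ t ∈ Icc 0 T, Y t = 0 := by
  have h0m : (0 : ℝ) ∈ Icc 0 T := ⟨le_rfl, hT.le⟩
  have hY0 : Y 0 = 0 := by simpa using hYP 0 h0m
  have hP0 : P 0 = 0 := by simpa [hY0] using hPY 0 h0m
  have hdY : ∀ t ∈ Icc 0 T, HasDerivWithinAt Y (P t) (Icc 0 T) t := fun t ht =>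
    hasDerivWithinAt_of_eq_integral hT.le hP (fun s hs => by rw [hY0, zero_add, hYP s hs]) ht
  -- Only P + αY is given as a primitive; subtracting αY, whose derivative is αP, isolates the
  -- derivative of P.
  have hdP : ∀ t ∈ Icc 0 T, HasDerivWithinAt P (-b * (ε * P t + Y t) - α * P t) (Icc 0 T) t := by
    intro t ht
    have h1 : HasDerivWithinAt (fun t => P t + α * Y t) (-b * (ε * P t + Y t)) (Icc 0 T) t :=
      hasDerivWithinAt_of_eq_integral (f := fun t => -b * (ε * P t + Y t)) hT.le
        (((hP.const_mul ε).add hY).const_mul (-b))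
        (fun s hs => by rw [hP0, hY0, mul_zero, add_zero, zero_add]; exact hPY s hs) ht
    refine (h1.sub ((hdY t ht).const_mul α)).congr (fun s _ => ?_) ?_ <;>
      simp
  -- A Lipschitz constant in the sup norm for the first-order system satisfied by (Y, P); with zero
  -- initial data Gronwall's bound is zero.
  set K := 1 + |b| * (|ε| + 1) + |α| with hK
  have h := norm_le_gronwallBound_of_norm_deriv_right_le (f := fun t => (Y t, P t))
    (f' := fun t => (P t, -b * (ε * P t + Y t) - α * P t)) (δ := 0) (K := K) (ε := 0) (a := 0)
    (b := T) (hY.prodMk hP)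
    (fun t ht => ((hdY t (Ico_subset_Icc_self ht)).prodMk
      (hdP t (Ico_subset_Icc_self ht))).mono_of_mem_nhdsWithin
        (Icc_mem_nhdsGE_of_mem ht))
    (by simp [hY0, hP0]) (fun t _ => by
      set m := ‖(Y t, P t)‖ with hm
      have hm0 : 0 ≤ m := norm_nonneg _
      have h1 : |Y t| ≤ m := norm_fst_le (Y t, P t)
      have h2 : |P t| ≤ m := norm_snd_le (Y t, P t)
      have hb := abs_nonneg b
      have ha := abs_nonneg α
      have he := abs_nonneg ε
      have e1 : 0 ≤ |b| * (|ε| + 1) * m := by positivity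
      have e2 : 0 ≤ |α| * m := by positivity
      rw [add_zero, Prod.norm_def]
      refine max_le ?_ ?_
      · simp only [Real.norm_eq_abs, hK]; linarith
      · simp only [Real.norm_eq_abs]
        refine (abs_sub _ _).trans ?_
        rw [abs_mul, abs_mul, abs_neg]
        have h3 : |ε * P t + Y t| ≤ (|ε| + 1) * m := by
          refine (abs_add_le _ _).trans ?_
          rw [abs_mul, add_mul, one_mul]
          gcongr
        calc |b| * |ε * P t + Y t| + |α| * |P t| ≤ |b| * ((|ε| + 1) * m) + |α| * m := by gcongr
          _ ≤ K * m := by simp only [hK]; linarith)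
  intro t ht
  have h1 := h t ht
  rw [gronwallBound_ε0_δ0] at h1
  exact abs_nonpos_iff.1 ((norm_fst_le (Y t, P t)).trans h1)

namespace IsSolution

lemma exists_bound (hv : IsSolution l T α ε lam f h0 h1 v) :
    ∃ C, ∀ x ∈ Icc 0 l, ∀ t ∈ Icc 0 T, |v x t| ≤ C ∧ |dt T v x t| ≤ C := by
  obtain ⟨B, hB⟩ := (isCompact_Icc.prod isCompact_Icc).exists_bound_of_continuousOn hv.continuousOn
  obtain ⟨D, hD⟩ := hv.bounded_dt
  exact ⟨max B D, fun x hx t ht => ⟨(hB (x, t) ⟨hx, ht⟩).trans (le_max_left _ _),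
    (hD (x, t) ⟨hx, ht⟩).trans (le_max_right _ _)⟩⟩

lemma continuousOn_dt_interior (hv : IsSolution l T α ε lam f h0 h1 v) :
    ContinuousOn (fun p : ℝ × ℝ => dt T v p.1 p.2) (Ioo 0 l ×ˢ Icc 0 T) :=
  hv.continuousOn_dt.mono fun p hp => ⟨⟨Ioo_subset_Icc_self hp.1, hp.2⟩, by
    rintro (e | e)
    · exact hp.1.1.ne' (congrArg Prod.fst e)
    · exact hp.1.2.ne (congrArg Prod.fst e)⟩

lemma continuousOn_dt_pos (hv : IsSolution l T α ε lam f h0 h1 v) :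
    ContinuousOn (fun p : ℝ × ℝ => dt T v p.1 p.2) (Icc 0 l ×ˢ Ioc 0 T) :=
  hv.continuousOn_dt.mono fun p hp => ⟨⟨hp.1, Ioc_subset_Icc_self hp.2⟩, by
    rintro (e | e) <;> exact hp.2.1.ne' (congrArg Prod.snd e)⟩

lemma hasDerivWithinAt_dt (hv : IsSolution l T α ε lam f h0 h1 v) {x t : ℝ} (hx : x ∈ Icc 0 l)
    (ht : t ∈ Icc 0 T) : HasDerivWithinAt (fun s => v x s) (dt T v x t) (Icc 0 T) t :=
  (hv.hasDt (x, t) ⟨hx, ht⟩).hasDerivWithinAt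

lemma dt_boundary (hT : 0 < T) {y : ℝ} (hy : ∀ t ∈ Ioc 0 T, v y t = 0) {t : ℝ}
    (ht : t ∈ Ioc 0 T) : dt T v y t = 0 := by
  refine dt_eq_of_hasDerivWithinAt hT ?_ (Ioc_subset_Icc_self ht)
  refine (hasDerivWithinAt_const t (Icc 0 T) (0 : ℝ)).congr_of_eventuallyEq ?_ (hy t ht)
  filter_upwards [self_mem_nhdsWithin, mem_nhdsWithin_of_mem_nhds (Ioi_mem_nhds ht.1)] with s h1 h2
  exact hy s ⟨h2, h1.2⟩

/-- Solutions of the strip problem after removal of the drift. -/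
lemma exists_stripEquation (hl : 0 < l) (hT : 0 < T) (hlam : 0 ≤ lam)
    (hv : IsSolution l T α ε lam f h0 h1 v)
    (hf : ContinuousOn (fun p : ℝ × ℝ => f p.1 p.2) (Omega l T))
    (hM : ∀ p ∈ Omega l T, |f p.1 p.2| ≤ M) :
    ∃ C wx wxx, StripEquation l T C
      (fun x t => untwist lam (fun x => dt T v x t) x + α * untwist lam (fun x => v x t) x)
      (fun x t => ε * untwist lam (fun x => dt T v x t) x + untwist lam (fun x => v x t) x) wx wxx
      (fun x t => -(lam ^ 2 / 4) * (ε * untwist lam (fun x => dt T v x t) x +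
        untwist lam (fun x => v x t) x) - untwist lam (fun x => f x t) x) := by
  obtain ⟨B, hB⟩ := hv.exists_bound
  have hB0 : 0 ≤ B := (abs_nonneg _).trans (hB 0 ⟨le_rfl, hl.le⟩ 0 ⟨le_rfl, hT.le⟩).1
  have hM0 : 0 ≤ M := (abs_nonneg _).trans
    (hM (l / 2, T) ⟨⟨by linarith, by linarith⟩, hT, le_rfl⟩)
  have hec : Continuous fun p : ℝ × ℝ => Real.exp (-(lam / 2 * p.1)) := by fun_prop
  have hed : ∀ x : ℝ, HasDerivAt (fun x => Real.exp (-(lam / 2 * x)))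
      (-(lam / 2) * Real.exp (-(lam / 2 * x))) x := fun x => by
    convert! ((hasDerivAt_id x).const_mul (lam / 2)).neg.exp using 1
    simp only [id, Pi.neg_apply]; ring
  have hV : ∀ x ∈ Icc 0 l, ∀ t ∈ Icc 0 T, |untwist lam (fun x => v x t) x| ≤ B :=
    fun x hx t ht => abs_untwist_le hlam hx.1 (hB x hx t ht).1
  have hP : ∀ x ∈ Icc 0 l, ∀ t ∈ Icc 0 T, |untwist lam (fun x => dt T v x t) x| ≤ B :=
    fun x hx t ht => abs_untwist_le hlam hx.1 (hB x hx t ht).2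
  have hW : ∀ x ∈ Icc 0 l, ∀ t ∈ Icc 0 T, |ε * untwist lam (fun x => dt T v x t) x +
      untwist lam (fun x => v x t) x| ≤ |ε| * B + B := fun x hx t ht => by
    refine (abs_add_le _ _).trans (add_le_add ?_ (hV x hx t ht))
    rw [abs_mul]; exact mul_le_mul_of_nonneg_left (hP x hx t ht) (abs_nonneg _)
  have e0 : 0 ≤ |α| * B := by positivity
  have e1 : 0 ≤ |ε| * B := by positivity
  have e2 : 0 ≤ lam ^ 2 / 4 * (|ε| * B + B) := by positivity
  have eW : ∀ x t, ε * untwist lam (fun x => dt T v x t) x + untwist lam (fun x => v x t) x =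
      Real.exp (-(lam / 2 * x)) * visc T ε v x t := fun x t => by
    simp only [untwist, visc]; ring
  have hdx : ∀ x ∈ Ioo 0 l, ∀ t ∈ Ioc 0 T,
      HasDerivAt (fun y => visc T ε v y t) (dx l (visc T ε v) x t) x := fun x hx t ht =>
    (hv.hasDx (x, t) ⟨hx, ht⟩).hasDerivWithinAt.hasDerivAt (Icc_mem_nhds hx.1 hx.2)
  have hdxx : ∀ x ∈ Ioo 0 l, ∀ t ∈ Ioc 0 T,
      HasDerivAt (fun y => dx l (visc T ε v) y t) (dx l (dx l (visc T ε v)) x t) x :=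
    fun x hx t ht => (hv.hasDxx (x, t) ⟨hx, ht⟩).hasDerivWithinAt.hasDerivAt
      (Icc_mem_nhds hx.1 hx.2)
  have hvc : ContinuousOn (fun p : ℝ × ℝ => v p.1 p.2) (Icc 0 l ×ˢ Icc 0 T) := hv.continuousOn
  have hWc : ContinuousOn (fun p : ℝ × ℝ => ε * untwist lam (fun x => dt T v x p.2) p.1 +
      untwist lam (fun x => v x p.2) p.1) (Icc 0 l ×ˢ Ioc 0 T) :=
    ((hec.continuousOn.mul hv.continuousOn_dt_pos).const_mul ε).add
      (hec.continuousOn.mul (hvc.mono (prod_mono le_rfl Ioc_subset_Icc_self)))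
  have hviscc : ContinuousOn (fun p : ℝ × ℝ => visc T ε v p.1 p.2) (Ioo 0 l ×ˢ Ioc 0 T) :=
    ((hv.continuousOn_dt_pos.const_mul ε).add
      (hvc.mono (prod_mono le_rfl Ioc_subset_Icc_self))).mono
      (prod_mono Ioo_subset_Icc_self le_rfl)
  -- The witnesses are the space derivatives of exp(−λx/2)(ε v_t + v). Multiplication by this
  -- exponential removes the first-order term and leaves the potential −λ²/4, which is placed in the
  -- remainder together with the source.
  refine ⟨B + |α| * B + (|ε| * B + B) + (lam ^ 2 / 4 * (|ε| * B + B) + M),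
    fun x t => Real.exp (-(lam / 2 * x)) * (dx l (visc T ε v) x t - lam / 2 * visc T ε v x t),
    fun x t => Real.exp (-(lam / 2 * x)) * (dx l (dx l (visc T ε v)) x t -
      lam * dx l (visc T ε v) x t + lam ^ 2 / 4 * visc T ε v x t), ?_, fun x hx t ht => ?_, hWc,
    fun x hx t ht => ?_, fun t ht => ?_, ?_, ?_, fun x hx t ht => ?_, fun x hx t ht => ?_,
    fun x hx t ht => ?_, fun x hx t ht => ?_⟩
  · exact (hec.continuousOn.mul hv.continuousOn_dt_interior).add
      ((hec.continuousOn.mul (hvc.mono (prod_mono Ioo_subset_Icc_self le_rfl))).const_mul α)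
  · have hx' := Ioo_subset_Icc_self hx
    have h3 : |α * untwist lam (fun x => v x t) x| ≤ |α| * B := by
      rw [abs_mul]; exact mul_le_mul_of_nonneg_left (hV x hx' t ht) (abs_nonneg _)
    linarith [abs_add_le (untwist lam (fun x => dt T v x t) x) (α * untwist lam (fun x => v x t) x),
      hP x hx' t ht]
  · linarith [hW x hx t (Ioc_subset_Icc_self ht)]
  · have b1 := dt_boundary hT (fun t ht => (hv.boundary t ht).1) ht
    have b2 := dt_boundary hT (fun t ht => (hv.boundary t ht).2) ht
    have b3 := hv.boundary t ht
    simp [untwist, b1, b2, b3.1, b3.2]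
  · exact hec.continuousOn.mul ((hv.continuousOn_dxx.sub (hv.continuousOn_dx.const_mul lam)).add
      (hviscc.const_mul _))
  · exact ((hWc.mono (prod_mono Ioo_subset_Icc_self le_rfl)).const_mul _).sub
      (hec.continuousOn.mul hf)
  · have hx' := Ioo_subset_Icc_self hx
    have h3 : |-(lam ^ 2 / 4) * (ε * untwist lam (fun x => dt T v x t) x +
        untwist lam (fun x => v x t) x)| ≤ lam ^ 2 / 4 * (|ε| * B + B) := by
      rw [abs_mul, abs_neg, abs_of_nonneg (by positivity : 0 ≤ lam ^ 2 / 4)]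
      exact mul_le_mul_of_nonneg_left (hW x hx' t (Ioc_subset_Icc_self ht)) (by positivity)
    have h4 : |untwist lam (fun x => f x t) x| ≤ M := abs_untwist_le hlam hx.1.le
      (hM (x, t) ⟨hx, ht⟩)
    refine (abs_sub _ _).trans ?_
    linarith
  · have hx' := Ioo_subset_Icc_self hx
    have ht' := Ioc_subset_Icc_self ht
    have h2 : HasDerivWithinAt (fun s => dt T v x s) (dt T (dt T v) x t) (Icc 0 T) t :=
      (hv.hasDtt (x, t) ⟨hx, ht⟩).hasDerivWithinAt
    have h3 := hv.hasDerivWithinAt_dt hx' ht'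
    have h4 := hv.equation (x, t) ⟨hx, ht⟩
    have h5 : dt T (fun y s => dt T v y s + α * v y s) x t =
        dt T (dt T v) x t + α * dt T v x t :=
      dt_eq_of_hasDerivWithinAt hT (h2.add (h3.const_mul α)) ht'
    simp only [stripOp, h5] at h4
    convert! (h2.const_mul (Real.exp (-(lam / 2 * x)))).add
      ((h3.const_mul (Real.exp (-(lam / 2 * x)))).const_mul α) using 1
    rw [eW]
    simp only [untwist]
    rw [← h4]; ring
  · simp only [eW]
    convert! (hed x).mul (hdx x hx t ht) using 1
    ring
  · convert! (hed x).mul ((hdxx x hx t ht).sub ((hdx x hx t ht).const_mul (lam / 2))) using 1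
    simp only [Pi.sub_apply]; ring

/-- The sine moments of solutions solve the modal equations. -/
lemma moments (hl : 0 < l) (hT : 0 < T) (hlam : 0 ≤ lam)
    (hv : IsSolution l T α ε lam f h0 h1 v)
    (hf : ContinuousOn (fun p : ℝ × ℝ => f p.1 p.2) (Omega l T))
    (hM : ∀ p ∈ Omega l T, |f p.1 p.2| ≤ M) (n : ℕ) :
    ∃ Y P : ℝ → ℝ, (∀ t, Y t = sinCoeff l (untwist lam fun x => v x t) n) ∧
      ContinuousOn Y (Icc 0 T) ∧ ContinuousOn P (Icc 0 T) ∧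
      Y 0 = sinCoeff l (untwist lam h0) n ∧ P 0 = sinCoeff l (untwist lam h1) n ∧
      (∀ t ∈ Icc 0 T, Y t - Y 0 = ∫ τ in (0 : ℝ)..t, P τ) ∧
      ∀ t ∈ Icc 0 T, P t + α * Y t - (P 0 + α * Y 0) = ∫ τ in (0 : ℝ)..t,
        (-bn l lam (n + 1) * (ε * P τ + Y τ) - sinCoeff l (untwist lam fun x => f x τ) n) := by
  obtain ⟨B, hB⟩ := hv.exists_bound
  have hec : Continuous fun p : ℝ × ℝ => Real.exp (-(lam / 2 * p.1)) := by fun_prop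
  have hvc : ContinuousOn (fun p : ℝ × ℝ => v p.1 p.2) (Icc 0 l ×ˢ Icc 0 T) := hv.continuousOn
  have hVc : ContinuousOn (fun p : ℝ × ℝ => untwist lam (fun x => v x p.2) p.1)
      (Ioo 0 l ×ˢ Icc 0 T) :=
    hec.continuousOn.mul (hvc.mono (prod_mono Ioo_subset_Icc_self le_rfl))
  have hPc : ContinuousOn (fun p : ℝ × ℝ => untwist lam (fun x => dt T v x p.2) p.1)
      (Ioo 0 l ×ˢ Icc 0 T) := hec.continuousOn.mul hv.continuousOn_dt_interior
  have hVb : ∀ x ∈ Ioo 0 l, ∀ t ∈ Icc 0 T, |untwist lam (fun x => v x t) x| ≤ B :=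
    fun x hx t ht => abs_untwist_le hlam hx.1.le (hB x (Ioo_subset_Icc_self hx) t ht).1
  have hPb : ∀ x ∈ Ioo 0 l, ∀ t ∈ Icc 0 T, |untwist lam (fun x => dt T v x t) x| ≤ B :=
    fun x hx t ht => abs_untwist_le hlam hx.1.le (hB x (Ioo_subset_Icc_self hx) t ht).2
  have hVI : ∀ t ∈ Icc 0 T, IntervalIntegrable (untwist lam fun x => v x t) volume 0 l :=
    fun t ht => intervalIntegrable_of_bounded hl.le
      (continuousOn_slice (Q := fun x t => untwist lam (fun x => v x t) x) hVc ht)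
      fun x hx => hVb x hx t ht
  have hPI : ∀ t ∈ Icc 0 T, IntervalIntegrable (untwist lam fun x => dt T v x t) volume 0 l :=
    fun t ht => intervalIntegrable_of_bounded hl.le
      (continuousOn_slice (Q := fun x t => untwist lam (fun x => dt T v x t) x) hPc ht)
      fun x hx => hPb x hx t ht
  have hFI : ∀ t ∈ Ioc 0 T, IntervalIntegrable (untwist lam fun x => f x t) volume 0 l :=
    fun t ht => intervalIntegrable_of_bounded hl.le
      (continuousOn_untwist (continuousOn_slice hf ht))
      fun x hx => abs_untwist_le hlam hx.1.le (hM (x, t) ⟨hx, ht⟩)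
  have h0m : (0 : ℝ) ∈ Icc 0 T := ⟨le_rfl, hT.le⟩
  obtain ⟨C, wx, wxx, hE⟩ := hv.exists_stripEquation hl hT hlam hf hM
  refine ⟨fun t => sinCoeff l (untwist lam fun x => v x t) n,
    fun t => sinCoeff l (untwist lam fun x => dt T v x t) n, fun _ => rfl,
    continuousOn_sinCoeff hl (Q := fun x t => untwist lam (fun x => v x t) x) hVc hVb n,
    continuousOn_sinCoeff hl (Q := fun x t => untwist lam (fun x => dt T v x t) x) hPc hPb n,
    sinCoeff_congr hl (fun x hx => by
      simp only [untwist]; rw [hv.initial x (Ioo_subset_Icc_self hx)]) n,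
    sinCoeff_congr hl (fun x hx => by simp only [untwist]; rw [hv.initial_dt x hx]) n,
    fun t ht => ?_, fun t ht => ?_⟩
  -- The fundamental theorem is applied in time at each interior x, and the sine coefficient is then
  -- exchanged with the time integral; boundedness of v_t makes this possible up to t = 0.
  · have hsub : Icc 0 t ⊆ Icc 0 T := Icc_subset_Icc_right ht.2
    have h1 := sinCoeff_integral hl (F := fun x t => untwist lam (fun x => dt T v x t) x) ht.1
      (hPc.mono (prod_mono le_rfl hsub)) (fun x hx t ht => hPb x hx t (hsub ht)) n
    rw [← sinCoeff_sub (hVI t ht) (hVI 0 h0m)]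
    refine (sinCoeff_congr hl (fun x hx => ?_) n).trans h1
    have hx' := Ioo_subset_Icc_self hx
    have hI : ContinuousOn (fun τ => dt T v x τ) (Icc 0 T) :=
      ContinuousOn.comp (f := fun τ : ℝ => (x, τ)) (g := fun p : ℝ × ℝ => dt T v p.1 p.2)
        hv.continuousOn_dt_interior (by fun_prop) fun τ hτ => ⟨hx, hτ⟩
    have h2 := intervalIntegral.integral_eq_sub_of_hasDerivAt_of_le ht.1
      (f := fun s => v x s) (f' := fun s => dt T v x s)
      (fun s hs => (hv.hasDerivWithinAt_dt hx' (hsub hs)).continuousWithinAt.mono hsub)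
      (fun s hs => (hv.hasDerivWithinAt_dt hx' (hsub (Ioo_subset_Icc_self hs))).hasDerivAt
        (Icc_mem_nhds hs.1 (hs.2.trans_le ht.2)))
      (ContinuousOn.intervalIntegrable (by rw [uIcc_of_le ht.1]; exact hI.mono hsub))
    simp only [untwist]
    rw [intervalIntegral.integral_const_mul, h2]; ring
  · have h1 := hE.sub_eq_integral hl n ht
    rw [sinCoeff_add (hPI t ht) ((hVI t ht).const_mul α), sinCoeff_const_mul,
      sinCoeff_add (hPI 0 h0m) ((hVI 0 h0m).const_mul α), sinCoeff_const_mul] at h1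
    refine h1.trans (intervalIntegral.integral_congr_ae (ae_of_all _ fun τ hτ => ?_))
    rw [uIoc_of_le ht.1] at hτ
    have hτ' : τ ∈ Ioc 0 T := ⟨hτ.1, hτ.2.trans ht.2⟩
    have hτI := Ioc_subset_Icc_self hτ'
    have hWI := ((hPI τ hτI).const_mul ε).add (hVI τ hτI)
    rw [sinCoeff_sub (hWI.const_mul _) (hFI τ hτ'), sinCoeff_const_mul,
      sinCoeff_add ((hPI τ hτI).const_mul ε) (hVI τ hτI), sinCoeff_const_mul, bn]
    ring

/-- The source coefficients cancel in the difference of the two moment equations, so each moment of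
the difference solves the homogeneous modal equation with zero data. Completeness of the sines at
the fixed time t gives equality of the continuous functions on the whole closed interval. -/
theorem eqOn (hl : 0 < l) (hT : 0 < T) (hlam : 0 ≤ lam)
    (hv₁ : IsSolution l T α ε lam f h0 h1 v₁) (hv₂ : IsSolution l T α ε lam f h0 h1 v₂)
    (hf : ContinuousOn (fun p : ℝ × ℝ => f p.1 p.2) (Omega l T))
    (hM : ∀ p ∈ Omega l T, |f p.1 p.2| ≤ M) :
    ∀ p ∈ closedStrip l T, v₁ p.1 p.2 = v₂ p.1 p.2 := by
  rintro ⟨x, t⟩ ⟨hx, ht⟩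
  have hcv : ∀ {v : ℝ → ℝ → ℝ}, IsSolution l T α ε lam f h0 h1 v →
      ContinuousOn (untwist lam fun x => v x t) (Icc 0 l) := fun {v} hv =>
    continuousOn_untwist (ContinuousOn.comp (f := fun x : ℝ => (x, t))
      (g := fun p : ℝ × ℝ => v p.1 p.2) hv.continuousOn (by fun_prop) fun x hx => ⟨hx, ht⟩)
  have hi : ∀ {p : ℝ → ℝ}, ContinuousOn p (Icc 0 l) → IntervalIntegrable p volume 0 l :=
    fun hp => ContinuousOn.intervalIntegrable (by rwa [uIcc_of_le hl.le])
  have hcoeff : ∀ n, sinCoeff l (fun x => untwist lam (fun x => v₁ x t) x -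
      untwist lam (fun x => v₂ x t) x) n = 0 := by
    intro n
    obtain ⟨Y₁, P₁, hY₁, hcY₁, hcP₁, hY₁0, hP₁0, hI₁, hJ₁⟩ := hv₁.moments hl hT hlam hf hM n
    obtain ⟨Y₂, P₂, hY₂, hcY₂, hcP₂, hY₂0, hP₂0, hI₂, hJ₂⟩ := hv₂.moments hl hT hlam hf hM n
    have hFc : ContinuousOn (fun τ => sinCoeff l (untwist lam fun x => f x τ) n) (Ioc 0 T) :=
      continuousOn_sinCoeff hl (Q := fun ξ τ => untwist lam (fun ξ => f ξ τ) ξ) (M := M)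
        ((by fun_prop : Continuous fun p : ℝ × ℝ => Real.exp (-(lam / 2 * p.1))).continuousOn.mul hf)
        (fun ξ hξ τ hτ => abs_untwist_le hlam hξ.1.le (hM (ξ, τ) ⟨hξ, hτ⟩)) n
    have hFI : ∀ s ∈ Icc 0 T, IntervalIntegrable
        (fun τ => sinCoeff l (untwist lam fun x => f x τ) n) volume 0 s := fun s hs =>
      intervalIntegrable_of_bounded (M := 2 * M) hs.1
        (hFc.mono fun τ hτ => ⟨hτ.1, hτ.2.le.trans hs.2⟩) fun τ hτ =>
        abs_sinCoeff_le hl (fun ξ hξ => abs_untwist_le hlam hξ.1.le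
          (hM (ξ, τ) ⟨hξ, hτ.1, hτ.2.le.trans hs.2⟩)) n
    have hI : ∀ {p : ℝ → ℝ}, ContinuousOn p (Icc 0 T) → ∀ s ∈ Icc 0 T,
        IntervalIntegrable p volume 0 s := fun hp s hs => ContinuousOn.intervalIntegrable (by
      rw [uIcc_of_le hs.1]; exact hp.mono (Icc_subset_Icc_right hs.2))
    have hz := eq_zero_of_integral_eq (α := α) (ε := ε) (b := bn l lam (n + 1))
      (Y := fun s => Y₁ s - Y₂ s) (P := fun s => P₁ s - P₂ s) hT (hcY₁.sub hcY₂) (hcP₁.sub hcP₂)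
      (fun s hs => by
        rw [intervalIntegral.integral_sub (hI hcP₁ s hs) (hI hcP₂ s hs), ← hI₁ s hs, ← hI₂ s hs,
          hY₁0, hY₂0]; ring)
      (fun s hs => by
        have hN : ∀ {Y P : ℝ → ℝ}, ContinuousOn Y (Icc 0 T) → ContinuousOn P (Icc 0 T) →
            IntervalIntegrable (fun τ => -bn l lam (n + 1) * (ε * P τ + Y τ) -
              sinCoeff l (untwist lam fun x => f x τ) n) volume 0 s := fun hY hP =>
          (hI (((hP.const_mul ε).add hY).const_mul _) s hs).sub (hFI s hs)
        have h3 := intervalIntegral.integral_sub (hN hcY₁ hcP₁) (hN hcY₂ hcP₂)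
        rw [← hJ₁ s hs, ← hJ₂ s hs, hY₁0, hY₂0, hP₁0, hP₂0] at h3
        have h4 : P₁ s - P₂ s + α * (Y₁ s - Y₂ s) = ∫ τ in (0 : ℝ)..s,
            ((-bn l lam (n + 1) * (ε * P₁ τ + Y₁ τ) - sinCoeff l (untwist lam fun x => f x τ) n) -
            (-bn l lam (n + 1) * (ε * P₂ τ + Y₂ τ) -
              sinCoeff l (untwist lam fun x => f x τ) n)) := by rw [h3]; ring
        rw [h4]
        refine intervalIntegral.integral_congr fun τ _ => ?_
        ring) t ht
    simp only [hY₁, hY₂] at hz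
    rwa [← sinCoeff_sub (hi (hcv hv₁)) (hi (hcv hv₂))] at hz
  have h : Real.exp (-(lam / 2 * x)) * v₁ x t - Real.exp (-(lam / 2 * x)) * v₂ x t = 0 :=
    eq_zero_of_sinCoeff_eq_zero hl ((hcv hv₁).sub (hcv hv₂)) hcoeff x hx
  rw [← mul_sub] at h
  exact sub_eq_zero.1 ((mul_eq_zero.1 h).resolve_left (Real.exp_pos _).ne')

end IsSolution

end

end StripProblem

end

/-! ### Assembly of the theorem -/

open StripProblem in
theorem theorem4p3 (l T α ε lam : ℝ) (hl : 0 < l) (hT : 0 < T) (hα : 0 < α) (hε : 0 < ε)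
    (hlam : 0 ≤ lam) (h0 h1 : ℝ → ℝ) (f : ℝ → ℝ → ℝ)
    (hh1 : ContDiffOn ℝ 1 h1 (Set.Icc 0 l))
    (hh0 : ContDiffOn ℝ 3 h0 (Set.Icc 0 l))
    (hh0_boundary : ∀ i : ℕ, i ≤ 2 →
      iteratedDerivWithin i h0 (Set.Icc 0 l) 0 = 0 ∧
      iteratedDerivWithin i h0 (Set.Icc 0 l) l = 0)
    (hf : ContinuousOn (fun p : ℝ × ℝ => f p.1 p.2) (Omega l T))
    (hf_bounded : ∃ M : ℝ, ∀ p ∈ Omega l T, |f p.1 p.2| ≤ M)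
    (hf_hasDx : ∀ p ∈ Omega l T, HasDx l f p.1 p.2)
    (hf_dx : ContinuousOn (fun p : ℝ × ℝ => dx l f p.1 p.2) (Omega l T)) :
    ExplicitWellDefined l T α ε lam f h0 h1 ∧
    IsSolution l T α ε lam f h0 h1 (explicitSolution l T α ε lam f h0 h1) ∧
    (∀ v : ℝ → ℝ → ℝ, IsSolution l T α ε lam f h0 h1 v →
      ∀ p ∈ closedStrip l T, v p.1 p.2 = explicitSolution l T α ε lam f h0 h1 p.1 p.2) ∧
    (h1 0 = 0 → h1 l = 0 →
      ContinuousOn (fun p : ℝ × ℝ => dt T (explicitSolution l T α ε lam f h0 h1) p.1 p.2)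
        (closedStrip l T) ∧
      ∀ x ∈ Set.Icc 0 l, dt T (explicitSolution l T α ε lam f h0 h1) x 0 = h1 x) := by
  obtain ⟨M, hM⟩ := hf_bounded
  -- The bound is tested at (l/2, T), a point of Ω_T.
  have hM0 : 0 ≤ M := (abs_nonneg _).trans
    (hM (l / 2, T) ⟨⟨by linarith, by linarith⟩, hT, le_rfl⟩)
  have hb := hh0_boundary 0 (by norm_num)
  rw [iteratedDerivWithin_zero] at hb
  have hc1 : ContinuousOn h1 (Icc 0 l) := hh1.continuousOn
  have hc0 : ContinuousOn h0 (Icc 0 l) := hh0.continuousOn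
  have hF := heatSource_untwist hlam hM0 hf hM hf_hasDx hf_dx
  obtain ⟨A, hS⟩ := exists_stripData hl hT hε hc1 (hh0.of_le (by norm_num)) hb.1 hb.2 hF
  have hu := fun (x : ℝ) (hx : x ∈ Icc 0 l) (t : ℝ) (ht : t ∈ Icc 0 T) =>
    explicitSolution_eq (α := α) hlam hS hc1 hc0 hf hM hx ht
  have hsol : IsSolution l T α ε lam f h0 h1 (explicitSolution l T α ε lam f h0 h1) := by
    refine hS.isSolution hu (fun x _ t _ => exp_mul_untwist (fun x => f x t) x) (fun x hx => ?_)
      fun x _ => exp_mul_untwist h1 x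
    -- The coefficients of the untwisted initial position are O(γ⁻²), so its sine series returns it
    -- on the closed interval.
    rw [← eq_sineSeries hl (continuousOn_untwist hc0) (summable_of_le_inv_gam_sq hl hS.bound₀) hx,
      exp_mul_untwist]
  refine ⟨explicitWellDefined hlam hS hc1 hc0 hf hM, hsol, fun v hv =>
    hv.eqOn hl hT hlam hsol hf hM, fun h10 h1l => ?_⟩
  have h := hS.continuousOn_dt_of_zero hu (by simp [untwist, h10]) (by simp [untwist, h1l])
  exact ⟨h.1, fun x hx => by rw [h.2 x hx, exp_mul_untwist]⟩
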